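/- **Setting.** Let $U\subset\mathbb R^3$ be open (a coordinate patch; the whole hyperboloid $\cong\mathbb R^3\setminus\{0\}$ is allowed) with a smooth Lorentzian metric $h_{ab}$ of constant curvature $+1$, i.e. locally the unit hyperboloid $-d\tau^2+\cosh^2\tau\,d\Omega^2$. Let $D_a$ be its Levi-Civita derivative, $\square=D^aD_a$, $\epsilon_{abc}$ its volume form; indices are raised with $h$, $T_{(ab)}=\frac12(T_{ab}+T_{ba})$, $\mathrm{curl}(T)_{ab}=\epsilon_a{}^{cd}D_cT_{db}$, $\sigma_a=D_a\sigma$, $\sigma_{ab}=D_aD_b\sigma$; "SDT" means symmetric, divergence-free and traceless. Let $\sigma$ be a smooth function, $k_{ab}$ a smooth SDT tensor, $i_{ab},h^{(2)}_{ab}$ smooth symmetric tensors on $U$. Consider any metric $$ds^2=\Big(1+\tfrac{2\sigma}{\rho}+\tfrac{\sigma^2}{\rho^2}+o(\rho^{-2})\Big)d\rho^2+o(\rho^{-1})\,d\rho\,dx^a+\rho^2\Big(h_{ab}+\tfrac{k_{ab}-2\sigma h_{ab}}{\rho}+\tfrac{\ln\rho}{\rho^2}i_{ab}+\tfrac{1}{\rho^2}h^{(2)}_{ab}+o(\rho^{-2})\Big)dx^adx^b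 ,$$ where the remainders are $C^2$ and their derivatives of order at most two obey the corresponding fall-off (each $\partial_\rho$ gains a factor $\rho^{-1}$). Say that Einstein's vacuum equations hold through order $n$ if $R_{\rho\rho}=o(\rho^{-n-2})$, $R_{\rho a}=o(\rho^{-n-1})$, $R_{ab}=o(\rho^{-n})$ as $\rho\to\infty$, over each point of $U$. **1. Radial expansion.** Einstein's equations hold through order $1$ if and only if $$(\square+3)\sigma=0,\qquad(\square-3)k_{ab}=0 .$$ They hold through order $2$ if and only if, in addition, the following system (E) holds: $$i^a{}_a=0,\quad D^bi_{ab}=0,\quad(\square-2)i_{ab}=0,$$ $$h^{(2)a}{}_a=12\sigma^2+\sigma_c\sigma^c+\tfrac14k_{cd}k^{cd}+k_{cd}\sigma^{cd},$$ $$D^bh^{(2)}_{ab}=\tfrac12D^bk_{ac}\,k_b{}^c+D_a\big(\sigma_c\sigma^c+8\sigma^2-\tfrac18k_{cd}k^{cd}+k_{cd}\sigma^{cd}\big),$$ $$(\square-2)h^{(2)}_{ab}=2i_{ab}+NL_{ab}(\sigma,\sigma)+NL_{ab}(\sigma,k)+NL_{ab}(k,k),$$ where $$NL_{ab}(\sigma,\sigma)=D_aD_b(5\sigma^2+\sigma_c\sigma^c)+h_{ab}(-18\sigma^2+4\sigma^c\sigma_c)+4\sigma\sigma_{ab},$$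 $$NL_{ab}(\sigma,k)=D_aD_b(k_{cd}\sigma^{cd})-2k_{cd}\sigma^{cd}h_{ab}+4\sigma k_{ab}+4\sigma^c(D_{(a}k_{b)c}-D_ck_{ab})+4\sigma_{c(a}k^c{}_{b)},$$ $$NL_{ab}(k,k)=k_{ac}k^c{}_b+k^{cd}(-D_dD_{(a}k_{b)c}+D_cD_dk_{ab})-\tfrac12D_bk^{cd}D_ak_{cd}+D^dk_{c(a}D_{b)}k_d{}^c+D_ck_{ad}D^ck^d{}_b-D_ck_{ad}D^dk^c{}_b .$$ **2. Equivalent systems.** Assume $(\square+3)\sigma=0$ and $(\square-3)k_{ab}=0$. Put $B_{ab}=\frac12\mathrm{curl}(k)_{ab}$ and $$Y_{ab}=-4B_{c(a}B_{b)}{}^c-2\epsilon_{cd(a}D^ck_{b)}{}^eB^d{}_e-2\epsilon_{cd(a}D_{b)}B^c{}_e\,k^{de},$$ $$Q^W_{ab}=\big(-2\sigma^2+\tfrac1{16}k_{cd}k^{cd}\big)h_{ab}-\tfrac12k_{ac}k^c{}_b,$$ $$\begin{aligned}Q^V_{ab}={}&\big(6\sigma^2+\sigma^c\sigma_c+\tfrac18k_{cd}k^{cd}+\tfrac18D_ck_{de}D^ck^{de}\big)h_{ab}+2\sigma\sigma_{ab}-2\sigma_a\sigma_b\\&+4\sigma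 k_{ab}-4\sigma^cD_ck_{ab}+4\sigma^cD_{(a}k_{b)c}+4\sigma_{c(a}k_{b)}{}^c-\sigma_{cd}k^{cd}h_{ab}\\&-\tfrac12k_{ac}k_b{}^c-\tfrac38D_ak_{cd}D_bk^{cd}+\tfrac18k^{cd}D_{(a}D_{b)}k_{cd}+Y_{ab},\end{aligned}$$ $$\begin{aligned}\kappa_{ab}={}&(2\sigma^2-2\sigma_c\sigma^c)h_{ab}+4\sigma\sigma_{ab}+4\big(\sigma k_{ab}+\sigma_{c(a}k_{b)}{}^c-\tfrac12\sigma_{cd}k^{cd}h_{ab}-\sigma^cD_ck_{ab}+\sigma^cD_{(a}k_{b)c}\big)\\&+Y_{ab}+\tfrac34k_{cd}k^{cd}h_{ab}-k_{ac}k^c{}_b+\tfrac14D_ck_{de}D^ck^{de}h_{ab}-\tfrac12D_ak_{cd}D_bk^{cd},\end{aligned}$$ $$V_{ab}=-h^{(2)}_{ab}+\tfrac12i_{ab}+Q^V_{ab},\qquad W_{ab}=\epsilon_a{}^{cd}D_c\big(h^{(2)}_{db}-\tfrac12i_{db}+Q^W_{db}\big).$$ Then $\mathrm{curl}(Q^V+Q^W)_{ab}=\mathrm{curl}(\kappa)_{(ab)}$,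 and every solution $(h^{(2)},i)$ of (E) satisfies $$W_{ab}=-\mathrm{curl}(V)_{ab}+\mathrm{curl}(\kappa)_{(ab)},\qquad V_{ab}=\mathrm{curl}(W)_{ab}-2i_{ab}.$$ The system (E) for $(h^{(2)},i)$ is equivalent to each of the following two systems: * (W) $W$ and $i$ are SDT, $(\square-2)W_{ab}=\mathrm{curl}(2i+\kappa)_{(ab)}$, $(\square-2)i_{ab}=0$; * (V) $V$ and $j$ are SDT, $(\square-2)V_{ab}=\mathrm{curl}(-2j+\mathrm{symcurl}\,\kappa)_{ab}$, $(\square-2)j_{ab}=0$, with $j=-\mathrm{curl}\,i$ and $(\mathrm{symcurl}\,\kappa)_{ab}=\mathrm{curl}(\kappa)_{(ab)}$. Precisely: $(h^{(2)},i)$ solves (E) if and only if $(W,i)$ solves (W) and $h^{(2)}=-(\mathrm{curl}\,W-2i)+\frac12i+Q^V$; conversely, for each smooth solution $(W,i)$ of (W), this formula defines a solution $(h^{(2)},i)$ of (E) whose associated tensor is the given $W$. Likewise, $(h^{(2)},i)$ solves (E) if and only if $(V,j)$ with $j=-\mathrm{curl}\,i$ solves (V) and $i=\mathrm{curl}\,j$;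 conversely, for each smooth solution $(V,j)$ of (V), $i=\mathrm{curl}\,j$ and $h^{(2)}=-V+\frac12i+Q^V$ are smooth and symmetric, solve (E), and satisfy $j=-\mathrm{curl}\,i$. -/

import Mathlib

open Set Filter Asymptotics
open scoped ContDiff

noncomputable section

namespace BeigSchmidt

/-! ### Coordinate tensor calculus

Fields are component functions in a coordinate chart. All identities are only ever asserted on an
open set on which the fields are smooth. -/

/-- Scalar functions of `n` real coordinates. -/
abbrev Fld (n : ℕ) := (Fin n → ℝ) → ℝ

/-- The coordinate derivative `∂_a f`. -/
def pd {n : ℕ} (a : Fin n) (f : Fld n) : Fld n := fun x => fderiv ℝ f x (Pi.single a 1)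

/-- The inverse metric `g^{ab}`. -/
def ginv {n : ℕ} (g : Fin n → Fin n → Fld n) (a b : Fin n) : Fld n :=
  fun x => (Matrix.of fun i j => g i j x)⁻¹ a b

/-- The Christoffel symbol `Γ^a_{bc}`. -/
def christoffel {n : ℕ} (g : Fin n → Fin n → Fld n) (a b c : Fin n) : Fld n :=
  (1 / 2 : ℝ) • ∑ e, ginv g a e * (pd b (g e c) + pd c (g e b) - pd e (g b c))

/-- The Riemann tensor `R^a_{bcd} = ∂_c Γ^a_{bd} + Γ^a_{ce} Γ^e_{bd} - (c ↔ d)`. -/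
def riemann {n : ℕ} (g : Fin n → Fin n → Fld n) (a b c d : Fin n) : Fld n :=
  pd c (christoffel g a b d) - pd d (christoffel g a b c) +
    ∑ e, (christoffel g a c e * christoffel g e b d - christoffel g a d e * christoffel g e b c)

/-- The Ricci tensor `R_{bd} = R^c_{bcd}`. -/
def ricci {n : ℕ} (g : Fin n → Fin n → Fld n) (b d : Fin n) : Fld n := ∑ c, riemann g c b c d

/-! ### The boundary metric and its covariant calculus -/

/-- Covectors, and covariant tensors of rank two and three, in three dimensions. -/
abbrev Cov1 := Fin 3 → Fld 3
abbrev Cov2 := Fin 3 → Fin 3 → Fld 3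
abbrev Cov3 := Fin 3 → Fin 3 → Fin 3 → Fld 3

/-- Equality of tensor fields on `U`. -/
def AgreeOn (U : Set (Fin 3 → ℝ)) (S T : Cov2) : Prop := ∀ a b, EqOn (S a b) (T a b) U

/-- `T` is a smooth symmetric covariant tensor field of rank two on `U`. -/
def IsSymTensor (U : Set (Fin 3 → ℝ)) (T : Cov2) : Prop :=
  (∀ a b, ContDiffOn ℝ ∞ (T a b) U) ∧ ∀ a b, EqOn (T a b) (T b a) U

/-- `h` is a smooth Lorentzian metric (signature `-++`) on `U` of constant curvature `+1`,
`R_{abcd} = h_{ac} h_{bd} - h_{ad} h_{bc}`, i.e. locally the metric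
`-dτ² + cosh² τ dΩ²` of the unit hyperboloid (three-dimensional de Sitter space). -/
def IsUnitHyperboloid (U : Set (Fin 3 → ℝ)) (h : Cov2) : Prop :=
  IsSymTensor U h ∧
  (∀ x ∈ U, ∃ P : Matrix (Fin 3) (Fin 3) ℝ, IsUnit P.det ∧
    P.transpose * (Matrix.of fun a b => h a b x) * P = Matrix.diagonal ![-1, 1, 1]) ∧
  ∀ x ∈ U, ∀ a b c d, riemann h a b c d x =
    (if a = c then h b d x else 0) - (if a = d then h b c x else 0)

/-- `D_a v_b` (the derivative index comes first, here and below). -/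
def D1 (h : Cov2) (v : Cov1) : Cov2 := fun a b =>
  pd a (v b) - ∑ e, christoffel h e a b * v e

/-- `D_c T_{ab}`. -/
def D2 (h : Cov2) (T : Cov2) : Cov3 := fun c a b =>
  pd c (T a b) - ∑ e, (christoffel h e c a * T e b + christoffel h e c b * T a e)

/-- `D_d S_{cab}`. -/
def D3 (h : Cov2) (S : Cov3) : Fin 3 → Cov3 := fun d c a b =>
  pd d (S c a b) - ∑ e, (christoffel h e d c * S e a b + christoffel h e d a * S c e b +
    christoffel h e d b * S c a e)

/-- `D_a f`. -/
def grad (f : Fld 3) : Cov1 := fun a => pd a f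

/-- `D_a D_b f`. -/
def hess (h : Cov2) (f : Fld 3) : Cov2 := D1 h (grad f)

/-- `D_d D_c T_{ab}`. -/
def DD (h : Cov2) (T : Cov2) : Fin 3 → Cov3 := D3 h (D2 h T)

/-- The trace `T^a_a`. -/
def tr (h : Cov2) (T : Cov2) : Fld 3 := ∑ a, ∑ b, ginv h a b * T a b

/-- The divergence `D^b T_{ab}`. -/
def dvg (h : Cov2) (T : Cov2) : Cov1 := fun a => ∑ b, ∑ c, ginv h b c * D2 h T c a b

/-- `□ f` for scalars. -/
def boxS (h : Cov2) (f : Fld 3) : Fld 3 := tr h (hess h f)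

/-- `□ T_{ab}` for tensors. -/
def boxT (h : Cov2) (T : Cov2) : Cov2 := fun a b => ∑ c, ∑ d, ginv h c d * DD h T c d a b

/-- Indices raised with `h`: `v^a`. -/
def up1 (h : Cov2) (v : Cov1) : Cov1 := fun a => ∑ b, ginv h a b * v b

/-- `T_a^b`. -/
def mixed (h : Cov2) (T : Cov2) : Cov2 := fun a b => ∑ c, ginv h b c * T a c

/-- `T^{ab}`. -/
def up2 (h : Cov2) (T : Cov2) : Cov2 := fun a b => ∑ c, ∑ d, ginv h a c * ginv h b d * T c d

/-- `S^{abc}`. -/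
def up3 (h : Cov2) (S : Cov3) : Cov3 := fun a b c =>
  ∑ d, ∑ e, ∑ f, ginv h a d * ginv h b e * ginv h c f * S d e f

/-- `S_{cd} T^{cd}`. -/
def inner2 (h : Cov2) (S T : Cov2) : Fld 3 := ∑ c, ∑ d, S c d * up2 h T c d

/-- `S_{ac} T_b^c`. -/
def prod2 (h : Cov2) (S T : Cov2) : Cov2 := fun a b => ∑ c, S a c * mixed h T b c

/-- The symmetrization `T_{(ab)} = (T_{ab} + T_{ba}) / 2`. -/
def symm (T : Cov2) : Cov2 := fun a b => (1 / 2 : ℝ) • (T a b + T b a)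

/-- The totally antisymmetric symbol with `[012] = 1`. -/
def leviSymbol (a b c : Fin 3) : ℝ :=
  ((a.val : ℝ) - b.val) * ((b.val : ℝ) - c.val) * ((c.val : ℝ) - a.val) / 2

/-- The volume form `ε_{abc} = √|det h| [abc]`. -/
def eps (h : Cov2) (a b c : Fin 3) : Fld 3 :=
  fun x => Real.sqrt |(Matrix.of fun i j => h i j x).det| * leviSymbol a b c

/-- `curl(T)_{ab} = ε_a^{cd} D_c T_{db}`. -/
def curl (h : Cov2) (T : Cov2) : Cov2 := fun a b =>
  ∑ c, ∑ d, ∑ c', ∑ d', eps h a c' d' * ginv h c' c * ginv h d' d * D2 h T c d b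

/-- `curl(T)_{(ab)}`. -/
def symCurl (h : Cov2) (T : Cov2) : Cov2 := symm (curl h T)

/-- Symmetric, divergence-free and traceless (SDT) smooth tensor fields on `U`. -/
def IsSDT (U : Set (Fin 3 → ℝ)) (h T : Cov2) : Prop :=
  IsSymTensor U T ∧ EqOn (tr h T) 0 U ∧ ∀ a, EqOn (dvg h T a) 0 U

/-! ### Quadratic expressions in `σ` and `k`

Notation: `σ_a = D_a σ`, `σ_{ab} = D_a D_b σ`. -/

/-- `σ_c σ^c`. -/
def gradSq (h : Cov2) (σ : Fld 3) : Fld 3 := ∑ c, grad σ c * up1 h (grad σ) c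

/-- `D_c k_{de} D^c k^{de}`. -/
def DkSq (h k : Cov2) : Fld 3 := ∑ c, ∑ d, ∑ e, D2 h k c d e * up3 h (D2 h k) c d e

/-- `D_a k_{cd} D_b k^{cd}`. -/
def DkDk (h k : Cov2) : Cov2 := fun a b => ∑ c, ∑ d, D2 h k a c d * up2 h (D2 h k b) c d

/-- `σ^c D_c k_{ab}`. -/
def sigDk (h : Cov2) (σ : Fld 3) (k : Cov2) : Cov2 := fun a b =>
  ∑ c, up1 h (grad σ) c * D2 h k c a b

/-- `σ^c D_{(a} k_{b)c}`. -/
def sigDkSym (h : Cov2) (σ : Fld 3) (k : Cov2) : Cov2 :=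
  symm fun a b => ∑ c, up1 h (grad σ) c * D2 h k a b c

/-- `σ_{c(a} k_{b)}^c`. -/
def hessK (h : Cov2) (σ : Fld 3) (k : Cov2) : Cov2 := symm (prod2 h (hess h σ) k)

/-- `NL_{ab}(σ,σ)
  = D_a D_b (5σ² + σ_c σ^c) + h_{ab} (-18σ² + 4 σ_c σ^c) + 4 σ σ_{ab}`. -/
def NLss (h : Cov2) (σ : Fld 3) : Cov2 := fun a b =>
  hess h ((5 : ℝ) • σ ^ 2 + gradSq h σ) a b +
    h a b * (-(18 : ℝ) • σ ^ 2 + (4 : ℝ) • gradSq h σ) + (4 : ℝ) • (σ * hess h σ a b)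

/-- `NL_{ab}(σ,k) = D_a D_b (k_{cd} σ^{cd}) - 2 k_{cd} σ^{cd} h_{ab} + 4 σ k_{ab}
  + 4 σ^c (D_{(a} k_{b)c} - D_c k_{ab}) + 4 σ_{c(a} k_{b)}^c`. -/
def NLsk (h : Cov2) (σ : Fld 3) (k : Cov2) : Cov2 := fun a b =>
  hess h (inner2 h k (hess h σ)) a b - (2 : ℝ) • (inner2 h k (hess h σ) * h a b) +
    (4 : ℝ) • (σ * k a b) + (4 : ℝ) • (sigDkSym h σ k a b - sigDk h σ k a b) +
    (4 : ℝ) • hessK h σ k a b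

/-- `NL_{ab}(k,k) = k_{ac} k^c_b + k^{cd} (-D_d D_{(a} k_{b)c} + D_c D_d k_{ab})
  - ½ D_b k^{cd} D_a k_{cd} + D^d k_{c(a} D_{b)} k_d^c + D_c k_{ad} D^c k^d_b
  - D_c k_{ad} D^d k^c_b`. -/
def NLkk (h k : Cov2) : Cov2 := fun a b =>
  prod2 h k k a b -
    symm (fun a b => ∑ c, ∑ d, up2 h k c d * DD h k d a b c) a b +
    (∑ c, ∑ d, up2 h k c d * DD h k c d a b) - (1 / 2 : ℝ) • DkDk h k a b +
    symm (fun a b => ∑ c, ∑ d, up2 h (fun e f => D2 h k e f a) d c * D2 h k b d c) a b +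
    (∑ c, ∑ d, D2 h k c a d * up2 h (fun e f => D2 h k e f b) c d) -
    ∑ c, ∑ d, D2 h k c a d * up2 h (fun e f => D2 h k e f b) d c

/-- `B_{ab} = ½ ε_a^{cd} D_c k_{db}`. -/
def magB (h k : Cov2) : Cov2 := fun a b => (1 / 2 : ℝ) • curl h k a b

/-- `Y_{ab} = -4 B_{c(a} B_{b)}^c - 2 ε_{cd(a} D^c k_{b)}^e B^d_e - 2 ε_{cd(a} D_{b)} B^c_e k^{de}`. -/
def Yten (h k : Cov2) : Cov2 := fun a b =>
  -(4 : ℝ) • symm (fun a b => ∑ c, magB h k c a * mixed h (magB h k) b c) a b -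
    (2 : ℝ) • symm (fun a b => ∑ c, ∑ d, ∑ e, ∑ c', ∑ d', ∑ e',
      eps h c d a * ginv h c c' * ginv h e e' * D2 h k c' b e' *
        (ginv h d d' * magB h k d' e)) a b -
    (2 : ℝ) • symm (fun a b => ∑ c, ∑ d, ∑ e, ∑ c',
      eps h c d a * (ginv h c c' * D2 h (magB h k) b c' e) * up2 h k d e) a b

/-- `Q^W_{ab} = (-2σ² + k_{cd} k^{cd} / 16) h_{ab} - ½ k_{ac} k^c_b`. -/
def QW (h : Cov2) (σ : Fld 3) (k : Cov2) : Cov2 := fun a b =>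
  (-(2 : ℝ) • σ ^ 2 + (1 / 16 : ℝ) • inner2 h k k) * h a b - (1 / 2 : ℝ) • prod2 h k k a b

/-- `Q^V_{ab} = (6σ² + σ^c σ_c + ⅛ k_{cd} k^{cd} + ⅛ D_c k_{de} D^c k^{de}) h_{ab}
  + 2 σ σ_{ab} - 2 σ_a σ_b
  + 4 σ k_{ab} - 4 σ^c D_c k_{ab} + 4 σ^c D_{(a} k_{b)c} + 4 σ_{c(a} k_{b)}^c - σ_{cd} k^{cd} h_{ab}
  - ½ k_{ac} k_b^c - ⅜ D_a k_{cd} D_b k^{cd} + ⅛ k^{cd} D_{(a} D_{b)} k_{cd} + Y_{ab}`. -/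
def QV (h : Cov2) (σ : Fld 3) (k : Cov2) : Cov2 := fun a b =>
  ((6 : ℝ) • σ ^ 2 + gradSq h σ + (1 / 8 : ℝ) • inner2 h k k + (1 / 8 : ℝ) • DkSq h k) * h a b +
    (2 : ℝ) • (σ * hess h σ a b) - (2 : ℝ) • (grad σ a * grad σ b) +
    (4 : ℝ) • (σ * k a b) - (4 : ℝ) • sigDk h σ k a b + (4 : ℝ) • sigDkSym h σ k a b +
    (4 : ℝ) • hessK h σ k a b - inner2 h (hess h σ) k * h a b -
    (1 / 2 : ℝ) • prod2 h k k a b - (3 / 8 : ℝ) • DkDk h k a b +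
    (1 / 8 : ℝ) • symm (fun a b => ∑ c, ∑ d, up2 h k c d * DD h k a b c d) a b + Yten h k a b

/-- `κ^{[σ,σ]}_{ab} = (2σ² - 2σ_c σ^c) h_{ab} + 4 σ σ_{ab}`. -/
def kappaSS (h : Cov2) (σ : Fld 3) : Cov2 := fun a b =>
  ((2 : ℝ) • σ ^ 2 - (2 : ℝ) • gradSq h σ) * h a b + (4 : ℝ) • (σ * hess h σ a b)

/-- `κ^{[σ,k]}_{ab} = σ k_{ab} + σ_{c(a} k_{b)}^c - ½ σ_{cd} k^{cd} h_{ab}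
  - σ^c D_c k_{ab} + σ^c D_{(a} k_{b)c}`. -/
def kappaSK (h : Cov2) (σ : Fld 3) (k : Cov2) : Cov2 := fun a b =>
  σ * k a b + hessK h σ k a b - (1 / 2 : ℝ) • (inner2 h (hess h σ) k * h a b) -
    sigDk h σ k a b + sigDkSym h σ k a b

/-- `κ^{[k,k]}_{ab} = ¾ k_{cd} k^{cd} h_{ab} - k_{ac} k^c_b
  + ¼ D_c k_{de} D^c k^{de} h_{ab} - ½ D_a k_{cd} D_b k^{cd}`. -/
def kappaKK (h k : Cov2) : Cov2 := fun a b =>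
  (3 / 4 : ℝ) • (inner2 h k k * h a b) - prod2 h k k a b + (1 / 4 : ℝ) • (DkSq h k * h a b) -
    (1 / 2 : ℝ) • DkDk h k a b

/-- `κ = κ^{[σ,σ]} + 4 κ^{[σ,k]} + Y + κ^{[k,k]}`. -/
def kappa (h : Cov2) (σ : Fld 3) (k : Cov2) : Cov2 :=
  kappaSS h σ + (4 : ℝ) • kappaSK h σ k + Yten h k + kappaKK h k

/-! ### The four-metric and the expansion of Einstein's equations

Spacetime coordinates are `p = (ρ, x)`, with `ρ = p 0` and `x = Fin.tail p`. -/

/-- Number of radial indices. -/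
def radial (μ : Fin 4) : ℕ := if μ = 0 then 1 else 0

/-- `f = o(ρ^{-m})` at every `x ∈ U`, differentiably: `f` is `C²` for large `ρ`, every derivative of
order at most two along `x` keeps the fall-off and every `∂_ρ` improves it by one power. -/
def IsRemainder (U : Set (Fin 3 → ℝ)) (m : ℕ) (f : Fld 4) : Prop :=
  ∀ x ∈ U,
    (∀ᶠ ρ : ℝ in atTop, ContDiffAt ℝ 2 f (Matrix.vecCons ρ x)) ∧
    ((fun ρ : ℝ => f (Matrix.vecCons ρ x)) =o[atTop] fun ρ => (ρ ^ m)⁻¹) ∧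
    (∀ μ, (fun ρ : ℝ => pd μ f (Matrix.vecCons ρ x)) =o[atTop] fun ρ => (ρ ^ (m + radial μ))⁻¹) ∧
    ∀ μ ν, (fun ρ : ℝ => pd μ (pd ν f) (Matrix.vecCons ρ x)) =o[atTop]
      fun ρ => (ρ ^ (m + radial μ + radial ν))⁻¹

/-- The metric
`ds² = (1 + 2σ/ρ + σ²/ρ² + s) dρ² + 2 N_a dρ dx^a
  + ρ² (h_{ab} + h1_{ab}/ρ + ln ρ i_{ab}/ρ² + h2_{ab}/ρ² + r_{ab}) dx^a dx^b`
with `h1_{ab} = k_{ab} - 2σ h_{ab}`. -/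
def metric (h : Cov2) (σ : Fld 3) (k i h2 : Cov2)
    (s : Fld 4) (N : Fin 3 → Fld 4) (r : Fin 3 → Fin 3 → Fld 4) : Fin 4 → Fin 4 → Fld 4 :=
  Fin.cons
    (Fin.cons
      (fun p => 1 + 2 * σ (Fin.tail p) / p 0 + σ (Fin.tail p) ^ 2 / p 0 ^ 2 + s p)
      (fun b => N b))
    (fun a => Fin.cons (N a) (fun b p =>
      p 0 ^ 2 * (h a b (Fin.tail p) +
        (k a b (Fin.tail p) - 2 * σ (Fin.tail p) * h a b (Fin.tail p)) / p 0 +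
        Real.log (p 0) * i a b (Fin.tail p) / p 0 ^ 2 + h2 a b (Fin.tail p) / p 0 ^ 2 + r a b p)))

/-- The remainders are of the order allowed by the expansion:
`s = o(ρ^{-2})`, `N_a = o(ρ^{-1})`, `r_{ab} = r_{ba} = o(ρ^{-2})`. -/
def AreRemainders (U : Set (Fin 3 → ℝ)) (s : Fld 4) (N : Fin 3 → Fld 4)
    (r : Fin 3 → Fin 3 → Fld 4) : Prop :=
  IsRemainder U 2 s ∧ (∀ a, IsRemainder U 1 (N a)) ∧ (∀ a b, IsRemainder U 2 (r a b)) ∧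
    ∀ a b, r a b = r b a

/-- Einstein's vacuum equations `R_{μν} = 0` hold through order `n`:
`R_{ρρ} = o(ρ^{-n-2})`, `R_{ρa} = o(ρ^{-n-1})`, `R_{ab} = o(ρ^{-n})` over every `x ∈ U`. -/
def EinsteinToOrder (U : Set (Fin 3 → ℝ)) (n : ℕ) (g : Fin 4 → Fin 4 → Fld 4) : Prop :=
  ∀ x ∈ U, ∀ μ ν, (fun ρ : ℝ => ricci g μ ν (Matrix.vecCons ρ x)) =o[atTop]
    fun ρ => (ρ ^ (n + radial μ + radial ν))⁻¹

/-! ### The systems of equations on the boundary -/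

/-- `(□ + 3) σ = 0` and `(□ - 3) k_{ab} = 0`. -/
def FirstOrderEqs (U : Set (Fin 3 → ℝ)) (h : Cov2) (σ : Fld 3) (k : Cov2) : Prop :=
  EqOn (boxS h σ + (3 : ℝ) • σ) 0 U ∧ AgreeOn U (boxT h k - (3 : ℝ) • k) 0

/-- `i_{ab}` is traceless and divergence-free, and `(□ - 2) i_{ab} = 0`. -/
def LogEqs (U : Set (Fin 3 → ℝ)) (h i : Cov2) : Prop :=
  IsSDT U h i ∧ AgreeOn U (boxT h i - (2 : ℝ) • i) 0

/-- The second-order equations: those for `i`, and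
* `h2^a_a = 12σ² + σ_c σ^c + ¼ k_{cd} k^{cd} + k_{cd} σ^{cd}`,
* `D^b h2_{ab} = ½ D^b k_{ac} k_b^c + D_a (σ_c σ^c + 8σ² - ⅛ k_{cd} k^{cd} + k_{cd} σ^{cd})`,
* `(□ - 2) h2_{ab} = 2 i_{ab} + NL_{ab}(σ,σ) + NL_{ab}(σ,k) + NL_{ab}(k,k)`. -/
def SecondOrderEqs (U : Set (Fin 3 → ℝ)) (h : Cov2) (σ : Fld 3) (k i h2 : Cov2) : Prop :=
  LogEqs U h i ∧
  EqOn (tr h h2) ((12 : ℝ) • σ ^ 2 + gradSq h σ + (1 / 4 : ℝ) • inner2 h k k +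
    inner2 h k (hess h σ)) U ∧
  (∀ a, EqOn (dvg h h2 a)
    ((1 / 2 : ℝ) • (∑ b, ∑ c, ∑ d, ginv h b d * D2 h k d a c * mixed h k b c) +
      pd a (gradSq h σ + (8 : ℝ) • σ ^ 2 - (1 / 8 : ℝ) • inner2 h k k +
        inner2 h k (hess h σ))) U) ∧
  AgreeOn U (boxT h h2 - (2 : ℝ) • h2) ((2 : ℝ) • i + NLss h σ + NLsk h σ k + NLkk h k)

/-- `V_{ab} = -h2_{ab} + ½ i_{ab} + Q^V_{ab}`. -/
def Vof (h : Cov2) (σ : Fld 3) (k i h2 : Cov2) : Cov2 := -h2 + (1 / 2 : ℝ) • i + QV h σ k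

/-- `W_{ab} = ε_a^{cd} D_c (h2_{db} - ½ i_{db} + Q^W_{db})`. -/
def Wof (h : Cov2) (σ : Fld 3) (k i h2 : Cov2) : Cov2 :=
  curl h (h2 - (1 / 2 : ℝ) • i + QW h σ k)

/-- `W` is SDT with `(□ - 2) W_{ab} = curl(2i + κ)_{(ab)}`; `i` is SDT with `(□ - 2) i_{ab} = 0`. -/
def WSystem (U : Set (Fin 3 → ℝ)) (h : Cov2) (σ : Fld 3) (k W i : Cov2) : Prop :=
  IsSDT U h W ∧ AgreeOn U (boxT h W - (2 : ℝ) • W) (symCurl h ((2 : ℝ) • i + kappa h σ k)) ∧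
  LogEqs U h i

/-- `V` is SDT with `(□ - 2) V_{ab} = curl(-2j + symcurl κ)_{ab}`, where `symcurl κ` has components
`curl(κ)_{(ab)}`; `j` is SDT with `(□ - 2) j_{ab} = 0`. -/
def VSystem (U : Set (Fin 3 → ℝ)) (h : Cov2) (σ : Fld 3) (k V j : Cov2) : Prop :=
  IsSDT U h V ∧
  AgreeOn U (boxT h V - (2 : ℝ) • V) (curl h (-(2 : ℝ) • j + symCurl h (kappa h σ k))) ∧
  LogEqs U h j

/-- `h2 = -V + ½ i + Q^V`, the inversion of the definition of `V`. -/
def h2of (h : Cov2) (σ : Fld 3) (k V i : Cov2) : Cov2 := -V + (1 / 2 : ℝ) • i + QV h σ k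

end BeigSchmidt

end

open BeigSchmidt

open Set Filter Asymptotics
open scoped ContDiff

noncomputable section

namespace BeigSchmidt

/-! ### The ring of smooth functions on an open set -/

/-- The functions that are smooth on `V`. -/
def smoothOn (V : Set (Fin 3 → ℝ)) : Subalgebra ℝ (Fld 3) where
  carrier := {f | ContDiffOn ℝ ∞ f V}
  mul_mem' := fun hf hg => ContDiffOn.mul hf hg
  add_mem' := fun hf hg => ContDiffOn.add hf hg
  algebraMap_mem' := fun _ => contDiffOn_const

lemma mem_smoothOn {V : Set (Fin 3 → ℝ)} {f : Fld 3} : f ∈ smoothOn V ↔ ContDiffOn ℝ ∞ f V :=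
  Iff.rfl

lemma smoothOn_mono {V U : Set (Fin 3 → ℝ)} (h : V ⊆ U) : smoothOn U ≤ smoothOn V :=
  fun _ hf => ContDiffOn.mono hf h

lemma contDiffAt_of_smoothOn {V : Set (Fin 3 → ℝ)} (hV : IsOpen V) {f : Fld 3}
    (hf : f ∈ smoothOn V) {x : Fin 3 → ℝ} (hx : x ∈ V) : ContDiffAt ℝ ∞ f x :=
  ContDiffOn.contDiffAt hf (hV.mem_nhds hx)

lemma differentiableAt_of_smoothOn {V : Set (Fin 3 → ℝ)} (hV : IsOpen V) {f : Fld 3}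
    (hf : f ∈ smoothOn V) {x : Fin 3 → ℝ} (hx : x ∈ V) : DifferentiableAt ℝ f x :=
  (contDiffAt_of_smoothOn hV hf hx).differentiableAt (by simp)

lemma pd_mem_smoothOn {V : Set (Fin 3 → ℝ)} (hV : IsOpen V) {f : Fld 3} (hf : f ∈ smoothOn V)
    (a : Fin 3) : pd a f ∈ smoothOn V := by
  have h : ContDiffOn ℝ ∞ (fderiv ℝ f) V := by
    refine ContDiffOn.fderiv_of_isOpen hf hV ?_
    simp
  exact h.clm_apply contDiffOn_const

section PdRules

variable {n : ℕ} {f g : Fld n} {x : Fin n → ℝ}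

lemma pd_add_apply (hf : DifferentiableAt ℝ f x) (hg : DifferentiableAt ℝ g x) (a : Fin n) :
    pd a (f + g) x = pd a f x + pd a g x := by
  simp [pd, fderiv_add hf hg]

lemma pd_mul_apply (hf : DifferentiableAt ℝ f x) (hg : DifferentiableAt ℝ g x) (a : Fin n) :
    pd a (f * g) x = f x * pd a g x + pd a f x * g x := by
  simp [pd, fderiv_mul hf hg, mul_comm]

lemma pd_smul_apply (c : ℝ) (hf : DifferentiableAt ℝ f x) (a : Fin n) :
    pd a (c • f) x = c * pd a f x := by
  simp [pd, fderiv_const_smul hf c]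

lemma pd_congr_apply (h : f =ᶠ[nhds x] g) (a : Fin n) : pd a f x = pd a g x := by
  simp [pd, h.fderiv_eq]

lemma pd_comm_apply (hf : ContDiffAt ℝ 2 f x) (a b : Fin n) :
    pd a (pd b f) x = pd b (pd a f) x := by
  have hd : DifferentiableAt ℝ (fderiv ℝ f) x :=
    (hf.fderiv_right (m := 1) (by norm_num)).differentiableAt (by simp)
  have key : ∀ u v : Fin n → ℝ, fderiv ℝ (fun y => fderiv ℝ f y u) x v =
      fderiv ℝ (fderiv ℝ f) x v u := by
    intro u v
    have := (hd.hasFDerivAt.clm_apply (hasFDerivAt_const u x)).fderiv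
    rw [this]; simp
  have hs : IsSymmSndFDerivAt ℝ f x := hf.isSymmSndFDerivAt (by simp)
  change fderiv ℝ (fun y => fderiv ℝ f y _) x _ = fderiv ℝ (fun y => fderiv ℝ f y _) x _
  rw [key, key]
  exact hs _ _

end PdRules

lemma pd_congr_of_eqOn {V : Set (Fin 3 → ℝ)} (hV : IsOpen V) {f g : Fld 3} (h : EqOn f g V)
    (a : Fin 3) : EqOn (pd a f) (pd a g) V := fun _ hx =>
  pd_congr_apply (h.eventuallyEq_of_mem (hV.mem_nhds hx)) a

/-- Restriction of functions to a subset. -/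
def restr (V : TopologicalSpace.Opens (Fin 3 → ℝ)) : Fld 3 →ₐ[ℝ] (↥V → ℝ) where
  toFun f x := f x.1
  map_one' := rfl
  map_mul' _ _ := rfl
  map_zero' := rfl
  map_add' _ _ := rfl
  commutes' _ := rfl

/-- The smooth functions on the open set `V`, as a subalgebra. -/
def smoothSub (V : TopologicalSpace.Opens (Fin 3 → ℝ)) : Subalgebra ℝ (↥V → ℝ) :=
  (smoothOn (V : Set (Fin 3 → ℝ))).map (restr V)

/-- The ring of smooth functions on the open set `V`. -/
def Sm (V : TopologicalSpace.Opens (Fin 3 → ℝ)) : Type := smoothSub V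

instance (V : TopologicalSpace.Opens (Fin 3 → ℝ)) : CommRing (Sm V) :=
  inferInstanceAs (CommRing (smoothSub V))

instance (V : TopologicalSpace.Opens (Fin 3 → ℝ)) : Algebra ℝ (Sm V) :=
  inferInstanceAs (Algebra ℝ (smoothSub V))

namespace Sm

variable {V : TopologicalSpace.Opens (Fin 3 → ℝ)}

/-- The restriction of a function that is smooth on `V`. -/
def mk (f : Fld 3) (hf : f ∈ smoothOn (V : Set (Fin 3 → ℝ))) : Sm V := ⟨restr V f, f, hf, rfl⟩

/-- A representative. -/
def rep (F : Sm V) : Fld 3 := F.2.choose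

lemma rep_mem (F : Sm V) : rep F ∈ smoothOn (V : Set (Fin 3 → ℝ)) := F.2.choose_spec.1

/-- Evaluation at a point. -/
def ev (x : V) : Sm V →ₐ[ℝ] ℝ := (Pi.evalAlgHom ℝ (fun _ : ↥V => ℝ) x).comp (smoothSub V).val

@[simp] lemma ev_mk (x : V) (f : Fld 3) (hf) : ev x (mk f hf) = f x := rfl

lemma ext_ev {F G : Sm V} (h : ∀ x : V, ev x F = ev x G) : F = G := Subtype.ext (funext h)

lemma mk_eq_mk {f g : Fld 3} {hf hg} : (mk f hf : Sm V) = mk g hg ↔ EqOn f g V := by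
  constructor
  · intro h x hx
    exact congrArg (ev ⟨x, hx⟩) h
  · intro h
    exact ext_ev fun x => h x.2

lemma mk_rep (F : Sm V) : mk (rep F) (rep_mem F) = F := Subtype.ext F.2.choose_spec.2

lemma rep_mk (f : Fld 3) (hf) : EqOn (rep (mk f hf : Sm V)) f V := by
  rw [← mk_eq_mk (hf := rep_mem _) (hg := hf)]
  exact mk_rep _

lemma rep_apply (F : Sm V) (x : V) : rep F x = ev x F := by
  conv_rhs => rw [← mk_rep F]
  rfl

lemma rep_contDiffAt (F : Sm V) (x : V) : ContDiffAt ℝ ∞ (rep F) x :=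
  contDiffAt_of_smoothOn V.isOpen (rep_mem F) x.2

lemma rep_diff (F : Sm V) (x : V) : DifferentiableAt ℝ (rep F) x :=
  differentiableAt_of_smoothOn V.isOpen (rep_mem F) x.2

/-- The partial derivative on the ring of smooth functions. -/
def pdFun (a : Fin 3) (F : Sm V) : Sm V := mk (pd a (rep F)) (pd_mem_smoothOn V.isOpen (rep_mem F) a)

lemma pdFun_mk (a : Fin 3) (f : Fld 3) (hf) :
    pdFun a (mk f hf : Sm V) = mk (pd a f) (pd_mem_smoothOn V.isOpen hf a) :=
  mk_eq_mk.2 (pd_congr_of_eqOn V.isOpen (rep_mk f hf) a)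

lemma ev_pdFun (a : Fin 3) (F : Sm V) (x : V) : ev x (pdFun a F) = pd a (rep F) x := rfl

lemma rep_eventuallyEq {F : Sm V} {f : Fld 3} (h : ∀ x : V, ev x F = f x) (x : V) :
    rep F =ᶠ[nhds (x : Fin 3 → ℝ)] f := by
  filter_upwards [V.isOpen.mem_nhds x.2] with y hy
  rw [← h ⟨y, hy⟩, ← rep_apply]

/-- The partial derivative as a derivation. -/
def der (a : Fin 3) : Derivation ℝ (Sm V) (Sm V) :=
  Derivation.mk'
    { toFun := pdFun a
      map_add' := fun F G => ext_ev fun x => by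
        rw [map_add, ev_pdFun, ev_pdFun, ev_pdFun, ← pd_add_apply (rep_diff F x) (rep_diff G x)]
        exact pd_congr_apply (rep_eventuallyEq (fun y => by simp [rep_apply]) x) a
      map_smul' := fun c F => ext_ev fun x => by
        rw [RingHom.id_apply, map_smul, ev_pdFun, ev_pdFun, smul_eq_mul,
          ← pd_smul_apply c (rep_diff F x)]
        exact pd_congr_apply (rep_eventuallyEq (fun y => by simp [rep_apply]) x) a }
    fun F G => ext_ev fun x => by
      change ev x (pdFun a (F * G)) = ev x (F * pdFun a G + G * pdFun a F)
      rw [map_add, map_mul, map_mul, ev_pdFun, ev_pdFun, ev_pdFun, ← rep_apply F, ← rep_apply G,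
        mul_comm (rep G _), ← pd_mul_apply (rep_diff F x) (rep_diff G x)]
      exact pd_congr_apply (rep_eventuallyEq (fun y => by simp [rep_apply]) x) a

lemma der_mk (a : Fin 3) (f : Fld 3) (hf) :
    der a (mk f hf : Sm V) = mk (pd a f) (pd_mem_smoothOn V.isOpen hf a) := pdFun_mk a f hf

lemma der_comm (a b : Fin 3) (F : Sm V) : der a (der b F) = der b (der a F) := by
  rw [← mk_rep F, der_mk, der_mk, der_mk, der_mk, mk_eq_mk]
  intro x hx
  exact pd_comm_apply ((rep_contDiffAt F ⟨x, hx⟩).of_le (by norm_cast)) a b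

end Sm

/-! ### Null frames over a differential ring -/

/-- The components of the metric in a null frame. -/
def nullMetric (R : Type*) [Zero R] [One R] (I J : Fin 3) : R := if J = I.rev then 1 else 0

/-- A torsion-free connection `Γ` over a ring with three commuting derivations, and a frame `E` with
coframe `F`. -/
structure Framed (R : Type*) [CommRing R] [Algebra ℝ R] where
  d : Fin 3 → Derivation ℝ R R
  d_comm : ∀ a b f, d a (d b f) = d b (d a f)
  Γ : Fin 3 → Fin 3 → Fin 3 → R
  Γ_symm : ∀ a b c, Γ a b c = Γ a c b
  E : Fin 3 → Fin 3 → R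
  F : Fin 3 → Fin 3 → R
  FE : ∀ I J, ∑ a, F I a * E a J = if I = J then 1 else 0
  EF : ∀ a b, ∑ I, E a I * F I b = if a = b then 1 else 0

namespace Framed

variable {R : Type*} [CommRing R] [Algebra ℝ R] (G : Framed R)
variable {M : Type*} [AddCommGroup M] [Module R M]

/-- Covariant differentiation in one more slot. -/
def cov (c : Fin 3) (D : M → M) (T : Fin 3 → M) : Fin 3 → M := fun a =>
  D (T a) - ∑ e, G.Γ e c a • T e

/-- The connection coefficients of the frame: `D_c E_I = ∑_L conn c I L E_L`. -/
def conn (c I L : Fin 3) : R := ∑ a, G.F L a * (G.d c (G.E a I) + ∑ b, G.Γ a c b * G.E b I)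

/-- Covariant differentiation of frame components in one more slot. -/
def covF (c : Fin 3) (D : M → M) (T : Fin 3 → M) : Fin 3 → M := fun I =>
  D (T I) - ∑ L, G.conn c I L • T L

/-- Frame components with respect to the first slot. -/
def tf (T : Fin 3 → M) : Fin 3 → M := fun I => ∑ a, G.E a I • T a

lemma tf_add (S T : Fin 3 → M) : G.tf (S + T) = G.tf S + G.tf T := by
  funext I; simp [tf, Finset.sum_add_distrib]

lemma tf_smul (r : R) (T : Fin 3 → M) : G.tf (r • T) = r • G.tf T := by
  funext I
  simp only [tf, Pi.smul_apply, Finset.smul_sum]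
  exact Finset.sum_congr rfl fun a _ => smul_comm _ _ _

lemma d_E (c a I : Fin 3) :
    G.d c (G.E a I) = ∑ L, G.conn c I L * G.E a L - ∑ b, G.Γ a c b * G.E b I := by
  have : ∑ L, G.conn c I L * G.E a L = ∑ x, (∑ L, G.E a L * G.F L x) *
      (G.d c (G.E x I) + ∑ b, G.Γ x c b * G.E b I) := by
    simp only [conn, Finset.sum_mul]
    rw [Finset.sum_comm]
    exact Finset.sum_congr rfl fun x _ => Finset.sum_congr rfl fun L _ => by ring
  rw [this]
  simp [G.EF]

/-- A differentiation rule on a module. -/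
structure IsCov (c : Fin 3) (D : M → M) : Prop where
  map_add : ∀ m n, D (m + n) = D m + D n
  leib : ∀ (r : R) m, D (r • m) = G.d c r • m + r • D m

variable {G}

lemma IsCov.map_zero {c : Fin 3} {D : M → M} (h : G.IsCov c D) : D 0 = 0 := by
  simpa using h.leib 0 0

lemma IsCov.map_neg {c : Fin 3} {D : M → M} (h : G.IsCov c D) (m : M) : D (-m) = - D m := by
  have := h.map_add m (-m)
  rw [add_neg_cancel, h.map_zero] at this
  exact (neg_eq_of_add_eq_zero_right this.symm).symm

lemma IsCov.map_sub {c : Fin 3} {D : M → M} (h : G.IsCov c D) (m n : M) :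
    D (m - n) = D m - D n := by
  rw [sub_eq_add_neg, h.map_add, h.map_neg, sub_eq_add_neg]

lemma IsCov.map_sum {c : Fin 3} {D : M → M} (h : G.IsCov c D) {ι : Type*} (s : Finset ι)
    (f : ι → M) : D (∑ i ∈ s, f i) = ∑ i ∈ s, D (f i) :=
  _root_.map_sum (⟨⟨D, h.map_zero⟩, h.map_add⟩ : M →+ M) f s

variable (G)

lemma isCov_d (c : Fin 3) : G.IsCov c (fun f : R => G.d c f) :=
  ⟨fun m n => by simp, fun r m => by simp [mul_comm, add_comm]⟩

variable {G}

lemma IsCov.cov {c : Fin 3} {D : M → M} (h : G.IsCov c D) : G.IsCov c (G.cov c D) := by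
  constructor
  · intro m n; funext a
    simp only [Framed.cov, Pi.add_apply, h.map_add, smul_add, Finset.sum_add_distrib]
    abel
  · intro r m; funext a
    simp only [Framed.cov, Pi.add_apply, Pi.smul_apply, h.leib, smul_sub, Finset.smul_sum,
      smul_comm r]
    abel

lemma IsCov.covF {c : Fin 3} {D : M → M} (h : G.IsCov c D) : G.IsCov c (G.covF c D) := by
  constructor
  · intro m n; funext a
    simp only [Framed.covF, Pi.add_apply, h.map_add, smul_add, Finset.sum_add_distrib]
    abel
  · intro r m; funext a
    simp only [Framed.covF, Pi.add_apply, Pi.smul_apply, h.leib, smul_sub, Finset.smul_sum,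
      smul_comm r]
    abel

/-- Covariant differentiation commutes with passing to frame components. -/
lemma tf_cov {c : Fin 3} {D D' : M → M} (h' : G.IsCov c D') (τ : M →ₗ[R] M)
    (hτ : ∀ m, τ (D m) = D' (τ m)) (T : Fin 3 → M) :
    G.tf (fun a => τ (G.cov c D T a)) = G.covF c D' (G.tf fun a => τ (T a)) := by
  funext I
  simp only [tf, cov, covF, map_sub, hτ, _root_.map_sum, map_smul, h'.map_sum, h'.leib,
    Finset.sum_add_distrib, smul_sub, Finset.sum_sub_distrib, d_E, sub_smul, Finset.sum_smul,
    Finset.smul_sum, smul_smul]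
  have h1 : ∑ x, ∑ L, (G.conn c I L * G.E x L) • τ (T x) =
      ∑ L, ∑ x, (G.conn c I L * G.E x L) • τ (T x) := Finset.sum_comm
  have h2 : ∑ x, ∑ i, (G.E x I * G.Γ i c x) • τ (T i) =
      ∑ x, ∑ i, (G.Γ x c i * G.E i I) • τ (T x) := by
    rw [Finset.sum_comm]
    simp only [mul_comm]
  rw [h1, h2]
  abel

/-- The commutator of covariant derivatives in one more slot. -/
lemma cov_comm {D : Fin 3 → M → M} (h : ∀ c, G.IsCov c (D c)) (c c' : Fin 3) (T : Fin 3 → M)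
    (a : Fin 3) :
    G.cov c (D c) (G.cov c' (D c') T) a - G.cov c' (D c') (G.cov c (D c) T) a =
      (D c (D c' (T a)) - D c' (D c (T a))) -
      ∑ f, (G.d c (G.Γ f a c') - G.d c' (G.Γ f a c) +
        ∑ e, (G.Γ f c e * G.Γ e a c' - G.Γ f c' e * G.Γ e a c)) • T f := by
  simp only [cov, (h _).map_sub, (h _).map_sum, (h _).leib, Finset.sum_add_distrib, smul_sub,
    Finset.smul_sum, smul_smul, Finset.sum_sub_distrib, add_smul, sub_smul, Finset.sum_smul]
  have h1 : ∀ c c', ∑ x, ∑ i, (G.Γ x c a * G.Γ i c' x) • T i =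
      ∑ x, ∑ i, (G.Γ x c' i * G.Γ i a c) • T x := by
    intro c c'
    rw [Finset.sum_comm]
    refine Finset.sum_congr rfl fun x _ => Finset.sum_congr rfl fun i _ => ?_
    rw [mul_comm, G.Γ_symm i c a]
  rw [h1 c c', h1 c' c]
  simp only [G.Γ_symm _ c a, G.Γ_symm _ c' a]
  abel

variable (G)

/-! #### Coordinate components -/

/-- `D_c v_a`. -/
def D1 (v : Fin 3 → R) (c a : Fin 3) : R := G.d c (v a) - ∑ e, G.Γ e c a * v e

/-- `D_c T_{ab}`. -/
def D2 (T : Fin 3 → Fin 3 → R) (c a b : Fin 3) : R :=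
  G.d c (T a b) - ∑ e, (G.Γ e c a * T e b + G.Γ e c b * T a e)

/-- `D_d S_{cab}`. -/
def D3 (S : Fin 3 → Fin 3 → Fin 3 → R) (d c a b : Fin 3) : R :=
  G.d d (S c a b) - ∑ e, (G.Γ e d c * S e a b + G.Γ e d a * S c e b + G.Γ e d b * S c a e)

lemma D1_eq (v : Fin 3 → R) (c : Fin 3) : G.D1 v c = G.cov c (G.d c) v := by
  funext a; simp [D1, cov]

lemma D2_eq (T : Fin 3 → Fin 3 → R) (c : Fin 3) :
    G.D2 T c = G.cov c (G.cov c (G.d c)) T := by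
  funext a b
  simp only [D2, cov, Pi.sub_apply, Finset.sum_apply, Pi.smul_apply, smul_eq_mul,
    Finset.sum_add_distrib]
  abel

lemma D3_eq (S : Fin 3 → Fin 3 → Fin 3 → R) (c : Fin 3) :
    G.D3 S c = G.cov c (G.cov c (G.cov c (G.d c))) S := by
  funext a b e
  simp only [D3, cov, Pi.sub_apply, Finset.sum_apply, Pi.smul_apply, smul_eq_mul,
    Finset.sum_add_distrib]
  abel

/-! #### Frame components -/

/-- The frame derivation. -/
def e (K : Fin 3) : Derivation ℝ R R := ∑ c, G.E c K • G.d c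

lemma e_apply (K : Fin 3) (f : R) : G.e K f = ∑ c, G.E c K * G.d c f := by
  have : ∀ s : Finset (Fin 3), (∑ c ∈ s, G.E c K • G.d c) f = ∑ c ∈ s, G.E c K * G.d c f := by
    intro s
    induction s using Finset.induction_on with
    | empty => simp
    | insert i s hi ih => rw [Finset.sum_insert hi, Finset.sum_insert hi, Derivation.add_apply, ih]; rfl
  exact this _

/-- The connection coefficients in the frame: `D_K E_I = ∑_L om K I L E_L`. -/
def om (K I L : Fin 3) : R := ∑ c, G.E c K * G.conn c I L

/-- Frame derivative of a covector. -/
def N1 (v : Fin 3 → R) (K I : Fin 3) : R := G.e K (v I) - ∑ L, G.om K I L * v L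

/-- Frame derivative of a rank-two tensor. -/
def N2 (T : Fin 3 → Fin 3 → R) (K I J : Fin 3) : R :=
  G.e K (T I J) - ∑ L, (G.om K I L * T L J + G.om K J L * T I L)

/-- Frame derivative of a rank-three tensor. -/
def N3 (S : Fin 3 → Fin 3 → Fin 3 → R) (P K I J : Fin 3) : R :=
  G.e P (S K I J) - ∑ L, (G.om P K L * S L I J + G.om P I L * S K L J + G.om P J L * S K I L)

/-- Frame components of a covector. -/
def tf1 (v : Fin 3 → R) : Fin 3 → R := G.tf v

/-- Frame components of a rank-two tensor. -/
def tf2 (T : Fin 3 → Fin 3 → R) : Fin 3 → Fin 3 → R := G.tf fun a => G.tf1 (T a)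

/-- Frame components of a rank-three tensor. -/
def tf3 (T : Fin 3 → Fin 3 → Fin 3 → R) : Fin 3 → Fin 3 → Fin 3 → R := G.tf fun a => G.tf2 (T a)

/-- Frame components of a rank-four tensor. -/
def tf4 (T : Fin 3 → Fin 3 → Fin 3 → Fin 3 → R) : Fin 3 → Fin 3 → Fin 3 → Fin 3 → R :=
  G.tf fun a => G.tf3 (T a)

/-- `tf` as a linear map. -/
def tfL {M : Type*} [AddCommGroup M] [Module R M] (τ : M →ₗ[R] M) : (Fin 3 → M) →ₗ[R] (Fin 3 → M) where
  toFun T := G.tf fun a => τ (T a)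
  map_add' S T := by rw [← tf_add]; congr 1; funext a; simp
  map_smul' r T := by
    rw [RingHom.id_apply, ← tf_smul]; congr 1; funext a; simp

/-- Passage to frame components as a linear map on covectors. -/
def tf1L : (Fin 3 → R) →ₗ[R] (Fin 3 → R) := G.tfL LinearMap.id

/-- Passage to frame components as a linear map on rank-two tensors. -/
def tf2L : (Fin 3 → Fin 3 → R) →ₗ[R] (Fin 3 → Fin 3 → R) := G.tfL G.tf1L

/-- Passage to frame components as a linear map on rank-three tensors. -/
def tf3L : (Fin 3 → Fin 3 → Fin 3 → R) →ₗ[R] (Fin 3 → Fin 3 → Fin 3 → R) := G.tfL G.tf2L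

lemma tf2L_apply (v) : G.tf2L v = G.tf2 v := rfl
lemma tf3L_apply (v) : G.tf3L v = G.tf3 v := rfl

lemma tf1_cov (c : Fin 3) (v : Fin 3 → R) :
    G.tf1 (G.cov c (G.d c) v) = G.covF c (G.d c) (G.tf1 v) :=
  tf_cov (G.isCov_d c) LinearMap.id (fun _ => rfl) v

lemma tf2_cov (c : Fin 3) (T : Fin 3 → Fin 3 → R) :
    G.tf2 (G.cov c (G.cov c (G.d c)) T) = G.covF c (G.covF c (G.d c)) (G.tf2 T) :=
  tf_cov (G.isCov_d c).covF G.tf1L (G.tf1_cov c) T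

lemma tf3_cov (c : Fin 3) (T : Fin 3 → Fin 3 → Fin 3 → R) :
    G.tf3 (G.cov c (G.cov c (G.cov c (G.d c))) T) =
      G.covF c (G.covF c (G.covF c (G.d c))) (G.tf3 T) :=
  tf_cov (G.isCov_d c).covF.covF G.tf2L (G.tf2_cov c) T

lemma e_zero_tf (f : R) (K : Fin 3) : G.tf1 (fun c => G.d c f) K = G.e K f := by
  simp [tf1, tf, e_apply]

lemma tf2_D1 (v : Fin 3 → R) : G.tf2 (G.D1 v) = G.N1 (G.tf1 v) := by
  funext K I
  have : ∀ c, G.tf1 (G.D1 v c) = G.covF c (G.d c) (G.tf1 v) := fun c => by rw [D1_eq, tf1_cov]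
  simp only [tf2, this]
  simp only [tf, covF, N1, e_apply, om, Finset.sum_apply, Pi.smul_apply, smul_eq_mul, mul_sub,
    Finset.sum_sub_distrib, Finset.mul_sum, Finset.sum_mul]
  congr 1
  rw [Finset.sum_comm]
  simp only [mul_assoc]

lemma tf3_D2 (T : Fin 3 → Fin 3 → R) : G.tf3 (G.D2 T) = G.N2 (G.tf2 T) := by
  funext K I J
  have : ∀ c, G.tf2 (G.D2 T c) = G.covF c (G.covF c (G.d c)) (G.tf2 T) := fun c => by
    rw [D2_eq, tf2_cov]
  simp only [tf3, this]
  simp only [tf, covF, N2, e_apply, om, Finset.sum_apply, Pi.smul_apply, Pi.sub_apply, smul_eq_mul,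
    mul_sub, Finset.sum_sub_distrib, Finset.mul_sum, Finset.sum_mul, Finset.sum_add_distrib]
  rw [sub_sub, add_comm]
  congr 2 <;> · rw [Finset.sum_comm]; simp only [mul_assoc]

lemma tf4_D3 (T : Fin 3 → Fin 3 → Fin 3 → R) : G.tf4 (G.D3 T) = G.N3 (G.tf3 T) := by
  funext K I J L
  have : ∀ c, G.tf3 (G.D3 T c) = G.covF c (G.covF c (G.covF c (G.d c))) (G.tf3 T) := fun c => by
    rw [D3_eq, tf3_cov]
  simp only [tf4, this]
  simp only [tf, covF, N3, e_apply, om, Finset.sum_apply, Pi.smul_apply, Pi.sub_apply, smul_eq_mul,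
    mul_sub, Finset.sum_sub_distrib, Finset.mul_sum, Finset.sum_mul, Finset.sum_add_distrib]
  have hs : ∀ f : Fin 3 → Fin 3 → R, ∑ x, ∑ y, f x y = ∑ y, ∑ x, f x y := fun f => Finset.sum_comm
  simp only [mul_assoc]
  rw [hs fun x i => G.E x K * (G.conn x L i * _), hs fun x i => G.E x K * (G.conn x J i * _),
    hs fun x i => G.E x K * (G.conn x I i * _)]
  abel

end Framed

/-! ### Spaces of constant curvature in a null frame -/

lemma nullMetric_comm {R : Type*} [Zero R] [One R] (I J : Fin 3) : nullMetric R I J = nullMetric R J I := by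
  have e1 : ∀ K I : Fin 3, (K = I.rev) ↔ (I = K.rev) := fun K I => by
    rw [← Fin.rev_inj, Fin.rev_rev, eq_comm]
  rw [nullMetric, nullMetric, if_congr (e1 J I) rfl rfl]

/-- A framed connection of constant curvature `+1` whose metric has null components in the frame. -/
structure Geo (R : Type*) [CommRing R] [Algebra ℝ R] extends Framed R where
  metric_d : ∀ c a b, d c (∑ I, F I a * F I.rev b) =
    ∑ e, (Γ e c a * (∑ I, F I e * F I.rev b) + Γ e c b * ∑ I, F I a * F I.rev e)
  curv : ∀ a b c c', d c (Γ a b c') - d c' (Γ a b c) +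
      ∑ e, (Γ a c e * Γ e b c' - Γ a c' e * Γ e b c) =
    (if a = c then ∑ I, F I b * F I.rev c' else 0) - (if a = c' then ∑ I, F I b * F I.rev c else 0)

namespace Geo

variable {R : Type*} [CommRing R] [Algebra ℝ R] (G : Geo R)

/-- The metric. -/
def h (a b : Fin 3) : R := ∑ I, G.F I a * G.F I.rev b

lemma h_symm (a b : Fin 3) : G.h a b = G.h b a := by
  simp only [h, Fin.sum_univ_three]
  simp [show Fin.rev (0 : Fin 3) = 2 from rfl, show Fin.rev (1 : Fin 3) = 1 from rfl,
    show Fin.rev (2 : Fin 3) = 0 from rfl]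
  ring

lemma sum_E_h (I c : Fin 3) : ∑ a, G.E a I * G.h a c = G.F I.rev c := by
  simp only [h, Finset.mul_sum]
  rw [Finset.sum_comm]
  have : ∀ J, ∑ a, G.E a I * (G.F J a * G.F J.rev c) = (if J = I then 1 else 0) * G.F J.rev c := by
    intro J
    rw [← G.FE, Finset.sum_mul]
    exact Finset.sum_congr rfl fun a _ => by ring
  simp [this]

lemma tf2_h : G.tf2 G.h = nullMetric R := by
  funext I J
  simp only [Framed.tf2, Framed.tf1, Framed.tf, Finset.sum_apply, Pi.smul_apply, smul_eq_mul, Finset.mul_sum]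
  rw [Finset.sum_comm]
  have : ∀ b, ∑ a, G.E a I * (G.E b J * G.h a b) = G.F I.rev b * G.E b J := by
    intro b
    rw [← sum_E_h, Finset.sum_mul]
    exact Finset.sum_congr rfl fun a _ => by ring
  simp only [this, G.FE, nullMetric]
  simp only [eq_comm]

lemma D2_h (c a b : Fin 3) : G.D2 G.h c a b = 0 := by
  rw [Framed.D2, sub_eq_zero]
  exact G.metric_d c a b

lemma om_antisymm (K I J : Fin 3) : G.om K I J.rev + G.om K J I.rev = 0 := by
  have h1 : G.tf3 (G.D2 G.h) K I J = 0 := by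
    have : G.D2 G.h = 0 := by funext c a b; exact G.D2_h c a b
    rw [this, ← Framed.tf3L_apply, map_zero]; rfl
  rw [Framed.tf3_D2, tf2_h] at h1
  simp only [Framed.N2, nullMetric] at h1
  have h2 : G.e K (if J = I.rev then (1 : R) else 0) = 0 := by
    split_ifs
    · exact Derivation.map_one_eq_zero _
    · exact map_zero _
  rw [h2] at h1
  have h3 : ∀ L : Fin 3, (J = L.rev) ↔ (L = J.rev) := fun L => by
    rw [← Fin.rev_inj, Fin.rev_rev, eq_comm]
  simp only [h3, mul_ite, mul_one, mul_zero, Finset.sum_add_distrib] at h1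
  simp only [Finset.sum_ite_eq', Finset.mem_univ, if_true] at h1
  linear_combination -h1

/-! #### Ricci identities -/

lemma curv_smul {M : Type*} [AddCommGroup M] [Module R M] (T : Fin 3 → M) (c c' b : Fin 3) :
    ∑ f, (G.d c (G.Γ f b c') - G.d c' (G.Γ f b c) +
      ∑ e, (G.Γ f c e * G.Γ e b c' - G.Γ f c' e * G.Γ e b c)) • T f =
    G.h b c' • T c - G.h b c • T c' := by
  simp only [G.curv]
  simp [h, sub_smul, ite_smul, Finset.sum_sub_distrib]

lemma cov_comm {M : Type*} [AddCommGroup M] [Module R M] {D : Fin 3 → M → M}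
    (hD : ∀ c, G.IsCov c (D c)) (c c' : Fin 3) (T : Fin 3 → M) (a : Fin 3) :
    G.cov c (D c) (G.cov c' (D c') T) a - G.cov c' (D c') (G.cov c (D c) T) a =
      (D c (D c' (T a)) - D c' (D c (T a))) - (G.h a c' • T c - G.h a c • T c') := by
  rw [Framed.cov_comm hD, curv_smul]

lemma D_comm_scalar (f : R) (c c' : Fin 3) :
    G.D1 (fun a => G.d a f) c c' = G.D1 (fun a => G.d a f) c' c := by
  simp only [Framed.D1, G.d_comm c c', G.Γ_symm _ c c']

lemma D_comm_one (v : Fin 3 → R) (c c' a : Fin 3) :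
    G.D2 (G.D1 v) c c' a - G.D2 (G.D1 v) c' c a = G.h a c * v c' - G.h a c' * v c := by
  have h1 := G.cov_comm G.isCov_d c c' v a
  rw [G.d_comm c c', sub_self] at h1
  have h2 : ∀ c c', G.D2 (G.D1 v) c c' a =
      G.cov c (G.d c) (G.cov c' (G.d c') v) a - ∑ e, G.Γ e c c' * G.D1 v e a := by
    intro c c'
    rw [← Framed.D1_eq, ← Framed.D1_eq]
    simp only [Framed.D2, Framed.D1, Finset.sum_add_distrib]
    ring
  rw [h2, h2]
  simp only [G.Γ_symm _ c c']
  rw [sub_sub_sub_cancel_right, h1]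
  simp only [smul_eq_mul]
  ring

lemma D_comm_two (T : Fin 3 → Fin 3 → R) (c c' a b : Fin 3) :
    G.D3 (G.D2 T) c c' a b - G.D3 (G.D2 T) c' c a b =
      G.h a c * T c' b - G.h a c' * T c b + (G.h b c * T a c' - G.h b c' * T a c) := by
  have h1 := congrFun (G.cov_comm (fun c => (G.isCov_d c).cov) c c' T a) b
  have h0 := G.cov_comm G.isCov_d c c' (T a) b
  rw [G.d_comm c c', sub_self] at h0
  have h2 : ∀ c c', G.D3 (G.D2 T) c c' a b =
      G.cov c (G.cov c (G.d c)) (G.cov c' (G.cov c' (G.d c')) T) a b -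
        ∑ e, G.Γ e c c' * G.D2 T e a b := by
    intro c c'
    rw [← Framed.D2_eq, ← Framed.D2_eq]
    simp only [Framed.D3, Framed.D2, Finset.sum_add_distrib]
    ring
  rw [h2, h2]
  simp only [G.Γ_symm _ c c']
  rw [sub_sub_sub_cancel_right]
  simp only [Pi.sub_apply, Pi.smul_apply, smul_eq_mul] at h1 h0
  rw [h1, h0]
  ring

variable {G} in
lemma tf1_mul_left (r : R) (v : Fin 3 → R) (I : Fin 3) :
    G.tf1 (fun a => r * v a) I = r * G.tf1 v I := by
  simp only [Framed.tf1, Framed.tf, smul_eq_mul, Finset.mul_sum]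
  exact Finset.sum_congr rfl fun a _ => by ring

lemma tf1_h (c I : Fin 3) : G.tf1 (fun a => G.h a c) I = G.F I.rev c := G.sum_E_h I c

lemma tf1_F (I J : Fin 3) : G.tf1 (fun c => G.F I.rev c) J = nullMetric R I J := by
  simp only [Framed.tf1, Framed.tf, smul_eq_mul, nullMetric, mul_comm (G.E _ _), G.FE]
  simp only [eq_comm]

lemma tf3_apply (X : Fin 3 → Fin 3 → Fin 3 → R) (K L I : Fin 3) :
    G.tf3 X K L I = G.tf1 (fun c => G.tf1 (fun c' => G.tf1 (fun a => X c c' a) I) L) K := by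
  simp [Framed.tf3, Framed.tf2, Framed.tf1, Framed.tf, Finset.sum_apply]

lemma tf4_apply (X : Fin 3 → Fin 3 → Fin 3 → Fin 3 → R) (K L I J : Fin 3) :
    G.tf4 X K L I J = G.tf1 (fun c => G.tf1 (fun c' => G.tf1 (fun a => G.tf1 (fun b => X c c' a b) J) I) L) K := by
  simp [Framed.tf4, Framed.tf3, Framed.tf2, Framed.tf1, Framed.tf, Finset.sum_apply]

lemma tf2_apply (X : Fin 3 → Fin 3 → R) (K L : Fin 3) :
    G.tf2 X K L = G.tf1 (fun c => G.tf1 (fun c' => X c c') L) K := by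
  simp [Framed.tf2, Framed.tf1, Framed.tf, Finset.sum_apply]

variable {G} in
lemma tf1_mul_right (r : R) (v : Fin 3 → R) (I : Fin 3) :
    G.tf1 (fun a => v a * r) I = G.tf1 v I * r := by
  simp only [mul_comm _ r, tf1_mul_left]

variable {G} in
lemma tf1_sub' (u v : Fin 3 → R) (I : Fin 3) :
    G.tf1 (fun a => u a - v a) I = G.tf1 u I - G.tf1 v I := by
  simp [Framed.tf1, Framed.tf, mul_sub, Finset.sum_sub_distrib]

variable {G} in
lemma tf1_add' (u v : Fin 3 → R) (I : Fin 3) :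
    G.tf1 (fun a => u a + v a) I = G.tf1 u I + G.tf1 v I := by
  simp [Framed.tf1, Framed.tf, mul_add, Finset.sum_add_distrib]

lemma tf1_comm (X : Fin 3 → Fin 3 → R) (K L : Fin 3) :
    G.tf1 (fun c => G.tf1 (fun c' => X c c') L) K = G.tf1 (fun c' => G.tf1 (fun c => X c c') K) L := by
  simp only [Framed.tf1, Framed.tf, smul_eq_mul, Finset.mul_sum]
  rw [Finset.sum_comm]
  exact Finset.sum_congr rfl fun a _ => Finset.sum_congr rfl fun b _ => by ring

lemma N_comm_scalar (f : R) (K L : Fin 3) :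
    G.N1 (fun I => G.e I f) K L = G.N1 (fun I => G.e I f) L K := by
  have h1 : (fun I => G.e I f) = G.tf1 fun c => G.d c f := by
    funext I; rw [Framed.e_zero_tf]
  rw [h1, ← Framed.tf2_D1, tf2_apply, tf2_apply, tf1_comm]
  simp only [G.D_comm_scalar]

lemma N_comm_one (v : Fin 3 → R) (K L I : Fin 3) :
    G.N2 (G.N1 (G.tf1 v)) K L I - G.N2 (G.N1 (G.tf1 v)) L K I =
      nullMetric R K I * G.tf1 v L - nullMetric R L I * G.tf1 v K := by
  rw [← Framed.tf2_D1, ← Framed.tf3_D2]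
  have h1 : G.tf3 (G.D2 (G.D1 v)) L K I =
      G.tf3 (fun c c' a => G.D2 (G.D1 v) c' c a) K L I := by
    rw [tf3_apply, tf3_apply, tf1_comm]
  rw [h1, tf3_apply, tf3_apply]
  simp only [← tf1_sub', D_comm_one]
  simp only [tf1_sub', tf1_mul_right, tf1_mul_left, tf1_h, tf1_F]
  simp only [nullMetric]
  have e1 : ∀ K I : Fin 3, (K = I.rev) ↔ (I = K.rev) := fun K I => by
    rw [← Fin.rev_inj, Fin.rev_rev, eq_comm]
  rw [if_congr (e1 K I) rfl rfl, if_congr (e1 L I) rfl rfl]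

lemma N_comm_two (T : Fin 3 → Fin 3 → R) (K L I J : Fin 3) :
    G.N3 (G.N2 (G.tf2 T)) K L I J - G.N3 (G.N2 (G.tf2 T)) L K I J =
      nullMetric R K I * G.tf2 T L J - nullMetric R L I * G.tf2 T K J +
      (nullMetric R K J * G.tf2 T I L - nullMetric R L J * G.tf2 T I K) := by
  rw [← Framed.tf3_D2, ← Framed.tf4_D3]
  have h1 : G.tf4 (G.D3 (G.D2 T)) L K I J =
      G.tf4 (fun c c' a b => G.D3 (G.D2 T) c' c a b) K L I J := by
    rw [tf4_apply, tf4_apply, tf1_comm]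
  rw [h1, tf4_apply, tf4_apply]
  simp only [← tf1_sub', D_comm_two]
  simp only [tf1_sub', tf1_add', tf1_mul_right, tf1_mul_left, tf1_h, tf1_F, ← tf2_apply]
  simp only [nullMetric_comm (R := R) I, nullMetric_comm (R := R) J, tf2_apply]
  rw [G.tf1_comm (fun c a => T a c), G.tf1_comm (fun c a => T a c)]

end Geo

/-! ### Smoothness of the inverse metric and of the Christoffel symbols -/

lemma contDiffAt_det {n m : ℕ} {k : WithTop ℕ∞} {A : Fin m → Fin m → Fld n} {x : Fin n → ℝ}
    (hA : ∀ i j, ContDiffAt ℝ k (A i j) x) :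
    ContDiffAt ℝ k (fun y => (Matrix.of fun i j => A i j y).det) x := by
  simp only [Matrix.det_apply, Matrix.of_apply]
  refine ContDiffAt.sum fun s _ => ?_
  refine ContDiffAt.const_smul _ ?_
  exact contDiffAt_prod fun i _ => hA _ _

lemma contDiffAt_ginv {n : ℕ} {k : WithTop ℕ∞} {g : Fin n → Fin n → Fld n} {x : Fin n → ℝ}
    (hg : ∀ i j, ContDiffAt ℝ k (g i j) x) (hdet : (Matrix.of fun i j => g i j x).det ≠ 0)
    (a b : Fin n) : ContDiffAt ℝ k (ginv g a b) x := by
  have h1 : ginv g a b = fun y => ((Matrix.of fun i j => g i j y).det)⁻¹ *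
      (Matrix.of fun i j => if i = b then (if j = a then 1 else 0) else g i j y).det := by
    funext y
    rw [ginv, Matrix.inv_def, Matrix.smul_apply, Matrix.adjugate_apply, Ring.inverse_eq_inv',
      smul_eq_mul]
    congr 2
    ext i j
    simp [Matrix.updateRow_apply, Pi.single_apply]
  rw [h1]
  refine ((contDiffAt_det hg).inv hdet).mul ?_
  refine contDiffAt_det (A := fun i j y => if i = b then (if j = a then 1 else 0) else g i j y) ?_
  intro i j
  by_cases hi : i = b
  · simp only [hi, if_true]; exact contDiffAt_const
  · simp only [hi, if_false]; exact hg i j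

lemma sum_g_ginv {n : ℕ} {g : Fin n → Fin n → Fld n} {x : Fin n → ℝ}
    (hdet : (Matrix.of fun i j => g i j x).det ≠ 0) (a b : Fin n) :
    ∑ e, g a e x * ginv g e b x = if a = b then 1 else 0 := by
  have := congrFun (congrFun (Matrix.mul_nonsing_inv (Matrix.of fun i j => g i j x)
    (isUnit_iff_ne_zero.2 hdet)) a) b
  rw [Matrix.mul_apply, Matrix.one_apply] at this
  exact this

variable {U : Set (Fin 3 → ℝ)} {h k i h2 S T : Cov2} {σ f g : Fld 3} {x₀ : Fin 3 → ℝ}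

/-- A coordinate patch of the unit hyperboloid. -/
class Patch (U : Set (Fin 3 → ℝ)) (h : outParam Cov2) : Prop where
  opn : IsOpen U
  hyp : IsUnitHyperboloid U h

lemma det_neg [Patch U h]
    {x : Fin 3 → ℝ} (hx : x ∈ U) : (Matrix.of fun a b => h a b x).det < 0 := by
  obtain ⟨P, -, hP2⟩ := Patch.hyp.2.1 x hx
  have := congrArg Matrix.det hP2
  rw [Matrix.det_mul, Matrix.det_mul, Matrix.det_transpose, Matrix.det_diagonal,
    Fin.prod_univ_three] at this
  simp only [Matrix.cons_val] at this
  nlinarith [sq_nonneg P.det]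

section

lemma h_mem [Patch U h] (a b : Fin 3) : h a b ∈ smoothOn U := Patch.hyp.1.1 a b

lemma ginv_mem [Patch U h] (a b : Fin 3) :
    ginv h a b ∈ smoothOn U := fun _ hx =>
  (contDiffAt_ginv (fun i j => contDiffAt_of_smoothOn Patch.opn (Patch.hyp.1.1 i j) hx)
    (det_neg hx).ne a b).contDiffWithinAt

lemma christoffel_mem [Patch U h] (a b c : Fin 3) :
    christoffel h a b c ∈ smoothOn U :=
  Subalgebra.smul_mem _ (Subalgebra.sum_mem _ fun e _ => mul_mem (ginv_mem a e)
    (sub_mem (add_mem (pd_mem_smoothOn Patch.opn (Patch.hyp.1.1 _ _) _) (pd_mem_smoothOn Patch.opn (Patch.hyp.1.1 _ _) _))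
      (pd_mem_smoothOn Patch.opn (Patch.hyp.1.1 _ _) _))) _

lemma pd_h_symm [Patch U h] {x : Fin 3 → ℝ} (hx : x ∈ U)
    (c a b : Fin 3) : pd c (h a b) x = pd c (h b a) x :=
  pd_congr_of_eqOn Patch.opn (Patch.hyp.1.2 a b) c hx

lemma christoffel_symm [Patch U h] {x : Fin 3 → ℝ} (hx : x ∈ U)
    (a b c : Fin 3) : christoffel h a b c x = christoffel h a c b x := by
  simp only [christoffel, Pi.smul_apply, Finset.sum_apply, Pi.mul_apply, Pi.sub_apply,
    Pi.add_apply]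
  congr 1
  refine Finset.sum_congr rfl fun e _ => ?_
  rw [pd_h_symm hx e b c]
  ring

lemma christoffel_lower [Patch U h] {x : Fin 3 → ℝ} (hx : x ∈ U)
    (b c a : Fin 3) : ∑ e, christoffel h e c a x * h e b x =
      (1 / 2) * (pd c (h b a) x + pd a (h b c) x - pd b (h c a) x) := by
  simp only [christoffel, Pi.smul_apply, Finset.sum_apply, Pi.mul_apply, Pi.sub_apply,
    Pi.add_apply, smul_eq_mul, Finset.mul_sum, Finset.sum_mul]
  rw [Finset.sum_comm]
  have : ∀ f, ∑ e, 1 / 2 * (ginv h e f x * (pd c (h f a) x + pd a (h f c) x - pd f (h c a) x)) *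
      h e b x = (if b = f then 1 else 0) * (1 / 2 *
        (pd c (h f a) x + pd a (h f c) x - pd f (h c a) x)) := by
    intro f
    rw [← sum_g_ginv (det_neg hx).ne b f, Finset.sum_mul]
    refine Finset.sum_congr rfl fun e _ => ?_
    rw [Patch.hyp.1.2 e b hx]
    ring
  rw [Finset.sum_congr rfl fun f _ => this f]
  simp

lemma pd_h [Patch U h] {x : Fin 3 → ℝ} (hx : x ∈ U)
    (c a b : Fin 3) : pd c (h a b) x =
      ∑ e, (christoffel h e c a x * h e b x + christoffel h e c b x * h a e x) := by
  rw [Finset.sum_add_distrib, christoffel_lower hx]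
  have : ∑ e, christoffel h e c b x * h a e x = ∑ e, christoffel h e c b x * h e a x :=
    Finset.sum_congr rfl fun e _ => by rw [Patch.hyp.1.2 a e hx]
  rw [this, christoffel_lower hx, pd_h_symm hx c b a, pd_h_symm hx a b c,
    pd_h_symm hx b a c]
  ring

end

/-! ### Existence of null frames that are parallel at a point -/

section Algebra

variable {R : Type*} [CommRing R]

lemma gramSchmidt_diag (a b c d e f r1 r2 r3 : R) (h1 : r1 ^ 2 * (-a) = 1)
    (h2 : r2 ^ 2 * (-a * (b ^ 2 - a * d)) = 1)
    (h3 : r3 ^ 2 * ((b ^ 2 - a * d) * -(a * d * f - a * e ^ 2 - b ^ 2 * f + 2 * b * c * e - c ^ 2 * d)) = 1) :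
    (!![r1, r2 * b, r3 * (c * d - b * e); 0, r2 * (-a), r3 * (a * e - b * c);
        0, 0, r3 * (b ^ 2 - a * d)] : Matrix (Fin 3) (Fin 3) R).transpose *
      !![a, b, c; b, d, e; c, e, f] *
      !![r1, r2 * b, r3 * (c * d - b * e); 0, r2 * (-a), r3 * (a * e - b * c);
        0, 0, r3 * (b ^ 2 - a * d)] = !![-1, 0, 0; 0, 1, 0; 0, 0, 1] := by
  ext i j
  fin_cases i <;> fin_cases j <;>
    simp [Matrix.mul_apply, Fin.sum_univ_three]
  · linear_combination -h1
  · ring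
  · ring
  · ring
  · linear_combination h2
  · ring
  · ring
  · ring
  · linear_combination h3

lemma null_of_diag (t : R) (ht : 2 * t = 1) :
    (!![-t, 0, 1; t, 0, 1; 0, 1, 0] : Matrix (Fin 3) (Fin 3) R).transpose *
      !![-1, 0, 0; 0, 1, 0; 0, 0, 1] * !![-t, 0, 1; t, 0, 1; 0, 1, 0] =
      Matrix.of (nullMetric R) := by
  ext i j
  fin_cases i <;> fin_cases j <;>
    simp [Matrix.mul_apply, Fin.sum_univ_three, nullMetric, Fin.ext_iff, Fin.rev]
  · linear_combination ht
  · linear_combination ht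

end Algebra

/-- A null frame near `x₀` that is parallel at `x₀`. -/
structure LocalFrame (U : Set (Fin 3 → ℝ)) (h : Cov2) (x₀ : Fin 3 → ℝ) where
  V : TopologicalSpace.Opens (Fin 3 → ℝ)
  sub : (V : Set (Fin 3 → ℝ)) ⊆ U
  mem : x₀ ∈ V
  G : Geo (Sm V)
  d_eq : G.d = Sm.der
  Γ_eq : ∀ a b c (x : V), Sm.ev x (G.Γ a b c) = christoffel h a b c x
  h_eq : ∀ a b (x : V), Sm.ev x (G.h a b) = h a b x
  hi_eq : ∀ a b (x : V), Sm.ev x (∑ I, G.E a I * G.E b I.rev) = ginv h a b x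
  det_eq : ∀ x : V, Real.sqrt |(Matrix.of fun i j => h i j x).det| *
    Sm.ev x (Matrix.of G.E).det = 1
  om_eq : ∀ K I L, Sm.ev ⟨x₀, mem⟩ (G.om K I L) = 0

lemma isOpen_pos (hU : IsOpen U) (hf : f ∈ smoothOn U) :
    IsOpen {x | x ∈ U ∧ 0 < f x} :=
  (ContDiffOn.continuousOn hf).isOpen_inter_preimage hU isOpen_Ioi

lemma invSqrt_mem {V : Set (Fin 3 → ℝ)} (hf : f ∈ smoothOn V) (hpos : ∀ x ∈ V, 0 < f x) :
    (fun x => (Real.sqrt (f x))⁻¹) ∈ smoothOn V :=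
  ContDiffOn.inv (ContDiffOn.sqrt hf fun x hx => (hpos x hx).ne')
    fun x hx => (Real.sqrt_pos.2 (hpos x hx)).ne'

lemma nullMetric_eq {R : Type*} [CommRing R] :
    Matrix.of (nullMetric R) = !![0, 0, 1; 0, 1, 0; 1, 0, 0] := by
  ext i j
  fin_cases i <;> fin_cases j <;> simp [nullMetric, Fin.ext_iff, Fin.rev]

lemma nullMetric_mul_self {R : Type*} [CommRing R] :
    Matrix.of (nullMetric R) * Matrix.of (nullMetric R) = 1 := by
  rw [nullMetric_eq]
  ext i j
  fin_cases i <;> fin_cases j <;> simp [Matrix.mul_apply, Fin.sum_univ_three]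

lemma nullMetric_sum {R : Type*} [CommRing R] (u : Fin 3 → R) (I : Fin 3) :
    ∑ J, nullMetric R I J * u J = u I.rev := by
  simp [nullMetric]

/-- A null frame for a metric over a differential ring yields a `Geo`. -/
def geoOfFrame {R : Type*} [CommRing R] [Algebra ℝ R] (d : Fin 3 → Derivation ℝ R R)
    (d_comm : ∀ a b f, d a (d b f) = d b (d a f)) (Γ : Fin 3 → Fin 3 → Fin 3 → R)
    (Γ_symm : ∀ a b c, Γ a b c = Γ a c b) (h : Fin 3 → Fin 3 → R)
    (metric_d : ∀ c a b, d c (h a b) = ∑ e, (Γ e c a * h e b + Γ e c b * h a e))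
    (curv : ∀ a b c c', d c (Γ a b c') - d c' (Γ a b c) +
      ∑ e, (Γ a c e * Γ e b c' - Γ a c' e * Γ e b c) =
      (if a = c then h b c' else 0) - (if a = c' then h b c else 0))
    (E F : Matrix (Fin 3) (Fin 3) R) (hFE : F * E = 1)
    (hF : ∀ a b, ∑ I, F I a * F I.rev b = h a b) : Geo R where
  d := d
  d_comm := d_comm
  Γ := Γ
  Γ_symm := Γ_symm
  E := E
  F := F
  FE I J := by
    have := congrFun (congrFun hFE I) J
    rwa [Matrix.mul_apply, Matrix.one_apply] at this
  EF a b := by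
    have hEF : E * F = 1 := mul_eq_one_comm.1 hFE
    have := congrFun (congrFun hEF a) b
    rwa [Matrix.mul_apply, Matrix.one_apply] at this
  metric_d c a b := by simp only [hF, metric_d]
  curv a b c c' := by simp only [hF, curv]

lemma exists_diag_pos [Patch U h]
    {x : Fin 3 → ℝ} (hx : x ∈ U) : ∃ P : Matrix (Fin 3) (Fin 3) ℝ, 0 < P.det ∧
      P.transpose * (Matrix.of fun a b => h a b x) * P = !![-1, 0, 0; 0, 1, 0; 0, 0, 1] := by
  obtain ⟨P, hP, hP2⟩ := Patch.hyp.2.1 x hx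
  have hd : Matrix.diagonal ![-1, 1, 1] = (!![-1, 0, 0; 0, 1, 0; 0, 0, 1] : Matrix (Fin 3) (Fin 3) ℝ) := by
    ext i j; fin_cases i <;> fin_cases j <;> simp
  rw [hd] at hP2
  rcases lt_or_gt_of_ne hP.ne_zero with h0 | h0
  · refine ⟨P * !![1, 0, 0; 0, 1, 0; 0, 0, -1], ?_, ?_⟩
    · rw [Matrix.det_mul]
      have : (!![1, 0, 0; 0, 1, 0; 0, 0, -1] : Matrix (Fin 3) (Fin 3) ℝ).det = -1 := by
        simp [Matrix.det_fin_three]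
      rw [this]; linarith
    · rw [Matrix.transpose_mul]
      have : ∀ A B C D : Matrix (Fin 3) (Fin 3) ℝ, A * B * C * (D * A) = A * (B * C * D) * A := by
        intros; noncomm_ring
      have ht : (!![1, 0, 0; 0, 1, 0; 0, 0, -1] : Matrix (Fin 3) (Fin 3) ℝ).transpose =
          !![1, 0, 0; 0, 1, 0; 0, 0, -1] := by
        ext i j; fin_cases i <;> fin_cases j <;> simp
      rw [ht, this, hP2]
      ext i j; fin_cases i <;> fin_cases j <;> simp [Matrix.mul_apply, Fin.sum_univ_three]
  · exact ⟨P, h0, hP2⟩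

/-- A frame, affine in the coordinates, that is parallel at `x₀` with value `P` there. -/
def parallelFrame (h : Cov2) (x₀ : Fin 3 → ℝ) (P : Matrix (Fin 3) (Fin 3) ℝ) (a i : Fin 3) : Fld 3 :=
  fun x => P a i - ∑ c, (∑ b, christoffel h a c b x₀ * P b i) * (x c - x₀ c)

lemma parallelFrame_mem (V : Set (Fin 3 → ℝ)) (h : Cov2) (x₀ : Fin 3 → ℝ)
    (P : Matrix (Fin 3) (Fin 3) ℝ) (a i : Fin 3) : parallelFrame h x₀ P a i ∈ smoothOn V := by
  rw [mem_smoothOn]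
  unfold parallelFrame
  fun_prop

lemma parallelFrame_self (h : Cov2) (x₀ : Fin 3 → ℝ) (P : Matrix (Fin 3) (Fin 3) ℝ) (a i : Fin 3) :
    parallelFrame h x₀ P a i x₀ = P a i := by
  simp [parallelFrame]

lemma pd_parallelFrame (h : Cov2) (x₀ : Fin 3 → ℝ) (P : Matrix (Fin 3) (Fin 3) ℝ) (a i c : Fin 3) :
    pd c (parallelFrame h x₀ P a i) x₀ = -∑ b, christoffel h a c b x₀ * P b i := by
  have h1 : HasFDerivAt (parallelFrame h x₀ P a i)
      (-∑ c, (∑ b, christoffel h a c b x₀ * P b i) • (ContinuousLinearMap.proj c : (Fin 3 → ℝ) →L[ℝ] ℝ)) x₀ := by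
    unfold parallelFrame
    have h2 : ∀ c : Fin 3, HasFDerivAt (fun x : Fin 3 → ℝ => (∑ b, christoffel h a c b x₀ * P b i) * (x c - x₀ c))
        ((∑ b, christoffel h a c b x₀ * P b i) • (ContinuousLinearMap.proj c : (Fin 3 → ℝ) →L[ℝ] ℝ)) x₀ := by
      intro c
      exact ((ContinuousLinearMap.proj c : (Fin 3 → ℝ) →L[ℝ] ℝ).hasFDerivAt.sub_const (x₀ c)).const_mul _
    have h3 := HasFDerivAt.fun_sum (u := Finset.univ) fun c _ => h2 c
    have := h3.const_sub (P a i)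
    exact this
  rw [pd, h1.fderiv]
  simp [Pi.single_apply]

section

variable {P : Matrix (Fin 3) (Fin 3) ℝ}

/-- The components of the metric in the affine frame. -/
def frameGram (h : Cov2) (x₀ : Fin 3 → ℝ) (P : Matrix (Fin 3) (Fin 3) ℝ) (i j : Fin 3) : Fld 3 :=
  ∑ a, ∑ b, parallelFrame h x₀ P a i * h a b * parallelFrame h x₀ P b j

lemma frameGram_mem [Patch U h] (i j : Fin 3) :
    frameGram h x₀ P i j ∈ smoothOn U :=
  Subalgebra.sum_mem _ fun _ _ => Subalgebra.sum_mem _ fun _ _ =>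
    mul_mem (mul_mem (parallelFrame_mem _ _ _ _ _ _) (Patch.hyp.1.1 _ _)) (parallelFrame_mem _ _ _ _ _ _)

lemma frameGram_symm [Patch U h] {x : Fin 3 → ℝ} (hx : x ∈ U) (i j : Fin 3) :
    frameGram h x₀ P i j x = frameGram h x₀ P j i x := by
  simp only [frameGram, Finset.sum_apply, Pi.mul_apply]
  rw [Finset.sum_comm]
  refine Finset.sum_congr rfl fun a _ => Finset.sum_congr rfl fun b _ => ?_
  rw [Patch.hyp.1.2 b a hx]; ring

lemma frameGram_eq (x : Fin 3 → ℝ) : (Matrix.of fun i j => frameGram h x₀ P i j x) =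
    (Matrix.of fun a i => parallelFrame h x₀ P a i x).transpose * (Matrix.of fun a b => h a b x) *
      (Matrix.of fun a i => parallelFrame h x₀ P a i x) := by
  ext i j
  simp only [frameGram, Matrix.of_apply, Finset.sum_apply, Pi.mul_apply, Matrix.mul_apply,
    Matrix.transpose_apply, Finset.sum_mul]
  rw [Finset.sum_comm]

lemma pd_frameGram [Patch U h] (hx : x₀ ∈ U) (c i j : Fin 3) :
    pd c (frameGram h x₀ P i j) x₀ = 0 := by
  have hV : x₀ ∈ (⟨U, Patch.opn⟩ : TopologicalSpace.Opens (Fin 3 → ℝ)) := hx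
  let V : TopologicalSpace.Opens (Fin 3 → ℝ) := ⟨U, Patch.opn⟩
  let p : Fin 3 → Fin 3 → Sm V := fun a i => Sm.mk (parallelFrame h x₀ P a i) (parallelFrame_mem _ _ _ _ _ _)
  let m : Fin 3 → Fin 3 → Sm V := fun a b => Sm.mk (h a b) (h_mem a b)
  have h1 : Sm.mk (frameGram h x₀ P i j) (frameGram_mem i j) = ∑ a, ∑ b, p a i * m a b * p b j := by
    apply Sm.ext_ev
    intro x
    simp [p, m, frameGram]
  have h2 : pd c (frameGram h x₀ P i j) x₀ =
      Sm.ev (⟨x₀, hV⟩ : V) (Sm.der c (Sm.mk (frameGram h x₀ P i j) (frameGram_mem i j))) := by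
    rw [Sm.der_mk, Sm.ev_mk]
  have hp : ∀ a i, Sm.ev (⟨x₀, hV⟩ : V) (p a i) = P a i := fun a i => by
    simp [p, parallelFrame_self]
  have hpd : ∀ a i, Sm.ev (⟨x₀, hV⟩ : V) (Sm.der c (p a i)) = -∑ b, christoffel h a c b x₀ * P b i :=
    fun a i => by
      simp only [p, Sm.der_mk, Sm.ev_mk, pd_parallelFrame]
  have hm : ∀ a b, Sm.ev (⟨x₀, hV⟩ : V) (m a b) = h a b x₀ := fun a b => rfl
  have hmd : ∀ a b, Sm.ev (⟨x₀, hV⟩ : V) (Sm.der c (m a b)) =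
      ∑ e, (christoffel h e c a x₀ * h e b x₀ + christoffel h e c b x₀ * h a e x₀) := fun a b => by
    simp only [m, Sm.der_mk, Sm.ev_mk, pd_h hx]
  rw [h2, h1]
  simp only [map_sum, Derivation.leibniz, smul_eq_mul, map_add, map_mul, hp, hpd, hm, hmd]
  simp only [Fin.sum_univ_three]
  ring

end

section

variable {R : Type*} [CommRing R]

/-- The Gram–Schmidt matrix, followed by the passage to a null basis. -/
def nullGS (M : Fin 3 → Fin 3 → R) (t r1 r2 r3 : R) : Matrix (Fin 3) (Fin 3) R :=
  !![r1, r2 * M 0 1, r3 * (M 0 2 * M 1 1 - M 0 1 * M 1 2);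
    0, r2 * (-M 0 0), r3 * (M 0 0 * M 1 2 - M 0 1 * M 0 2);
    0, 0, r3 * (M 0 1 ^ 2 - M 0 0 * M 1 1)] * !![-t, 0, 1; t, 0, 1; 0, 1, 0]

lemma nullGS_gram (M : Fin 3 → Fin 3 → R) (hM : ∀ i j, M i j = M j i) (t r1 r2 r3 : R)
    (ht : 2 * t = 1) (h1 : r1 ^ 2 * (-M 0 0) = 1)
    (h2 : r2 ^ 2 * (-M 0 0 * (M 0 1 ^ 2 - M 0 0 * M 1 1)) = 1)
    (h3 : r3 ^ 2 * ((M 0 1 ^ 2 - M 0 0 * M 1 1) * -(Matrix.of M).det) = 1) :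
    (nullGS M t r1 r2 r3).transpose * Matrix.of M * nullGS M t r1 r2 r3 =
      Matrix.of (nullMetric R) := by
  have hM' : Matrix.of M = !![M 0 0, M 0 1, M 0 2; M 0 1, M 1 1, M 1 2; M 0 2, M 1 2, M 2 2] := by
    ext i j; fin_cases i <;> fin_cases j <;> simp [hM 1 0, hM 2 0, hM 2 1]
  rw [← null_of_diag t ht, ← gramSchmidt_diag (M 0 0) (M 0 1) (M 0 2) (M 1 1) (M 1 2) (M 2 2) r1 r2 r3
    h1 h2, ← hM', nullGS, Matrix.transpose_mul]
  · simp only [Matrix.mul_assoc]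
  · rw [← h3, Matrix.det_fin_three]
    simp only [Matrix.of_apply, hM 1 0, hM 2 0, hM 2 1]
    ring

lemma det_nullGS (M : Fin 3 → Fin 3 → R) (t r1 r2 r3 : R) (ht : 2 * t = 1) :
    (nullGS M t r1 r2 r3).det = r1 * (r2 * -M 0 0) * (r3 * (M 0 1 ^ 2 - M 0 0 * M 1 1)) := by
  rw [nullGS, Matrix.det_mul, Matrix.det_fin_three, Matrix.det_fin_three]
  simp only [Matrix.cons_val', Matrix.cons_val, Matrix.of_apply]
  linear_combination (r1 * (r2 * -M 0 0) * (r3 * (M 0 1 ^ 2 - M 0 0 * M 1 1))) * ht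

lemma der_nullGS [Algebra ℝ R] (D : Derivation ℝ R R) (φ : R →ₐ[ℝ] ℝ) (M : Fin 3 → Fin 3 → R)
    (t r1 r2 r3 : R) (ht : φ (D t) = 0) (hM : ∀ i j, φ (D (M i j)) = 0)
    (h1 : φ (D r1) = 0) (h2 : φ (D r2) = 0) (h3 : φ (D r3) = 0) (i j : Fin 3) :
    φ (D (nullGS M t r1 r2 r3 i j)) = 0 := by
  fin_cases i <;> fin_cases j <;>
    simp [nullGS, Matrix.mul_apply, Fin.sum_univ_three, ht, hM, h1, h2, h3, pow_two]

lemma der_det_three [Algebra ℝ R] (D : Derivation ℝ R R) (φ : R →ₐ[ℝ] ℝ) (M : Fin 3 → Fin 3 → R)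
    (hM : ∀ i j, φ (D (M i j)) = 0) : φ (D (Matrix.of M).det) = 0 := by
  rw [Matrix.det_fin_three]
  simp only [Matrix.of_apply, map_sub, map_add, Derivation.leibniz, smul_eq_mul, map_mul, hM,
    mul_zero, add_zero, sub_zero]

lemma der_invSqrt [Algebra ℝ R] (D : Derivation ℝ R R) (φ : R →ₐ[ℝ] ℝ) (r f : R)
    (hr : r ^ 2 * f = 1) (hf : φ (D f) = 0) : φ (D r) = 0 := by
  have h1 := congrArg (fun y => φ (D y)) hr
  simp only [Derivation.leibniz, pow_two, smul_eq_mul, map_add, map_mul, hf,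
    Derivation.map_one_eq_zero, map_zero] at h1
  have h2 := congrArg φ hr
  simp only [map_mul, map_pow, map_one] at h2
  have h3 : φ r ≠ 0 := by
    intro h; rw [h] at h2; simp at h2
  have h4 : φ f ≠ 0 := by
    intro h; rw [h] at h2; simp at h2
  have h5 : (2 * φ f * φ r) * φ (D r) = 0 := by linarith
  exact (mul_eq_zero.1 h5).resolve_left (by positivity)

end

lemma sum_mul_rev {R : Type*} [CommRing R] (u v : Fin 3 → R) :
    ∑ I, u I * v I.rev = ∑ I, ∑ J, u I * nullMetric R I J * v J := by
  refine Finset.sum_congr rfl fun I _ => ?_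
  rw [← nullMetric_sum v I, Finset.mul_sum]
  exact Finset.sum_congr rfl fun J _ => by ring

theorem exists_localFrame [Patch U h] (hx₀ : x₀ ∈ U) :
    Nonempty (LocalFrame U h x₀) := by
  obtain ⟨P, hPdet, hP⟩ := exists_diag_pos hx₀
  let Mf := frameGram h x₀ P
  have hMf : ∀ i j, Mf i j ∈ smoothOn U := frameGram_mem
  let dM : Fld 3 := fun x => (Matrix.of fun i j => Mf i j x).det
  have hdM : dM ∈ smoothOn U := fun x hx =>
    (contDiffAt_det fun i j => contDiffAt_of_smoothOn Patch.opn (hMf i j) hx).contDiffWithinAt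
  let dP : Fld 3 := fun x => (Matrix.of fun a i => parallelFrame h x₀ P a i x).det
  have hdP : dP ∈ smoothOn U := fun x hx =>
    (contDiffAt_det fun i j => contDiffAt_of_smoothOn Patch.opn (parallelFrame_mem U h x₀ P i j) hx).contDiffWithinAt
  let D1 : Fld 3 := -Mf 0 0
  let D2 : Fld 3 := Mf 0 1 ^ 2 - Mf 0 0 * Mf 1 1
  have hD1 : D1 ∈ smoothOn U := neg_mem (hMf 0 0)
  have hD2 : D2 ∈ smoothOn U := sub_mem (pow_mem (hMf 0 1) 2) (mul_mem (hMf 0 0) (hMf 1 1))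
  have hD12 : D1 * D2 ∈ smoothOn U := mul_mem hD1 hD2
  have hD23 : D2 * -dM ∈ smoothOn U := mul_mem hD2 (neg_mem hdM)
  let V' : TopologicalSpace.Opens (Fin 3 → ℝ) :=
    ⟨{x | x ∈ U ∧ 0 < D1 x} ∩ {x | x ∈ U ∧ 0 < (D1 * D2) x} ∩ {x | x ∈ U ∧ 0 < (D2 * -dM) x} ∩
      {x | x ∈ U ∧ 0 < dP x}, (((isOpen_pos Patch.opn hD1).inter (isOpen_pos Patch.opn hD12)).inter
        (isOpen_pos Patch.opn hD23)).inter (isOpen_pos Patch.opn hdP)⟩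
  have hM0 : ∀ i j, Mf i j x₀ = (!![-1, 0, 0; 0, 1, 0; 0, 0, 1] : Matrix (Fin 3) (Fin 3) ℝ) i j := by
    intro i j
    have := frameGram_eq (h := h) (x₀ := x₀) (P := P) x₀
    simp only [parallelFrame_self] at this
    exact congrFun (congrFun (this.trans hP) i) j
  have hd1 : D1 x₀ = 1 := by simp [D1, hM0]
  have hd2 : D2 x₀ = 1 := by simp [D2, hM0]
  have hdm : dM x₀ = -1 := by simp [dM, hM0, Matrix.det_fin_three]
  have hVx : x₀ ∈ V' := by
    refine ⟨⟨⟨⟨hx₀, ?_⟩, hx₀, ?_⟩, hx₀, ?_⟩, hx₀, ?_⟩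
    · simp [hd1]
    · simp [hd1, hd2]
    · simp [hd2, hdm]
    · simp only [dP, parallelFrame_self]; exact hPdet
  obtain ⟨V, hVx, hV⟩ : ∃ V : TopologicalSpace.Opens (Fin 3 → ℝ), x₀ ∈ V ∧ ∀ x ∈ V,
      ((((x ∈ U ∧ 0 < D1 x) ∧ (x ∈ U ∧ 0 < (D1 * D2) x)) ∧ (x ∈ U ∧ 0 < (D2 * -dM) x)) ∧
      (x ∈ U ∧ 0 < dP x)) := ⟨V', hVx, fun x hx => hx⟩
  have hVU : (V : Set (Fin 3 → ℝ)) ⊆ U := fun x hx => (hV x hx).2.1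
  have mono := smoothOn_mono hVU
  let m : Fin 3 → Fin 3 → Sm V := fun i j => Sm.mk (Mf i j) (mono (hMf i j))
  let hS : Matrix (Fin 3) (Fin 3) (Sm V) := Matrix.of fun a b => Sm.mk (h a b) (mono (h_mem a b))
  let p : Matrix (Fin 3) (Fin 3) (Sm V) := Matrix.of fun a i =>
    Sm.mk (parallelFrame h x₀ P a i) (parallelFrame_mem _ _ _ _ _ _)
  let Γ : Fin 3 → Fin 3 → Fin 3 → Sm V := fun a b c => Sm.mk (christoffel h a b c) (mono (christoffel_mem a b c))
  let r1 : Sm V := Sm.mk _ (invSqrt_mem (mono hD1) fun x hx => (hV x hx).1.1.1.2)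
  let r2 : Sm V := Sm.mk _ (invSqrt_mem (mono hD12) fun x hx => (hV x hx).1.1.2.2)
  let r3 : Sm V := Sm.mk _ (invSqrt_mem (mono hD23) fun x hx => (hV x hx).1.2.2)
  let t : Sm V := algebraMap ℝ (Sm V) (1 / 2)
  have ht : 2 * t = 1 := by
    have : (2 : Sm V) = algebraMap ℝ (Sm V) 2 := (map_ofNat _ 2).symm
    rw [this, ← map_mul]; norm_num
  have hr : ∀ y : ℝ, 0 < y → (Real.sqrt y)⁻¹ ^ 2 * y = 1 := fun y hy => by
    rw [inv_pow, Real.sq_sqrt hy.le, inv_mul_cancel₀ hy.ne']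
  have hdetm : ∀ x : V, Sm.ev x (Matrix.of m).det = dM x := by
    intro x
    rw [AlgHom.map_det]
    rfl
  have h1 : r1 ^ 2 * (-m 0 0) = 1 := Sm.ext_ev fun x => by
    have := hr _ (hV x x.2).1.1.1.2
    simpa [r1, m, D1] using this
  have h2 : r2 ^ 2 * (-m 0 0 * (m 0 1 ^ 2 - m 0 0 * m 1 1)) = 1 := Sm.ext_ev fun x => by
    have := hr _ (hV x x.2).1.1.2.2
    simpa [r2, m, D1, D2] using this
  have h3 : r3 ^ 2 * ((m 0 1 ^ 2 - m 0 0 * m 1 1) * -(Matrix.of m).det) = 1 := Sm.ext_ev fun x => by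
    have := hr _ (hV x x.2).1.2.2
    simp only [map_mul, map_neg, hdetm]
    simpa [r3, m, D2] using this
  have hmsymm : ∀ i j, m i j = m j i := fun i j => Sm.ext_ev fun x => frameGram_symm (hVU x.2) i j
  have hhsymm : hS.transpose = hS := by
    ext1 i j; exact Sm.ext_ev fun x => Patch.hyp.1.2 j i (hVU x.2)
  have hgram : p.transpose * hS * p = Matrix.of m := by
    ext1 i j
    apply Sm.ext_ev
    intro x
    have := congrFun (congrFun (frameGram_eq (h := h) (x₀ := x₀) (P := P) x) i) j
    simp only [Matrix.mul_apply, Matrix.transpose_apply, map_sum, map_mul] at this ⊢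
    exact this.symm
  let N := nullGS m t r1 r2 r3
  have hN : N.transpose * Matrix.of m * N = Matrix.of (nullMetric (Sm V)) :=
    nullGS_gram m hmsymm t r1 r2 r3 ht h1 h2 h3
  let J : Matrix (Fin 3) (Fin 3) (Sm V) := Matrix.of (nullMetric (Sm V))
  have hJJ : J * J = 1 := nullMetric_mul_self
  have hJt : J.transpose = J := by ext1 i j; exact nullMetric_comm j i
  let E : Matrix (Fin 3) (Fin 3) (Sm V) := p * N
  have hE : E.transpose * hS * E = J := by
    have : E.transpose * hS * E = N.transpose * (p.transpose * hS * p) * N := by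
      simp only [E, Matrix.transpose_mul, Matrix.mul_assoc]
    rw [this, hgram, hN]
  let F : Matrix (Fin 3) (Fin 3) (Sm V) := J * (E.transpose * hS)
  have hFE : F * E = 1 := by rw [Matrix.mul_assoc, hE, hJJ]
  have hEF : E * F = 1 := mul_eq_one_comm.1 hFE
  have hF : ∀ a b, ∑ I, F I a * F I.rev b = hS a b := by
    intro a b
    have h4 : F.transpose * J * F = hS := by
      have : F.transpose = hS * E * J := by
        rw [Matrix.transpose_mul, Matrix.transpose_mul, Matrix.transpose_transpose, hhsymm, hJt]
      rw [this, Matrix.mul_assoc _ J J, hJJ, Matrix.mul_one, Matrix.mul_assoc, hEF, Matrix.mul_one]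
    rw [← h4, sum_mul_rev (fun I => F I a) (fun J => F J b), Matrix.mul_apply]
    simp only [Matrix.mul_apply, Finset.sum_mul, Matrix.transpose_apply]
    exact Finset.sum_comm
  have hdΓ : ∀ c a b, Sm.der c (hS a b) = ∑ e, (Γ e c a * hS e b + Γ e c b * hS a e) := by
    intro c a b
    apply Sm.ext_ev
    intro x
    simp only [hS, Γ, Matrix.of_apply, Sm.der_mk, Sm.ev_mk, map_sum, map_add, map_mul]
    exact pd_h (hVU x.2) c a b
  have hcurv : ∀ a b c c', Sm.der c (Γ a b c') - Sm.der c' (Γ a b c) +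
      ∑ e, (Γ a c e * Γ e b c' - Γ a c' e * Γ e b c) =
      (if a = c then hS b c' else 0) - (if a = c' then hS b c else 0) := by
    intro a b c c'
    apply Sm.ext_ev
    intro x
    have := Patch.hyp.2.2 x (hVU x.2) a b c c'
    simp only [riemann, Pi.add_apply, Pi.sub_apply, Finset.sum_apply, Pi.mul_apply] at this
    simp only [Γ, Sm.der_mk, map_add, map_sub, map_sum, map_mul, Sm.ev_mk, this, apply_ite (Sm.ev x),
      map_zero]
    rfl
  let G : Geo (Sm V) := geoOfFrame Sm.der Sm.der_comm Γ
    (fun a b c => Sm.ext_ev fun x => christoffel_symm (hVU x.2) a b c)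
    hS hdΓ hcurv E F hFE hF
  have hhG : ∀ a b, G.h a b = hS a b := hF
  refine ⟨⟨V, hVU, hVx, G, rfl, fun _ _ _ _ => rfl, fun a b x => by rw [hhG]; rfl, ?_, ?_, ?_⟩⟩
  · intro a b x
    have h4 : (E * J * E.transpose) * hS = 1 := by
      have : (E * J * E.transpose) * hS = E * F := by simp only [F, Matrix.mul_assoc]
      rw [this, hEF]
    have h5 : (Sm.ev x).mapMatrix (E * J * E.transpose) * (Matrix.of fun i j => h i j x) = 1 := by
      have := congrArg (Sm.ev x).mapMatrix h4
      rw [map_mul, map_one] at this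
      exact this
    rw [ginv, Matrix.inv_eq_left_inv h5]
    change Sm.ev x (∑ I, E a I * E b I.rev) = Sm.ev x ((E * J * E.transpose) a b)
    congr 1
    rw [sum_mul_rev (fun I => E a I) (fun J => E b J), Matrix.mul_apply]
    simp only [Matrix.mul_apply, Finset.sum_mul, Matrix.transpose_apply]
    exact Finset.sum_comm
  · intro x
    have h4 : (Sm.ev x E.det) ^ 2 * (Matrix.of fun i j => h i j x).det = -1 := by
      have := congrArg (fun A => Sm.ev x (Matrix.det A)) hE
      simp only [Matrix.det_mul, Matrix.det_transpose, map_mul] at this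
      have hdJ : J.det = -1 := by
        simp only [J, nullMetric_eq, Matrix.det_fin_three]; simp
      have hdh : Sm.ev x hS.det = (Matrix.of fun i j => h i j x).det := by
        rw [AlgHom.map_det]; rfl
      rw [hdJ, hdh, map_neg, map_one] at this
      linarith
    have h5 : 0 < Sm.ev x E.det := by
      have hp : Sm.ev x p.det = dP x := by rw [AlgHom.map_det]; rfl
      rw [Matrix.det_mul, det_nullGS _ _ _ _ _ ht, map_mul, hp]
      have hd1 := (hV x x.2).1.1.1.2
      have hd12 := (hV x x.2).1.1.2.2
      have hd23 := (hV x x.2).1.2.2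
      have hdp := (hV x x.2).2.2
      have hd2 : 0 < D2 x := pos_of_mul_pos_right hd12 hd1.le
      have e1 : Sm.ev x (r1 * (r2 * -m 0 0) * (r3 * (m 0 1 ^ 2 - m 0 0 * m 1 1))) =
        (Real.sqrt (D1 x))⁻¹ * ((Real.sqrt ((D1 * D2) x))⁻¹ * D1 x) *
          ((Real.sqrt ((D2 * -dM) x))⁻¹ * D2 x) := by
        simp [r1, r2, r3, m, D1, D2]
      rw [e1]
      have := Real.sqrt_pos.2 hd1
      have := Real.sqrt_pos.2 hd12
      have := Real.sqrt_pos.2 hd23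
      positivity
    have hneg := det_neg (hVU x.2)
    rw [abs_of_neg hneg]
    change _ * Sm.ev x E.det = 1
    have h6 : (Real.sqrt (-(Matrix.of fun i j => h i j x).det) * Sm.ev x E.det) ^ 2 = 1 := by
      rw [mul_pow, Real.sq_sqrt (by linarith)]; linarith
    have h7 : 0 ≤ Real.sqrt (-(Matrix.of fun i j => h i j x).det) * Sm.ev x E.det := by positivity
    exact (pow_eq_one_iff_of_nonneg h7 two_ne_zero).1 h6
  · intro K I L
    let φ : Sm V →ₐ[ℝ] ℝ := Sm.ev ⟨x₀, hVx⟩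
    have hmd : ∀ c i j, φ (Sm.der c (m i j)) = 0 := fun c i j => by
      simp only [m, Sm.der_mk, φ, Sm.ev_mk]
      exact pd_frameGram hx₀ c i j
    have htd : ∀ c, φ (Sm.der c t) = 0 := fun c => by
      rw [Derivation.map_algebraMap, map_zero]
    clear_value m t r1 r2 r3
    have hdet : ∀ c, φ (Sm.der c (Matrix.of m).det) = 0 := fun c =>
      der_det_three (Sm.der c) φ m (hmd c)
    have hNd : ∀ c i j, φ (Sm.der c (N i j)) = 0 := fun c i j => by
      refine der_nullGS (Sm.der c) φ m t r1 r2 r3 ?_ (hmd c) (der_invSqrt _ _ _ _ h1 ?_)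
        (der_invSqrt _ _ _ _ h2 ?_) (der_invSqrt _ _ _ _ h3 ?_) i j
      · exact htd c
      · simp only [map_neg, hmd, neg_zero]
      · simp only [map_neg, hmd, pow_two, Derivation.leibniz, map_sub, map_add, map_mul,
          smul_eq_mul, mul_zero, neg_zero, add_zero, sub_zero]
      · simp only [map_neg, hmd, pow_two, Derivation.leibniz, map_sub, map_add, map_mul,
          smul_eq_mul, mul_zero, neg_zero, add_zero, sub_zero, hdet]
    have hE0 : ∀ c a I, φ (Sm.der c (E a I) + ∑ b, Γ a c b * E b I) = 0 := by
      intro c a I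
      have e1 : ∀ a I, E a I = ∑ i, p a i * N i I := fun a I => Matrix.mul_apply
      have e2 : ∀ a i, φ (p a i) = P a i := fun a i => parallelFrame_self h x₀ P a i
      have e3 : ∀ a i, φ (Sm.der c (p a i)) = -∑ b, christoffel h a c b x₀ * P b i := fun a i => by
        simp only [p, Matrix.of_apply, Sm.der_mk, φ, Sm.ev_mk, pd_parallelFrame]
      have e4 : ∀ b, φ (Γ a c b) = christoffel h a c b x₀ := fun b => rfl
      simp only [e1, map_sum, Derivation.leibniz, smul_eq_mul, map_add, map_mul, e2, e3, e4, hNd]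
      simp only [Fin.sum_univ_three]
      ring
    have hc : ∀ c, φ (G.conn c I L) = 0 := fun c => by
      rw [Framed.conn, map_sum]
      refine Finset.sum_eq_zero fun a _ => ?_
      rw [map_mul]
      exact mul_eq_zero_of_right _ (hE0 c a I)
    rw [Framed.om, map_sum]
    refine Finset.sum_eq_zero fun c _ => ?_
    rw [map_mul]
    exact mul_eq_zero_of_right _ (hc c)

/-! ### Smoothness of the tensor fields -/

/-- Smoothness of all components. -/
def Smooth1 (U : Set (Fin 3 → ℝ)) (v : Cov1) : Prop := ∀ a, v a ∈ smoothOn U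
/-- Smoothness of all components. -/
def Smooth2 (U : Set (Fin 3 → ℝ)) (T : Cov2) : Prop := ∀ a b, T a b ∈ smoothOn U
/-- Smoothness of all components. -/
def Smooth3 (U : Set (Fin 3 → ℝ)) (S : Cov3) : Prop := ∀ a b c, S a b c ∈ smoothOn U

lemma sum_smooth {f : Fin 3 → Fld 3} (hf : ∀ i, f i ∈ smoothOn U) :
    ∑ i, f i ∈ smoothOn U := Subalgebra.sum_mem _ fun i _ => hf i

section

lemma smul_smooth (c : ℝ) (hf : f ∈ smoothOn U) : c • f ∈ smoothOn U :=
  Subalgebra.smul_mem _ hf c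

lemma Smooth2.add (hS : Smooth2 U S) (hT : Smooth2 U T) : Smooth2 U (S + T) :=
  fun a b => add_mem (hS a b) (hT a b)

lemma Smooth2.sub (hS : Smooth2 U S) (hT : Smooth2 U T) : Smooth2 U (S - T) :=
  fun a b => sub_mem (hS a b) (hT a b)

lemma Smooth2.neg (hT : Smooth2 U T) : Smooth2 U (-T) := fun a b => neg_mem (hT a b)

lemma Smooth2.smul (c : ℝ) (hT : Smooth2 U T) : Smooth2 U (c • T) :=
  fun a b => smul_smooth c (hT a b)

lemma symm_mem (hT : Smooth2 U T) : Smooth2 U (symm T) :=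
  fun a b => smul_smooth _ (add_mem (hT a b) (hT b a))

variable [Patch U h]

lemma grad_mem [Patch U h] (hσ : σ ∈ smoothOn U) : Smooth1 U (grad σ) := fun a => pd_mem_smoothOn Patch.opn hσ a

lemma D1_mem {v : Cov1} (hv : Smooth1 U v) : Smooth2 U (D1 h v) := fun a b =>
  sub_mem (pd_mem_smoothOn Patch.opn (hv b) a)
    (sum_smooth fun e => mul_mem (christoffel_mem _ _ _) (hv e))

lemma D2_mem (hT : Smooth2 U T) : Smooth3 U (D2 h T) := fun c a b =>
  sub_mem (pd_mem_smoothOn Patch.opn (hT a b) c) (sum_smooth fun e =>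
    add_mem (mul_mem (christoffel_mem _ _ _) (hT _ _))
      (mul_mem (christoffel_mem _ _ _) (hT _ _)))

lemma D3_mem {S : Cov3} (hS : Smooth3 U S) (d c a b : Fin 3) : D3 h S d c a b ∈ smoothOn U :=
  sub_mem (pd_mem_smoothOn Patch.opn (hS c a b) d) (sum_smooth fun e =>
    add_mem (add_mem (mul_mem (christoffel_mem _ _ _) (hS _ _ _))
      (mul_mem (christoffel_mem _ _ _) (hS _ _ _)))
      (mul_mem (christoffel_mem _ _ _) (hS _ _ _)))

lemma DD_mem (hT : Smooth2 U T) (d c a b : Fin 3) : DD h T d c a b ∈ smoothOn U :=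
  D3_mem (D2_mem hT) d c a b

lemma hess_mem (hσ : σ ∈ smoothOn U) : Smooth2 U (hess h σ) := D1_mem (grad_mem hσ)

lemma tr_mem (hT : Smooth2 U T) : tr h T ∈ smoothOn U :=
  sum_smooth fun a => sum_smooth fun b => mul_mem (ginv_mem a b) (hT a b)

lemma dvg_mem (hT : Smooth2 U T) : Smooth1 U (dvg h T) := fun _ =>
  sum_smooth fun b => sum_smooth fun c => mul_mem (ginv_mem b c) (D2_mem hT _ _ _)

lemma boxT_mem (hT : Smooth2 U T) : Smooth2 U (boxT h T) := fun _ _ =>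
  sum_smooth fun b => sum_smooth fun c => mul_mem (ginv_mem b c) (DD_mem hT _ _ _ _)

lemma up1_mem {v : Cov1} (hv : Smooth1 U v) : Smooth1 U (up1 h v) := fun _ =>
  sum_smooth fun b => mul_mem (ginv_mem _ b) (hv b)

lemma mixed_mem (hT : Smooth2 U T) : Smooth2 U (mixed h T) := fun _ _ =>
  sum_smooth fun c => mul_mem (ginv_mem _ c) (hT _ _)

lemma up2_mem (hT : Smooth2 U T) : Smooth2 U (up2 h T) := fun _ _ =>
  sum_smooth fun _ => sum_smooth fun _ =>
    mul_mem (mul_mem (ginv_mem _ _) (ginv_mem _ _)) (hT _ _)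

lemma up3_mem {S : Cov3} (hS : Smooth3 U S) : Smooth3 U (up3 h S) := fun _ _ _ =>
  sum_smooth fun _ => sum_smooth fun _ => sum_smooth fun _ =>
    mul_mem (mul_mem (mul_mem (ginv_mem _ _) (ginv_mem _ _)) (ginv_mem _ _))
      (hS _ _ _)

lemma inner2_mem (hS : Smooth2 U S) (hT : Smooth2 U T) : inner2 h S T ∈ smoothOn U :=
  sum_smooth fun _ => sum_smooth fun _ => mul_mem (hS _ _) (up2_mem hT _ _)

lemma prod2_mem (hS : Smooth2 U S) (hT : Smooth2 U T) : Smooth2 U (prod2 h S T) := fun _ _ =>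
  sum_smooth fun _ => mul_mem (hS _ _) (mixed_mem hT _ _)

lemma eps_mem (a b c : Fin 3) : eps h a b c ∈ smoothOn U := by
  have hdet : (fun x => (Matrix.of fun i j => h i j x).det) ∈ smoothOn U := fun x hx =>
    (contDiffAt_det fun i j => contDiffAt_of_smoothOn Patch.opn (h_mem i j) hx).contDiffWithinAt
  have h1 : (fun x => Real.sqrt |(Matrix.of fun i j => h i j x).det|) ∈ smoothOn U := by
    have h2 : (fun x => Real.sqrt (-(Matrix.of fun i j => h i j x).det)) ∈ smoothOn U :=
      ContDiffOn.sqrt (neg_mem hdet) fun x hx => by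
        have := det_neg hx
        exact (neg_pos.2 this).ne'
    exact ContDiffOn.congr h2 fun x hx => by rw [abs_of_neg (det_neg hx)]
  exact mul_mem h1 (contDiffOn_const : ContDiffOn ℝ ∞ (fun _ => leviSymbol a b c) U)

lemma curl_mem (hT : Smooth2 U T) : Smooth2 U (curl h T) := fun _ _ =>
  sum_smooth fun _ => sum_smooth fun _ => sum_smooth fun _ => sum_smooth fun _ =>
    mul_mem (mul_mem (mul_mem (eps_mem _ _ _) (ginv_mem _ _)) (ginv_mem _ _))
      (D2_mem hT _ _ _)

lemma symCurl_mem (hT : Smooth2 U T) : Smooth2 U (symCurl h T) := symm_mem (curl_mem hT)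

lemma gradSq_mem (hσ : σ ∈ smoothOn U) : gradSq h σ ∈ smoothOn U :=
  sum_smooth fun _ => mul_mem (grad_mem hσ _) (up1_mem (grad_mem hσ) _)

lemma DkSq_mem (hk : Smooth2 U k) : DkSq h k ∈ smoothOn U :=
  sum_smooth fun _ => sum_smooth fun _ => sum_smooth fun _ =>
    mul_mem (D2_mem hk _ _ _) (up3_mem (D2_mem hk) _ _ _)

lemma DkDk_mem (hk : Smooth2 U k) : Smooth2 U (DkDk h k) := fun _ b =>
  sum_smooth fun _ => sum_smooth fun _ =>
    mul_mem (D2_mem hk _ _ _) (up2_mem (fun _ _ => D2_mem hk b _ _) _ _)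

lemma sigDk_mem (hσ : σ ∈ smoothOn U) (hk : Smooth2 U k) : Smooth2 U (sigDk h σ k) := fun _ _ =>
  sum_smooth fun _ => mul_mem (up1_mem (grad_mem hσ) _) (D2_mem hk _ _ _)

lemma sigDkSym_mem (hσ : σ ∈ smoothOn U) (hk : Smooth2 U k) : Smooth2 U (sigDkSym h σ k) :=
  symm_mem fun _ _ =>
    sum_smooth fun _ => mul_mem (up1_mem (grad_mem hσ) _) (D2_mem hk _ _ _)

lemma hessK_mem (hσ : σ ∈ smoothOn U) (hk : Smooth2 U k) : Smooth2 U (hessK h σ k) :=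
  symm_mem (prod2_mem (hess_mem hσ) hk)

lemma magB_mem (hk : Smooth2 U k) : Smooth2 U (magB h k) :=
  fun _ _ => smul_smooth _ (curl_mem hk _ _)

lemma Yten_mem (hk : Smooth2 U k) : Smooth2 U (Yten h k) := by
  have hB := magB_mem hk
  have hg := ginv_mem (U := U) (h := h)
  have he := eps_mem (U := U) (h := h)
  refine fun a b => sub_mem (sub_mem (smul_smooth _ (symm_mem (fun a b => ?_) a b))
    (smul_smooth _ (symm_mem (fun a b => ?_) a b))) (smul_smooth _ (symm_mem (fun a b => ?_) a b))
  · exact sum_smooth fun c => mul_mem (hB _ _) (mixed_mem hB _ _)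
  · exact sum_smooth fun c => sum_smooth fun d => sum_smooth fun e => sum_smooth fun c' =>
      sum_smooth fun d' => sum_smooth fun e' => mul_mem (mul_mem (mul_mem (mul_mem (he _ _ _)
        (hg _ _)) (hg _ _)) (D2_mem hk _ _ _)) (mul_mem (hg _ _) (hB _ _))
  · exact sum_smooth fun c => sum_smooth fun d => sum_smooth fun e => sum_smooth fun c' =>
      mul_mem (mul_mem (he _ _ _) (mul_mem (hg _ _) (D2_mem hB _ _ _)))
        (up2_mem hk _ _)

lemma QW_mem (hσ : σ ∈ smoothOn U) (hk : Smooth2 U k) : Smooth2 U (QW h σ k) := fun a b =>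
  sub_mem (mul_mem (add_mem (smul_smooth _ (pow_mem hσ 2)) (smul_smooth _ (inner2_mem hk hk)))
    (h_mem a b)) (smul_smooth _ (prod2_mem hk hk a b))

lemma QV_mem (hσ : σ ∈ smoothOn U) (hk : Smooth2 U k) : Smooth2 U (QV h σ k) := fun a b => by
  have hg := h_mem (U := U) (h := h) a b
  have hs2 := hess_mem hσ
  have h1 := add_mem (add_mem (add_mem (smul_smooth 6 (pow_mem hσ 2)) (gradSq_mem hσ))
    (smul_smooth (1 / 8) (inner2_mem hk hk))) (smul_smooth (1 / 8) (DkSq_mem hk))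
  refine add_mem (add_mem (sub_mem (sub_mem (sub_mem (add_mem (add_mem (sub_mem (add_mem (sub_mem
    (add_mem (mul_mem h1 hg) (smul_smooth _ (mul_mem hσ (hs2 a b))))
    (smul_smooth _ (mul_mem (grad_mem hσ a) (grad_mem hσ b))))
    (smul_smooth _ (mul_mem hσ (hk a b)))) (smul_smooth _ (sigDk_mem hσ hk a b)))
    (smul_smooth _ (sigDkSym_mem hσ hk a b))) (smul_smooth _ (hessK_mem hσ hk a b)))
    (mul_mem (inner2_mem hs2 hk) hg)) (smul_smooth _ (prod2_mem hk hk a b)))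
    (smul_smooth _ (DkDk_mem hk a b))) (smul_smooth _ (symm_mem (fun a b => ?_) a b)))
    (Yten_mem hk a b)
  exact sum_smooth fun c => sum_smooth fun d =>
    mul_mem (up2_mem hk c d) (DD_mem hk _ _ _ _)

lemma kappa_mem (hσ : σ ∈ smoothOn U) (hk : Smooth2 U k) : Smooth2 U (kappa h σ k) := by
  have hs2 := hess_mem hσ
  refine ((Smooth2.add (fun a b => ?_) (Smooth2.smul 4 fun a b => ?_)).add
    (Yten_mem hk)).add fun a b => ?_
  · exact add_mem (mul_mem (sub_mem (smul_smooth 2 (pow_mem hσ 2))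
      (smul_smooth 2 (gradSq_mem hσ))) (h_mem a b)) (smul_smooth _ (mul_mem hσ (hs2 a b)))
  · exact add_mem (sub_mem (sub_mem (add_mem (mul_mem hσ (hk a b)) (hessK_mem hσ hk a b))
      (smul_smooth _ (mul_mem (inner2_mem hs2 hk) (h_mem a b))))
      (sigDk_mem hσ hk a b)) (sigDkSym_mem hσ hk a b)
  · exact sub_mem (add_mem (sub_mem (smul_smooth _ (mul_mem (inner2_mem hk hk) (h_mem a b)))
      (prod2_mem hk hk a b)) (smul_smooth _ (mul_mem (DkSq_mem hk) (h_mem a b))))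
      (smul_smooth _ (DkDk_mem hk a b))

end

/-! ### Frame components of tensor fields -/

namespace Sm

open Classical in
/-- The restriction of a function to `V`, or `0` if it is not smooth there. -/
def lift (V : TopologicalSpace.Opens (Fin 3 → ℝ)) (f : Fld 3) : Sm V :=
  if hf : f ∈ smoothOn (V : Set (Fin 3 → ℝ)) then mk f hf else 0

variable {V : TopologicalSpace.Opens (Fin 3 → ℝ)}

lemma lift_eq (hf : f ∈ smoothOn (V : Set (Fin 3 → ℝ))) : lift V f = mk f hf := by
  rw [lift, dif_pos hf]

lemma ev_lift (hf : f ∈ smoothOn (V : Set (Fin 3 → ℝ))) (x : V) : ev x (lift V f) = f x := by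
  rw [lift_eq hf, ev_mk]

lemma der_lift (hf : f ∈ smoothOn (V : Set (Fin 3 → ℝ))) (a : Fin 3) :
    der a (lift V f) = lift V (pd a f) := by
  rw [lift_eq hf, der_mk, lift_eq (pd_mem_smoothOn V.isOpen hf a)]

end Sm

namespace LocalFrame

variable (L : LocalFrame U h x₀)

/-- The base point. -/
def pt : L.V := ⟨x₀, L.mem⟩

/-- Evaluation at the base point. -/
def ev0 : Sm L.V →ₐ[ℝ] ℝ := Sm.ev L.pt

/-- The restriction of a scalar. -/
def fr0 (f : Fld 3) : Sm L.V := Sm.lift L.V f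
/-- Frame components. -/
def fr1 (v : Cov1) : Fin 3 → Sm L.V := L.G.tf1 fun a => L.fr0 (v a)
/-- Frame components. -/
def fr2 (T : Cov2) : Fin 3 → Fin 3 → Sm L.V := L.G.tf2 fun a b => L.fr0 (T a b)
/-- Frame components. -/
def fr3 (S : Cov3) : Fin 3 → Fin 3 → Fin 3 → Sm L.V := L.G.tf3 fun a b c => L.fr0 (S a b c)
/-- Frame components. -/
def fr4 (S : Fin 3 → Cov3) : Fin 3 → Fin 3 → Fin 3 → Fin 3 → Sm L.V :=
  L.G.tf4 fun d a b c => L.fr0 (S d a b c)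

lemma mono : smoothOn U ≤ smoothOn (L.V : Set (Fin 3 → ℝ)) := smoothOn_mono L.sub

lemma ev_fr0 (hf : f ∈ smoothOn U) (x : L.V) : Sm.ev x (L.fr0 f) = f x :=
  Sm.ev_lift (L.mono hf) x

lemma d_fr0 (hf : f ∈ smoothOn U) (a : Fin 3) : L.G.d a (L.fr0 f) = L.fr0 (pd a f) := by
  rw [L.d_eq]; exact Sm.der_lift (L.mono hf) a

lemma fr0_congr (hf : f ∈ smoothOn U) (hg : g ∈ smoothOn U) (hfg : EqOn f g U) :
    L.fr0 f = L.fr0 g :=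
  Sm.ext_ev fun x => by rw [L.ev_fr0 hf, L.ev_fr0 hg, hfg (L.sub x.2)]

variable [Patch U h]

lemma fr2_D1 {v : Cov1} (hv : Smooth1 U v) : L.fr2 (D1 h v) = L.G.N1 (L.fr1 v) := by
  rw [fr1, ← Framed.tf2_D1, fr2]
  congr 1
  funext c a
  apply Sm.ext_ev
  intro x
  rw [L.ev_fr0 (D1_mem hv c a), Framed.D1, L.d_fr0 (hv a), map_sub,
    L.ev_fr0 (pd_mem_smoothOn Patch.opn (hv a) c)]
  simp [D1, L.Γ_eq, L.ev_fr0 (hv _)]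

lemma fr3_D2 (hT : Smooth2 U T) : L.fr3 (D2 h T) = L.G.N2 (L.fr2 T) := by
  rw [fr2, ← Framed.tf3_D2, fr3]
  congr 1
  funext c a b
  apply Sm.ext_ev
  intro x
  rw [L.ev_fr0 (D2_mem hT c a b), Framed.D2, L.d_fr0 (hT a b), map_sub,
    L.ev_fr0 (pd_mem_smoothOn Patch.opn (hT a b) c)]
  simp [D2, L.Γ_eq, L.ev_fr0 (hT _ _)]

lemma fr4_D3 {S : Cov3} (hS : Smooth3 U S) : L.fr4 (D3 h S) = L.G.N3 (L.fr3 S) := by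
  rw [fr3, ← Framed.tf4_D3, fr4]
  congr 1
  funext d c a b
  apply Sm.ext_ev
  intro x
  rw [L.ev_fr0 (D3_mem hS d c a b), Framed.D3, L.d_fr0 (hS c a b), map_sub,
    L.ev_fr0 (pd_mem_smoothOn Patch.opn (hS c a b) d)]
  simp [D3, L.Γ_eq, L.ev_fr0 (hS _ _ _)]

lemma fr1_grad (hf : f ∈ smoothOn U) : L.fr1 (grad f) = fun K => L.G.e K (L.fr0 f) := by
  funext K
  rw [← Framed.e_zero_tf, fr1]
  congr 1
  funext c
  rw [L.d_fr0 hf]; rfl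

lemma fr4_DD (hT : Smooth2 U T) : L.fr4 (DD h T) = L.G.N3 (L.G.N2 (L.fr2 T)) := by
  rw [DD, L.fr4_D3 (D2_mem hT), L.fr3_D2 hT]

end LocalFrame

/-! ### Contractions in a null frame -/

@[elab_as_elim]
lemma fin3_cases {P : Fin 3 → Prop} (h0 : P 0) (h1 : P 1) (h2 : P 2) (I : Fin 3) : P I := by
  fin_cases I <;> assumption

lemma fin3_symm {α : Type*} {t : Fin 3 → Fin 3 → α} (h : ∀ I J, t I J = t J I) :
    t 1 0 = t 0 1 ∧ t 2 0 = t 0 2 ∧ t 2 1 = t 1 2 := ⟨h 1 0, h 2 0, h 2 1⟩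

lemma fin3_comm {t r : Fin 3 → Fin 3 → ℝ} (h : ∀ A B, t A B - t B A = r A B) :
    t 1 0 = r 1 0 + t 0 1 ∧ t 2 0 = r 2 0 + t 0 2 ∧ t 2 1 = r 2 1 + t 1 2 :=
  ⟨eq_add_of_sub_eq (h 1 0), eq_add_of_sub_eq (h 2 0), eq_add_of_sub_eq (h 2 1)⟩

lemma rev3 : (0 : Fin 3).rev = 2 ∧ (1 : Fin 3).rev = 1 ∧ (2 : Fin 3).rev = 0 := ⟨rfl, rfl, rfl⟩

section Transform

variable {R : Type*} [CommRing R]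

/-- First null index paired with `I` in the volume form. -/
def crossFst : Fin 3 → Fin 3 := ![1, 0, 2]
/-- Second null index paired with `I` in the volume form. -/
def crossSnd : Fin 3 → Fin 3 := ![0, 2, 1]

/-- `ε_I^{KL} X_{KL}` in a null frame. -/
def ncross (X : Fin 3 → Fin 3 → R) (I : Fin 3) : R :=
  X (crossFst I) (crossSnd I) - X (crossSnd I) (crossFst I)

lemma ncross_values (X : Fin 3 → Fin 3 → R) : ncross X 0 = X 1 0 - X 0 1 ∧
    ncross X 1 = X 0 2 - X 2 0 ∧ ncross X 2 = X 2 1 - X 1 2 := ⟨rfl, rfl, rfl⟩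

/-- Components of one slot with respect to a frame. -/
def t1 (E : Fin 3 → Fin 3 → R) (v : Fin 3 → R) (I : Fin 3) : R := ∑ a, E a I * v a

variable (E : Fin 3 → Fin 3 → R)

lemma t1_sum {ι : Type*} (s : Finset ι) (v : ι → Fin 3 → R) (I : Fin 3) :
    t1 E (fun a => ∑ i ∈ s, v i a) I = ∑ i ∈ s, t1 E (v i) I := by
  simp only [t1, Finset.mul_sum]; exact Finset.sum_comm

lemma t1_mul_left (r : R) (v : Fin 3 → R) (I : Fin 3) :
    t1 E (fun a => r * v a) I = r * t1 E v I := by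
  simp only [t1, Finset.mul_sum]; exact Finset.sum_congr rfl fun _ _ => by ring

lemma t1_mul_right (r : R) (v : Fin 3 → R) (I : Fin 3) :
    t1 E (fun a => v a * r) I = t1 E v I * r := by
  simp only [mul_comm _ r, t1_mul_left]

lemma t1_comm (X : Fin 3 → Fin 3 → R) (I J : Fin 3) :
    t1 E (fun a => t1 E (fun b => X a b) J) I = t1 E (fun b => t1 E (fun a => X a b) I) J := by
  simp only [t1, Finset.mul_sum]
  rw [Finset.sum_comm]
  exact Finset.sum_congr rfl fun _ _ => Finset.sum_congr rfl fun _ _ => by ring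

lemma t1_sub' (u v : Fin 3 → R) (I : Fin 3) :
    t1 E (fun a => u a - v a) I = t1 E u I - t1 E v I := by
  simp [t1, mul_sub, Finset.sum_sub_distrib]

/-- The inverse metric of a null frame. -/
def frameInv (a b : Fin 3) : R := ∑ I, E a I * E b I.rev

lemma sum_rev (f : Fin 3 → R) : ∑ I : Fin 3, f I.rev = ∑ I, f I :=
  Equiv.sum_comp Fin.revPerm f

lemma frameInv_comm (a b : Fin 3) : frameInv E a b = frameInv E b a := by
  rw [frameInv, ← sum_rev, frameInv]
  simp only [Fin.rev_rev, mul_comm]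

lemma contract (X : Fin 3 → Fin 3 → R) :
    ∑ a, ∑ b, frameInv E a b * X a b = ∑ I, t1 E (fun a => t1 E (fun b => X a b) I.rev) I := by
  simp only [frameInv, t1, Finset.sum_mul, Finset.mul_sum]
  rw [Finset.sum_comm' (t' := Finset.univ) (s' := fun _ => Finset.univ) (by simp)]
  have : ∀ a b : Fin 3 → Fin 3 → Fin 3 → R, a = b → ∑ x, ∑ y, ∑ z, a x y z = ∑ z, ∑ y, ∑ x, b x y z := by
    rintro a _ rfl
    rw [Finset.sum_congr rfl fun x _ => Finset.sum_comm, Finset.sum_comm]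
    exact Finset.sum_congr rfl fun x _ => Finset.sum_comm
  rw [this _ _ rfl]
  refine Finset.sum_congr rfl fun I _ => Finset.sum_congr rfl fun _ _ =>
    Finset.sum_congr rfl fun _ _ => by ring

end Transform

section Volume

variable (E : Fin 3 → Fin 3 → ℝ)

lemma levi_transform (I K M : Fin 3) :
    t1 E (fun a => t1 E (fun c => t1 E (fun d => leviSymbol a c d) M) K) I =
      (Matrix.of E).det * leviSymbol I K M := by
  simp only [t1, Fin.sum_univ_three, Matrix.det_fin_three, Matrix.of_apply]
  induction I using fin3_cases <;> induction K using fin3_cases <;>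
    induction M using fin3_cases <;> norm_num [leviSymbol] <;> ring

lemma levi_sum (X : Fin 3 → Fin 3 → ℝ) (I : Fin 3) :
    ∑ K, ∑ M, leviSymbol I K M * X K.rev M.rev = ncross X I := by
  simp only [Fin.sum_univ_three, rev3]
  induction I using fin3_cases <;>
    norm_num [leviSymbol, ncross_values] <;> ring

lemma eps_contract {s : ℝ} (hs : s * (Matrix.of E).det = 1) (X : Fin 3 → Fin 3 → ℝ) (I : Fin 3) :
    t1 E (fun a => ∑ c, ∑ d, ∑ c', ∑ d', s * leviSymbol a c' d' * frameInv E c' c *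
      frameInv E d' d * X c d) I = ncross (fun K M => t1 E (fun c => t1 E (fun d => X c d) M) K) I := by
  have h1 : ∀ a, ∑ c, ∑ d, ∑ c', ∑ d', s * leviSymbol a c' d' * frameInv E c' c *
      frameInv E d' d * X c d = ∑ c', ∑ c, frameInv E c' c * ∑ d', ∑ d, frameInv E d' d *
        (s * leviSymbol a c' d' * X c d) := by
    intro a
    rw [Finset.sum_congr rfl fun c _ => Finset.sum_comm, Finset.sum_comm]
    refine Finset.sum_congr rfl fun c' _ => Finset.sum_congr rfl fun c _ => ?_
    rw [Finset.sum_comm, Finset.mul_sum]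
    refine Finset.sum_congr rfl fun d' _ => ?_
    rw [Finset.mul_sum]
    exact Finset.sum_congr rfl fun d _ => by ring
  simp only [h1, contract, t1_mul_left, t1_mul_right, t1_sum]
  rw [← levi_sum]
  refine Finset.sum_congr rfl fun K _ => Finset.sum_congr rfl fun M _ => ?_
  rw [levi_transform, ← mul_assoc, hs, one_mul]

end Volume

section Pairings

variable {R : Type*} [CommRing R] (E : Fin 3 → Fin 3 → R)

lemma contract_one (u w : Fin 3 → R) :
    ∑ c, u c * ∑ c', frameInv E c c' * w c' = ∑ K, t1 E u K * t1 E w K.rev := by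
  have : ∀ c, u c * ∑ c', frameInv E c c' * w c' = ∑ c', frameInv E c c' * (u c * w c') := by
    intro c; rw [Finset.mul_sum]; exact Finset.sum_congr rfl fun _ _ => by ring
  simp only [this, contract, t1_mul_left, t1_mul_right]

lemma contract_two (X Y : Fin 3 → Fin 3 → R) :
    ∑ c, ∑ d, X c d * ∑ c', ∑ d', frameInv E c c' * frameInv E d d' * Y c' d' =
      ∑ K, ∑ M, t1 E (fun c => t1 E (fun d => X c d) M) K *
        t1 E (fun c => t1 E (fun d => Y c d) M.rev) K.rev := by
  have : ∀ c, ∑ d, X c d * ∑ c', ∑ d', frameInv E c c' * frameInv E d d' * Y c' d' =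
      ∑ c', frameInv E c c' * ∑ d, X c d * ∑ d', frameInv E d d' * Y c' d' := by
    intro c
    simp only [Finset.mul_sum]
    rw [Finset.sum_comm]
    exact Finset.sum_congr rfl fun _ _ => Finset.sum_congr rfl fun _ _ =>
      Finset.sum_congr rfl fun _ _ => by ring
  simp only [this, contract_one, contract, t1_sum, t1_mul_left, t1_mul_right]

lemma contract_three (X Y : Fin 3 → Fin 3 → Fin 3 → R) :
    ∑ c, ∑ d, ∑ e, X c d e * ∑ c', ∑ d', ∑ e',
      frameInv E c c' * frameInv E d d' * frameInv E e e' * Y c' d' e' =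
      ∑ K, ∑ M, ∑ P, t1 E (fun c => t1 E (fun d => t1 E (fun e => X c d e) P) M) K *
        t1 E (fun c => t1 E (fun d => t1 E (fun e => Y c d e) P.rev) M.rev) K.rev := by
  have : ∀ c, ∑ d, ∑ e, X c d e * ∑ c', ∑ d', ∑ e',
      frameInv E c c' * frameInv E d d' * frameInv E e e' * Y c' d' e' =
      ∑ c', frameInv E c c' * ∑ d, ∑ e, X c d e *
        ∑ d', ∑ e', frameInv E d d' * frameInv E e e' * Y c' d' e' := by
    intro c
    simp only [Finset.mul_sum]
    rw [Finset.sum_congr rfl fun d _ => Finset.sum_comm, Finset.sum_comm]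
    exact Finset.sum_congr rfl fun _ _ => Finset.sum_congr rfl fun _ _ =>
      Finset.sum_congr rfl fun _ _ => Finset.sum_congr rfl fun _ _ =>
      Finset.sum_congr rfl fun _ _ => by ring
  simp only [this, contract_two, contract, t1_sum, t1_mul_left, t1_mul_right]

end Pairings

namespace LocalFrame

variable (L : LocalFrame U h x₀)

/-- The frame at a point. -/
def ex (x : L.V) (a I : Fin 3) : ℝ := Sm.ev x (L.G.E a I)

lemma ev_tf1 (v : Fin 3 → Sm L.V) (x : L.V) (I : Fin 3) :
    Sm.ev x (L.G.tf1 v I) = t1 (L.ex x) (fun a => Sm.ev x (v a)) I := by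
  simp [Framed.tf1, Framed.tf, t1, ex]

lemma ev_fr1 {v : Cov1} (hv : Smooth1 U v) (x : L.V) (I : Fin 3) :
    Sm.ev x (L.fr1 v I) = t1 (L.ex x) (fun a => v a x) I := by
  rw [fr1, ev_tf1]; simp only [L.ev_fr0 (hv _)]

lemma ev_fr2 (hT : Smooth2 U T) (x : L.V) (I J : Fin 3) :
    Sm.ev x (L.fr2 T I J) = t1 (L.ex x) (fun a => t1 (L.ex x) (fun b => T a b x) J) I := by
  rw [fr2, Geo.tf2_apply, ev_tf1]; simp only [ev_tf1, L.ev_fr0 (hT _ _)]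

lemma ev_fr3 {S : Cov3} (hS : Smooth3 U S) (x : L.V) (K I J : Fin 3) :
    Sm.ev x (L.fr3 S K I J) =
      t1 (L.ex x) (fun c => t1 (L.ex x) (fun a => t1 (L.ex x) (fun b => S c a b x) J) I) K := by
  rw [fr3, Geo.tf3_apply, ev_tf1]; simp only [ev_tf1, L.ev_fr0 (hS _ _ _)]

lemma ev_fr4 {S : Fin 3 → Cov3} (hS : ∀ d, Smooth3 U (S d)) (x : L.V) (P K I J : Fin 3) :
    Sm.ev x (L.fr4 S P K I J) = t1 (L.ex x) (fun d => t1 (L.ex x)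
      (fun c => t1 (L.ex x) (fun a => t1 (L.ex x) (fun b => S d c a b x) J) I) K) P := by
  rw [fr4, Geo.tf4_apply, ev_tf1]; simp only [ev_tf1, L.ev_fr0 (hS _ _ _ _)]

lemma ginv_eq (x : L.V) (a b : Fin 3) : ginv h a b x = frameInv (L.ex x) a b := by
  rw [← L.hi_eq]; simp [frameInv, ex]

lemma fr2_add (hS : Smooth2 U S) (hT : Smooth2 U T) :
    L.fr2 (S + T) = L.fr2 S + L.fr2 T := by
  funext I J
  refine Sm.ext_ev fun x => ?_
  simp only [Pi.add_apply, map_add]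
  rw [L.ev_fr2 (hS.add hT), L.ev_fr2 hS, L.ev_fr2 hT]
  simp [t1, mul_add, Finset.sum_add_distrib]

lemma fr2_smul (c : ℝ) (hT : Smooth2 U T) : L.fr2 (c • T) = c • L.fr2 T := by
  funext I J
  refine Sm.ext_ev fun x => ?_
  simp only [Pi.smul_apply, map_smul]
  rw [L.ev_fr2 (hT.smul c), L.ev_fr2 hT]
  simp only [Pi.smul_apply, smul_eq_mul, t1_mul_left]

lemma fr2_neg (hT : Smooth2 U T) : L.fr2 (-T) = -L.fr2 T := by
  have := L.fr2_smul (-1) hT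
  rwa [neg_one_smul, neg_one_smul] at this

lemma fr2_sub (hS : Smooth2 U S) (hT : Smooth2 U T) :
    L.fr2 (S - T) = L.fr2 S - L.fr2 T := by
  rw [sub_eq_add_neg, L.fr2_add hS hT.neg, L.fr2_neg hT, sub_eq_add_neg]

lemma fr2_symm (hT : Smooth2 U T) (I J : Fin 3) :
    L.fr2 (symm T) I J = (1 / 2 : ℝ) • (L.fr2 T I J + L.fr2 T J I) := by
  refine Sm.ext_ev fun x => ?_
  rw [L.ev_fr2 (symm_mem hT), map_smul, map_add, L.ev_fr2 hT, L.ev_fr2 hT, t1_comm _ _ J I]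
  simp [symm, t1, mul_add, Finset.sum_add_distrib, Finset.mul_sum]
  ring_nf

lemma fr2_scalar (hf : f ∈ smoothOn U) (hT : Smooth2 U T) (I J : Fin 3) :
    L.fr2 (fun a b => f * T a b) I J = L.fr0 f * L.fr2 T I J := by
  refine Sm.ext_ev fun x => ?_
  rw [L.ev_fr2 (fun a b => mul_mem hf (hT a b)), map_mul, L.ev_fr2 hT, L.ev_fr0 hf]
  simp only [Pi.mul_apply, t1_mul_left]

lemma fr2_tensor {v w : Cov1} (hv : Smooth1 U v) (hw : Smooth1 U w) (I J : Fin 3) :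
    L.fr2 (fun a b => v a * w b) I J = L.fr1 v I * L.fr1 w J := by
  refine Sm.ext_ev fun x => ?_
  rw [L.ev_fr2 (fun a b => mul_mem (hv a) (hw b)), map_mul, L.ev_fr1 hv, L.ev_fr1 hw]
  simp only [Pi.mul_apply, t1_mul_left, t1_mul_right]

lemma fr0_add (hf : f ∈ smoothOn U) (hg : g ∈ smoothOn U) :
    L.fr0 (f + g) = L.fr0 f + L.fr0 g :=
  Sm.ext_ev fun x => by rw [map_add, L.ev_fr0 (add_mem hf hg), L.ev_fr0 hf, L.ev_fr0 hg]; rfl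

lemma fr0_sub (hf : f ∈ smoothOn U) (hg : g ∈ smoothOn U) :
    L.fr0 (f - g) = L.fr0 f - L.fr0 g :=
  Sm.ext_ev fun x => by rw [map_sub, L.ev_fr0 (sub_mem hf hg), L.ev_fr0 hf, L.ev_fr0 hg]; rfl

lemma fr0_smul (c : ℝ) (hf : f ∈ smoothOn U) : L.fr0 (c • f) = c • L.fr0 f :=
  Sm.ext_ev fun x => by rw [map_smul, L.ev_fr0 (smul_smooth c hf), L.ev_fr0 hf]; rfl

lemma fr0_pow (hf : f ∈ smoothOn U) (n : ℕ) : L.fr0 (f ^ n) = L.fr0 f ^ n :=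
  Sm.ext_ev fun x => by rw [map_pow, L.ev_fr0 (pow_mem hf n), L.ev_fr0 hf]; rfl

variable [Patch U h]

lemma fr2_h : L.fr2 h = nullMetric (Sm L.V) := by
  rw [← Geo.tf2_h L.G, fr2]
  congr 1
  funext a b
  exact Sm.ext_ev fun x => by rw [L.ev_fr0 (h_mem a b), L.h_eq]

lemma fr0_tr (hT : Smooth2 U T) : L.fr0 (tr h T) = ∑ I, L.fr2 T I I.rev := by
  refine Sm.ext_ev fun x => ?_
  rw [L.ev_fr0 (tr_mem hT), map_sum]
  simp only [L.ev_fr2 hT, tr, Finset.sum_apply, Pi.mul_apply, ginv_eq, contract]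

lemma fr1_dvg (hT : Smooth2 U T) (I : Fin 3) :
    L.fr1 (dvg h T) I = ∑ K, L.G.N2 (L.fr2 T) K I K.rev := by
  rw [← L.fr3_D2 hT]
  refine Sm.ext_ev fun x => ?_
  rw [L.ev_fr1 (dvg_mem hT), map_sum]
  simp only [L.ev_fr3 (D2_mem hT), dvg, Finset.sum_apply, Pi.mul_apply, ginv_eq, contract,
    t1_sum]
  rw [← sum_rev]
  refine Finset.sum_congr rfl fun K _ => ?_
  rw [Fin.rev_rev, t1_comm, t1_comm _ _ K I]
  have : ∀ a, t1 (L.ex x) (fun b => t1 (L.ex x) (fun c => D2 h T c a b x) K) K.rev =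
    t1 (L.ex x) (fun c => t1 (L.ex x) (fun b => D2 h T c a b x) K.rev) K := fun a => t1_comm _ _ _ _
  rw [t1_comm]
  simp only [this]

lemma fr2_box (hT : Smooth2 U T) (I J : Fin 3) :
    L.fr2 (boxT h T) I J = ∑ K, L.G.N3 (L.G.N2 (L.fr2 T)) K K.rev I J := by
  rw [← L.fr4_DD hT]
  refine Sm.ext_ev fun x => ?_
  rw [L.ev_fr2 (boxT_mem hT), map_sum]
  simp only [L.ev_fr4 (fun d => DD_mem hT d), boxT, Finset.sum_apply, Pi.mul_apply, ginv_eq,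
    contract, t1_sum]
  refine Finset.sum_congr rfl fun K _ => ?_
  have h1 : ∀ X : Fin 3 → Fin 3 → Fin 3 → Fin 3 → ℝ, ∀ A B C D, t1 (L.ex x) (fun a => t1 (L.ex x) (fun b =>
      t1 (L.ex x) (fun c => t1 (L.ex x) (fun d => X c d a b) D) C) B) A = t1 (L.ex x) (fun c =>
      t1 (L.ex x) (fun d => t1 (L.ex x) (fun a => t1 (L.ex x) (fun b => X c d a b) B) A) D) C := by
    intro X A B C D
    have e1 : ∀ a, t1 (L.ex x) (fun b => t1 (L.ex x) (fun c => t1 (L.ex x) (fun d => X c d a b) D) C) B =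
        t1 (L.ex x) (fun c => t1 (L.ex x) (fun d => t1 (L.ex x) (fun b => X c d a b) B) D) C := by
      intro a
      rw [t1_comm]
      simp only [fun c => t1_comm (L.ex x) (fun b d => X c d a b)]
    simp only [e1]
    rw [t1_comm]
    simp only [fun c => t1_comm (L.ex x) (fun a d => t1 (L.ex x) (fun b => X c d a b) B)]
  exact h1 _ _ _ _ _

lemma fr2_curl (hT : Smooth2 U T) (I J : Fin 3) :
    L.fr2 (curl h T) I J = ncross (fun K M => L.G.N2 (L.fr2 T) K M J) I := by
  rw [← L.fr3_D2 hT]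
  refine Sm.ext_ev fun x => ?_
  have hd : Real.sqrt |(Matrix.of fun i j => h i j x).det| * (Matrix.of (L.ex x)).det = 1 := by
    rw [← L.det_eq x, AlgHom.map_det]; rfl
  rw [L.ev_fr2 (curl_mem hT), t1_comm]
  simp only [curl, Finset.sum_apply, Pi.mul_apply, ginv_eq, eps, eps_contract _ hd, t1_sub',
    ncross, map_sub, L.ev_fr3 (D2_mem hT)]
  have h1 : ∀ (X : Fin 3 → Fin 3 → Fin 3 → ℝ) A B C, t1 (L.ex x) (fun b => t1 (L.ex x) (fun c =>
      t1 (L.ex x) (fun d => X c d b) C) B) A =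
      t1 (L.ex x) (fun c => t1 (L.ex x) (fun d => t1 (L.ex x) (fun b => X c d b) A) C) B := by
    intro X A B C
    rw [t1_comm]
    simp only [fun c => t1_comm (L.ex x) (fun b d => X c d b)]
  simp only [h1 fun c d b => D2 h T c d b x]

end LocalFrame

/-! ### Quadratic expressions in a null frame -/

namespace LocalFrame

variable (L : LocalFrame U h x₀)
variable [Patch U h]
/-- Exchange of the outer and the inner pair of slots. -/
lemma fr4_swap {S : Fin 3 → Cov3} (hS : ∀ d, Smooth3 U (S d)) (I J K M : Fin 3) :
    L.fr4 (fun a b c d => S c d a b) I J K M = L.fr4 S K M I J := by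
  refine Sm.ext_ev fun x => ?_
  rw [L.ev_fr4 hS, L.ev_fr4 (fun a b c d => hS c d a b)]
  have e1 : ∀ a, t1 (L.ex x) (fun b => t1 (L.ex x) (fun c => t1 (L.ex x) (fun d => S c d a b x) M) K) J =
      t1 (L.ex x) (fun c => t1 (L.ex x) (fun d => t1 (L.ex x) (fun b => S c d a b x) J) M) K := by
    intro a
    rw [t1_comm]
    simp only [fun c => t1_comm (L.ex x) (fun b d => S c d a b x)]
  simp only [e1]
  rw [t1_comm]
  simp only [fun c => t1_comm (L.ex x) (fun a d => t1 (L.ex x) (fun b => S c d a b x) J)]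

/-- Exchange of the two middle slots. -/
lemma fr4_mid {S : Fin 3 → Cov3} (hS : ∀ d, Smooth3 U (S d)) (I J K M : Fin 3) :
    L.fr4 (fun a b c d => S a c b d) I J K M = L.fr4 S I K J M := by
  refine Sm.ext_ev fun x => ?_
  rw [L.ev_fr4 hS, L.ev_fr4 (fun a b c d => hS a c b d)]
  simp only [fun a => t1_comm (L.ex x) (fun b c => t1 (L.ex x) (fun d => S a c b d x) M)]

/-- Exchange of the two first slots. -/
lemma fr4_fst {S : Fin 3 → Cov3} (hS : ∀ d, Smooth3 U (S d)) (I J K M : Fin 3) :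
    L.fr4 (fun a b c d => S b a c d) I J K M = L.fr4 S J I K M := by
  refine Sm.ext_ev fun x => ?_
  rw [L.ev_fr4 hS, L.ev_fr4 (fun a b c d => hS b a c d)]
  rw [t1_comm]

/-- Exchange of the two last slots. -/
lemma fr4_lst {S : Fin 3 → Cov3} (hS : ∀ d, Smooth3 U (S d)) (I J K M : Fin 3) :
    L.fr4 (fun a b c d => S a b d c) I J K M = L.fr4 S I J M K := by
  refine Sm.ext_ev fun x => ?_
  rw [L.ev_fr4 hS, L.ev_fr4 (fun a b c d => hS a b d c)]
  simp only [fun a b => t1_comm (L.ex x) (fun c d => S a b d c x)]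

/-- Exchange of the two first slots. -/
lemma fr3_fst {S : Cov3} (hS : Smooth3 U S) (I J K : Fin 3) :
    L.fr3 (fun a b c => S b a c) I J K = L.fr3 S J I K := by
  refine Sm.ext_ev fun x => ?_
  rw [L.ev_fr3 hS, L.ev_fr3 (fun a b c => hS b a c)]
  rw [t1_comm]

/-- Exchange of the two last slots. -/
lemma fr3_lst {S : Cov3} (hS : Smooth3 U S) (I J K : Fin 3) :
    L.fr3 (fun a b c => S a c b) I J K = L.fr3 S I K J := by
  refine Sm.ext_ev fun x => ?_
  rw [L.ev_fr3 hS, L.ev_fr3 (fun a b c => hS a c b)]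
  simp only [fun a => t1_comm (L.ex x) (fun b c => S a c b x)]

lemma fr0_gradSq (hf : f ∈ smoothOn U) :
    L.fr0 (gradSq h f) = ∑ K, L.G.e K (L.fr0 f) * L.G.e K.rev (L.fr0 f) := by
  have h1 := congrFun (L.fr1_grad hf)
  simp only [← h1]
  refine Sm.ext_ev fun x => ?_
  rw [L.ev_fr0 (gradSq_mem hf), map_sum]
  simp only [map_mul, L.ev_fr1 (grad_mem hf), gradSq, up1, Finset.sum_apply, Pi.mul_apply,
    ginv_eq, contract_one]

lemma fr0_inner2 (hS : Smooth2 U S) (hT : Smooth2 U T) :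
    L.fr0 (inner2 h S T) = ∑ K, ∑ M, L.fr2 S K M * L.fr2 T K.rev M.rev := by
  refine Sm.ext_ev fun x => ?_
  rw [L.ev_fr0 (inner2_mem hS hT), map_sum]
  simp only [map_sum, map_mul, L.ev_fr2 hS, L.ev_fr2 hT, inner2, up2, Finset.sum_apply,
    Pi.mul_apply, ginv_eq, contract_two]

lemma fr0_DkSq (hk : Smooth2 U k) :
    L.fr0 (DkSq h k) = ∑ K, ∑ M, ∑ P, L.G.N2 (L.fr2 k) K M P *
      L.G.N2 (L.fr2 k) K.rev M.rev P.rev := by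
  rw [← L.fr3_D2 hk]
  refine Sm.ext_ev fun x => ?_
  rw [L.ev_fr0 (DkSq_mem hk), map_sum]
  simp only [map_sum, map_mul, L.ev_fr3 (D2_mem hk), DkSq, up3, Finset.sum_apply,
    Pi.mul_apply, ginv_eq, contract_three]

lemma fr2_prod2 (hS : Smooth2 U S) (hT : Smooth2 U T) (I J : Fin 3) :
    L.fr2 (prod2 h S T) I J = ∑ K, L.fr2 S I K * L.fr2 T J K.rev := by
  refine Sm.ext_ev fun x => ?_
  rw [L.ev_fr2 (prod2_mem hS hT), map_sum]
  simp only [map_mul, L.ev_fr2 hS, L.ev_fr2 hT, prod2, mixed, Finset.sum_apply, Pi.mul_apply,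
    ginv_eq, contract_one, t1_sum, t1_mul_left, t1_mul_right]

lemma fr2_DkDk (hk : Smooth2 U k) (I J : Fin 3) :
    L.fr2 (DkDk h k) I J = ∑ K, ∑ M, L.G.N2 (L.fr2 k) I K M * L.G.N2 (L.fr2 k) J K.rev M.rev := by
  rw [← L.fr3_D2 hk]
  refine Sm.ext_ev fun x => ?_
  rw [L.ev_fr2 (DkDk_mem hk), map_sum]
  simp only [map_sum, map_mul, L.ev_fr3 (D2_mem hk), DkDk, up2, Finset.sum_apply,
    Pi.mul_apply, ginv_eq, contract_two, t1_sum, t1_mul_left, t1_mul_right]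

lemma fr2_sigDk (hf : f ∈ smoothOn U) (hk : Smooth2 U k) (I J : Fin 3) :
    L.fr2 (sigDk h f k) I J = ∑ K, L.G.e K.rev (L.fr0 f) * L.G.N2 (L.fr2 k) K I J := by
  have h1 := congrFun (L.fr1_grad hf)
  simp only [← h1, ← L.fr3_D2 hk]
  refine Sm.ext_ev fun x => ?_
  rw [L.ev_fr2 (sigDk_mem hf hk), map_sum]
  have : ∀ a b, sigDk h f k a b x =
      ∑ c, D2 h k c a b x * ∑ c', frameInv (L.ex x) c c' * grad f c' x := fun a b => by
    simp only [sigDk, up1, Finset.sum_apply, Pi.mul_apply, ginv_eq, mul_comm]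
  simp only [this, map_mul, L.ev_fr1 (grad_mem hf), L.ev_fr3 (D2_mem hk),
    contract_one, t1_sum, t1_mul_right]
  refine Finset.sum_congr rfl fun K _ => ?_
  rw [mul_comm]
  simp only [fun a => t1_comm (L.ex x) (fun b c => D2 h k c a b x)]
  rw [t1_comm]

lemma fr2_sigDk' (hf : f ∈ smoothOn U) (hk : Smooth2 U k) (I J : Fin 3) :
    L.fr2 (fun a b => ∑ c, up1 h (grad f) c * D2 h k a b c) I J =
      ∑ K, L.G.e K.rev (L.fr0 f) * L.G.N2 (L.fr2 k) I J K := by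
  have h1 := congrFun (L.fr1_grad hf)
  simp only [← h1, ← L.fr3_D2 hk]
  refine Sm.ext_ev fun x => ?_
  rw [L.ev_fr2 (fun _ _ => sum_smooth fun _ => mul_mem (up1_mem (grad_mem hf) _)
    (D2_mem hk _ _ _)), map_sum]
  have : ∀ a b, (∑ c, up1 h (grad f) c * D2 h k a b c) x =
      ∑ c, D2 h k a b c x * ∑ c', frameInv (L.ex x) c c' * grad f c' x := fun a b => by
    simp only [up1, Finset.sum_apply, Pi.mul_apply, ginv_eq, mul_comm]
  simp only [this, map_mul, L.ev_fr1 (grad_mem hf), L.ev_fr3 (D2_mem hk),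
    contract_one, t1_sum, t1_mul_right]
  exact Finset.sum_congr rfl fun K _ => mul_comm _ _

lemma fr2_up2_mul {S : Fin 3 → Cov3} (hk : Smooth2 U k) (hS : ∀ d, Smooth3 U (S d))
    (I J : Fin 3) :
    L.fr2 (fun a b => ∑ c, ∑ d, up2 h k c d * S a b c d) I J =
      ∑ K, ∑ M, L.fr2 k K.rev M.rev * L.fr4 S I J K M := by
  refine Sm.ext_ev fun x => ?_
  rw [L.ev_fr2 (fun _ _ => sum_smooth fun _ => sum_smooth fun _ =>
    mul_mem (up2_mem hk _ _) (hS _ _ _ _)), map_sum]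
  have : ∀ a b, (∑ c, ∑ d, up2 h k c d * S a b c d) x = ∑ c, ∑ d, S a b c d x *
      ∑ c', ∑ d', frameInv (L.ex x) c c' * frameInv (L.ex x) d d' * k c' d' x := fun a b => by
    simp only [up2, Finset.sum_apply, Pi.mul_apply, ginv_eq, mul_comm]
  simp only [this, map_sum, map_mul, L.ev_fr2 hk, L.ev_fr4 hS,
    contract_two, t1_sum, t1_mul_right]
  exact Finset.sum_congr rfl fun K _ => Finset.sum_congr rfl fun M _ => mul_comm _ _

lemma fr2_mul_up2 {S S' : Cov3} (hS : Smooth3 U S) (hS' : Smooth3 U S') (I J : Fin 3) :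
    L.fr2 (fun a b => ∑ c, ∑ d, S a c d * up2 h (fun e f => S' b e f) c d) I J =
      ∑ K, ∑ M, L.fr3 S I K M * L.fr3 S' J K.rev M.rev := by
  refine Sm.ext_ev fun x => ?_
  rw [L.ev_fr2 (fun _ b => sum_smooth fun _ => sum_smooth fun _ =>
    mul_mem (hS _ _ _) (up2_mem (fun e f => hS' b e f) _ _)), map_sum]
  simp only [map_sum, map_mul, L.ev_fr3 hS, L.ev_fr3 hS', up2, Finset.sum_apply,
    Pi.mul_apply, ginv_eq, contract_two, t1_sum, t1_mul_left, t1_mul_right]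

lemma fr1_divTerm (hk : Smooth2 U k) (I : Fin 3) :
    L.fr1 (fun a => ∑ b, ∑ c, ∑ d, ginv h b d * D2 h k d a c * mixed h k b c) I =
      ∑ K, ∑ M, L.G.N2 (L.fr2 k) K I M * L.fr2 k K.rev M.rev := by
  rw [← L.fr3_D2 hk]
  have hg := ginv_mem (U := U) (h := h)
  refine Sm.ext_ev fun x => ?_
  rw [L.ev_fr1 (fun a => sum_smooth fun b => sum_smooth fun c => sum_smooth fun d =>
    mul_mem (mul_mem (hg _ _) (D2_mem hk _ _ _)) (mixed_mem hk _ _)), map_sum]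
  have : ∀ a, (∑ b, ∑ c, ∑ d, ginv h b d * D2 h k d a c * mixed h k b c) x = ∑ d, ∑ c, D2 h k d a c x *
      ∑ b, ∑ e, frameInv (L.ex x) d b * frameInv (L.ex x) c e * k b e x := fun a => by
    simp only [mixed, Finset.sum_apply, Pi.mul_apply, ginv_eq, Finset.mul_sum]
    rw [Finset.sum_congr rfl fun _ _ => Finset.sum_comm, Finset.sum_comm,
      Finset.sum_congr rfl fun _ _ => Finset.sum_comm]
    refine Finset.sum_congr rfl fun d _ => Finset.sum_congr rfl fun c _ => Finset.sum_congr rfl fun b _ =>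
      Finset.sum_congr rfl fun e _ => ?_
    rw [frameInv_comm _ b d]; ring
  simp only [this, map_sum, map_mul, L.ev_fr2 hk, L.ev_fr3 (D2_mem hk),
    contract_two, t1_sum, t1_mul_right]
  refine Finset.sum_congr rfl fun K _ => Finset.sum_congr rfl fun M _ => ?_
  rw [t1_comm]

/-- The first term of `Y`, before symmetrization. -/
def yOne (h k : Cov2) : Cov2 := fun a b => ∑ c, magB h k c a * mixed h (magB h k) b c

/-- The second term of `Y`, before symmetrization. -/
def yTwo (h k : Cov2) : Cov2 := fun a b => ∑ c, ∑ d, ∑ e, ∑ c', ∑ d', ∑ e',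
      eps h c d a * ginv h c c' * ginv h e e' * D2 h k c' b e' *
        (ginv h d d' * magB h k d' e)

/-- The third term of `Y`, before symmetrization. -/
def yThree (h k : Cov2) : Cov2 := fun a b => ∑ c, ∑ d, ∑ e, ∑ c',
      eps h c d a * (ginv h c c' * D2 h (magB h k) b c' e) * up2 h k d e

lemma Yten_eq (k : Cov2) : Yten h k = -(4 : ℝ) • symm (yOne h k) - (2 : ℝ) • symm (yTwo h k) -
    (2 : ℝ) • symm (yThree h k) := rfl

lemma yOne_mem (hk : Smooth2 U k) : Smooth2 U (yOne h k) := fun _ _ =>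
  sum_smooth fun _ => mul_mem (magB_mem hk _ _) (mixed_mem (magB_mem hk) _ _)

lemma yTwo_mem (hk : Smooth2 U k) : Smooth2 U (yTwo h k) := fun _ _ =>
  sum_smooth fun _ => sum_smooth fun _ => sum_smooth fun _ => sum_smooth fun _ =>
      sum_smooth fun _ => sum_smooth fun _ => mul_mem (mul_mem (mul_mem (mul_mem
        (eps_mem _ _ _) (ginv_mem _ _)) (ginv_mem _ _)) (D2_mem hk _ _ _))
        (mul_mem (ginv_mem _ _) (magB_mem hk _ _))

lemma yThree_mem (hk : Smooth2 U k) : Smooth2 U (yThree h k) := fun _ _ =>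
  sum_smooth fun _ => sum_smooth fun _ => sum_smooth fun _ => sum_smooth fun _ =>
      mul_mem (mul_mem (eps_mem _ _ _) (mul_mem (ginv_mem _ _)
        (D2_mem (magB_mem hk) _ _ _))) (up2_mem hk _ _)

lemma fr2_yOne (hk : Smooth2 U k) (I J : Fin 3) :
    L.fr2 (yOne h k) I J = ∑ K, L.fr2 (magB h k) K I * L.fr2 (magB h k) J K.rev := by
  refine Sm.ext_ev fun x => ?_
  rw [L.ev_fr2 (yOne_mem hk), map_sum]
  simp only [map_mul, L.ev_fr2 (magB_mem hk), yOne, mixed, Finset.sum_apply, Pi.mul_apply,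
    ginv_eq, contract_one, t1_sum, t1_mul_left, t1_mul_right]
  refine Finset.sum_congr rfl fun K _ => ?_
  rw [t1_comm]

lemma fr2_yTwo (hk : Smooth2 U k) (I J : Fin 3) :
    L.fr2 (yTwo h k) I J = ncross (fun K M => ∑ P, L.G.N2 (L.fr2 k) K J P *
      L.fr2 (magB h k) M P.rev) I := by
  rw [← L.fr3_D2 hk]
  refine Sm.ext_ev fun x => ?_
  have hd : Real.sqrt |(Matrix.of fun i j => h i j x).det| * (Matrix.of (L.ex x)).det = 1 := by
    rw [← L.det_eq x, AlgHom.map_det]; rfl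
  rw [L.ev_fr2 (yTwo_mem hk), t1_comm]
  have h1 : ∀ a b, yTwo h k a b x = ∑ c, ∑ d, ∑ c', ∑ d',
      Real.sqrt |(Matrix.of fun i j => h i j x).det| * leviSymbol a c' d' * frameInv (L.ex x) c' c *
      frameInv (L.ex x) d' d * ∑ e', D2 h k c b e' x * ∑ e, frameInv (L.ex x) e' e * magB h k d e x := by
    intro a b
    simp only [yTwo, Finset.sum_apply, Pi.mul_apply, ginv_eq, eps, Finset.mul_sum]
    have hs : ∀ X : Fin 3 → Fin 3 → Fin 3 → Fin 3 → Fin 3 → Fin 3 → ℝ,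
        ∑ c', ∑ d', ∑ e, ∑ c, ∑ d, ∑ e', X c' d' e c d e' =
        ∑ c, ∑ d, ∑ c', ∑ d', ∑ e', ∑ e, X c' d' e c d e' := by
      intro X
      have := Fintype.sum_equiv (⟨fun p => (p.2.2.2.1, p.2.2.2.2.1, p.1, p.2.1, p.2.2.2.2.2, p.2.2.1), fun q => (q.2.2.1, q.2.2.2.1, q.2.2.2.2.2, q.1, q.2.1, q.2.2.2.2.1), fun _ => rfl, fun _ => rfl⟩ :
        (Fin 3 × Fin 3 × Fin 3 × Fin 3 × Fin 3 × Fin 3) ≃ _)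
        (fun p => X p.1 p.2.1 p.2.2.1 p.2.2.2.1 p.2.2.2.2.1 p.2.2.2.2.2)
        (fun q => X q.2.2.1 q.2.2.2.1 q.2.2.2.2.2 q.1 q.2.1 q.2.2.2.2.1) fun _ => rfl
      simpa only [Fintype.sum_prod_type] using this
    rw [hs]
    refine Finset.sum_congr rfl fun c _ => Finset.sum_congr rfl fun d _ => Finset.sum_congr rfl
      fun c' _ => Finset.sum_congr rfl fun d' _ => Finset.sum_congr rfl fun e' _ =>
      Finset.sum_congr rfl fun e _ => ?_
    rw [frameInv_comm _ e e', show leviSymbol a c' d' = leviSymbol c' d' a by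
      unfold leviSymbol; ring]
    ring
  simp only [h1, contract_one, eps_contract _ hd, t1_sum, t1_mul_left, t1_mul_right, ncross,
    t1_sub', map_sub, map_sum, map_mul, L.ev_fr3 (D2_mem hk), L.ev_fr2 (magB_mem hk)]
  have h2 : ∀ A B, t1 (L.ex x) (fun b => t1 (L.ex x) (fun c => t1 (L.ex x) (fun d => D2 h k c b d x) A) B) J =
      t1 (L.ex x) (fun c => t1 (L.ex x) (fun b => t1 (L.ex x) (fun d => D2 h k c b d x) A) J) B :=
    fun _ _ => t1_comm _ _ _ _
  simp only [h2]

lemma fr2_yThree (hk : Smooth2 U k) (I J : Fin 3) :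
    L.fr2 (yThree h k) I J = ncross (fun K M => ∑ P, L.G.N2 (L.fr2 (magB h k)) J K P *
      L.fr2 k M P.rev) I := by
  have hB := magB_mem hk
  rw [← L.fr3_D2 hB]
  refine Sm.ext_ev fun x => ?_
  have hd : Real.sqrt |(Matrix.of fun i j => h i j x).det| * (Matrix.of (L.ex x)).det = 1 := by
    rw [← L.det_eq x, AlgHom.map_det]; rfl
  rw [L.ev_fr2 (yThree_mem hk), t1_comm]
  have h1 : ∀ a b, yThree h k a b x = ∑ c, ∑ d, ∑ c', ∑ d',
      Real.sqrt |(Matrix.of fun i j => h i j x).det| * leviSymbol a c' d' * frameInv (L.ex x) c' c *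
      frameInv (L.ex x) d' d * ∑ e, D2 h (magB h k) b c e x * ∑ e', frameInv (L.ex x) e e' * k d e' x := by
    intro a b
    simp only [yThree, up2, Finset.sum_apply, Pi.mul_apply, ginv_eq, eps, Finset.mul_sum]
    have hs : ∀ X : Fin 3 → Fin 3 → Fin 3 → Fin 3 → Fin 3 → Fin 3 → ℝ,
        ∑ c', ∑ d', ∑ e, ∑ c, ∑ d, ∑ e', X c' d' e c d e' =
        ∑ c, ∑ d, ∑ c', ∑ d', ∑ e, ∑ e', X c' d' e c d e' := by
      intro X
      have := Fintype.sum_equiv (⟨fun p => (p.2.2.2.1, p.2.2.2.2.1, p.1, p.2.1, p.2.2.1, p.2.2.2.2.2), fun q => (q.2.2.1, q.2.2.2.1, q.2.2.2.2.1, q.1, q.2.1, q.2.2.2.2.2), fun _ => rfl, fun _ => rfl⟩ :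
        (Fin 3 × Fin 3 × Fin 3 × Fin 3 × Fin 3 × Fin 3) ≃ _)
        (fun p => X p.1 p.2.1 p.2.2.1 p.2.2.2.1 p.2.2.2.2.1 p.2.2.2.2.2)
        (fun q => X q.2.2.1 q.2.2.2.1 q.2.2.2.2.1 q.1 q.2.1 q.2.2.2.2.2) fun _ => rfl
      simpa only [Fintype.sum_prod_type] using this
    rw [hs]
    refine Finset.sum_congr rfl fun c _ => Finset.sum_congr rfl fun d _ => Finset.sum_congr rfl
      fun c' _ => Finset.sum_congr rfl fun d' _ => Finset.sum_congr rfl fun e' _ =>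
      Finset.sum_congr rfl fun e _ => ?_
    rw [show leviSymbol a c' d' = leviSymbol c' d' a by unfold leviSymbol; ring]
    ring
  simp only [h1, contract_one, eps_contract _ hd, t1_sum, t1_mul_left, t1_mul_right, ncross,
    t1_sub', map_sub, map_sum, map_mul, L.ev_fr3 (D2_mem hB), L.ev_fr2 hk]

end LocalFrame

/-! ### Jets at a point in a frame that is parallel there -/

namespace LocalFrame

variable (L : LocalFrame U h x₀)

lemma ev0_om (K I J : Fin 3) : L.ev0 (L.G.om K I J) = 0 := L.om_eq K I J

lemma ev0_N1 (v : Fin 3 → Sm L.V) (K I : Fin 3) : L.ev0 (L.G.N1 v K I) = L.ev0 (L.G.e K (v I)) := by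
  simp [Framed.N1, ev0_om]

lemma ev0_N2 (T : Fin 3 → Fin 3 → Sm L.V) (K I J : Fin 3) :
    L.ev0 (L.G.N2 T K I J) = L.ev0 (L.G.e K (T I J)) := by
  simp [Framed.N2, ev0_om]

lemma ev0_N3 (S : Fin 3 → Fin 3 → Fin 3 → Sm L.V) (P K I J : Fin 3) :
    L.ev0 (L.G.N3 S P K I J) = L.ev0 (L.G.e P (S K I J)) := by
  simp [Framed.N3, ev0_om]

lemma ev0_null (I J : Fin 3) : L.ev0 (nullMetric (Sm L.V) I J) = nullMetric ℝ I J := by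
  unfold nullMetric; split_ifs <;> simp

lemma e_null (K I J : Fin 3) : L.G.e K (nullMetric (Sm L.V) I J) = 0 := by
  unfold nullMetric; split_ifs
  · exact Derivation.map_one_eq_zero _
  · exact map_zero _

/-- The value of a tensor. -/
def j0 (T : Cov2) (I J : Fin 3) : ℝ := L.ev0 (L.fr2 T I J)
/-- The first covariant derivative of a tensor. -/
def j1 (T : Cov2) (K I J : Fin 3) : ℝ := L.ev0 (L.G.N2 (L.fr2 T) K I J)
/-- The second covariant derivative of a tensor. -/
def j2 (T : Cov2) (P K I J : Fin 3) : ℝ := L.ev0 (L.G.N3 (L.G.N2 (L.fr2 T)) P K I J)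
/-- The value of a scalar. -/
def s0 (f : Fld 3) : ℝ := L.ev0 (L.fr0 f)
/-- The gradient of a scalar. -/
def s1 (f : Fld 3) (I : Fin 3) : ℝ := L.ev0 (L.G.e I (L.fr0 f))
/-- The frame components of the Hessian of a scalar. -/
def frH (f : Fld 3) : Fin 3 → Fin 3 → Sm L.V := L.G.N1 fun I => L.G.e I (L.fr0 f)
/-- The second covariant derivative of a scalar. -/
def s2 (f : Fld 3) (K I : Fin 3) : ℝ := L.ev0 (L.frH f K I)
/-- The third covariant derivative of a scalar. -/
def s3 (f : Fld 3) (P K I : Fin 3) : ℝ := L.ev0 (L.G.N2 (L.frH f) P K I)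

lemma ev0_e_fr2 (T : Cov2) (K I J : Fin 3) : L.ev0 (L.G.e K (L.fr2 T I J)) = L.j1 T K I J :=
  (L.ev0_N2 _ _ _ _).symm

lemma ev0_e_N2 (T : Cov2) (P K I J : Fin 3) :
    L.ev0 (L.G.e P (L.G.N2 (L.fr2 T) K I J)) = L.j2 T P K I J :=
  (L.ev0_N3 (L.G.N2 (L.fr2 T)) P K I J).symm

lemma ev0_e_e (f : Fld 3) (K I : Fin 3) : L.ev0 (L.G.e K (L.G.e I (L.fr0 f))) = L.s2 f K I :=
  (L.ev0_N1 (fun I => L.G.e I (L.fr0 f)) K I).symm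

lemma ev0_e_frH (f : Fld 3) (P K I : Fin 3) : L.ev0 (L.G.e P (L.frH f K I)) = L.s3 f P K I :=
  (L.ev0_N2 (L.frH f) P K I).symm

lemma frH_symm (f : Fld 3) (K I : Fin 3) : L.frH f K I = L.frH f I K :=
  L.G.N_comm_scalar _ K I

lemma s2_symm (f : Fld 3) (K I : Fin 3) : L.s2 f K I = L.s2 f I K := by
  rw [s2, s2, frH_symm]

lemma s3_symm (f : Fld 3) (P K I : Fin 3) : L.s3 f P K I = L.s3 f P I K := by
  rw [← ev0_e_frH, frH_symm, ev0_e_frH]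

variable [Patch U h]

lemma s3_comm (hf : f ∈ smoothOn U) (P K I : Fin 3) : L.s3 f P K I - L.s3 f K P I =
    nullMetric ℝ P I * L.s1 f K - nullMetric ℝ K I * L.s1 f P := by
  have h1 := L.G.N_comm_one (fun a => L.fr0 (grad f a)) P K I
  have h2 := L.fr1_grad hf
  rw [fr1] at h2
  rw [h2] at h1
  have := congrArg L.ev0 h1
  simp only [map_sub, map_mul, ev0_null] at this
  exact this

lemma j2_comm (T : Cov2) (P K I J : Fin 3) : L.j2 T P K I J - L.j2 T K P I J =
    nullMetric ℝ P I * L.j0 T K J - nullMetric ℝ K I * L.j0 T P J +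
      (nullMetric ℝ P J * L.j0 T I K - nullMetric ℝ K J * L.j0 T I P) := by
  have := congrArg L.ev0 (L.G.N_comm_two (fun a b => L.fr0 (T a b)) P K I J)
  simp only [map_sub, map_add, map_mul, ev0_null] at this
  exact this

lemma fr2_congr (hS : Smooth2 U S) (hT : Smooth2 U T) (hST : AgreeOn U S T) :
    L.fr2 S = L.fr2 T := by
  rw [fr2, fr2]; congr 1; funext a b; exact L.fr0_congr (hS a b) (hT a b) (hST a b)

lemma fr1_congr {v w : Cov1} (hv : Smooth1 U v) (hw : Smooth1 U w) (hvw : ∀ a, EqOn (v a) (w a) U) :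
    L.fr1 v = L.fr1 w := by
  rw [fr1, fr1]; congr 1; funext a; exact L.fr0_congr (hv a) (hw a) (hvw a)

lemma fr2_swap (hT : Smooth2 U T) (I J : Fin 3) :
    L.fr2 (fun a b => T b a) I J = L.fr2 T J I := by
  refine Sm.ext_ev fun x => ?_
  rw [L.ev_fr2 hT, L.ev_fr2 (fun a b => hT b a), t1_comm]

lemma fr2_symmetric (hT : IsSymTensor U T) (I J : Fin 3) : L.fr2 T I J = L.fr2 T J I := by
  rw [← L.fr2_swap hT.1 I J]
  exact congrFun (congrFun (L.fr2_congr hT.1 (fun a b => hT.1 b a) hT.2) I) J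

lemma j0_symm (hT : IsSymTensor U T) (I J : Fin 3) : L.j0 T I J = L.j0 T J I := by
  rw [j0, L.fr2_symmetric hT, j0]

lemma N2_symm (hT : IsSymTensor U T) (K I J : Fin 3) :
    L.G.N2 (L.fr2 T) K I J = L.G.N2 (L.fr2 T) K J I := by
  rw [Framed.N2, Framed.N2, L.fr2_symmetric hT I J]
  congr 1
  refine Finset.sum_congr rfl fun A _ => ?_
  rw [L.fr2_symmetric hT A J, L.fr2_symmetric hT I A, add_comm]

lemma j1_symm (hT : IsSymTensor U T) (K I J : Fin 3) : L.j1 T K I J = L.j1 T K J I := by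
  rw [j1, L.N2_symm hT, j1]

lemma j2_symm (hT : IsSymTensor U T) (P K I J : Fin 3) :
    L.j2 T P K I J = L.j2 T P K J I := by
  rw [← ev0_e_N2, L.N2_symm hT, ev0_e_N2]

/-! #### Recovering coordinate components -/

lemma eq_of_t1 {v w : Fin 3 → ℝ} (hvw : ∀ I, t1 (L.ex L.pt) v I = t1 (L.ex L.pt) w I) : v = w := by
  have key : ∀ u : Fin 3 → ℝ, ∀ a, ∑ I, L.ev0 (L.G.F I a) * t1 (L.ex L.pt) u I = u a := by
    intro u a
    have h1 : ∀ b, ∑ I, L.ev0 (L.G.F I a) * L.ex L.pt b I = if b = a then 1 else 0 := by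
      intro b
      have := congrArg L.ev0 (L.G.EF b a)
      rw [map_sum] at this
      simp only [map_mul] at this
      rw [show (if b = a then (1 : ℝ) else 0) = L.ev0 (if b = a then 1 else 0) by split_ifs <;> simp,
        ← this]
      exact Finset.sum_congr rfl fun I _ => mul_comm _ _
    simp only [t1, Finset.mul_sum]
    rw [Finset.sum_comm]
    simp only [← mul_assoc, ← Finset.sum_mul, h1]
    simp
  funext a
  rw [← key v a, ← key w a]
  simp only [hvw]

lemma eq_of_j0 (hS : Smooth2 U S) (hT : Smooth2 U T)
    (hST : ∀ I J, L.j0 S I J = L.j0 T I J) (a b : Fin 3) : S a b x₀ = T a b x₀ := by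
  have h1 : ∀ I J, t1 (L.ex L.pt) (fun a => t1 (L.ex L.pt) (fun b => S a b x₀) J) I =
      t1 (L.ex L.pt) (fun a => t1 (L.ex L.pt) (fun b => T a b x₀) J) I := fun I J => by
    have := hST I J
    simp only [j0, ev0] at this
    rw [L.ev_fr2 hS, L.ev_fr2 hT] at this
    exact this
  have h2 : ∀ J, (fun a => t1 (L.ex L.pt) (fun b => S a b x₀) J) = fun a =>
      t1 (L.ex L.pt) (fun b => T a b x₀) J := fun J => L.eq_of_t1 fun I => h1 I J
  exact congrFun (L.eq_of_t1 fun J => congrFun (h2 J) a) b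

lemma eq_of_fr1 {v w : Cov1} (hv : Smooth1 U v) (hw : Smooth1 U w)
    (hvw : ∀ I, L.ev0 (L.fr1 v I) = L.ev0 (L.fr1 w I)) (a : Fin 3) : v a x₀ = w a x₀ := by
  have h1 : ∀ I, t1 (L.ex L.pt) (fun a => v a x₀) I = t1 (L.ex L.pt) (fun a => w a x₀) I := fun I => by
    have := hvw I
    simp only [ev0] at this
    rw [L.ev_fr1 hv, L.ev_fr1 hw] at this
    exact this
  exact congrFun (L.eq_of_t1 h1) a

/-! #### Jets of derived tensors -/

lemma s0_eq (hf : f ∈ smoothOn U) : L.s0 f = f x₀ := L.ev_fr0 hf L.pt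

lemma j0_curl (hT : Smooth2 U T) (I J : Fin 3) :
    L.j0 (curl h T) I J = ncross (fun A B => L.j1 T A B J) I := by
  rw [j0, L.fr2_curl hT]; simp only [ncross, map_sub]; rfl

lemma j1_curl (hT : Smooth2 U T) (K I J : Fin 3) :
    L.j1 (curl h T) K I J = ncross (fun A B => L.j2 T K A B J) I := by
  rw [← ev0_e_fr2, L.fr2_curl hT]; simp only [ncross, map_sub, ev0_e_N2]

lemma j0_box (hT : Smooth2 U T) (I J : Fin 3) :
    L.j0 (boxT h T) I J = ∑ K, L.j2 T K K.rev I J := by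
  rw [j0, L.fr2_box hT, map_sum]; rfl

lemma s0_tr (hT : Smooth2 U T) : L.s0 (tr h T) = ∑ I, L.j0 T I I.rev := by
  rw [s0, L.fr0_tr hT, map_sum]; rfl

lemma s1_tr (hT : Smooth2 U T) (K : Fin 3) :
    L.s1 (tr h T) K = ∑ I, L.j1 T K I I.rev := by
  rw [s1, L.fr0_tr hT, map_sum, map_sum]; simp only [ev0_e_fr2]

lemma ev0_dvg (hT : Smooth2 U T) (I : Fin 3) :
    L.ev0 (L.fr1 (dvg h T) I) = ∑ K, L.j1 T K I K.rev := by
  rw [L.fr1_dvg hT, map_sum]; rfl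

lemma j0_D1_dvg (hT : Smooth2 U T) (K I : Fin 3) :
    L.j0 (D1 h (dvg h T)) K I = ∑ M, L.j2 T K M I M.rev := by
  rw [j0, L.fr2_D1 (dvg_mem hT), ev0_N1, L.fr1_dvg hT, map_sum, map_sum]
  simp only [ev0_e_N2]

lemma fr2_hess (hf : f ∈ smoothOn U) :
    L.fr2 (hess h f) = L.frH f := by
  rw [hess, L.fr2_D1 (grad_mem hf), L.fr1_grad hf]; rfl

lemma j0_hess (hf : f ∈ smoothOn U) (K I : Fin 3) :
    L.j0 (hess h f) K I = L.s2 f K I := by rw [j0, L.fr2_hess hf]; rfl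

lemma j1_hess (hf : f ∈ smoothOn U) (P K I : Fin 3) :
    L.j1 (hess h f) P K I = L.s3 f P K I := by rw [j1, L.fr2_hess hf]; rfl

lemma j0_scalar_h (hf : f ∈ smoothOn U) (I J : Fin 3) :
    L.j0 (fun a b => f * h a b) I J = L.s0 f * nullMetric ℝ I J := by
  rw [j0, L.fr2_scalar hf h_mem, L.fr2_h, map_mul, ev0_null]; rfl

lemma j1_scalar_h (hf : f ∈ smoothOn U) (K I J : Fin 3) :
    L.j1 (fun a b => f * h a b) K I J = L.s1 f K * nullMetric ℝ I J := by
  rw [← ev0_e_fr2, L.fr2_scalar hf h_mem, L.fr2_h]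
  simp [Derivation.leibniz, e_null, ev0_null, s1, mul_comm]

end LocalFrame

/-! ### Linear identities for the curl -/

lemma null_values {R : Type*} [CommRing R] :
    nullMetric R 0 0 = 0 ∧ nullMetric R 0 1 = 0 ∧ nullMetric R 0 2 = 1 ∧ nullMetric R 1 0 = 0 ∧
    nullMetric R 1 1 = 1 ∧ nullMetric R 1 2 = 0 ∧ nullMetric R 2 0 = 1 ∧ nullMetric R 2 1 = 0 ∧
    nullMetric R 2 2 = 0 := ⟨rfl, rfl, rfl, rfl, rfl, rfl, rfl, rfl, rfl⟩

section JetAlgebra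

variable {t : Fin 3 → Fin 3 → ℝ} {dt : Fin 3 → Fin 3 → Fin 3 → ℝ}
  {ddt : Fin 3 → Fin 3 → Fin 3 → Fin 3 → ℝ}

lemma jet_curl_curl (ht : ∀ I J, t I J = t J I) (hd : ∀ P K I J, ddt P K I J = ddt P K J I)
    (hc : ∀ P K I J, ddt P K I J - ddt K P I J =
      nullMetric ℝ P I * t K J - nullMetric ℝ K I * t P J +
      (nullMetric ℝ P J * t I K - nullMetric ℝ K J * t I P)) (I J : Fin 3) :
    ncross (fun A B => ncross (fun C D => ddt A C D J) B) I =
      ∑ K, ddt K K.rev I J - 3 * t I J + (∑ K, t K K.rev) * nullMetric ℝ I J -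
        ∑ M, ddt I M J M.rev := by
  have cw := fun I J => fin3_comm fun A B => hc A B I J
  have dw := fun P K => fin3_symm (hd P K)
  induction I using fin3_cases <;> induction J using fin3_cases <;>
    simp only [ncross_values, Fin.sum_univ_three, rev3, cw, dw, fin3_symm ht, null_values] <;> ring

lemma jet_tr_curl (hd : ∀ K I J, dt K I J = dt K J I) :
    ∑ I, ncross (fun A B => dt A B I.rev) I = 0 := by
  have dw := fun K => fin3_symm (hd K)
  simp only [ncross_values, Fin.sum_univ_three, rev3, dw]
  ring

lemma jet_curl_symm_iff (hd : ∀ K I J, dt K I J = dt K J I) :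
    (∀ I J, ncross (fun A B => dt A B J) I = ncross (fun A B => dt A B I) J) ↔
      ∀ I, ∑ K, dt K I K.rev = ∑ K, dt I K K.rev := by
  have dw := fun K => fin3_symm (hd K)
  constructor
  · intro H I
    have h1 := H 0 1
    have h2 := H 0 2
    have h3 := H 1 2
    induction I using fin3_cases <;>
    simp only [ncross_values, Fin.sum_univ_three, rev3, dw] at h1 h2 h3 ⊢ <;> linarith
  · intro H I J
    have h1 := H 0
    have h2 := H 1
    have h3 := H 2
    induction I using fin3_cases <;> induction J using fin3_cases <;>
    simp only [ncross_values, Fin.sum_univ_three, rev3, dw] at h1 h2 h3 ⊢ <;> linarith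

lemma jet_div_curl (ht : ∀ I J, t I J = t J I) (hd : ∀ P K I J, ddt P K I J = ddt P K J I)
    (hc : ∀ P K I J, ddt P K I J - ddt K P I J =
      nullMetric ℝ P I * t K J - nullMetric ℝ K I * t P J +
      (nullMetric ℝ P J * t I K - nullMetric ℝ K J * t I P)) (J : Fin 3) :
    ∑ K, ncross (fun A B => ddt K A B J) K.rev = 0 := by
  have cw := fun I J => fin3_comm fun A B => hc A B I J
  have dw := fun P K => fin3_symm (hd P K)
  induction J using fin3_cases <;>
    simp only [ncross_values, Fin.sum_univ_three, rev3, cw, dw, fin3_symm ht, null_values] <;> ring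

end JetAlgebra

section Agree

lemma AgreeOn.symm (hST : AgreeOn U S T) : AgreeOn U T S := fun a b => (hST a b).symm

lemma AgreeOn.trans {R : Cov2} (h1 : AgreeOn U S T) (h2 : AgreeOn U T R) : AgreeOn U S R :=
  fun a b => (h1 a b).trans (h2 a b)

lemma AgreeOn.refl (S : Cov2) : AgreeOn U S S := fun _ _ _ _ => rfl

lemma AgreeOn.add {S' T' : Cov2} (h1 : AgreeOn U S T) (h2 : AgreeOn U S' T') :
    AgreeOn U (S + S') (T + T') := fun a b _ hx => congrArg₂ (· + ·) (h1 a b hx) (h2 a b hx)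

lemma AgreeOn.sub {S' T' : Cov2} (h1 : AgreeOn U S T) (h2 : AgreeOn U S' T') :
    AgreeOn U (S - S') (T - T') := fun a b _ hx => congrArg₂ (· - ·) (h1 a b hx) (h2 a b hx)

lemma AgreeOn.smul (c : ℝ) (h1 : AgreeOn U S T) :
    AgreeOn U (c • S) (c • T) := fun a b _ hx => congrArg (c * ·) (h1 a b hx)

lemma AgreeOn.neg (h1 : AgreeOn U S T) :
    AgreeOn U (-S) (-T) := fun a b _ hx => congrArg (-·) (h1 a b hx)

variable [Patch U h]

lemma agreeOn_of_frames (hS : Smooth2 U S) (hT : Smooth2 U T)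
    (H : ∀ x₀, ∀ L : LocalFrame U h x₀, ∀ I J, L.j0 S I J = L.j0 T I J) : AgreeOn U S T := by
  intro a b x hx
  obtain ⟨L⟩ := exists_localFrame hx
  exact L.eq_of_j0 hS hT (H x L) a b

lemma eqOn_of_frames {v w : Cov1} (hv : Smooth1 U v) (hw : Smooth1 U w)
    (H : ∀ x₀, ∀ L : LocalFrame U h x₀, ∀ I, L.ev0 (L.fr1 v I) = L.ev0 (L.fr1 w I)) (a : Fin 3) :
    EqOn (v a) (w a) U := by
  intro x hx
  obtain ⟨L⟩ := exists_localFrame hx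
  exact L.eq_of_fr1 hv hw (H x L) a

lemma eqOn_of_frames₀ (hf : f ∈ smoothOn U) (hg : g ∈ smoothOn U)
    (H : ∀ x₀, ∀ L : LocalFrame U h x₀, L.s0 f = L.s0 g) : EqOn f g U := by
  intro x hx
  obtain ⟨L⟩ := exists_localFrame hx
  rw [← L.s0_eq hf, ← L.s0_eq hg, H x L]

end Agree

namespace LocalFrame

variable (L : LocalFrame U h x₀)
lemma N2_add (S T : Fin 3 → Fin 3 → Sm L.V) : L.G.N2 (S + T) = L.G.N2 S + L.G.N2 T := by
  funext K I J
  simp only [Framed.N2, Pi.add_apply, map_add, mul_add, Finset.sum_add_distrib]; ring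

lemma N2_smul (c : ℝ) (T : Fin 3 → Fin 3 → Sm L.V) : L.G.N2 (c • T) = c • L.G.N2 T := by
  funext K I J
  simp only [Framed.N2, Pi.smul_apply, Derivation.map_smul, mul_smul_comm, smul_sub, Finset.smul_sum, smul_add]

lemma j0_add (hS : Smooth2 U S) (hT : Smooth2 U T) (I J : Fin 3) :
    L.j0 (S + T) I J = L.j0 S I J + L.j0 T I J := by
  rw [j0, L.fr2_add hS hT]; exact map_add _ _ _

lemma j0_smul (c : ℝ) (hT : Smooth2 U T) (I J : Fin 3) : L.j0 (c • T) I J = c * L.j0 T I J := by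
  rw [j0, L.fr2_smul c hT]; exact map_smul L.ev0 c _

lemma j0_sub (hS : Smooth2 U S) (hT : Smooth2 U T) (I J : Fin 3) :
    L.j0 (S - T) I J = L.j0 S I J - L.j0 T I J := by
  rw [j0, L.fr2_sub hS hT]; exact map_sub _ _ _

lemma j0_neg (hT : Smooth2 U T) (I J : Fin 3) : L.j0 (-T) I J = -L.j0 T I J := by
  rw [j0, L.fr2_neg hT]; exact map_neg _ _

lemma j1_add (hS : Smooth2 U S) (hT : Smooth2 U T) (K I J : Fin 3) :
    L.j1 (S + T) K I J = L.j1 S K I J + L.j1 T K I J := by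
  rw [j1, L.fr2_add hS hT, L.N2_add]; exact map_add _ _ _

lemma j1_smul (c : ℝ) (hT : Smooth2 U T) (K I J : Fin 3) :
    L.j1 (c • T) K I J = c * L.j1 T K I J := by
  rw [j1, L.fr2_smul c hT, L.N2_smul]; exact map_smul L.ev0 c _

lemma j1_sub (hS : Smooth2 U S) (hT : Smooth2 U T) (K I J : Fin 3) :
    L.j1 (S - T) K I J = L.j1 S K I J - L.j1 T K I J := by
  have h1 : S - T = S + (-1 : ℝ) • T := by rw [neg_one_smul, sub_eq_add_neg]
  rw [h1, L.j1_add hS (hT.smul _), L.j1_smul _ hT]; ring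

lemma j2_add (hS : Smooth2 U S) (hT : Smooth2 U T) (P K I J : Fin 3) :
    L.j2 (S + T) P K I J = L.j2 S P K I J + L.j2 T P K I J := by
  rw [← ev0_e_N2, L.fr2_add hS hT, L.N2_add]
  simp only [Pi.add_apply, map_add, ev0_e_N2]

lemma j2_smul (c : ℝ) (hT : Smooth2 U T) (P K I J : Fin 3) :
    L.j2 (c • T) P K I J = c * L.j2 T P K I J := by
  rw [← ev0_e_N2, L.fr2_smul c hT, L.N2_smul]
  simp only [Pi.smul_apply, Derivation.map_smul, map_smul, ev0_e_N2, smul_eq_mul]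

end LocalFrame

section Curl

variable [Patch U h]

lemma curl_congr (hS : Smooth2 U S) (hT : Smooth2 U T) (hST : AgreeOn U S T) :
    AgreeOn U (curl h S) (curl h T) :=
  agreeOn_of_frames (curl_mem hS) (curl_mem hT) fun _ L I J => by
    rw [L.j0_curl hS, L.j0_curl hT]
    unfold LocalFrame.j1; rw [L.fr2_congr hS hT hST]

lemma boxT_congr (hS : Smooth2 U S) (hT : Smooth2 U T) (hST : AgreeOn U S T) :
    AgreeOn U (boxT h S) (boxT h T) :=
  agreeOn_of_frames (boxT_mem hS) (boxT_mem hT) fun _ L I J => by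
    rw [L.j0_box hS, L.j0_box hT]
    unfold LocalFrame.j2; rw [L.fr2_congr hS hT hST]

lemma dvg_congr (hS : Smooth2 U S) (hT : Smooth2 U T) (hST : AgreeOn U S T) (a : Fin 3) :
    EqOn (dvg h S a) (dvg h T a) U :=
  eqOn_of_frames (dvg_mem hS) (dvg_mem hT) (fun _ L I => by
    rw [L.ev0_dvg hS, L.ev0_dvg hT]
    unfold LocalFrame.j1; rw [L.fr2_congr hS hT hST]) a

lemma tr_congr (hST : AgreeOn U S T) : EqOn (tr h S) (tr h T) U := fun x hx => by
  simp only [tr, Finset.sum_apply, Pi.mul_apply, hST _ _ hx]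

lemma curl_add (hS : Smooth2 U S) (hT : Smooth2 U T) :
    AgreeOn U (curl h (S + T)) (curl h S + curl h T) :=
  agreeOn_of_frames (curl_mem (hS.add hT))
    ((curl_mem hS).add (curl_mem hT)) fun _ L I J => by
    rw [L.j0_add (curl_mem hS) (curl_mem hT), L.j0_curl hS, L.j0_curl hT,
      L.j0_curl (hS.add hT)]
    simp only [ncross, L.j1_add hS hT]; ring

lemma curl_smul (c : ℝ) (hT : Smooth2 U T) : AgreeOn U (curl h (c • T)) (c • curl h T) :=
  agreeOn_of_frames (curl_mem (hT.smul c)) ((curl_mem hT).smul c) fun _ L I J => by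
    rw [L.j0_smul c (curl_mem hT), L.j0_curl hT, L.j0_curl (hT.smul c)]
    simp only [ncross, L.j1_smul c hT]; ring

lemma curl_neg (hT : Smooth2 U T) : AgreeOn U (curl h (-T)) (-curl h T) := by
  have := curl_smul (-1) hT
  rwa [neg_one_smul, neg_one_smul] at this

lemma curl_sub (hS : Smooth2 U S) (hT : Smooth2 U T) :
    AgreeOn U (curl h (S - T)) (curl h S - curl h T) := by
  rw [sub_eq_add_neg, sub_eq_add_neg]
  exact (curl_add hS hT.neg).trans ((AgreeOn.refl _).add (curl_neg hT))

lemma boxT_add (hS : Smooth2 U S) (hT : Smooth2 U T) :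
    AgreeOn U (boxT h (S + T)) (boxT h S + boxT h T) :=
  agreeOn_of_frames (boxT_mem (hS.add hT))
    ((boxT_mem hS).add (boxT_mem hT)) fun _ L I J => by
    rw [L.j0_add (boxT_mem hS) (boxT_mem hT), L.j0_box hS, L.j0_box hT,
      L.j0_box (hS.add hT)]
    simp only [L.j2_add hS hT, Finset.sum_add_distrib]

lemma boxT_smul (c : ℝ) (hT : Smooth2 U T) : AgreeOn U (boxT h (c • T)) (c • boxT h T) :=
  agreeOn_of_frames (boxT_mem (hT.smul c)) ((boxT_mem hT).smul c) fun _ L I J => by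
    rw [L.j0_smul c (boxT_mem hT), L.j0_box hT, L.j0_box (hT.smul c)]
    simp only [L.j2_smul c hT, Finset.mul_sum]

lemma dvg_add (hS : Smooth2 U S) (hT : Smooth2 U T) (a : Fin 3) :
    EqOn (dvg h (S + T) a) (dvg h S a + dvg h T a) U := by
  intro x hx
  obtain ⟨L⟩ := exists_localFrame hx
  have hm : Smooth1 U (dvg h S + dvg h T) := fun a =>
    add_mem (dvg_mem hS a) (dvg_mem hT a)
  refine L.eq_of_fr1 (w := dvg h S + dvg h T) (dvg_mem (hS.add hT)) hm (fun I => ?_) a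
  have : L.ev0 (L.fr1 (dvg h S + dvg h T) I) = L.ev0 (L.fr1 (dvg h S) I) + L.ev0 (L.fr1 (dvg h T) I) := by
    simp only [LocalFrame.ev0]
    rw [L.ev_fr1 hm, L.ev_fr1 (dvg_mem hS), L.ev_fr1 (dvg_mem hT)]
    simp [t1, mul_add, Finset.sum_add_distrib]
  rw [this, L.ev0_dvg hS, L.ev0_dvg hT, L.ev0_dvg (hS.add hT)]
  simp only [L.j1_add hS hT, Finset.sum_add_distrib]

lemma dvg_smul (c : ℝ) (hT : Smooth2 U T) (a : Fin 3) :
    EqOn (dvg h (c • T) a) (c • dvg h T a) U := by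
  intro x hx
  obtain ⟨L⟩ := exists_localFrame hx
  have hm : Smooth1 U (c • dvg h T) := fun a => smul_smooth c (dvg_mem hT a)
  refine L.eq_of_fr1 (w := c • dvg h T) (dvg_mem (hT.smul c)) hm (fun I => ?_) a
  have : L.ev0 (L.fr1 (c • dvg h T) I) = c * L.ev0 (L.fr1 (dvg h T) I) := by
    simp only [LocalFrame.ev0]
    rw [L.ev_fr1 hm, L.ev_fr1 (dvg_mem hT)]
    simp only [Pi.smul_apply, smul_eq_mul, t1_mul_left]
  rw [this, L.ev0_dvg hT, L.ev0_dvg (hT.smul c)]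
  simp only [L.j1_smul c hT, Finset.mul_sum]

lemma tr_add : tr h (S + T) = tr h S + tr h T := by
  simp only [tr, Pi.add_apply, mul_add, Finset.sum_add_distrib]

lemma tr_smul (c : ℝ) : tr h (c • T) = c • tr h T := by
  simp only [tr, Pi.smul_apply, mul_smul_comm, Finset.smul_sum]

/-- The curl of the curl of a symmetric tensor. -/
theorem curl_curl (hT : IsSymTensor U T) : AgreeOn U (curl h (curl h T))
    (boxT h T - (3 : ℝ) • T + (fun a b => tr h T * h a b) - D1 h (dvg h T)) := by
  have hC := curl_mem hT.1
  have hB := boxT_mem hT.1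
  have h3 : Smooth2 U ((3 : ℝ) • T) := Smooth2.smul 3 hT.1
  have ht : Smooth2 U (fun a b => tr h T * h a b) := fun a b =>
    mul_mem (tr_mem hT.1) (h_mem a b)
  have hD := D1_mem (dvg_mem hT.1)
  refine agreeOn_of_frames (curl_mem hC) (((hB.sub h3).add ht).sub hD) fun _ L I J => ?_
  rw [L.j0_sub ((hB.sub h3).add ht) hD, L.j0_add (hB.sub h3) ht, L.j0_sub hB h3,
    L.j0_smul 3 hT.1, L.j0_box hT.1, L.j0_scalar_h (tr_mem hT.1),
    L.j0_D1_dvg hT.1, L.s0_tr hT.1, L.j0_curl hC]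
  simp only [L.j1_curl hT.1]
  exact jet_curl_curl (L.j0_symm hT) (L.j2_symm hT) (L.j2_comm T) I J

theorem tr_curl (hT : IsSymTensor U T) : EqOn (tr h (curl h T)) 0 U := by
  refine eqOn_of_frames₀ (tr_mem (curl_mem hT.1)) (zero_mem _) fun _ L => ?_
  rw [L.s0_tr (curl_mem hT.1), L.s0_eq (zero_mem _)]
  simp only [L.j0_curl hT.1]
  exact jet_tr_curl (L.j1_symm hT)

lemma fr1_grad_tr (L : LocalFrame U h x₀) (hT : Smooth2 U T) (I : Fin 3) :
    L.ev0 (L.fr1 (grad (tr h T)) I) = ∑ K, L.j1 T I K K.rev := by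
  rw [L.fr1_grad (tr_mem hT), ← L.s1_tr hT]; rfl

theorem curl_symmetric (hT : IsSymTensor U T)
    (hd : ∀ a, EqOn (dvg h T a) (grad (tr h T) a) U) : IsSymTensor U (curl h T) := by
  refine ⟨curl_mem hT.1, ?_⟩
  have hC : Smooth2 U (fun a b => curl h T b a) := fun a b => curl_mem hT.1 b a
  refine agreeOn_of_frames (T := fun a b => curl h T b a) (curl_mem hT.1) hC
    fun _ L I J => ?_
  rw [LocalFrame.j0, LocalFrame.j0, L.fr2_swap (curl_mem hT.1)]
  change L.j0 _ I J = L.j0 _ J I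
  rw [L.j0_curl hT.1, L.j0_curl hT.1]
  refine (jet_curl_symm_iff (L.j1_symm hT)).2 (fun I => ?_) I J
  rw [← L.ev0_dvg hT.1, ← fr1_grad_tr L hT.1,
    L.fr1_congr (dvg_mem hT.1) (grad_mem (tr_mem hT.1)) hd]

theorem dvg_eq_of_curl_symmetric (hT : IsSymTensor U T) (hC : IsSymTensor U (curl h T)) (a : Fin 3) :
    EqOn (dvg h T a) (grad (tr h T) a) U := by
  refine eqOn_of_frames (dvg_mem hT.1) (grad_mem (tr_mem hT.1)) (fun _ L => ?_) a
  simp only [fr1_grad_tr L hT.1, L.ev0_dvg hT.1]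
  refine (jet_curl_symm_iff (L.j1_symm hT)).1 fun I J => ?_
  rw [← L.j0_curl hT.1, ← L.j0_curl hT.1, L.j0_symm hC]

theorem dvg_curl (hT : IsSymTensor U T) (hC : IsSymTensor U (curl h T)) (a : Fin 3) :
    EqOn (dvg h (curl h T) a) 0 U := by
  refine eqOn_of_frames (w := 0) (dvg_mem hC.1) (fun _ => zero_mem _) (fun _ L I => ?_) a
  have h0 : L.ev0 (L.fr1 0 I) = 0 := by
    have : L.fr1 0 = 0 := by
      funext I
      refine Sm.ext_ev fun x => ?_
      rw [L.ev_fr1 (U := U) (v := 0) (fun _ => zero_mem _)]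
      simp [t1]
    rw [this]; exact map_zero _
  rw [h0, L.ev0_dvg hC.1]
  simp only [L.j1_symm hC _ I, L.j1_curl hT.1]
  exact jet_div_curl (L.j0_symm hT) (L.j2_symm hT) (L.j2_comm T) I

lemma IsSDT.dvg_eq (hT : IsSDT U h T) (a : Fin 3) : EqOn (dvg h T a) (grad (tr h T) a) U := by
  intro x hx
  rw [hT.2.2 a hx, grad, pd_congr_of_eqOn Patch.opn hT.2.1 _ hx]
  simp [pd]

theorem curl_sdt (hT : IsSDT U h T) : IsSDT U h (curl h T) := by
  have hC := curl_symmetric hT.1 (hT.dvg_eq)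
  exact ⟨hC, tr_curl hT.1, dvg_curl hT.1 hC⟩

theorem curl_curl_sdt (hT : IsSDT U h T) :
    AgreeOn U (curl h (curl h T)) (boxT h T - (3 : ℝ) • T) := by
  refine (curl_curl hT.1).trans fun a b x hx => ?_
  have h1 : D1 h (dvg h T) a b x = 0 := by
    have : ∀ e, dvg h T e x = 0 := fun e => hT.2.2 e hx
    simp [D1, pd_congr_of_eqOn Patch.opn (hT.2.2 b) _ hx, this]
    simp [pd]
  have h2 : tr h T x = 0 := hT.2.1 hx
  simp [h1, h2]

/-- The curl commutes with the wave operator on SDT tensors. -/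
theorem boxT_curl (hT : IsSDT U h T) : AgreeOn U (boxT h (curl h T)) (curl h (boxT h T)) := by
  have hC := curl_sdt hT
  have hB := boxT_mem hT.1.1
  have h3 : Smooth2 U ((3 : ℝ) • T) := Smooth2.smul 3 hT.1.1
  have h1 := curl_curl_sdt hC
  have h2 := curl_congr (curl_mem hC.1.1) (hB.sub h3) (curl_curl_sdt hT)
  have h4 := (curl_sub hB h3).trans ((AgreeOn.refl _).sub (curl_smul 3 hT.1.1))
  intro a b x hx
  have e1 := h1 a b hx
  have e2 := h2 a b hx
  have e4 := h4 a b hx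
  simp only [Pi.sub_apply, Pi.smul_apply, smul_eq_mul] at e1 e2 e4
  linarith

theorem curl_hess (hf : f ∈ smoothOn U) :
    AgreeOn U (curl h (hess h f)) (-curl h (fun a b => f * h a b)) := by
  have h1 := hess_mem hf
  have h2 : Smooth2 U (fun a b => f * h a b) := fun a b => mul_mem hf (h_mem a b)
  refine agreeOn_of_frames (curl_mem h1) (curl_mem h2).neg fun _ L I J => ?_
  rw [L.j0_neg (curl_mem h2), L.j0_curl h1, L.j0_curl h2]
  simp only [ncross, L.j1_hess hf, L.j1_scalar_h hf]
  have := L.s3_comm hf (crossFst I) (crossSnd I) J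
  linarith

end Curl

/-! ### Normal forms of jets -/

/-- Fixing one slot of a symmetric traceless tensor of rank `n + 1` in a null frame. Such a tensor
of rank `n` is encoded by its `2 n + 1` components without a pair of indices `0, 2`. -/
def stfSlot (n : ℕ) (s : ℕ → ℝ) (K : Fin 3) (w : ℕ) : ℝ :=
  if K = 0 then (if w ≤ n then s w else -s w / 2) else
    if K = 1 then s (w + 1) else if w < n then -s (w + 2) / 2 else s (w + 2)

/-- Components of a symmetric traceless tensor of rank two. -/
def stf2 (t : ℕ → ℝ) (I J : Fin 3) : ℝ := stfSlot 1 t I J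

/-- The part of `D_K T_{IJ}` determined by `curl T = 2 B`. -/
def jetCurl (b : ℕ → ℝ) (K : Fin 3) (w : ℕ) : ℝ :=
  if K = 0 then
    match w with | 0 => 0 | 1 => -2 / 3 * b 0 | 2 => -4 / 3 * b 1 | 3 => b 2 | _ => 4 / 3 * b 3
  else if K = 1 then
    match w with | 0 => 4 / 3 * b 0 | 1 => 2 / 3 * b 1 | 2 => 0 | 3 => -2 / 3 * b 3 | _ => -4 / 3 * b 4
  else
    match w with | 0 => -4 / 3 * b 1 | 1 => -b 2 | 2 => 4 / 3 * b 3 | 3 => 2 / 3 * b 4 | _ => 0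

/-- First derivatives of an SDT tensor with curl `2 B`. -/
def jetOne (s b : ℕ → ℝ) (K : Fin 3) (w : ℕ) : ℝ := stfSlot 2 s K w + jetCurl b K w

/-- The derivative of the symmetric part of the first derivatives of an SDT tensor. -/
def jetTwo (s c t : ℕ → ℝ) (P : Fin 3) (w : ℕ) : ℝ :=
  stfSlot 3 s P w +
    (if P = 0 then
      match w with
      | 0 => 0 | 1 => -4 / 3 * c 0 | 2 => 4 * t 0 - 8 / 3 * c 1 | 3 => 2 * t 1 - 8 / 3 * c 2
      | 4 => 4 / 3 * c 3 | 5 => t 3 + 4 / 3 * c 4 | _ => 2 * t 4 + 4 / 3 * c 5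
    else if P = 1 then
      match w with
      | 0 => 0 | 1 => 5 * t 0 - 4 / 3 * c 1 | 2 => 4 * t 1 - 4 / 3 * c 2 | 3 => 3 * t 2 - 4 / 3 * c 3
      | 4 => 2 * t 3 - 4 / 3 * c 4 | 5 => t 4 - 4 / 3 * c 5 | _ => -4 / 3 * c 6
    else 0)

lemma stf2_values (t : ℕ → ℝ) : stf2 t 0 0 = t 0 ∧ stf2 t 0 1 = t 1 ∧ stf2 t 0 2 = -t 2 / 2 ∧
    stf2 t 1 0 = t 1 ∧ stf2 t 1 1 = t 2 ∧ stf2 t 1 2 = t 3 ∧ stf2 t 2 0 = -t 2 / 2 ∧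
    stf2 t 2 1 = t 3 ∧ stf2 t 2 2 = t 4 := by
  and_intros <;> rfl

lemma jet_values :
    (∀ n s w, stfSlot n s 0 w = (if w ≤ n then s w else -s w / 2) ∧ stfSlot n s 1 w = s (w + 1) ∧
      stfSlot n s 2 w = if w < n then -s (w + 2) / 2 else s (w + 2)) ∧
    (∀ s b K w, jetOne s b K w = stfSlot 2 s K w + jetCurl b K w) ∧
    (∀ b, jetCurl b 0 0 = 0 ∧ jetCurl b 0 1 = -2 / 3 * b 0 ∧ jetCurl b 0 2 = -4 / 3 * b 1 ∧
      jetCurl b 0 3 = b 2 ∧ jetCurl b 0 4 = 4 / 3 * b 3 ∧ jetCurl b 1 0 = 4 / 3 * b 0 ∧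
      jetCurl b 1 1 = 2 / 3 * b 1 ∧ jetCurl b 1 2 = 0 ∧ jetCurl b 1 3 = -2 / 3 * b 3 ∧
      jetCurl b 1 4 = -4 / 3 * b 4 ∧ jetCurl b 2 0 = -4 / 3 * b 1 ∧ jetCurl b 2 1 = -b 2 ∧
      jetCurl b 2 2 = 4 / 3 * b 3 ∧ jetCurl b 2 3 = 2 / 3 * b 4 ∧ jetCurl b 2 4 = 0) ∧
    (∀ s c t, jetTwo s c t 0 0 = s 0 + 0 ∧ jetTwo s c t 0 1 = s 1 + -4 / 3 * c 0 ∧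
      jetTwo s c t 0 2 = s 2 + (4 * t 0 - 8 / 3 * c 1) ∧
      jetTwo s c t 0 3 = s 3 + (2 * t 1 - 8 / 3 * c 2) ∧ jetTwo s c t 0 4 = -s 4 / 2 + 4 / 3 * c 3 ∧
      jetTwo s c t 0 5 = -s 5 / 2 + (t 3 + 4 / 3 * c 4) ∧
      jetTwo s c t 0 6 = -s 6 / 2 + (2 * t 4 + 4 / 3 * c 5) ∧
      jetTwo s c t 1 0 = s 1 + 0 ∧ jetTwo s c t 1 1 = s 2 + (5 * t 0 - 4 / 3 * c 1) ∧
      jetTwo s c t 1 2 = s 3 + (4 * t 1 - 4 / 3 * c 2) ∧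
      jetTwo s c t 1 3 = s 4 + (3 * t 2 - 4 / 3 * c 3) ∧
      jetTwo s c t 1 4 = s 5 + (2 * t 3 - 4 / 3 * c 4) ∧ jetTwo s c t 1 5 = s 6 + (t 4 - 4 / 3 * c 5) ∧
      jetTwo s c t 1 6 = s 7 + -4 / 3 * c 6 ∧ jetTwo s c t 2 0 = -s 2 / 2 + 0 ∧
      jetTwo s c t 2 1 = -s 3 / 2 + 0 ∧ jetTwo s c t 2 2 = -s 4 / 2 + 0 ∧ jetTwo s c t 2 3 = s 5 + 0 ∧
      jetTwo s c t 2 4 = s 6 + 0 ∧ jetTwo s c t 2 5 = s 7 + 0 ∧ jetTwo s c t 2 6 = s 8 + 0) := by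
  and_intros <;> intros <;> and_intros <;> rfl

lemma exists_stf2 {t : Fin 3 → Fin 3 → ℝ} (hs : ∀ I J, t I J = t J I) (htr : ∑ I, t I I.rev = 0) :
    ∃ u, t = stf2 u := by
  refine ⟨fun w => if w = 0 then t 0 0 else if w = 1 then t 0 1 else if w = 2 then t 1 1 else
    if w = 3 then t 1 2 else t 2 2, ?_⟩
  simp only [Fin.sum_univ_three, rev3] at htr
  have h20 := hs 2 0
  funext I J
  induction I using fin3_cases <;> induction J using fin3_cases <;>
    simp [stf2_values, jet_values, hs 1 0, hs 2 1] <;> linarith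

lemma exists_jetOne {dt : Fin 3 → Fin 3 → Fin 3 → ℝ} (hs : ∀ K I J, dt K I J = dt K J I)
    (htr : ∀ K, ∑ I, dt K I I.rev = 0) (hd : ∀ I, ∑ K, dt K I K.rev = 0) {b : ℕ → ℝ}
    (hb : ∀ I J, ncross (fun A B => dt A B J) I = 2 * stf2 b I J) :
    ∃ s, ∀ K I J, dt K I J = stf2 (jetOne s b K) I J := by
  refine ⟨fun w => if w = 0 then dt 0 0 0 else if w = 1 then dt 1 0 0 - 4 / 3 * b 0 else
    if w = 2 then dt 1 0 1 - 2 / 3 * b 1 else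
    if w = 3 then dt 1 1 1 else if w = 4 then dt 1 1 2 + 2 / 3 * b 3 else
    if w = 5 then dt 1 2 2 + 4 / 3 * b 4 else dt 2 2 2, ?_⟩
  have a0 := htr 0
  have a1 := htr 1
  have a2 := htr 2
  have e0 := hd 0
  have e1 := hd 1
  have e2 := hd 2
  have b00 := hb 0 0
  have b01 := hb 0 1
  have b02 := hb 0 2
  have b10 := hb 1 0
  have b11 := hb 1 1
  have b12 := hb 1 2
  have b20 := hb 2 0
  have b21 := hb 2 1
  have b22 := hb 2 2
  have hw := fun K => fin3_symm (hs K)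
  simp only [Fin.sum_univ_three, rev3, ncross_values, stf2_values, jet_values, hw] at a0 a1 a2 e0 e1 e2 b00 b01 b02 b10 b11 b12 b20 b21 b22
  intro K I J
  induction K using fin3_cases <;> induction I using fin3_cases <;> induction J using fin3_cases <;>
    simp only [stf2_values, jet_values, hw] <;> norm_num <;> linarith

lemma stf2_jetOne_congr {u v b : ℕ → ℝ} (huv : ∀ w < 7, u w = v w) (K I J : Fin 3) :
    stf2 (jetOne u b K) I J = stf2 (jetOne v b K) I J := by
  have hw : ∀ w < 5, jetOne u b K w = jetOne v b K w := by
    intro w hw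
    induction K using fin3_cases <;>
      simp only [stf2_values, jet_values, huv w (by omega), huv (w + 1) (by omega), huv (w + 2) (by omega)]
  induction I using fin3_cases <;> induction J using fin3_cases <;>
    simp only [stf2_values, hw 0 (by omega), hw 1 (by omega), hw 2 (by omega), hw 3 (by omega),
      hw 4 (by omega)]

/-- The third derivatives of a scalar with `(□ + 3) f = 0`. -/
lemma exists_jetScalar {p : Fin 3 → ℝ} {ddp : Fin 3 → Fin 3 → Fin 3 → ℝ}
    (hs : ∀ P K I, ddp P K I = ddp P I K) (htr : ∀ P, ∑ I, ddp P I I.rev = -3 * p P)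
    (hc : ∀ P K I, ddp P K I - ddp K P I = nullMetric ℝ P I * p K - nullMetric ℝ K I * p P) :
    ∃ u, ∀ P K I, ddp P K I = stf2 (stfSlot 2 u P) K I - p P * nullMetric ℝ K I := by
  refine ⟨fun w => if w = 0 then ddp 0 0 0 else if w = 1 then ddp 1 0 0 else
    if w = 2 then ddp 1 1 0 else if w = 3 then ddp 1 1 1 + p 1 else if w = 4 then ddp 1 1 2 else
    if w = 5 then ddp 1 2 2 else ddp 2 2 2, ?_⟩
  have a0 := htr 0
  have a1 := htr 1
  have a2 := htr 2
  have hw := fun K => fin3_symm (hs K)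
  have c0 := hc 1 0 0
  have c1 := hc 1 0 1
  have c2 := hc 1 0 2
  have e0 := hc 2 0 0
  have e1 := hc 2 0 1
  have e2 := hc 2 0 2
  have f0 := hc 2 1 0
  have f1 := hc 2 1 1
  have f2 := hc 2 1 2
  simp only [Fin.sum_univ_three, rev3, null_values, hw] at a0 a1 a2 c0 c1 c2 e0 e1 e2 f0 f1 f2
  intro P K I
  induction P using fin3_cases <;> induction K using fin3_cases <;> induction I using fin3_cases <;>
    simp only [stf2_values, jet_values, null_values, hw] <;> norm_num <;> linarith

lemma exists_jetTwo {t : ℕ → ℝ} {c : ℕ → ℝ} {ddt : Fin 3 → Fin 3 → Fin 3 → Fin 3 → ℝ}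
    (hs : ∀ P K I J, ddt P K I J = ddt P K J I)
    (htr : ∀ P K, ∑ I, ddt P K I I.rev = 0) (hd : ∀ P I, ∑ K, ddt P K I K.rev = 0)
    (hb : ∀ P I J, ncross (fun A B => ddt P A B J) I = 2 * stf2 (stfSlot 2 c P) I J)
    (hc : ∀ P K I J, ddt P K I J - ddt K P I J =
      nullMetric ℝ P I * stf2 t K J - nullMetric ℝ K I * stf2 t P J +
      (nullMetric ℝ P J * stf2 t I K - nullMetric ℝ K J * stf2 t I P)) :
    ∃ s, ∀ P K I J, ddt P K I J = stf2 (jetOne (jetTwo s c t P) (stfSlot 2 c P) K) I J := by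
  have H := fun P => exists_jetOne (hs P) (htr P) (hd P) (hb P)
  choose S hS using H
  refine ⟨fun w => if w = 0 then S 0 0 else if w = 1 then S 1 0 else
    if w = 2 then -2 * S 2 0 else if w = 3 then -2 * S 2 1 else if w = 4 then -2 * S 2 2 else
    if w = 5 then S 2 3 else if w = 6 then S 2 4 else if w = 7 then S 2 5 else S 2 6, ?_⟩
  simp only [hS] at hc
  have q10 := hc 1 0
  have q20 := hc 2 0
  have q21 := hc 2 1
  clear hc hs htr hd hb
  have a1 := q10 0 0
  have a2 := q10 0 1
  have a3 := q10 1 1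
  have a4 := q10 1 2
  have a5 := q10 2 2
  have a6 := q20 0 0
  have a7 := q20 0 1
  have a8 := q20 1 1
  have a9 := q20 1 2
  have a10 := q20 2 2
  have a11 := q21 0 0
  have a12 := q21 0 1
  have a13 := q21 1 1
  have a14 := q21 1 2
  have a15 := q21 2 2
  clear q10 q20 q21
  simp only [stf2_values, jet_values, null_values, Nat.reduceAdd, Nat.reduceLeDiff, Nat.reduceLT, ite_true,
    ite_false] at a1 a2 a3 a4 a5 a6 a7 a8 a9 a10 a11 a12 a13 a14 a15
  intro P K I J
  rw [hS]
  refine stf2_jetOne_congr (fun w hw => ?_) K I J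
  clear hS
  induction P using fin3_cases <;> interval_cases w <;>
    simp only [stf2_values, jet_values] <;> norm_num <;> linarith

namespace Geo

variable {R : Type*} [CommRing R] [Algebra ℝ R] (G : Geo R)

lemma om_vals (K : Fin 3) : G.om K 0 2 = 0 ∧ G.om K 2 0 = 0 ∧ G.om K 1 1 = 0 ∧
    G.om K 1 2 = -G.om K 0 1 ∧ G.om K 2 2 = -G.om K 0 0 ∧ G.om K 2 1 = -G.om K 1 0 := by
  have half : ∀ r : R, r + r = 0 → r = 0 := fun r hr => by
    have : (2 : ℝ) • r = 0 := by rw [two_smul, hr]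
    have h2 := congrArg ((1 / 2 : ℝ) • ·) this
    simpa [smul_smul] using h2
  have h00 := G.om_antisymm K 0 0
  have h22 := G.om_antisymm K 2 2
  have h11 := G.om_antisymm K 1 1
  have h01 := G.om_antisymm K 0 1
  have h02 := G.om_antisymm K 0 2
  have h12 := G.om_antisymm K 1 2
  simp only [rev3] at h00 h22 h11 h01 h02 h12
  exact ⟨half _ h00, half _ h22, half _ h11, by linear_combination h01,
    by linear_combination h02, by linear_combination h12⟩

/-- Covariant differentiation commutes with the trace. -/
lemma N2_trace (T : Fin 3 → Fin 3 → R) (K : Fin 3) :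
    ∑ I, G.N2 T K I I.rev = G.e K (∑ I, T I I.rev) := by
  obtain ⟨h1, h2, h3, h4, h5, h6⟩ := G.om_vals K
  simp only [Framed.N2, Fin.sum_univ_three, rev3, map_add, h1, h2, h3, h4, h5, h6]
  ring

/-- The Leibniz rule for the full contraction of two tensors. -/
lemma e_contract (S T : Fin 3 → Fin 3 → R) (P : Fin 3) :
    G.e P (∑ K, ∑ M, S K M * T K.rev M.rev) =
      ∑ K, ∑ M, (G.N2 S P K M * T K.rev M.rev + S K M * G.N2 T P K.rev M.rev) := by
  obtain ⟨h1, h2, h3, h4, h5, h6⟩ := G.om_vals P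
  simp only [Framed.N2, Fin.sum_univ_three, rev3, map_add, Derivation.leibniz, smul_eq_mul, h1, h2,
    h3, h4, h5, h6]
  ring

/-- The Leibniz rule for the product of two tensors. -/
lemma N2_prod (S T : Fin 3 → Fin 3 → R) (P I J : Fin 3) :
    G.N2 (fun I J => ∑ K, S I K * T J K.rev) P I J =
      ∑ K, (G.N2 S P I K * T J K.rev + S I K * G.N2 T P J K.rev) := by
  obtain ⟨h1, h2, h3, h4, h5, h6⟩ := G.om_vals P
  simp only [Framed.N2, Fin.sum_univ_three, rev3, map_add, Derivation.leibniz, smul_eq_mul, h1, h2,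
    h3, h4, h5, h6]
  ring

end Geo

lemma jetOne_zero (c : ℕ → ℝ) (K : Fin 3) : jetOne c 0 K = stfSlot 2 c K := by
  funext w
  have : jetCurl 0 K w = 0 := by
    unfold jetCurl
    split_ifs <;> split <;> simp
  rw [jetOne, this, add_zero]

namespace LocalFrame

variable (L : LocalFrame U h x₀)
variable [Patch U h]

lemma fr0_zero : L.fr0 0 = 0 :=
  Sm.ext_ev fun x => by rw [L.ev_fr0 (zero_mem (smoothOn U)), map_zero]; rfl

lemma fr1_zero : L.fr1 0 = 0 := by
  funext I
  refine Sm.ext_ev fun x => ?_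
  rw [L.ev_fr1 (U := U) (v := 0) (fun _ => zero_mem _)]
  simp [t1]

lemma sdt_trace (hT : IsSDT U h T) : ∑ I, L.fr2 T I I.rev = 0 := by
  rw [← L.fr0_tr hT.1.1, L.fr0_congr (tr_mem hT.1.1) (zero_mem _) hT.2.1,
    L.fr0_zero]

lemma sdt_N2_trace (hT : IsSDT U h T) (K : Fin 3) : ∑ I, L.G.N2 (L.fr2 T) K I I.rev = 0 := by
  rw [Geo.N2_trace, L.sdt_trace hT, map_zero]

lemma sdt_N2_div (hT : IsSDT U h T) (I : Fin 3) : ∑ K, L.G.N2 (L.fr2 T) K I K.rev = 0 := by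
  rw [← L.fr1_dvg hT.1.1,
    L.fr1_congr (dvg_mem hT.1.1) (w := 0) (fun _ => zero_mem _) hT.2.2, L.fr1_zero]
  rfl

lemma exists_j0 (hT : IsSDT U h T) : ∃ t, ∀ I J, L.j0 T I J = stf2 t I J := by
  obtain ⟨t, ht⟩ := exists_stf2 (L.j0_symm hT.1) (by
    have := congrArg L.ev0 (L.sdt_trace hT)
    rwa [map_sum, map_zero] at this)
  exact ⟨t, fun I J => congrFun (congrFun ht I) J⟩

lemma exists_j1 (hT : IsSDT U h T) {b : ℕ → ℝ} (hb : ∀ I J, L.j0 (curl h T) I J = 2 * stf2 b I J) :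
    ∃ s, ∀ K I J, L.j1 T K I J = stf2 (jetOne s b K) I J :=
  exists_jetOne (L.j1_symm hT.1)
    (fun K => by
      have := congrArg L.ev0 (L.sdt_N2_trace hT K)
      rwa [map_sum, map_zero] at this)
    (fun I => by
      have := congrArg L.ev0 (L.sdt_N2_div hT I)
      rwa [map_sum, map_zero] at this)
    fun I J => by rw [← L.j0_curl hT.1.1, hb]

lemma exists_j2 (hT : IsSDT U h T) {t c : ℕ → ℝ} (ht : ∀ I J, L.j0 T I J = stf2 t I J)
    (hc : ∀ P I J, L.j1 (curl h T) P I J = 2 * stf2 (stfSlot 2 c P) I J) :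
    ∃ s, ∀ P K I J, L.j2 T P K I J = stf2 (jetOne (jetTwo s c t P) (stfSlot 2 c P) K) I J :=
  exists_jetTwo (L.j2_symm hT.1)
    (fun P K => by
      have := congrArg (fun f => L.ev0 (L.G.e P f)) (L.sdt_N2_trace hT K)
      simpa only [map_sum, map_zero, ev0_e_N2] using this)
    (fun P I => by
      have := congrArg (fun f => L.ev0 (L.G.e P f)) (L.sdt_N2_div hT I)
      simpa only [map_sum, map_zero, ev0_e_N2] using this)
    (fun P I J => by rw [← L.j1_curl hT.1.1, hc])
    (fun P K I J => by rw [L.j2_comm]; simp only [ht])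

end LocalFrame

section Magnetic

variable [Patch U h]

lemma isSDT_smul (c : ℝ) (hT : IsSDT U h T) : IsSDT U h (c • T) := by
  refine ⟨⟨Smooth2.smul c hT.1.1, fun a b x hx => congrArg (c * ·) (hT.1.2 a b hx)⟩, fun x hx => ?_,
    fun a x hx => ?_⟩
  · rw [tr_smul]; simp [hT.2.1 hx]
  · rw [dvg_smul c hT.1.1 a hx]; simp [hT.2.2 a hx]

lemma magB_sdt (hk : IsSDT U h k) : IsSDT U h (magB h k) :=
  isSDT_smul (1 / 2) (curl_sdt hk)

lemma curl_magB (hk : IsSDT U h k) (hk3 : AgreeOn U (boxT h k - (3 : ℝ) • k) 0) :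
    AgreeOn U (curl h (magB h k)) 0 := by
  refine (curl_smul (1 / 2) (curl_mem hk.1.1)).trans ?_
  have := ((curl_curl_sdt hk).trans hk3).smul (1 / 2)
  rwa [smul_zero] at this

end Magnetic

/-- The jets of `σ`, `k` and `B` at the base point of a local frame in normal form. -/
structure JetData (L : LocalFrame U h x₀)
    (σ : Fld 3) (k : Cov2) where
  t : ℕ → ℝ
  b : ℕ → ℝ
  s : ℕ → ℝ
  c : ℕ → ℝ
  u : ℕ → ℝ
  v : ℕ → ℝ
  a : ℕ → ℝ
  w : ℕ → ℝ
  k0 : ∀ I J, L.j0 k I J = stf2 t I J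
  B0 : ∀ I J, L.j0 (magB h k) I J = stf2 b I J
  k1 : ∀ K I J, L.j1 k K I J = stf2 (jetOne s b K) I J
  B1 : ∀ K I J, L.j1 (magB h k) K I J = stf2 (stfSlot 2 c K) I J
  k2 : ∀ P K I J, L.j2 k P K I J = stf2 (jetOne (jetTwo u c t P) (stfSlot 2 c P) K) I J
  B2 : ∀ P K I J, L.j2 (magB h k) P K I J = stf2 (stfSlot 2 (jetTwo v 0 b P) K) I J
  f2 : ∀ K I, L.s2 σ K I = stf2 a K I - L.s0 σ * nullMetric ℝ K I
  f3 : ∀ P K I, L.s3 σ P K I = stf2 (stfSlot 2 w P) K I - L.s1 σ P * nullMetric ℝ K I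

lemma exists_jetData (L : LocalFrame U h x₀)
    [Patch U h] (hσ : σ ∈ smoothOn U)
    (hk : IsSDT U h k) (hF : FirstOrderEqs U h σ k) : Nonempty (JetData L σ k) := by
  have hB := magB_sdt hk
  have hcB := curl_magB hk hF.2
  have hBs := hB.1.1
  have hcurl : curl h k = (2 : ℝ) • magB h k := by
    funext a b; simp only [magB, Pi.smul_apply, smul_smul]; norm_num
  obtain ⟨t, ht⟩ := L.exists_j0 hk
  obtain ⟨b, hb⟩ := L.exists_j0 hB
  obtain ⟨s, hs⟩ := L.exists_j1 hk (b := b) fun I J => by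
    rw [hcurl, L.j0_smul 2 hBs, hb]
  have hz : ∀ I J, L.fr2 (curl h (magB h k)) I J = 0 := by
    intro I J
    rw [L.fr2_congr (curl_mem hBs) (T := 0) (fun _ _ => zero_mem _) hcB]
    refine Sm.ext_ev fun x => ?_
    rw [L.ev_fr2 (U := U) (T := 0) (fun _ _ => zero_mem _)]
    simp [t1]
  obtain ⟨c, hc⟩ := L.exists_j1 hB (b := 0) fun I J => by
    rw [LocalFrame.j0, hz, map_zero]
    induction I using fin3_cases <;> induction J using fin3_cases <;>
      simp [stf2_values, jet_values]
  simp only [jetOne_zero] at hc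
  obtain ⟨u, hu⟩ := L.exists_j2 hk (c := c) ht fun P I J => by
    rw [hcurl, L.j1_smul 2 hBs, hc]
  have hst0 : ∀ P, stfSlot 2 0 P = 0 := by
    intro P; funext w; unfold stfSlot; split_ifs <;> simp
  obtain ⟨v, hv⟩ := L.exists_j2 hB (c := 0) hb fun P I J => by
    rw [← L.ev0_e_fr2, hz, map_zero, map_zero, hst0]
    induction I using fin3_cases <;> induction J using fin3_cases <;>
      simp [stf2_values, jet_values]
  simp only [hst0, jetOne_zero] at hv
  have hbox : L.fr0 (boxS h σ) = -(3 : ℝ) • L.fr0 σ := by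
    rw [← L.fr0_smul (-3) hσ]
    refine L.fr0_congr (tr_mem (hess_mem hσ)) (smul_smooth _ hσ) fun x hx => ?_
    have := hF.1 hx
    simp only [Pi.add_apply, Pi.smul_apply, smul_eq_mul, Pi.zero_apply] at this ⊢
    linarith
  have htr := L.fr0_tr (hess_mem hσ)
  rw [show tr h (hess h σ) = boxS h σ from rfl, hbox, L.fr2_hess hσ] at htr
  obtain ⟨a, ha⟩ := exists_stf2 (t := fun K I => L.s2 σ K I + L.s0 σ * nullMetric ℝ K I)
    (fun K I => by rw [L.s2_symm, nullMetric_comm]) (by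
      have := congrArg L.ev0 htr
      rw [map_sum, map_smul] at this
      change -3 * L.s0 σ = ∑ I, L.s2 σ I I.rev at this
      rw [Finset.sum_add_distrib, ← this]
      simp only [Fin.sum_univ_three, rev3, null_values]
      ring)
  obtain ⟨w, hw⟩ := exists_jetScalar (p := L.s1 σ) (L.s3_symm σ) (fun P => by
    have := congrArg (fun f => L.ev0 (L.G.e P f)) htr
    simp only [map_sum, Derivation.map_smul, map_smul, L.ev0_e_frH] at this
    rw [← this]; rfl) (L.s3_comm hσ)
  exact ⟨⟨t, b, s, c, u, v, a, w, ht, hb, hs, hc, hu, hv,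
    fun K I => by rw [← congrFun (congrFun ha K) I]; ring, hw⟩⟩

lemma cross_values : crossFst 0 = 1 ∧ crossFst 1 = 0 ∧ crossFst 2 = 2 ∧ crossSnd 0 = 0 ∧
    crossSnd 1 = 2 ∧ crossSnd 2 = 1 := ⟨rfl, rfl, rfl, rfl, rfl, rfl⟩

/-! ### The symmetric-curl tensor underlying the sources -/

section Definitions

variable (h : Cov2) (σ : Fld 3) (k : Cov2)

/-- The part of the common source quadratic in `σ`. -/
def srcSS : Cov2 := (fun a b => ((5 : ℝ) • σ ^ 2 + gradSq h σ) * h a b) +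
  (4 : ℝ) • fun a b => σ * hess h σ a b

/-- The part of the common source bilinear in `σ` and `k`. -/
def srcSK : Cov2 := (4 : ℝ) • ((fun a b => σ * k a b) + hessK h σ k - sigDk h σ k + sigDkSym h σ k) -
  fun a b => inner2 h (hess h σ) k * h a b

/-- The part of the common source quadratic in `k`. -/
def srcKK : Cov2 := (fun a b => ((1 / 8 : ℝ) • inner2 h k k + (1 / 8 : ℝ) • DkSq h k) * h a b) +
  Yten h k - prod2 h k k - (1 / 2 : ℝ) • DkDk h k

end Definitions

section Smooth
variable [Patch U h] (hσ : σ ∈ smoothOn U) (hk : Smooth2 U k)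

lemma scalar_mem (hf : f ∈ smoothOn U) (hT : Smooth2 U T) :
    Smooth2 U (fun a b => f * T a b) := fun a b => mul_mem hf (hT a b)

lemma srcSS_mem (hσ : σ ∈ smoothOn U) : Smooth2 U (srcSS h σ) :=
  (scalar_mem (add_mem (smul_smooth _ (pow_mem hσ 2)) (gradSq_mem hσ)) h_mem).add
    (Smooth2.smul 4 (scalar_mem hσ (hess_mem hσ)))

lemma srcSK_mem (hσ : σ ∈ smoothOn U) (hk : Smooth2 U k) : Smooth2 U (srcSK h σ k) :=
  (Smooth2.smul 4 ((((scalar_mem hσ hk).add (hessK_mem hσ hk)).sub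
    (sigDk_mem hσ hk)).add (sigDkSym_mem hσ hk))).sub
    (scalar_mem (inner2_mem (hess_mem hσ) hk) h_mem)

lemma srcKK_mem (hk : Smooth2 U k) : Smooth2 U (srcKK h k) :=
  (((scalar_mem (add_mem (smul_smooth _ (inner2_mem hk hk)) (smul_smooth _ (DkSq_mem hk)))
    h_mem).add (Yten_mem hk)).sub (prod2_mem hk hk)).sub
    (Smooth2.smul _ (DkDk_mem hk))

end Smooth

namespace LocalFrame

variable (L : LocalFrame U h x₀)
variable [Patch U h]

lemma ev0_fr2 (T : Cov2) (I J : Fin 3) : L.ev0 (L.fr2 T I J) = L.j0 T I J := rfl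
lemma ev0_N2_fr2 (T : Cov2) (K I J : Fin 3) : L.ev0 (L.G.N2 (L.fr2 T) K I J) = L.j1 T K I J := rfl
lemma ev0_fr0 (f : Fld 3) : L.ev0 (L.fr0 f) = L.s0 f := rfl
lemma ev0_e_fr0 (f : Fld 3) (K : Fin 3) : L.ev0 (L.G.e K (L.fr0 f)) = L.s1 f K := rfl
lemma ev0_frH (f : Fld 3) (K I : Fin 3) : L.ev0 (L.frH f K I) = L.s2 f K I := rfl

lemma fr2_hessK (hσ : σ ∈ smoothOn U) (hk : Smooth2 U k) (I J : Fin 3) :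
    L.fr2 (hessK h σ k) I J = (1 / 2 : ℝ) • ((∑ K, L.frH σ I K * L.fr2 k J K.rev) +
      ∑ K, L.frH σ J K * L.fr2 k I K.rev) := by
  have h2 := hess_mem hσ
  rw [hessK, L.fr2_symm (prod2_mem h2 hk), L.fr2_prod2 h2 hk, L.fr2_prod2 h2 hk,
    L.fr2_hess hσ]

lemma fr2_sigDkSym (hσ : σ ∈ smoothOn U) (hk : Smooth2 U k) (I J : Fin 3) :
    L.fr2 (sigDkSym h σ k) I J =
      (1 / 2 : ℝ) • ((∑ K, L.G.e K.rev (L.fr0 σ) * L.G.N2 (L.fr2 k) I J K) +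
        ∑ K, L.G.e K.rev (L.fr0 σ) * L.G.N2 (L.fr2 k) J I K) := by
  rw [sigDkSym, L.fr2_symm, L.fr2_sigDk' hσ hk, L.fr2_sigDk' hσ hk]
  exact fun _ _ => sum_smooth fun _ => mul_mem (up1_mem (grad_mem hσ) _)
    (D2_mem hk _ _ _)

lemma fr2_srcSS (hσ : σ ∈ smoothOn U) (I J : Fin 3) :
    L.fr2 (srcSS h σ) I J = ((5 : ℝ) • (L.fr0 σ * L.fr0 σ) +
      ∑ K, L.G.e K (L.fr0 σ) * L.G.e K.rev (L.fr0 σ)) * nullMetric _ I J +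
      (4 : ℝ) • (L.fr0 σ * L.frH σ I J) := by
  have h5 := smul_smooth (U := U) 5 (pow_mem hσ 2)
  have hg := gradSq_mem hσ
  have hs := hess_mem hσ
  rw [srcSS, L.fr2_add (scalar_mem (add_mem h5 hg) h_mem) (Smooth2.smul 4 (scalar_mem hσ hs)),
    L.fr2_smul 4 (scalar_mem hσ hs)]
  simp only [Pi.add_apply, Pi.smul_apply]
  rw [L.fr2_scalar (add_mem h5 hg) h_mem, L.fr2_scalar hσ hs, L.fr0_add h5 hg,
    L.fr0_smul _ (pow_mem hσ 2), L.fr0_pow hσ, L.fr0_gradSq hσ, L.fr2_h, L.fr2_hess hσ,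
    pow_two]

lemma fr2_srcSK (hσ : σ ∈ smoothOn U) (hk : Smooth2 U k) (I J : Fin 3) :
    L.fr2 (srcSK h σ k) I J = (4 : ℝ) • (L.fr0 σ * L.fr2 k I J +
      (1 / 2 : ℝ) • ((∑ K, L.frH σ I K * L.fr2 k J K.rev) + ∑ K, L.frH σ J K * L.fr2 k I K.rev) -
      ∑ K, L.G.e K.rev (L.fr0 σ) * L.G.N2 (L.fr2 k) K I J +
      (1 / 2 : ℝ) • ((∑ K, L.G.e K.rev (L.fr0 σ) * L.G.N2 (L.fr2 k) I J K) +
        ∑ K, L.G.e K.rev (L.fr0 σ) * L.G.N2 (L.fr2 k) J I K)) -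
      (∑ K, ∑ M, L.frH σ K M * L.fr2 k K.rev M.rev) * nullMetric _ I J := by
  have h1 := scalar_mem hσ hk
  have h2 := hessK_mem hσ hk
  have h3 := sigDk_mem hσ hk
  have h4 := sigDkSym_mem hσ hk
  have h5 := inner2_mem (hess_mem hσ) hk
  rw [srcSK, L.fr2_sub (Smooth2.smul 4 (((h1.add h2).sub h3).add h4)) (scalar_mem h5 h_mem),
    L.fr2_smul 4 (((h1.add h2).sub h3).add h4), L.fr2_add ((h1.add h2).sub h3) h4,
    L.fr2_sub (h1.add h2) h3, L.fr2_add h1 h2]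
  simp only [Pi.add_apply, Pi.smul_apply, Pi.sub_apply]
  rw [L.fr2_scalar h5 h_mem, L.fr2_scalar hσ hk, L.fr2_h, L.fr2_hessK hσ hk,
    L.fr2_sigDk hσ hk, L.fr2_sigDkSym hσ hk, L.fr0_inner2 (hess_mem hσ) hk,
    L.fr2_hess hσ]

lemma fr2_Yten (hk : Smooth2 U k) (I J : Fin 3) :
    L.fr2 (Yten h k) I J = -(4 : ℝ) • (1 / 2 : ℝ) •
        ((∑ K, L.fr2 (magB h k) K I * L.fr2 (magB h k) J K.rev) +
          ∑ K, L.fr2 (magB h k) K J * L.fr2 (magB h k) I K.rev) -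
      (2 : ℝ) • (1 / 2 : ℝ) •
        (ncross (fun K M => ∑ P, L.G.N2 (L.fr2 k) K J P * L.fr2 (magB h k) M P.rev) I +
          ncross (fun K M => ∑ P, L.G.N2 (L.fr2 k) K I P * L.fr2 (magB h k) M P.rev) J) -
      (2 : ℝ) • (1 / 2 : ℝ) •
        (ncross (fun K M => ∑ P, L.G.N2 (L.fr2 (magB h k)) J K P * L.fr2 k M P.rev) I +
          ncross (fun K M => ∑ P, L.G.N2 (L.fr2 (magB h k)) I K P * L.fr2 k M P.rev) J) := by
  have h1 := yOne_mem hk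
  have h2 := yTwo_mem hk
  have h3 := yThree_mem hk
  rw [Yten_eq, L.fr2_sub ((Smooth2.smul (-4) (symm_mem h1)).sub (Smooth2.smul 2 (symm_mem h2)))
    (Smooth2.smul 2 (symm_mem h3)), L.fr2_sub (Smooth2.smul (-4) (symm_mem h1))
    (Smooth2.smul 2 (symm_mem h2)), L.fr2_smul _ (symm_mem h1), L.fr2_smul _ (symm_mem h2),
    L.fr2_smul _ (symm_mem h3)]
  simp only [Pi.sub_apply, Pi.smul_apply, L.fr2_symm h1, L.fr2_symm h2, L.fr2_symm h3,
    L.fr2_yOne hk, L.fr2_yTwo hk, L.fr2_yThree hk]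

lemma fr2_srcKK (hk : Smooth2 U k) (I J : Fin 3) :
    L.fr2 (srcKK h k) I J = ((1 / 8 : ℝ) • (∑ K, ∑ M, L.fr2 k K M * L.fr2 k K.rev M.rev) +
      (1 / 8 : ℝ) • ∑ K, ∑ M, ∑ P, L.G.N2 (L.fr2 k) K M P *
        L.G.N2 (L.fr2 k) K.rev M.rev P.rev) * nullMetric _ I J + L.fr2 (Yten h k) I J -
      (∑ K, L.fr2 k I K * L.fr2 k J K.rev) -
      (1 / 2 : ℝ) • ∑ K, ∑ M, L.G.N2 (L.fr2 k) I K M * L.G.N2 (L.fr2 k) J K.rev M.rev := by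
  have h0 := inner2_mem hk hk
  have hq := DkSq_mem hk
  have h1 := add_mem (smul_smooth (U := U) (1 / 8) h0) (smul_smooth (1 / 8) hq)
  have h2 := Yten_mem hk
  have h3 := prod2_mem hk hk
  have h4 := DkDk_mem hk
  have h5 := scalar_mem h1 h_mem
  rw [srcKK, L.fr2_sub ((h5.add h2).sub h3) (Smooth2.smul _ h4), L.fr2_sub (h5.add h2) h3,
    L.fr2_add h5 h2, L.fr2_smul _ h4]
  simp only [Pi.add_apply, Pi.smul_apply, Pi.sub_apply]
  rw [L.fr2_scalar h1 h_mem, L.fr0_add (smul_smooth _ h0) (smul_smooth _ hq), L.fr0_smul _ h0,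
    L.fr0_smul _ hq, L.fr0_inner2 hk hk, L.fr0_DkSq hk, L.fr2_h,
    L.fr2_prod2 hk hk, L.fr2_DkDk hk]

lemma srcSS_div (D : JetData L σ k) (hσ : σ ∈ smoothOn U) (I : Fin 3) :
    ∑ K, L.j1 (srcSS h σ) K I K.rev = ∑ K, L.j1 (srcSS h σ) I K K.rev := by
  simp only [← ev0_e_fr2, L.fr2_srcSS hσ, map_add, Derivation.leibniz, Derivation.map_smul,
    map_smul, map_mul, smul_eq_mul, e_null, mul_zero, map_sum, ev0_null, ev0_e_e, ev0_e_frH,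
    ev0_fr0, ev0_e_fr0, ev0_frH, D.f2, D.f3, zero_add]
  induction I using fin3_cases <;>
  simp only [Fin.sum_univ_three, rev3, null_values, stf2_values, jet_values, Nat.reduceAdd, Nat.reduceLeDiff,
    Nat.reduceLT, ite_true, ite_false] <;> ring

lemma srcSK_div (D : JetData L σ k) (hσ : σ ∈ smoothOn U) (hk : Smooth2 U k) (I : Fin 3) :
    ∑ K, L.j1 (srcSK h σ k) K I K.rev = ∑ K, L.j1 (srcSK h σ k) I K K.rev := by
  simp only [← ev0_e_fr2, L.fr2_srcSK hσ hk, map_add, map_sub, Derivation.leibniz,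
    Derivation.map_smul, map_smul, map_mul, smul_eq_mul, e_null, mul_zero, map_sum, ev0_null, ev0_e_e,
    ev0_e_frH, ev0_fr0, ev0_e_fr0, ev0_frH, ev0_fr2, ev0_N2_fr2, zero_add]
  simp only [ev0_e_fr2, ev0_e_N2, D.f2, D.f3, D.k0, D.k1, D.k2]
  induction I using fin3_cases <;>
  simp only [Fin.sum_univ_three, rev3, null_values, stf2_values, jet_values, Nat.reduceAdd, Nat.reduceLeDiff,
    Nat.reduceLT, ite_true, ite_false] <;> ring

set_option maxHeartbeats 1000000 in
lemma srcKK_div (D : JetData L σ k) (hk : Smooth2 U k) (I : Fin 3) :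
    ∑ K, L.j1 (srcKK h k) K I K.rev = ∑ K, L.j1 (srcKK h k) I K K.rev := by
  simp only [← ev0_e_fr2, L.fr2_srcKK hk, L.fr2_Yten hk, map_add, map_sub,
    Derivation.leibniz, ncross,
    Derivation.map_smul, map_smul, map_mul, smul_eq_mul, e_null, mul_zero, map_sum, ev0_null, ev0_e_e,
    ev0_fr2, ev0_N2_fr2, zero_add]
  simp only [ev0_e_fr2, ev0_e_N2, D.k0, D.k1, D.k2, D.B0, D.B1, D.B2]
  induction I using fin3_cases <;>
  simp only [Fin.sum_univ_three, rev3, null_values, stf2_values, jet_values, cross_values, Pi.zero_apply,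
    Nat.reduceAdd, Nat.reduceLeDiff, Nat.reduceLT, ite_true, ite_false] <;> ring

end LocalFrame

/-! ### Hessians and wave operators of quadratic expressions -/

/-- `k^{cd} D_{(a} D_{b)} k_{cd}`. -/
def kDDk (h k : Cov2) : Cov2 := symm fun a b => ∑ c, ∑ d, up2 h k c d * DD h k a b c d

/-- `k^{cd} D_d D_a k_{bc}`. -/
def kDaDk (h k : Cov2) : Cov2 := fun a b => ∑ c, ∑ d, up2 h k c d * DD h k d a b c

/-- `k^{cd} D_c D_d k_{ab}`. -/
def kDcDk (h k : Cov2) : Cov2 := fun a b => ∑ c, ∑ d, up2 h k c d * DD h k c d a b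

/-- `D_b k^{cd} D_c k_{da}`. -/
def DkDkMixed (h k : Cov2) : Cov2 := fun a b =>
  ∑ c, ∑ d, up2 h (fun e f => D2 h k e f a) d c * D2 h k b d c

/-- `D_c k_{ad} D^c k^d_b`. -/
def DkDkInner (h k : Cov2) : Cov2 := fun a b =>
  ∑ c, ∑ d, D2 h k c a d * up2 h (fun e f => D2 h k e f b) c d

/-- `D_c k_{ad} D^d k^c_b`. -/
def DkDkCross (h k : Cov2) : Cov2 := fun a b =>
  ∑ c, ∑ d, D2 h k c a d * up2 h (fun e f => D2 h k e f b) d c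

lemma NLkk_eq (h k : Cov2) : NLkk h k = prod2 h k k - symm (kDaDk h k) + kDcDk h k -
    (1 / 2 : ℝ) • DkDk h k + symm (DkDkMixed h k) + DkDkInner h k - DkDkCross h k := rfl

section Smooth

variable [Patch U h] (hk : Smooth2 U k)
include hk

lemma kDDk_mem' : Smooth2 U (fun a b => ∑ c, ∑ d, up2 h k c d * DD h k a b c d) := fun _ _ =>
  sum_smooth fun _ => sum_smooth fun _ => mul_mem (up2_mem hk _ _) (DD_mem hk _ _ _ _)

lemma kDDk_mem : Smooth2 U (kDDk h k) := symm_mem (kDDk_mem' hk)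

lemma kDaDk_mem : Smooth2 U (kDaDk h k) := fun _ _ =>
  sum_smooth fun _ => sum_smooth fun _ => mul_mem (up2_mem hk _ _) (DD_mem hk _ _ _ _)

lemma kDcDk_mem : Smooth2 U (kDcDk h k) := fun _ _ =>
  sum_smooth fun _ => sum_smooth fun _ => mul_mem (up2_mem hk _ _) (DD_mem hk _ _ _ _)

lemma DkDkMixed_mem : Smooth2 U (DkDkMixed h k) := fun _ _ =>
  sum_smooth fun _ => sum_smooth fun _ => mul_mem (up2_mem
    (fun e f => D2_mem hk e f _) _ _) (D2_mem hk _ _ _)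

lemma DkDkInner_mem : Smooth2 U (DkDkInner h k) := fun _ _ =>
  sum_smooth fun _ => sum_smooth fun _ => mul_mem (D2_mem hk _ _ _) (up2_mem
    (fun e f => D2_mem hk e f _) _ _)

lemma DkDkCross_mem : Smooth2 U (DkDkCross h k) := fun _ _ =>
  sum_smooth fun _ => sum_smooth fun _ => mul_mem (D2_mem hk _ _ _) (up2_mem
    (fun e f => D2_mem hk e f _) _ _)

end Smooth

namespace LocalFrame

variable (L : LocalFrame U h x₀)

variable [Patch U h]

lemma fr4_rot {S : Fin 3 → Cov3} (hS : ∀ d, Smooth3 U (S d)) (I J K M : Fin 3) :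
    L.fr4 (fun a b c d => S d a b c) I J K M = L.fr4 S M I J K := by
  rw [← L.fr4_fst hS I M J K, ← L.fr4_mid (S := fun a b c d => S b a c d) (fun d a b c => hS a d b c),
    ← L.fr4_lst (S := fun a b c d => S c a b d) (fun d a b c => hS b d a c)]

lemma fr3_rot {S : Cov3} (hS : Smooth3 U S) (I J K : Fin 3) :
    L.fr3 (fun a b c => S b c a) I J K = L.fr3 S J K I := by
  rw [← L.fr3_lst hS J I K, ← L.fr3_fst (S := fun a b c => S a c b) (fun a b c => hS a c b)]

lemma fr2_kDDk (hk : Smooth2 U k) (I J : Fin 3) :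
    L.fr2 (kDDk h k) I J = (1 / 2 : ℝ) •
      ((∑ K, ∑ M, L.fr2 k K.rev M.rev * L.G.N3 (L.G.N2 (L.fr2 k)) I J K M) +
        ∑ K, ∑ M, L.fr2 k K.rev M.rev * L.G.N3 (L.G.N2 (L.fr2 k)) J I K M) := by
  rw [kDDk, L.fr2_symm (kDDk_mem' hk), L.fr2_up2_mul hk (fun d a b c => DD_mem hk _ _ _ _),
    L.fr2_up2_mul hk (fun d a b c => DD_mem hk _ _ _ _)]
  have : L.fr4 (fun a b c d => DD h k a b c d) = L.fr4 (DD h k) := rfl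
  rw [this, L.fr4_DD hk]

lemma fr2_kDaDk (hk : Smooth2 U k) (I J : Fin 3) :
    L.fr2 (kDaDk h k) I J =
      ∑ K, ∑ M, L.fr2 k K.rev M.rev * L.G.N3 (L.G.N2 (L.fr2 k)) M I J K := by
  have h1 := L.fr2_up2_mul hk (S := fun a b c d => DD h k d a b c)
    (fun d a b c => DD_mem hk _ _ _ _) I J
  simp only [L.fr4_rot (S := DD h k) (fun d a b c => DD_mem hk d a b c), L.fr4_DD hk] at h1
  exact h1

lemma fr2_kDcDk (hk : Smooth2 U k) (I J : Fin 3) :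
    L.fr2 (kDcDk h k) I J =
      ∑ K, ∑ M, L.fr2 k K.rev M.rev * L.G.N3 (L.G.N2 (L.fr2 k)) K M I J := by
  have h1 := L.fr2_up2_mul hk (S := fun a b c d => DD h k c d a b)
    (fun d a b c => DD_mem hk _ _ _ _) I J
  simp only [L.fr4_swap (S := DD h k) (fun d a b c => DD_mem hk d a b c), L.fr4_DD hk] at h1
  exact h1

lemma fr2_DkDkMixed (hk : Smooth2 U k) (I J : Fin 3) :
    L.fr2 (DkDkMixed h k) I J =
      ∑ K, ∑ M, L.G.N2 (L.fr2 k) J K M * L.G.N2 (L.fr2 k) K.rev M.rev I := by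
  have hD := D2_mem hk
  have h1 := L.fr2_mul_up2 (S' := fun a b c => D2 h k b c a) hD (fun a b c => hD b c a) J I
  simp only [L.fr3_rot hD, L.fr3_D2 hk] at h1
  rw [← h1, ← L.fr2_swap (T := fun a b => ∑ c, ∑ d, D2 h k a c d * up2 h (fun e f => D2 h k e f b) c d)
    (fun _ _ => sum_smooth fun _ => sum_smooth fun _ => mul_mem (hD _ _ _) (up2_mem
    (fun e f => hD e f _) _ _))]
  refine congrFun (congrFun (congrArg L.fr2 ?_) I) J
  funext a b
  rw [DkDkMixed, Finset.sum_comm]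
  exact Finset.sum_congr rfl fun _ _ => Finset.sum_congr rfl fun _ _ => mul_comm _ _

lemma fr2_DkDkInner (hk : Smooth2 U k) (I J : Fin 3) :
    L.fr2 (DkDkInner h k) I J =
      ∑ K, ∑ M, L.G.N2 (L.fr2 k) K I M * L.G.N2 (L.fr2 k) K.rev M.rev J := by
  have hD := D2_mem hk
  have h1 := L.fr2_mul_up2 (S := fun a b c => D2 h k b a c) (S' := fun a b c => D2 h k b c a)
    (fun a b c => hD b a c) (fun a b c => hD b c a) I J
  simp only [L.fr3_rot hD, L.fr3_fst hD, L.fr3_D2 hk] at h1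
  exact h1

lemma fr2_DkDkCross (hk : Smooth2 U k) (I J : Fin 3) :
    L.fr2 (DkDkCross h k) I J =
      ∑ K, ∑ M, L.G.N2 (L.fr2 k) K I M * L.G.N2 (L.fr2 k) M.rev K.rev J := by
  have hD := D2_mem hk
  have h1 := L.fr2_mul_up2 (S := fun a b c => D2 h k b a c) (S' := fun a b c => D2 h k c b a)
    (fun a b c => hD b a c) (fun a b c => hD c b a) I J
  simp only [L.fr3_rot (S := fun a b c => D2 h k b a c) (fun a b c => hD b a c), L.fr3_fst hD,
    L.fr3_D2 hk] at h1
  rw [← h1]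
  refine congrFun (congrFun (congrArg L.fr2 ?_) I) J
  funext a b
  refine Finset.sum_congr rfl fun c _ => Finset.sum_congr rfl fun d _ => ?_
  congr 1
  simp only [up2]
  rw [Finset.sum_comm]
  refine Finset.sum_congr rfl fun e _ => Finset.sum_congr rfl fun f _ => ?_
  ring

lemma s2_sq (hσ : σ ∈ smoothOn U) (I J : Fin 3) :
    L.s2 (σ ^ 2) I J = 2 * (L.s0 σ * L.s2 σ I J) + 2 * (L.s1 σ I * L.s1 σ J) := by
  rw [← ev0_e_e, L.fr0_pow hσ, pow_two]
  simp only [Derivation.leibniz, map_add, map_mul, smul_eq_mul, ev0_fr0, ev0_e_fr0, ev0_e_e]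
  ring

lemma s1_sq (hσ : σ ∈ smoothOn U) (I : Fin 3) :
    L.s1 (σ ^ 2) I = 2 * (L.s0 σ * L.s1 σ I) := by
  rw [← ev0_e_fr0, L.fr0_pow hσ, pow_two]
  simp only [Derivation.leibniz, map_add, map_mul, smul_eq_mul, ev0_fr0, ev0_e_fr0]
  ring

lemma s2_inner2_self (hk : Smooth2 U k) (I J : Fin 3) :
    L.s2 (inner2 h k k) I J = ∑ K, ∑ M, (L.j2 k I J K M * L.j0 k K.rev M.rev +
      L.j1 k J K M * L.j1 k I K.rev M.rev + L.j1 k I K M * L.j1 k J K.rev M.rev +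
      L.j0 k K M * L.j2 k I J K.rev M.rev) := by
  rw [← ev0_e_e, L.fr0_inner2 hk hk, Geo.e_contract]
  simp only [map_sum, Derivation.leibniz, map_add, map_mul, smul_eq_mul, ev0_fr2, ev0_N2_fr2, ev0_e_fr2,
    ev0_e_N2]
  refine Finset.sum_congr rfl fun K _ => Finset.sum_congr rfl fun M _ => by ring

lemma j2_prod2_self (hk : Smooth2 U k) (P Q I J : Fin 3) :
    L.j2 (prod2 h k k) P Q I J = ∑ K, (L.j2 k P Q I K * L.j0 k J K.rev +
      L.j1 k Q I K * L.j1 k P J K.rev + L.j1 k P I K * L.j1 k Q J K.rev +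
      L.j0 k I K * L.j2 k P Q J K.rev) := by
  have h1 : L.fr2 (prod2 h k k) = fun I J => ∑ K, L.fr2 k I K * L.fr2 k J K.rev := by
    funext I J; exact L.fr2_prod2 hk hk I J
  rw [← ev0_e_N2, h1, Geo.N2_prod]
  simp only [map_sum, Derivation.leibniz, map_add, map_mul, smul_eq_mul, ev0_fr2, ev0_N2_fr2, ev0_e_fr2,
    ev0_e_N2]
  refine Finset.sum_congr rfl fun K _ => by ring

lemma j1_prod2_self (hk : Smooth2 U k) (P I J : Fin 3) :
    L.j1 (prod2 h k k) P I J = ∑ K, (L.j1 k P I K * L.j0 k J K.rev +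
      L.j0 k I K * L.j1 k P J K.rev) := by
  rw [← ev0_e_fr2, L.fr2_prod2 hk hk]
  simp only [map_sum, Derivation.leibniz, map_add, map_mul, smul_eq_mul, ev0_fr2, ev0_e_fr2]
  refine Finset.sum_congr rfl fun K _ => by ring

end LocalFrame

section

variable [Patch U h]

theorem hess_sq (hσ : σ ∈ smoothOn U) : AgreeOn U (hess h (σ ^ 2))
    ((2 : ℝ) • (fun a b => σ * hess h σ a b) + (2 : ℝ) • fun a b => grad σ a * grad σ b) := by
  have h1 := scalar_mem hσ (hess_mem hσ)
  have h2 : Smooth2 U (fun a b => grad σ a * grad σ b) := fun a b =>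
    mul_mem (grad_mem hσ a) (grad_mem hσ b)
  refine agreeOn_of_frames (hess_mem (pow_mem hσ 2)) ((Smooth2.smul 2 h1).add
    (Smooth2.smul 2 h2)) fun _ L I J => ?_
  rw [L.j0_add (Smooth2.smul 2 h1) (Smooth2.smul 2 h2), L.j0_smul 2 h1, L.j0_smul 2 h2,
    L.j0_hess (pow_mem hσ 2), L.s2_sq hσ, LocalFrame.j0, LocalFrame.j0, L.fr2_scalar hσ
    (hess_mem hσ), L.fr2_tensor (grad_mem hσ) (grad_mem hσ), L.fr1_grad hσ,
    L.fr2_hess hσ]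
  simp only [map_mul]
  rfl

theorem hess_inner2_self (hk : Smooth2 U k) : AgreeOn U (hess h (inner2 h k k))
    ((2 : ℝ) • DkDk h k + (2 : ℝ) • kDDk h k) := by
  have h1 := DkDk_mem hk
  have h2 := kDDk_mem hk
  have h3 := inner2_mem hk hk
  refine agreeOn_of_frames (hess_mem h3) ((Smooth2.smul 2 h1).add
    (Smooth2.smul 2 h2)) fun _ L I J => ?_
  have e1 := L.s2_inner2_self hk I J
  have e2 := L.s2_inner2_self hk J I
  rw [L.s2_symm] at e2
  rw [L.j0_add (Smooth2.smul 2 h1) (Smooth2.smul 2 h2), L.j0_smul 2 h1, L.j0_smul 2 h2,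
    L.j0_hess h3, LocalFrame.j0, LocalFrame.j0, L.fr2_DkDk hk, L.fr2_kDDk hk]
  simp only [map_smul, map_add, map_sum, map_mul, smul_eq_mul]
  change _ = 2 * (∑ K, ∑ M, L.j1 k I K M * L.j1 k J K.rev M.rev) + 2 * (1 / 2 *
    ((∑ K, ∑ M, L.j0 k K.rev M.rev * L.j2 k I J K M) + ∑ K, ∑ M, L.j0 k K.rev M.rev * L.j2 k J I K M))
  have e3 : L.s2 (inner2 h k k) I J = 1 / 2 * (L.s2 (inner2 h k k) I J + L.s2 (inner2 h k k) I J) := by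
    ring
  rw [e3]; nth_rw 1 [e1]; rw [e2]
  simp only [Fin.sum_univ_three, rev3]
  ring

end

/-! ### Identities between the quadratic tensors -/

lemma QV_eq (h : Cov2) (σ : Fld 3) (k : Cov2) : QV h σ k =
    (fun a b => ((6 : ℝ) • σ ^ 2 + gradSq h σ + (1 / 8 : ℝ) • inner2 h k k +
      (1 / 8 : ℝ) • DkSq h k) * h a b) + (2 : ℝ) • (fun a b => σ * hess h σ a b) -
    (2 : ℝ) • (fun a b => grad σ a * grad σ b) + (4 : ℝ) • (fun a b => σ * k a b) -
    (4 : ℝ) • sigDk h σ k + (4 : ℝ) • sigDkSym h σ k + (4 : ℝ) • hessK h σ k -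
    (fun a b => inner2 h (hess h σ) k * h a b) - (1 / 2 : ℝ) • prod2 h k k -
    (3 / 8 : ℝ) • DkDk h k + (1 / 8 : ℝ) • kDDk h k + Yten h k := rfl

lemma QW_eq (h : Cov2) (σ : Fld 3) (k : Cov2) : QW h σ k =
    (fun a b => (-(2 : ℝ) • σ ^ 2 + (1 / 16 : ℝ) • inner2 h k k) * h a b) -
      (1 / 2 : ℝ) • prod2 h k k := rfl

/-- The common source of the two systems. -/
def src (h : Cov2) (σ : Fld 3) (k : Cov2) : Cov2 := srcSS h σ + srcSK h σ k + srcKK h k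

lemma kappa_eq (h : Cov2) (σ : Fld 3) (k : Cov2) : kappa h σ k = src h σ k + fun a b =>
    (-(3 : ℝ) • σ ^ 2 - (3 : ℝ) • gradSq h σ + (5 / 8 : ℝ) • inner2 h k k +
      (1 / 8 : ℝ) • DkSq h k - inner2 h (hess h σ) k) * h a b := by
  funext a b x
  simp only [kappa, src, srcSS, srcSK, srcKK, kappaSS, kappaSK, kappaKK, Pi.add_apply, Pi.sub_apply,
    Pi.mul_apply, Pi.smul_apply, smul_eq_mul, Pi.pow_apply]
  ring

section

variable [Patch U h]

lemma src_mem (hσ : σ ∈ smoothOn U) (hk : Smooth2 U k) : Smooth2 U (src h σ k) :=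
  ((srcSS_mem hσ).add (srcSK_mem hσ hk)).add (srcKK_mem hk)

theorem QV_add_QW (hσ : σ ∈ smoothOn U) (hk : Smooth2 U k) :
    AgreeOn U (QV h σ k + QW h σ k) (src h σ k -
      (hess h (σ ^ 2) + fun a b => σ ^ 2 * h a b) +
      (1 / 16 : ℝ) • (hess h (inner2 h k k) + fun a b => inner2 h k k * h a b)) := by
  intro a b x hx
  have h1 := hess_sq hσ a b hx
  have h2 := hess_inner2_self hk a b hx
  simp only [Pi.add_apply, Pi.sub_apply, Pi.mul_apply, Pi.smul_apply, smul_eq_mul] at h1 h2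
  simp only [QV_eq, QW_eq, src, srcSS, srcSK, srcKK, Pi.add_apply, Pi.sub_apply,
    Pi.mul_apply, Pi.smul_apply, smul_eq_mul, Pi.pow_apply, h1, h2]
  ring

lemma isSymTensor_of_frames (hT : Smooth2 U T)
    (H : ∀ x₀, ∀ L : LocalFrame U h x₀, ∀ I J, L.fr2 T I J = L.fr2 T J I) : IsSymTensor U T :=
  ⟨hT, agreeOn_of_frames (T := fun a b => T b a) hT (fun a b => hT b a) fun x₀ L I J => by
    rw [LocalFrame.j0, LocalFrame.j0, L.fr2_swap hT, H]⟩

lemma IsSymTensor.add (hS : IsSymTensor U S) (hT : IsSymTensor U T) :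
    IsSymTensor U (S + T) :=
  ⟨Smooth2.add hS.1 hT.1, fun a b _ hx => congrArg₂ (· + ·) (hS.2 a b hx) (hT.2 a b hx)⟩

lemma IsSymTensor.sub (hS : IsSymTensor U S) (hT : IsSymTensor U T) :
    IsSymTensor U (S - T) :=
  ⟨Smooth2.sub hS.1 hT.1, fun a b _ hx => congrArg₂ (· - ·) (hS.2 a b hx) (hT.2 a b hx)⟩

lemma IsSymTensor.smul (c : ℝ) (hT : IsSymTensor U T) : IsSymTensor U (c • T) :=
  ⟨Smooth2.smul c hT.1, fun a b _ hx => congrArg (c * ·) (hT.2 a b hx)⟩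

lemma IsSymTensor.neg (hT : IsSymTensor U T) : IsSymTensor U (-T) :=
  ⟨Smooth2.neg hT.1, fun a b _ hx => congrArg (-·) (hT.2 a b hx)⟩

lemma isSymTensor_symm (hT : Smooth2 U T) : IsSymTensor U (symm T) :=
  ⟨symm_mem hT, fun a b x _ => by simp only [symm, Pi.smul_apply, Pi.add_apply, add_comm]⟩

lemma isSymTensor_scalar_h (hf : f ∈ smoothOn U) : IsSymTensor U (fun a b => f * h a b) :=
  ⟨fun a b => mul_mem hf (h_mem a b), fun a b _ hx => congrArg (f _ * ·) (Patch.hyp.1.2 a b hx)⟩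

lemma isSymTensor_scalar (hf : f ∈ smoothOn U) (hT : IsSymTensor U T) :
    IsSymTensor U (fun a b => f * T a b) :=
  ⟨fun a b => mul_mem hf (hT.1 a b), fun a b _ hx => congrArg (f _ * ·) (hT.2 a b hx)⟩

lemma hess_symTensor (hf : f ∈ smoothOn U) : IsSymTensor U (hess h f) :=
  isSymTensor_of_frames (hess_mem hf) fun _ L I J => by
    rw [L.fr2_hess hf, L.frH_symm]

lemma prod2_self_symTensor (hk : Smooth2 U k) : IsSymTensor U (prod2 h k k) :=
  isSymTensor_of_frames (prod2_mem hk hk) fun _ L I J => by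
    simp only [L.fr2_prod2 hk hk, Fin.sum_univ_three, rev3]; ring

lemma DkDk_symTensor (hk : Smooth2 U k) : IsSymTensor U (DkDk h k) :=
  isSymTensor_of_frames (DkDk_mem hk) fun _ L I J => by
    simp only [L.fr2_DkDk hk, Fin.sum_univ_three, rev3]; ring

lemma sigDk_symTensor (hσ : σ ∈ smoothOn U) (hk : IsSymTensor U k) : IsSymTensor U (sigDk h σ k) :=
  isSymTensor_of_frames (sigDk_mem hσ hk.1) fun _ L I J => by
    simp only [L.fr2_sigDk hσ hk.1, L.N2_symm hk _ I]

lemma hessK_symTensor (hσ : σ ∈ smoothOn U) (hk : Smooth2 U k) : IsSymTensor U (hessK h σ k) :=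
  isSymTensor_symm (prod2_mem (hess_mem hσ) hk)

lemma sigDkSym_symTensor (hσ : σ ∈ smoothOn U) (hk : Smooth2 U k) :
    IsSymTensor U (sigDkSym h σ k) :=
  isSymTensor_symm fun _ _ => sum_smooth fun _ => mul_mem (up1_mem (grad_mem hσ) _)
    (D2_mem hk _ _ _)

lemma Yten_symTensor (hk : Smooth2 U k) : IsSymTensor U (Yten h k) := by
  rw [LocalFrame.Yten_eq]
  exact ((IsSymTensor.smul _ (isSymTensor_symm (LocalFrame.yOne_mem hk))).sub
    (IsSymTensor.smul _ (isSymTensor_symm (LocalFrame.yTwo_mem hk)))).sub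
    (IsSymTensor.smul _ (isSymTensor_symm (LocalFrame.yThree_mem hk)))

lemma src_symTensor (hσ : σ ∈ smoothOn U) (hk : IsSymTensor U k) : IsSymTensor U (src h σ k) := by
  have h1 := smul_smooth (U := U) 5 (pow_mem hσ 2)
  have hg := gradSq_mem hσ
  have hi := inner2_mem (hess_mem hσ) hk.1
  have h0 := smul_smooth (U := U) (1 / 8) (inner2_mem hk.1 hk.1)
  have hq := smul_smooth (U := U) (1 / 8) (DkSq_mem hk.1)
  refine IsSymTensor.add (IsSymTensor.add ?_ ?_) ?_
  · exact (isSymTensor_scalar_h (add_mem h1 hg)).add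
      ((isSymTensor_scalar hσ (hess_symTensor hσ)).smul 4)
  · exact (((((isSymTensor_scalar hσ hk).add (hessK_symTensor hσ hk.1)).sub
      (sigDk_symTensor hσ hk)).add (sigDkSym_symTensor hσ hk.1)).smul 4).sub
      (isSymTensor_scalar_h hi)
  · exact (((isSymTensor_scalar_h (add_mem h0 hq)).add (Yten_symTensor hk.1)).sub
      (prod2_self_symTensor hk.1)).sub ((DkDk_symTensor hk.1).smul _)

lemma QW_symTensor (hσ : σ ∈ smoothOn U) (hk : Smooth2 U k) : IsSymTensor U (QW h σ k) :=
  (isSymTensor_scalar_h (add_mem (smul_smooth _ (pow_mem hσ 2))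
    (smul_smooth _ (inner2_mem hk hk)))).sub ((prod2_self_symTensor hk).smul _)

lemma QV_symTensor (hσ : σ ∈ smoothOn U) (hk : IsSymTensor U k) : IsSymTensor U (QV h σ k) := by
  have h1 := smul_smooth (U := U) 6 (pow_mem hσ 2)
  have hg := gradSq_mem hσ
  have hi := inner2_mem (hess_mem hσ) hk.1
  have h0 := smul_smooth (U := U) (1 / 8) (inner2_mem hk.1 hk.1)
  have hq := smul_smooth (U := U) (1 / 8) (DkSq_mem hk.1)
  have hd : IsSymTensor U (fun a b => grad σ a * grad σ b) :=
    ⟨fun a b => mul_mem (grad_mem hσ a) (grad_mem hσ b), fun a b _ _ => mul_comm _ _⟩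
  rw [QV_eq]
  exact (((((((((((isSymTensor_scalar_h (add_mem (add_mem (add_mem h1 hg) h0) hq)).add
    ((isSymTensor_scalar hσ (hess_symTensor hσ)).smul 2)).sub (hd.smul 2)).add
    ((isSymTensor_scalar hσ hk).smul 4)).sub ((sigDk_symTensor hσ hk).smul 4)).add
    ((sigDkSym_symTensor hσ hk.1).smul 4)).add ((hessK_symTensor hσ hk.1).smul 4)).sub
    (isSymTensor_scalar_h hi)).sub ((prod2_self_symTensor hk.1).smul _)).sub
    ((DkDk_symTensor hk.1).smul _)).add ((isSymTensor_symm (kDDk_mem' hk.1)).smul _)).add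
    (Yten_symTensor hk.1)

lemma dvg_src (hσ : σ ∈ smoothOn U) (hk : IsSDT U h k) (hF : FirstOrderEqs U h σ k) (a : Fin 3) :
    EqOn (dvg h (src h σ k) a) (grad (tr h (src h σ k)) a) U := by
  have hm := src_mem hσ hk.1.1
  have h1 := srcSS_mem hσ
  have h2 := srcSK_mem hσ hk.1.1
  have h3 := srcKK_mem hk.1.1
  refine eqOn_of_frames (dvg_mem hm) (grad_mem (tr_mem hm)) (fun _ L I => ?_) a
  obtain ⟨D⟩ := exists_jetData L hσ hk hF
  rw [fr1_grad_tr L hm, L.ev0_dvg hm]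
  simp only [src, L.j1_add (h1.add h2) h3, L.j1_add h1 h2, Finset.sum_add_distrib,
    L.srcSS_div D hσ, L.srcSK_div D hσ hk.1.1, L.srcKK_div D hk.1.1]

/-- The curl of a conformal multiple of the metric is antisymmetric. -/
lemma curl_scalar_h_antisymm (hf : f ∈ smoothOn U) :
    AgreeOn U (symCurl h (fun a b => f * h a b)) 0 := by
  have hm : Smooth2 U (fun a b => f * h a b) := fun a b => mul_mem hf (h_mem a b)
  have hc := curl_mem hm
  refine agreeOn_of_frames (symm_mem hc) (T := 0) (fun _ _ => zero_mem _) fun _ L I J => ?_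
  have e0 : L.j0 0 I J = 0 := by
    rw [LocalFrame.j0]
    exact (congrArg L.ev0 (Sm.ext_ev fun x => by
      rw [L.ev_fr2 (U := U) (T := 0) fun _ _ => zero_mem _]; simp [t1])).trans (map_zero L.ev0)
  rw [e0, symCurl, LocalFrame.j0, L.fr2_symm hc, map_smul, map_add]
  change (1 / 2 : ℝ) • (L.j0 (curl h _) I J + L.j0 (curl h _) J I) = 0
  simp only [L.j0_curl hm, L.j1_scalar_h hf]
  induction I using fin3_cases <;> induction J using fin3_cases <;>
    simp only [ncross_values, null_values] <;> simp

lemma symm_of_symTensor (hT : IsSymTensor U T) : AgreeOn U (symm T) T := fun a b x hx => by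
  have := hT.2 a b hx
  simp only [symm, Pi.smul_apply, Pi.add_apply, smul_eq_mul]; linarith

lemma symCurl_add (hS : Smooth2 U S) (hT : Smooth2 U T) :
    AgreeOn U (symCurl h (S + T)) (symCurl h S + symCurl h T) := fun a b x hx => by
  have h1 := curl_add hS hT a b hx
  have h2 := curl_add hS hT b a hx
  simp only [Pi.add_apply] at h1 h2
  simp only [symCurl, symm, Pi.smul_apply, Pi.add_apply, smul_eq_mul, h1, h2]; ring

theorem curl_src_symTensor (hσ : σ ∈ smoothOn U) (hk : IsSDT U h k) (hF : FirstOrderEqs U h σ k) :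
    IsSymTensor U (curl h (src h σ k)) :=
  curl_symmetric (src_symTensor hσ hk.1) (dvg_src hσ hk hF)

theorem symCurl_kappa (hσ : σ ∈ smoothOn U) (hk : IsSDT U h k) (hF : FirstOrderEqs U h σ k) :
    AgreeOn U (symCurl h (kappa h σ k)) (curl h (src h σ k)) := by
  have hi := inner2_mem (hess_mem hσ) hk.1.1
  have hg : (-(3 : ℝ) • σ ^ 2 - (3 : ℝ) • gradSq h σ + (5 / 8 : ℝ) • inner2 h k k +
      (1 / 8 : ℝ) • DkSq h k - inner2 h (hess h σ) k) ∈ smoothOn U :=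
    sub_mem (add_mem (add_mem (sub_mem (smul_smooth _ (pow_mem hσ 2))
      (smul_smooth _ (gradSq_mem hσ))) (smul_smooth _ (inner2_mem hk.1.1 hk.1.1)))
      (smul_smooth _ (DkSq_mem hk.1.1))) hi
  rw [kappa_eq]
  refine (symCurl_add (src_mem hσ hk.1.1) (scalar_mem hg h_mem)).trans ?_
  have := (symm_of_symTensor (curl_src_symTensor hσ hk hF)).add
    (curl_scalar_h_antisymm hg)
  rwa [add_zero] at this

lemma curl_hess_add (hf : f ∈ smoothOn U) :
    AgreeOn U (curl h (hess h f + fun a b => f * h a b)) 0 := fun a b x hx => by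
  have h1 := curl_add (hess_mem hf) (scalar_mem hf h_mem) a b hx
  have h2 := curl_hess hf a b hx
  simp only [Pi.add_apply, Pi.neg_apply] at h1 h2
  simp only [h1, h2, Pi.zero_apply]; ring

theorem curl_QV_add_QW (hσ : σ ∈ smoothOn U) (hk : IsSDT U h k) (hF : FirstOrderEqs U h σ k) :
    AgreeOn U (curl h (QV h σ k + QW h σ k)) (symCurl h (kappa h σ k)) := by
  have h2 : σ ^ 2 ∈ smoothOn U := pow_mem hσ 2
  have hi := inner2_mem hk.1.1 hk.1.1
  have m1 := src_mem hσ hk.1.1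
  have m2 := (hess_mem h2).add (scalar_mem h2 h_mem)
  have m3 := (hess_mem hi).add (scalar_mem hi h_mem)
  have mQ := (QV_mem hσ hk.1.1).add (QW_mem hσ hk.1.1)
  refine AgreeOn.trans ?_ (symCurl_kappa hσ hk hF).symm
  refine (curl_congr mQ ((m1.sub m2).add (Smooth2.smul _ m3))
    (QV_add_QW hσ hk.1.1)).trans ?_
  refine (curl_add (m1.sub m2) (Smooth2.smul _ m3)).trans ?_
  intro a b x hx
  have e1 := curl_sub m1 m2 a b hx
  have e2 := curl_smul (1 / 16) m3 a b hx
  have e3 := curl_hess_add h2 a b hx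
  have e4 := curl_hess_add hi a b hx
  simp only [Pi.sub_apply, Pi.smul_apply, Pi.zero_apply, smul_eq_mul] at e1 e2 e3 e4
  simp only [Pi.add_apply, e1, e2, e3, e4]; ring

lemma symCurl_kappa_symTensor (hσ : σ ∈ smoothOn U) (hk : IsSDT U h k) :
    IsSymTensor U (symCurl h (kappa h σ k)) :=
  isSymTensor_symm (curl_mem (kappa_mem hσ hk.1.1))

end

/-! ### Trace and divergence of the quadratic tensors -/

namespace LocalFrame

variable (L : LocalFrame U h x₀)
variable [Patch U h]

lemma fr2_Yten_eq (D : JetData L σ k) (hk : Smooth2 U k) (I J : Fin 3) :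
    L.j0 (Yten h k) I J = L.j0 (symm (DkDkMixed h k) + kDcDk h k - symm (kDaDk h k) -
      DkDkCross h k) I J := by
  have m1 := DkDkMixed_mem hk
  have m2 := kDcDk_mem hk
  have m3 := kDaDk_mem hk
  have m4 := DkDkCross_mem hk
  rw [L.j0_sub (((symm_mem m1).add m2).sub (symm_mem m3)) m4, L.j0_sub ((symm_mem m1).add m2)
    (symm_mem m3), L.j0_add (symm_mem m1) m2]
  simp only [j0]
  rw [L.fr2_symm m1, L.fr2_symm m3]
  simp only [L.fr2_DkDkMixed hk, L.fr2_DkDkCross hk, L.fr2_kDcDk hk,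
    L.fr2_kDaDk hk, L.fr2_Yten hk, map_add, map_sub, map_sum, map_mul, map_smul,
    smul_eq_mul, ncross, ev0_fr2, ev0_N2_fr2]
  have e2 : ∀ P K I J, L.ev0 (L.G.N3 (L.G.N2 (L.fr2 k)) P K I J) = L.j2 k P K I J :=
    fun _ _ _ _ => rfl
  simp only [e2, D.k0, D.k1, D.k2, D.B0, D.B1]
  induction I using fin3_cases <;> induction J using fin3_cases <;>
  simp only [Fin.sum_univ_three, rev3, null_values, stf2_values, jet_values, cross_values, Nat.reduceAdd,
    Nat.reduceLeDiff, Nat.reduceLT, ite_true, ite_false] <;> ring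

lemma fr2_QV (hσ : σ ∈ smoothOn U) (hk : Smooth2 U k) (I J : Fin 3) :
    L.fr2 (QV h σ k) I J = ((6 : ℝ) • (L.fr0 σ * L.fr0 σ) + (∑ K, L.G.e K (L.fr0 σ) * L.G.e K.rev (L.fr0 σ)) +
      (1 / 8 : ℝ) • (∑ K, ∑ M, L.fr2 k K M * L.fr2 k K.rev M.rev) +
      (1 / 8 : ℝ) • ∑ K, ∑ M, ∑ P, L.G.N2 (L.fr2 k) K M P *
        L.G.N2 (L.fr2 k) K.rev M.rev P.rev) * nullMetric _ I J +
      (2 : ℝ) • (L.fr0 σ * L.frH σ I J) - (2 : ℝ) • (L.G.e I (L.fr0 σ) * L.G.e J (L.fr0 σ)) +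
      (4 : ℝ) • (L.fr0 σ * L.fr2 k I J) - (4 : ℝ) • (∑ K, L.G.e K.rev (L.fr0 σ) * L.G.N2 (L.fr2 k) K I J) +
      (4 : ℝ) • ((1 / 2 : ℝ) • ((∑ K, L.G.e K.rev (L.fr0 σ) * L.G.N2 (L.fr2 k) I J K) +
        ∑ K, L.G.e K.rev (L.fr0 σ) * L.G.N2 (L.fr2 k) J I K)) +
      (4 : ℝ) • ((1 / 2 : ℝ) • ((∑ K, L.frH σ I K * L.fr2 k J K.rev) + ∑ K, L.frH σ J K * L.fr2 k I K.rev)) -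
      (∑ K, ∑ M, L.frH σ K M * L.fr2 k K.rev M.rev) * nullMetric _ I J -
      (1 / 2 : ℝ) • (∑ K, L.fr2 k I K * L.fr2 k J K.rev) -
      (3 / 8 : ℝ) • (∑ K, ∑ M, L.G.N2 (L.fr2 k) I K M * L.G.N2 (L.fr2 k) J K.rev M.rev) +
      (1 / 8 : ℝ) • L.fr2 (kDDk h k) I J + L.fr2 (Yten h k) I J := by
  have h1 := smul_smooth (U := U) 6 (pow_mem hσ 2)
  have hg := gradSq_mem hσ
  have hi := inner2_mem (hess_mem hσ) hk
  have h0' := inner2_mem hk hk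
  have hq' := DkSq_mem hk
  have h0 := smul_smooth (U := U) (1 / 8) h0'
  have hq := smul_smooth (U := U) (1 / 8) hq'
  have hd : Smooth2 U (fun a b => grad σ a * grad σ b) :=
    fun a b => mul_mem (grad_mem hσ a) (grad_mem hσ b)
  have a1 := scalar_mem (add_mem (add_mem (add_mem h1 hg) h0) hq) h_mem
  have b2 := scalar_mem hσ (hess_mem hσ)
  have b4 := scalar_mem hσ hk
  have b5 := sigDk_mem hσ hk
  have b6 := sigDkSym_mem hσ hk
  have b7 := hessK_mem hσ hk
  have b8 := scalar_mem hi h_mem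
  have b9 := prod2_mem hk hk
  have b10 := DkDk_mem hk
  have b11 := kDDk_mem hk
  have b12 := Yten_mem hk
  have a2 := a1.add (Smooth2.smul 2 b2)
  have a3 := a2.sub (Smooth2.smul 2 hd)
  have a4 := a3.add (Smooth2.smul 4 b4)
  have a5 := a4.sub (Smooth2.smul 4 b5)
  have a6 := a5.add (Smooth2.smul 4 b6)
  have a7 := a6.add (Smooth2.smul 4 b7)
  have a8 := a7.sub b8
  have a9 := a8.sub (Smooth2.smul (1 / 2) b9)
  have a10 := a9.sub (Smooth2.smul (3 / 8) b10)
  have a11 := a10.add (Smooth2.smul (1 / 8) b11)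
  rw [QV_eq, L.fr2_add a11 b12, L.fr2_add a10 (Smooth2.smul _ b11), L.fr2_sub a9 (Smooth2.smul _ b10),
    L.fr2_sub a8 (Smooth2.smul _ b9), L.fr2_sub a7 b8, L.fr2_add a6 (Smooth2.smul _ b7),
    L.fr2_add a5 (Smooth2.smul _ b6), L.fr2_sub a4 (Smooth2.smul _ b5), L.fr2_add a3 (Smooth2.smul _ b4),
    L.fr2_sub a2 (Smooth2.smul _ hd), L.fr2_add a1 (Smooth2.smul _ b2), L.fr2_smul _ b2,
    L.fr2_smul _ hd, L.fr2_smul _ b4, L.fr2_smul _ b5, L.fr2_smul _ b6, L.fr2_smul _ b7,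
    L.fr2_smul _ b9, L.fr2_smul _ b10, L.fr2_smul _ b11]
  simp only [Pi.add_apply, Pi.smul_apply, Pi.sub_apply]
  rw [L.fr2_scalar (add_mem (add_mem (add_mem h1 hg) h0) hq) h_mem,
    L.fr0_add (add_mem (add_mem h1 hg) h0) hq, L.fr0_add (add_mem h1 hg) h0, L.fr0_add h1 hg,
    L.fr0_smul _ h0', L.fr0_smul _ hq', L.fr0_smul _ (pow_mem hσ 2), L.fr0_pow hσ,
    L.fr0_gradSq hσ, L.fr0_inner2 hk hk, L.fr0_DkSq hk, L.fr2_h,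
    L.fr2_scalar hσ (hess_mem hσ), L.fr2_hess hσ, L.fr2_tensor (grad_mem hσ) (grad_mem hσ),
    L.fr1_grad hσ, L.fr2_scalar hσ hk, L.fr2_sigDk hσ hk, L.fr2_sigDkSym hσ hk,
    L.fr2_hessK hσ hk, L.fr2_scalar hi h_mem, L.fr0_inner2 (hess_mem hσ) hk,
    L.fr2_prod2 hk hk, L.fr2_DkDk hk, L.fr2_h, L.fr2_hess hσ, pow_two]

lemma s0_tr_QV (D : JetData L σ k) (hσ : σ ∈ smoothOn U) (hk : Smooth2 U k) :
    L.s0 (tr h (QV h σ k)) = L.s0 ((12 : ℝ) • σ ^ 2 + gradSq h σ + (1 / 4 : ℝ) • inner2 h k k +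
      inner2 h k (hess h σ)) := by
  have h1 := smul_smooth (U := U) 12 (pow_mem hσ 2)
  have hg := gradSq_mem hσ
  have hi := inner2_mem hk (hess_mem hσ)
  have h0' := inner2_mem hk hk
  have h0 := smul_smooth (U := U) (1 / 4) h0'
  rw [L.s0_tr (QV_mem hσ hk), s0, L.fr0_add (add_mem (add_mem h1 hg) h0) hi,
    L.fr0_add (add_mem h1 hg) h0, L.fr0_add h1 hg, L.fr0_smul _ h0', L.fr0_smul _ (pow_mem hσ 2),
    L.fr0_pow hσ, L.fr0_gradSq hσ, L.fr0_inner2 hk hk,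
    L.fr0_inner2 hk (hess_mem hσ), L.fr2_hess hσ, pow_two]
  simp only [j0]
  simp only [L.fr2_QV hσ hk, L.fr2_kDDk hk, L.fr2_Yten hk, map_add, map_sub, map_sum,
    map_mul, map_smul, smul_eq_mul, ncross, ev0_fr2, ev0_N2_fr2, ev0_fr0, ev0_e_fr0, ev0_frH, ev0_null]
  have e2 : ∀ P K I J, L.ev0 (L.G.N3 (L.G.N2 (L.fr2 k)) P K I J) = L.j2 k P K I J :=
    fun _ _ _ _ => rfl
  simp only [e2, D.k0, D.k1, D.k2, D.B0, D.B1, D.f2]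
  simp only [Fin.sum_univ_three, rev3, null_values, stf2_values, jet_values, cross_values, Nat.reduceAdd,
    Nat.reduceLeDiff, Nat.reduceLT, ite_true, ite_false]
  ring

end LocalFrame

/-- The right-hand side of the trace equation. -/
def traceSrc (h : Cov2) (σ : Fld 3) (k : Cov2) : Fld 3 :=
  (12 : ℝ) • σ ^ 2 + gradSq h σ + (1 / 4 : ℝ) • inner2 h k k + inner2 h k (hess h σ)

/-- The right-hand side of the divergence equation. -/
def divSrc (h : Cov2) (σ : Fld 3) (k : Cov2) : Cov1 := fun a =>
  (1 / 2 : ℝ) • (∑ b, ∑ c, ∑ d, ginv h b d * D2 h k d a c * mixed h k b c) +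
    pd a (gradSq h σ + (8 : ℝ) • σ ^ 2 - (1 / 8 : ℝ) • inner2 h k k + inner2 h k (hess h σ))

namespace LocalFrame

variable (L : LocalFrame U h x₀)

lemma s0_add (hf : f ∈ smoothOn U) (hg : g ∈ smoothOn U) :
    L.s0 (f + g) = L.s0 f + L.s0 g := by rw [s0, L.fr0_add hf hg, map_add]; rfl

lemma s0_smul (c : ℝ) (hf : f ∈ smoothOn U) : L.s0 (c • f) = c * L.s0 f := by
  rw [s0, L.fr0_smul c hf, map_smul]; rfl

lemma s1_add (hf : f ∈ smoothOn U) (hg : g ∈ smoothOn U) (I : Fin 3) :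
    L.s1 (f + g) I = L.s1 f I + L.s1 g I := by rw [s1, L.fr0_add hf hg, map_add, map_add]; rfl

lemma s1_smul (c : ℝ) (hf : f ∈ smoothOn U) (I : Fin 3) :
    L.s1 (c • f) I = c * L.s1 f I := by
  rw [s1, L.fr0_smul c hf, Derivation.map_smul, map_smul]; rfl

lemma s2_add (hf : f ∈ smoothOn U) (hg : g ∈ smoothOn U) (I J : Fin 3) :
    L.s2 (f + g) I J = L.s2 f I J + L.s2 g I J := by
  simp only [← ev0_e_e, L.fr0_add hf hg, map_add]

lemma s2_smul (c : ℝ) (hf : f ∈ smoothOn U) (I J : Fin 3) :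
    L.s2 (c • f) I J = c * L.s2 f I J := by
  simp only [← ev0_e_e, L.fr0_smul c hf, Derivation.map_smul, map_smul, smul_eq_mul]

lemma j2_sub (hS : Smooth2 U S) (hT : Smooth2 U T) (P K I J : Fin 3) :
    L.j2 (S - T) P K I J = L.j2 S P K I J - L.j2 T P K I J := by
  have h1 : S - T = S + (-1 : ℝ) • T := by rw [neg_one_smul, sub_eq_add_neg]
  rw [h1, L.j2_add hS (hT.smul _), L.j2_smul _ hT]; ring

variable [Patch U h]

lemma j2_scalar_h (hf : f ∈ smoothOn U) (P K I J : Fin 3) :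
    L.j2 (fun a b => f * h a b) P K I J = L.s2 f P K * nullMetric ℝ I J := by
  have h1 : L.G.N2 (L.fr2 fun a b => f * h a b) K I J = L.G.e K (L.fr0 f) * nullMetric _ I J := by
    obtain ⟨o1, o2, o3, o4, o5, o6⟩ := L.G.om_vals K
    rw [Framed.N2]
    simp only [L.fr2_scalar hf h_mem, L.fr2_h, Derivation.leibniz, e_null, smul_zero, zero_add,
      smul_eq_mul]
    induction I using fin3_cases <;> induction J using fin3_cases <;>
    simp only [Fin.sum_univ_three, null_values, o1, o2, o3, o4, o5, o6] <;> ring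
  rw [← ev0_e_N2, h1, Derivation.leibniz, e_null, smul_zero, zero_add, smul_eq_mul, map_mul, ev0_null,
    ev0_e_e, mul_comm]

lemma s0_boxS (hf : f ∈ smoothOn U) : L.s0 (boxS h f) = ∑ I, L.s2 f I I.rev := by
  rw [boxS, L.s0_tr (hess_mem hf)]
  simp only [L.j0_hess hf]

lemma sum_j2_of_box (hk : IsSDT U h k) (hF : FirstOrderEqs U h σ k) (I J : Fin 3) :
    ∑ P, L.j2 k P P.rev I J = 3 * L.j0 k I J := by
  have h3 : Smooth2 U ((3 : ℝ) • k) := Smooth2.smul 3 hk.1.1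
  rw [← L.j0_box hk.1.1, ← L.j0_smul 3 hk.1.1, j0, j0]
  refine congrArg L.ev0 (congrFun (congrFun (L.fr2_congr (boxT_mem hk.1.1) h3
    fun a b x hx => ?_) I) J)
  have := hF.2 a b hx
  simp only [Pi.sub_apply, Pi.zero_apply] at this
  linarith

lemma sum_s2_of_box (hσ : σ ∈ smoothOn U) (hF : FirstOrderEqs U h σ k) :
    ∑ P, L.s2 σ P P.rev = -3 * L.s0 σ := by
  rw [← L.s0_boxS hσ, ← L.s0_smul (-3) hσ, s0, s0]
  refine congrArg L.ev0 (L.fr0_congr (tr_mem (hess_mem hσ)) (smul_smooth _ hσ)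
    fun x hx => ?_)
  have := hF.1 hx
  simp only [Pi.add_apply, Pi.smul_apply, smul_eq_mul, Pi.zero_apply] at this ⊢
  linarith

end LocalFrame

section

variable [Patch U h]

lemma hess_add (hf : f ∈ smoothOn U) (hg : g ∈ smoothOn U) :
    AgreeOn U (hess h (f + g)) (hess h f + hess h g) := by
  have h1 := hess_mem hf
  have h2 := hess_mem hg
  refine agreeOn_of_frames (hess_mem (add_mem hf hg)) (h1.add h2) fun _ L I J => ?_
  rw [L.j0_add h1 h2, L.j0_hess hf, L.j0_hess hg, L.j0_hess (add_mem hf hg),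
    L.s2_add hf hg]

lemma hess_smul (c : ℝ) (hf : f ∈ smoothOn U) :
    AgreeOn U (hess h (c • f)) (c • hess h f) := by
  have h1 := hess_mem hf
  refine agreeOn_of_frames (hess_mem (smul_smooth c hf)) (Smooth2.smul c h1)
    fun _ L I J => ?_
  rw [L.j0_smul c h1, L.j0_hess hf, L.j0_hess (smul_smooth c hf), L.s2_smul c hf]

lemma inner2_comm (hS : Smooth2 U S) (hT : Smooth2 U T) :
    EqOn (inner2 h S T) (inner2 h T S) U :=
  eqOn_of_frames₀ (inner2_mem hS hT) (inner2_mem hT hS) fun _ L => by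
    rw [LocalFrame.s0, LocalFrame.s0, L.fr0_inner2 hS hT, L.fr0_inner2 hT hS]
    simp only [Fin.sum_univ_three, rev3]; congr 1; ring

lemma boxS_sq (hσ : σ ∈ smoothOn U) (hF : FirstOrderEqs U h σ k) :
    EqOn (boxS h (σ ^ 2)) ((2 : ℝ) • gradSq h σ - (6 : ℝ) • σ ^ 2) U := by
  have hg := gradSq_mem hσ
  have h2 := pow_mem hσ 2
  refine eqOn_of_frames₀ (tr_mem (hess_mem h2)) (sub_mem (smul_smooth _ hg)
    (smul_smooth _ h2)) fun _ L => ?_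
  rw [L.s0_boxS h2, LocalFrame.s0, L.fr0_sub (smul_smooth _ hg) (smul_smooth _ h2),
    L.fr0_smul _ hg, L.fr0_smul _ h2, L.fr0_gradSq hσ, L.fr0_pow hσ]
  simp only [L.s2_sq hσ, map_sub, map_smul, map_sum, map_mul, smul_eq_mul, map_pow,
    L.ev0_e_fr0, L.ev0_fr0, Finset.sum_add_distrib, ← Finset.mul_sum, L.sum_s2_of_box hσ hF]
  ring

lemma boxS_inner2_self (hk : IsSDT U h k) (hF : FirstOrderEqs U h σ k) :
    EqOn (boxS h (inner2 h k k)) ((6 : ℝ) • inner2 h k k + (2 : ℝ) • DkSq h k) U := by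
  have hi := inner2_mem hk.1.1 hk.1.1
  have hq := DkSq_mem hk.1.1
  refine eqOn_of_frames₀ (tr_mem (hess_mem hi)) (add_mem (smul_smooth _ hi)
    (smul_smooth _ hq)) fun _ L => ?_
  have hb := L.sum_j2_of_box hk hF
  rw [L.s0_boxS hi, L.s0_add (smul_smooth _ hi) (smul_smooth _ hq), L.s0_smul _ hi,
    L.s0_smul _ hq, LocalFrame.s0, LocalFrame.s0, L.fr0_inner2 hk.1.1 hk.1.1,
    L.fr0_DkSq hk.1.1]
  simp only [L.s2_inner2_self hk.1.1, map_sum, map_mul, L.ev0_fr2, L.ev0_N2_fr2]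
  have e : ∑ K, ∑ M, (∑ P, L.j2 k P P.rev K M) * L.j0 k K.rev M.rev =
      3 * ∑ K, ∑ M, L.j0 k K M * L.j0 k K.rev M.rev := by
    simp only [hb, Finset.mul_sum, mul_assoc]
  simp only [Fin.sum_univ_three, rev3] at e ⊢
  linear_combination 2 * e

lemma boxT_prod2_self (hk : IsSDT U h k) (hF : FirstOrderEqs U h σ k) :
    AgreeOn U (boxT h (prod2 h k k)) ((6 : ℝ) • prod2 h k k + (2 : ℝ) • DkDkInner h k) := by
  have hp := prod2_mem hk.1.1 hk.1.1
  have hi := DkDkInner_mem hk.1.1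
  refine agreeOn_of_frames (boxT_mem hp) ((Smooth2.smul 6 hp).add (Smooth2.smul 2 hi))
    fun _ L I J => ?_
  have hb := L.sum_j2_of_box hk hF
  rw [L.j0_box hp, L.j0_add (Smooth2.smul 6 hp) (Smooth2.smul 2 hi), L.j0_smul _ hp,
    L.j0_smul _ hi, LocalFrame.j0, LocalFrame.j0, L.fr2_prod2 hk.1.1 hk.1.1,
    L.fr2_DkDkInner hk.1.1]
  simp only [L.j2_prod2_self hk.1.1, map_sum, map_mul, L.ev0_fr2, L.ev0_N2_fr2,
    L.j1_symm hk.1 _ _ J]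
  have e : ∑ K, ((∑ P, L.j2 k P P.rev I K) * L.j0 k J K.rev + L.j0 k I K * ∑ P, L.j2 k P P.rev J K.rev) =
      6 * ∑ K, L.j0 k I K * L.j0 k J K.rev := by
    simp only [hb, Finset.mul_sum]
    exact Finset.sum_congr rfl fun _ _ => by ring
  simp only [Fin.sum_univ_three, rev3] at e ⊢
  linear_combination e

lemma QW_scalar_mem (hσ : σ ∈ smoothOn U) (hk : Smooth2 U k) :
    -(2 : ℝ) • σ ^ 2 + (1 / 16 : ℝ) • inner2 h k k ∈ smoothOn U :=
  add_mem (smul_smooth _ (pow_mem hσ 2)) (smul_smooth _ (inner2_mem hk hk))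

lemma boxT_QW (hσ : σ ∈ smoothOn U) (hk : IsSDT U h k) (hF : FirstOrderEqs U h σ k) :
    AgreeOn U (boxT h (QW h σ k)) ((fun a b => (-(2 : ℝ) • ((2 : ℝ) • gradSq h σ - (6 : ℝ) • σ ^ 2) +
      (1 / 16 : ℝ) • ((6 : ℝ) • inner2 h k k + (2 : ℝ) • DkSq h k)) * h a b) -
      (1 / 2 : ℝ) • ((6 : ℝ) • prod2 h k k + (2 : ℝ) • DkDkInner h k)) := by
  have hf := QW_scalar_mem hσ hk.1.1
  have hm := scalar_mem hf h_mem
  have hp := prod2_mem hk.1.1 hk.1.1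
  have hi := inner2_mem hk.1.1 hk.1.1
  have h2 := pow_mem hσ 2
  have hf' : boxS h (-(2 : ℝ) • σ ^ 2 + (1 / 16 : ℝ) • inner2 h k k) ∈ smoothOn U :=
    tr_mem (hess_mem hf)
  have hB : AgreeOn U (boxT h (QW h σ k))
      ((fun a b => boxS h (-(2 : ℝ) • σ ^ 2 + (1 / 16 : ℝ) • inner2 h k k) * h a b) -
        (1 / 2 : ℝ) • boxT h (prod2 h k k)) := by
    have m2 := Smooth2.smul (1 / 2) (boxT_mem hp)
    refine agreeOn_of_frames (boxT_mem (QW_mem hσ hk.1.1))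
      ((scalar_mem hf' h_mem).sub m2) fun _ L I J => ?_
    rw [L.j0_box (QW_mem hσ hk.1.1), L.j0_sub (scalar_mem hf' h_mem) m2,
      L.j0_smul _ (boxT_mem hp), L.j0_box hp, L.j0_scalar_h hf', L.s0_boxS hf,
      Finset.mul_sum, Finset.sum_mul, ← Finset.sum_sub_distrib]
    refine Finset.sum_congr rfl fun K _ => ?_
    rw [QW_eq, L.j2_sub hm (Smooth2.smul _ hp), L.j2_smul _ hp, L.j2_scalar_h hf]
  refine hB.trans fun a b x hx => ?_
  have e1 : boxS h (-(2 : ℝ) • σ ^ 2 + (1 / 16 : ℝ) • inner2 h k k) x =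
      -2 * boxS h (σ ^ 2) x + (1 / 16) * boxS h (inner2 h k k) x := by
    have t1 : EqOn _ _ U := tr_congr (h := h) (hess_add (smul_smooth (-2) h2) (smul_smooth (1 / 16) hi))
    have t2 : EqOn _ _ U := tr_congr (h := h) (hess_smul (-2) h2)
    have t3 : EqOn _ _ U := tr_congr (h := h) (hess_smul (1 / 16) hi)
    have := t1 hx
    rw [tr_add] at this
    have t2' := t2 hx
    have t3' := t3 hx
    rw [tr_smul] at t2' t3'
    rw [Pi.add_apply, t2', t3'] at this
    exact this
  have e2 := boxS_sq hσ hF hx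
  have e3 := boxS_inner2_self hk hF hx
  have e4 := boxT_prod2_self hk hF a b hx
  simp only [Pi.add_apply, Pi.sub_apply, Pi.mul_apply, Pi.smul_apply, smul_eq_mul] at e1 e2 e3 e4
  simp only [Pi.add_apply, Pi.sub_apply, Pi.mul_apply, Pi.smul_apply, smul_eq_mul, e1, e2, e3, e4]

lemma tr_QW (hσ : σ ∈ smoothOn U) (hk : Smooth2 U k) :
    EqOn (tr h (QW h σ k)) (-(6 : ℝ) • σ ^ 2 + (-(5 / 16) : ℝ) • inner2 h k k) U := by
  have hf := QW_scalar_mem hσ hk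
  have hm := scalar_mem hf h_mem
  have hp := prod2_mem hk hk
  have hi := inner2_mem hk hk
  have h2 := pow_mem hσ 2
  refine eqOn_of_frames₀ (tr_mem (QW_mem hσ hk)) (add_mem (smul_smooth _ h2)
    (smul_smooth _ hi)) fun _ L => ?_
  rw [L.s0_tr (QW_mem hσ hk), L.s0_add (smul_smooth _ h2) (smul_smooth _ hi),
    L.s0_smul _ h2, L.s0_smul _ hi, QW_eq]
  simp only [L.j0_sub hm (Smooth2.smul _ hp), L.j0_smul _ hp, L.j0_scalar_h hf,
    L.s0_add (smul_smooth (-2) h2) (smul_smooth (1 / 16) hi), L.s0_smul _ h2, L.s0_smul _ hi]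
  simp only [LocalFrame.j0, LocalFrame.s0, L.fr2_prod2 hk hk, L.fr0_inner2 hk hk, map_sum,
    map_mul]
  simp only [Fin.sum_univ_three, rev3, null_values]
  ring

theorem tr_QV (hσ : σ ∈ smoothOn U) (hk : IsSDT U h k) (hF : FirstOrderEqs U h σ k) :
    EqOn (tr h (QV h σ k)) (traceSrc h σ k) U :=
  eqOn_of_frames₀ (tr_mem (QV_mem hσ hk.1.1))
    (add_mem (add_mem (add_mem (smul_smooth _ (pow_mem hσ 2)) (gradSq_mem hσ))
      (smul_smooth _ (inner2_mem hk.1.1 hk.1.1)))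
      (inner2_mem hk.1.1 (hess_mem hσ))) fun _ L => by
    obtain ⟨D⟩ := exists_jetData L hσ hk hF
    exact L.s0_tr_QV D hσ hk.1.1

theorem Yten_eq_products (hσ : σ ∈ smoothOn U) (hk : IsSDT U h k) (hF : FirstOrderEqs U h σ k) :
    AgreeOn U (Yten h k) (symm (DkDkMixed h k) + kDcDk h k - symm (kDaDk h k) - DkDkCross h k) :=
  agreeOn_of_frames (Yten_mem hk.1.1)
    ((((symm_mem (DkDkMixed_mem hk.1.1)).add (kDcDk_mem hk.1.1)).sub
      (symm_mem (kDaDk_mem hk.1.1))).sub (DkDkCross_mem hk.1.1)) fun _ L I J => by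
    obtain ⟨D⟩ := exists_jetData L hσ hk hF
    exact L.fr2_Yten_eq D hk.1.1 I J

end

section

variable [Patch U h]

lemma traceSrc_mem (hσ : σ ∈ smoothOn U) (hk : Smooth2 U k) : traceSrc h σ k ∈ smoothOn U :=
  add_mem (add_mem (add_mem (smul_smooth _ (pow_mem hσ 2)) (gradSq_mem hσ))
    (smul_smooth _ (inner2_mem hk hk))) (inner2_mem hk (hess_mem hσ))

lemma divTerm_mem (hk : Smooth2 U k) :
    Smooth1 U (fun a => ∑ b, ∑ c, ∑ d, ginv h b d * D2 h k d a c * mixed h k b c) := fun _ =>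
  sum_smooth fun _ => sum_smooth fun _ => sum_smooth fun _ =>
    mul_mem (mul_mem (ginv_mem _ _) (D2_mem hk _ _ _)) (mixed_mem hk _ _)

lemma divSrc_scalar_mem (hσ : σ ∈ smoothOn U) (hk : Smooth2 U k) :
    gradSq h σ + (8 : ℝ) • σ ^ 2 - (1 / 8 : ℝ) • inner2 h k k + inner2 h k (hess h σ) ∈ smoothOn U :=
  add_mem (sub_mem (add_mem (gradSq_mem hσ) (smul_smooth _ (pow_mem hσ 2)))
    (smul_smooth _ (inner2_mem hk hk))) (inner2_mem hk (hess_mem hσ))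

lemma divSrc_mem (hσ : σ ∈ smoothOn U) (hk : Smooth2 U k) : Smooth1 U (divSrc h σ k) := fun a =>
  add_mem (smul_smooth _ (divTerm_mem hk a)) (grad_mem (divSrc_scalar_mem hσ hk) a)

lemma ev0_divSrc (L : LocalFrame U h x₀) (hσ : σ ∈ smoothOn U) (hk : Smooth2 U k)
    (I : Fin 3) : L.ev0 (L.fr1 (divSrc h σ k) I) =
      1 / 2 * (∑ K, ∑ M, L.j1 k K I M * L.j0 k K.rev M.rev) +
      L.s1 (gradSq h σ + (8 : ℝ) • σ ^ 2 - (1 / 8 : ℝ) • inner2 h k k + inner2 h k (hess h σ)) I := by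
  have hf := divSrc_scalar_mem hσ hk
  have h1 := congrArg L.ev0 (L.fr1_divTerm hk I)
  have h2 := congrArg L.ev0 (congrFun (L.fr1_grad hf) I)
  simp only [map_sum, map_mul] at h1
  change _ = ∑ K, ∑ M, L.j1 k K I M * L.j0 k K.rev M.rev at h1
  change _ = L.s1 _ I at h2
  rw [← h1, ← h2]
  simp only [LocalFrame.ev0, L.ev_fr1 (divSrc_mem hσ hk), L.ev_fr1 (divTerm_mem hk),
    L.ev_fr1 (grad_mem hf), divSrc, t1, Pi.add_apply, Pi.smul_apply, smul_eq_mul, grad,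
    Finset.mul_sum, ← Finset.sum_add_distrib]
  refine Finset.sum_congr rfl fun a _ => by ring

lemma dvg_QV_add_QW (hσ : σ ∈ smoothOn U) (hk : IsSDT U h k) (hF : FirstOrderEqs U h σ k) (a : Fin 3) :
    EqOn (dvg h (QV h σ k + QW h σ k) a) (grad (tr h (QV h σ k + QW h σ k)) a) U := by
  have hQ := (QV_symTensor hσ hk.1).add (QW_symTensor hσ hk.1.1)
  have hC : IsSymTensor U (curl h (QV h σ k + QW h σ k)) := by
    have h1 := curl_QV_add_QW hσ hk hF
    have h2 := symCurl_kappa_symTensor hσ hk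
    refine ⟨curl_mem hQ.1, fun a b x hx => ?_⟩
    rw [h1 a b hx, h1 b a hx, h2.2 a b hx]
  exact dvg_eq_of_curl_symmetric hQ hC a

theorem dvg_QV (hσ : σ ∈ smoothOn U) (hk : IsSDT U h k) (hF : FirstOrderEqs U h σ k) (a : Fin 3) :
    EqOn (dvg h (QV h σ k) a) (divSrc h σ k a) U := by
  have mV := QV_mem hσ hk.1.1
  have mW := QW_mem hσ hk.1.1
  refine eqOn_of_frames (dvg_mem mV) (divSrc_mem hσ hk.1.1) (fun _ L I => ?_) a
  have hf := QW_scalar_mem hσ hk.1.1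
  have hm := scalar_mem hf h_mem
  have hp := prod2_mem hk.1.1 hk.1.1
  have hi := inner2_mem hk.1.1 hk.1.1
  have hg := gradSq_mem hσ
  have hs := inner2_mem hk.1.1 (hess_mem hσ)
  have h2 := pow_mem hσ 2
  have e1 : ∑ K, L.j1 (QV h σ k + QW h σ k) K I K.rev = ∑ K, L.j1 (QV h σ k + QW h σ k) I K K.rev := by
    rw [← fr1_grad_tr L (mV.add mW), ← L.ev0_dvg (mV.add mW),
      L.fr1_congr (dvg_mem (mV.add mW)) (grad_mem (tr_mem (mV.add mW)))
        (dvg_QV_add_QW hσ hk hF)]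
  simp only [L.j1_add mV mW, Finset.sum_add_distrib, ← L.s1_tr mV, ← L.s1_tr mW] at e1
  have e2 : L.s1 (tr h (QV h σ k)) I = L.s1 (traceSrc h σ k) I := by
    rw [LocalFrame.s1, L.fr0_congr (tr_mem mV) (traceSrc_mem hσ hk.1.1) (tr_QV hσ hk hF)]
    rfl
  have e3 : L.s1 (tr h (QW h σ k)) I = L.s1 (-(6 : ℝ) • σ ^ 2 + (-(5 / 16) : ℝ) • inner2 h k k) I := by
    rw [LocalFrame.s1, L.fr0_congr (tr_mem mW) (add_mem (smul_smooth _ h2) (smul_smooth _ hi))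
      (tr_QW hσ hk.1.1)]
    rfl
  have e4 : ∑ K, L.j1 (QW h σ k) K I K.rev = -2 * L.s1 (σ ^ 2) I + 1 / 16 * L.s1 (inner2 h k k) I -
      1 / 2 * ∑ K, ∑ M, L.j1 k K I M * L.j0 k K.rev M.rev := by
    have hd : ∀ M, ∑ K, L.j1 k K K.rev M = 0 := fun M => by
      have := congrArg L.ev0 (L.sdt_N2_div hk M)
      rw [map_sum, map_zero] at this
      rw [← this]
      exact Finset.sum_congr rfl fun K _ => L.j1_symm hk.1 _ _ _
    have h0 := hd 0
    have h1 := hd 1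
    have h2' := hd 2
    rw [QW_eq]
    simp only [L.j1_sub hm (Smooth2.smul _ hp), L.j1_smul _ hp, L.j1_scalar_h hf,
      L.j1_prod2_self hk.1.1, L.s1_add (smul_smooth (-2) h2) (smul_smooth (1 / 16) hi),
      L.s1_smul _ h2, L.s1_smul _ hi]
    induction I using fin3_cases <;>
    simp only [Fin.sum_univ_three, rev3, null_values] at h0 h1 h2' ⊢
    · linear_combination (-1 / 2 * L.j0 k 0 0) * h2' - 1 / 2 * L.j0 k 0 1 * h1 - 1 / 2 * L.j0 k 0 2 * h0
    · linear_combination (-1 / 2 * L.j0 k 1 0) * h2' - 1 / 2 * L.j0 k 1 1 * h1 - 1 / 2 * L.j0 k 1 2 * h0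
    · linear_combination (-1 / 2 * L.j0 k 2 0) * h2' - 1 / 2 * L.j0 k 2 1 * h1 - 1 / 2 * L.j0 k 2 2 * h0
  have e5 : L.s1 (traceSrc h σ k) I = 12 * L.s1 (σ ^ 2) I + L.s1 (gradSq h σ) I +
      1 / 4 * L.s1 (inner2 h k k) I + L.s1 (inner2 h k (hess h σ)) I := by
    have a1 := add_mem (smul_smooth (U := U) 12 h2) hg
    have a2 := add_mem a1 (smul_smooth (1 / 4) hi)
    rw [traceSrc, L.s1_add a2 hs, L.s1_add a1 (smul_smooth _ hi), L.s1_add (smul_smooth _ h2) hg,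
      L.s1_smul _ h2, L.s1_smul _ hi]
  rw [ev0_divSrc L hσ hk.1.1, L.ev0_dvg mV]
  have e6 : L.s1 (gradSq h σ + (8 : ℝ) • σ ^ 2 - (1 / 8 : ℝ) • inner2 h k k + inner2 h k (hess h σ)) I =
      L.s1 (gradSq h σ) I + 8 * L.s1 (σ ^ 2) I - 1 / 8 * L.s1 (inner2 h k k) I +
        L.s1 (inner2 h k (hess h σ)) I := by
    have a1 := add_mem hg (smul_smooth (U := U) 8 h2)
    have a2 := sub_mem a1 (smul_smooth (1 / 8) hi)
    have : gradSq h σ + (8 : ℝ) • σ ^ 2 - (1 / 8 : ℝ) • inner2 h k k =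
      gradSq h σ + (8 : ℝ) • σ ^ 2 + (-(1 / 8) : ℝ) • inner2 h k k := by module
    rw [L.s1_add a2 hs, this, L.s1_add a1 (smul_smooth _ hi), L.s1_add hg (smul_smooth _ h2),
      L.s1_smul _ h2, L.s1_smul _ hi]
    ring
  rw [e6]
  rw [e2, e3, e4, e5, L.s1_add (smul_smooth _ h2) (smul_smooth _ hi), L.s1_smul _ h2,
    L.s1_smul _ hi] at e1
  linear_combination e1

lemma D1_congr {v w : Cov1} (hv : Smooth1 U v) (hw : Smooth1 U w) (hvw : ∀ a, EqOn (v a) (w a) U) :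
    AgreeOn U (D1 h v) (D1 h w) :=
  agreeOn_of_frames (D1_mem hv) (D1_mem hw) fun _ L I J => by
    rw [LocalFrame.j0, LocalFrame.j0, L.fr2_D1 hv, L.fr2_D1 hw, L.fr1_congr hv hw hvw]

/-- The source of the wave equation for the second-order metric in terms of `QV`. -/
theorem curl_symCurl_kappa (hσ : σ ∈ smoothOn U) (hk : IsSDT U h k) (hF : FirstOrderEqs U h σ k) :
    AgreeOn U (curl h (symCurl h (kappa h σ k)))
      (boxT h (QV h σ k) - (2 : ℝ) • QV h σ k - (NLss h σ + NLsk h σ k + NLkk h k)) := by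
  have sV := QV_symTensor hσ hk.1
  have sW := QW_symTensor hσ hk.1.1
  have mV := sV.1
  have mW := sW.1
  have sX := sV.add sW
  have mX := sX.1
  have hi := inner2_mem hk.1.1 hk.1.1
  have hg := gradSq_mem hσ
  have hs := inner2_mem hk.1.1 (hess_mem hσ)
  have h2 := pow_mem hσ 2
  refine (curl_congr (symCurl_mem (kappa_mem hσ hk.1.1)) (curl_mem mX)
    (curl_QV_add_QW hσ hk hF).symm).trans ((curl_curl sX).trans ?_)
  have trX : EqOn (tr h (QV h σ k + QW h σ k)) ((6 : ℝ) • σ ^ 2 + gradSq h σ +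
      (-(1 / 16) : ℝ) • inner2 h k k + inner2 h k (hess h σ)) U := fun x hx => by
    have e1 := tr_QV hσ hk hF hx
    have e2 := tr_QW hσ hk.1.1 hx
    rw [tr_add, Pi.add_apply, e1, e2]
    simp only [traceSrc, Pi.add_apply, Pi.smul_apply, smul_eq_mul]
    ring
  have m6 := smul_smooth (U := U) 6 h2
  have m16 := smul_smooth (U := U) (-(1 / 16)) hi
  have m1 := add_mem m6 hg
  have m3 := add_mem m1 m16
  have m4 := add_mem m3 hs
  have hD : AgreeOn U (D1 h (dvg h (QV h σ k + QW h σ k))) (hess h ((6 : ℝ) • σ ^ 2 + gradSq h σ +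
      (-(1 / 16) : ℝ) • inner2 h k k + inner2 h k (hess h σ))) :=
    D1_congr (dvg_mem mX) (grad_mem m4) fun a x hx => by
      rw [dvg_QV_add_QW hσ hk hF a hx, grad, pd_congr_of_eqOn Patch.opn trX _ hx, grad]
  intro a b x hx
  have b1 := boxT_add mV mW a b hx
  have b2 := boxT_QW hσ hk hF a b hx
  have d0 := hD a b hx
  have d1 := hess_add m3 hs a b hx
  have d2 := hess_add m1 m16 a b hx
  have d3 := hess_add m6 hg a b hx
  have d4 := hess_smul 6 h2 a b hx
  have d5 := hess_smul (-(1 / 16)) hi a b hx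
  have d6 := hess_add (smul_smooth 5 h2) hg a b hx
  have d7 := hess_smul 5 h2 a b hx
  have d8 := hess_sq hσ a b hx
  have d9 := hess_inner2_self hk.1.1 a b hx
  have y := Yten_eq_products hσ hk hF a b hx
  have t := trX hx
  have c := inner2_comm hk.1.1 (hess_mem hσ) hx
  simp only [Pi.add_apply, Pi.sub_apply, Pi.smul_apply, Pi.mul_apply, Pi.pow_apply,
    smul_eq_mul] at b1 b2 d0 d1 d2 d3 d4 d5 d6 d7 d8 d9 y t c
  simp only [Pi.add_apply, Pi.sub_apply, Pi.smul_apply, Pi.mul_apply, Pi.pow_apply, smul_eq_mul,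
    NLkk_eq, NLss, NLsk, d6, d7, d8, b1, b2, d0, d1, d2, d3, d4, d5, d9, t]
  simp only [QV_eq, QW_eq, Pi.add_apply, Pi.sub_apply, Pi.smul_apply, Pi.mul_apply, Pi.pow_apply,
    smul_eq_mul, y, c]
  ring

end

/-! ### The equivalent systems -/

section

variable [Patch U h]

lemma IsSymTensor.congr (hS : IsSymTensor U S) (hTm : Smooth2 U T) (hST : AgreeOn U S T) :
    IsSymTensor U T :=
  ⟨hTm, fun a b x hx => by rw [← hST a b hx, ← hST b a hx, hS.2 a b hx]⟩

lemma IsSDT.congr (hS : IsSDT U h S) (hTm : Smooth2 U T) (hST : AgreeOn U S T) : IsSDT U h T :=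
  ⟨hS.1.congr hTm hST, (tr_congr hST).symm.trans hS.2.1, fun a =>
    (dvg_congr hS.1.1 hTm hST a).symm.trans (hS.2.2 a)⟩

lemma IsSDT.add (hS : IsSDT U h S) (hT : IsSDT U h T) : IsSDT U h (S + T) := by
  refine ⟨hS.1.add hT.1, fun x hx => ?_, fun a x hx => ?_⟩
  · rw [tr_add, Pi.add_apply, hS.2.1 hx, hT.2.1 hx]; simp
  · rw [dvg_add hS.1.1 hT.1.1 a hx, Pi.add_apply, hS.2.2 a hx, hT.2.2 a hx]; simp

lemma IsSDT.neg (hT : IsSDT U h T) : IsSDT U h (-T) := by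
  have := isSDT_smul (-1) hT
  rwa [neg_one_smul] at this

lemma symCurl_kappa_sdt (hσ : σ ∈ smoothOn U) (hk : IsSDT U h k) (hF : FirstOrderEqs U h σ k) :
    IsSDT U h (symCurl h (kappa h σ k)) := by
  have hs := src_symTensor hσ hk.1
  have hc := curl_src_symTensor hσ hk hF
  exact IsSDT.congr ⟨hc, tr_curl hs, dvg_curl hs hc⟩
    (symCurl_mem (kappa_mem hσ hk.1.1)) (symCurl_kappa hσ hk hF).symm

lemma LogEqs.curl_curl_eq (hi : LogEqs U h i) : AgreeOn U (curl h (curl h i)) (-i) := by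
  refine (curl_curl_sdt hi.1).trans fun a b x hx => ?_
  have := hi.2 a b hx
  simp only [Pi.sub_apply, Pi.smul_apply, Pi.zero_apply, Pi.neg_apply, smul_eq_mul] at this ⊢
  linarith

lemma LogEqs.curl (hi : LogEqs U h i) : LogEqs U h (curl h i) := by
  refine ⟨curl_sdt hi.1, (((boxT_curl hi.1).trans (curl_congr
    (boxT_mem hi.1.1.1) (Smooth2.smul 2 hi.1.1.1) ?_)).trans
    (curl_smul 2 hi.1.1.1)).sub (AgreeOn.refl _) |>.trans ?_⟩
  · intro a b x hx
    have := hi.2 a b hx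
    simp only [Pi.sub_apply, Pi.zero_apply] at this
    linarith
  · rw [sub_self]; exact AgreeOn.refl _

lemma LogEqs.neg (hi : LogEqs U h i) : LogEqs U h (-i) := by
  refine ⟨hi.1.neg, fun a b x hx => ?_⟩
  have h1 := boxT_smul (-1) hi.1.1.1 a b hx
  have h2 := hi.2 a b hx
  rw [neg_one_smul] at h1
  simp only [Pi.sub_apply, Pi.smul_apply, Pi.zero_apply, Pi.neg_apply, smul_eq_mul] at h1 h2 ⊢
  linarith

lemma LogEqs.congr (hi : LogEqs U h i) (hT : Smooth2 U T) (hiT : AgreeOn U i T) : LogEqs U h T :=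
  ⟨hi.1.congr hT hiT, (((boxT_congr hi.1.1.1 hT hiT).sub (hiT.smul 2)).symm.trans hi.2)⟩

variable {V W j : Cov2} (hσ : σ ∈ smoothOn U) (hk : IsSDT U h k)

include hσ hk

lemma Vof_symTensor (hi : IsSymTensor U i) (h2s : IsSymTensor U h2) :
    IsSymTensor U (Vof h σ k i h2) :=
  (h2s.neg.add (hi.smul _)).add (QV_symTensor hσ hk.1)

lemma h2of_symTensor (hi : IsSymTensor U i) (hV : IsSymTensor U V) :
    IsSymTensor U (h2of h σ k V i) :=
  (hV.neg.add (hi.smul _)).add (QV_symTensor hσ hk.1)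

omit hσ hk in
lemma Vof_h2of (h : Cov2) (σ : Fld 3) (k V i : Cov2) : Vof h σ k i (h2of h σ k V i) = V := by
  rw [Vof, h2of]; abel

omit hσ hk in
lemma h2of_Vof (h : Cov2) (σ : Fld 3) (k i h2 : Cov2) : h2of h σ k (Vof h σ k i h2) i = h2 := by
  rw [Vof, h2of]; abel

/-- The second-order equations as a wave equation for `V`. -/
theorem secondOrderEqs_iff (hF : FirstOrderEqs U h σ k) (hi : IsSymTensor U i)
    (h2s : IsSymTensor U h2) : SecondOrderEqs U h σ k i h2 ↔ LogEqs U h i ∧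
      IsSDT U h (Vof h σ k i h2) ∧
      AgreeOn U (boxT h (Vof h σ k i h2) - (2 : ℝ) • Vof h σ k i h2)
        (curl h (symCurl h (kappa h σ k)) - (2 : ℝ) • i) := by
  have mV := QV_mem hσ hk.1.1
  have m1 := Smooth2.neg h2s.1
  have m2 := Smooth2.smul (1 / 2) hi.1
  have sV := Vof_symTensor hσ hk hi h2s
  have eT : ∀ x ∈ U, tr h i x = 0 → tr h (Vof h σ k i h2) x = traceSrc h σ k x - tr h h2 x := by
    intro x hx h0
    rw [Vof, tr_add, tr_add, tr_smul, ← neg_one_smul ℝ h2, tr_smul]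
    simp only [Pi.add_apply, Pi.smul_apply, smul_eq_mul, tr_QV hσ hk hF hx, h0]
    ring
  have eD : ∀ a, ∀ x ∈ U, dvg h i a x = 0 →
      dvg h (Vof h σ k i h2) a x = divSrc h σ k a x - dvg h h2 a x := by
    intro a x hx h0
    have d1 := dvg_add (m1.add m2) mV a hx
    have d2 := dvg_add m1 m2 a hx
    have d3 := dvg_smul (1 / 2) hi.1 a hx
    have d4 := dvg_smul (-1) h2s.1 a hx
    rw [neg_one_smul] at d4
    simp only [Pi.add_apply, Pi.smul_apply, smul_eq_mul] at d1 d2 d3 d4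
    rw [Vof, d1, d2, d3, d4, dvg_QV hσ hk hF a hx, h0]
    ring
  have eB : ∀ a b, ∀ x ∈ U, boxT h i a b x = 2 * i a b x →
      boxT h (Vof h σ k i h2) a b x - 2 * Vof h σ k i h2 a b x -
        (curl h (symCurl h (kappa h σ k)) a b x - 2 * i a b x) =
      (2 * i a b x + NLss h σ a b x + NLsk h σ k a b x + NLkk h k a b x) -
        (boxT h h2 a b x - 2 * h2 a b x) := by
    intro a b x hx h0
    have d1 := boxT_add (m1.add m2) mV a b hx
    have d2 := boxT_add m1 m2 a b hx
    have d3 := boxT_smul (1 / 2) hi.1 a b hx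
    have d4 := boxT_smul (-1) h2s.1 a b hx
    have d5 := curl_symCurl_kappa hσ hk hF a b hx
    rw [neg_one_smul] at d4
    simp only [Pi.add_apply, Pi.sub_apply, Pi.smul_apply, smul_eq_mul] at d1 d2 d3 d4 d5
    rw [d5, Vof, d1, d2, d3, d4, h0]
    simp only [Pi.add_apply, Pi.neg_apply, Pi.smul_apply, smul_eq_mul]
    ring
  constructor
  · rintro ⟨hL, hT, hD, hB⟩
    refine ⟨hL, ⟨sV, fun x hx => ?_, fun a x hx => ?_⟩, fun a b x hx => ?_⟩
    · have h1 := hT hx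
      rw [eT x hx (hL.1.2.1 hx), h1]
      exact sub_self _
    · have h1 := hD a hx
      rw [eD a x hx (hL.1.2.2 a hx), h1]
      exact sub_self _
    · have h0 := hL.2 a b hx
      have h1 := hB a b hx
      simp only [Pi.add_apply, Pi.sub_apply, Pi.smul_apply, smul_eq_mul, Pi.zero_apply] at h0 h1 ⊢
      have := eB a b x hx (by linarith)
      linarith
  · rintro ⟨hL, hV, hB⟩
    refine ⟨hL, fun x hx => ?_, fun a x hx => ?_, fun a b x hx => ?_⟩
    · have h1 := eT x hx (hL.1.2.1 hx)
      rw [hV.2.1 hx, Pi.zero_apply] at h1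
      exact (sub_eq_zero.1 h1.symm).symm
    · have h1 := eD a x hx (hL.1.2.2 a hx)
      rw [hV.2.2 a hx, Pi.zero_apply] at h1
      exact (sub_eq_zero.1 h1.symm).symm
    · have h0 := hL.2 a b hx
      have h1 := hB a b hx
      simp only [Pi.add_apply, Pi.sub_apply, Pi.smul_apply, smul_eq_mul, Pi.zero_apply] at h0 h1 ⊢
      have := eB a b x hx (by linarith)
      linarith

theorem Wof_eq (hF : FirstOrderEqs U h σ k) (hi : IsSymTensor U i) (h2s : IsSymTensor U h2) :
    AgreeOn U (Wof h σ k i h2) (-curl h (Vof h σ k i h2) + symCurl h (kappa h σ k)) := by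
  have mV := QV_mem hσ hk.1.1
  have mW := QW_mem hσ hk.1.1
  have mVof := (Vof_symTensor hσ hk hi h2s).1
  have e : h2 - (1 / 2 : ℝ) • i + QW h σ k = (QV h σ k + QW h σ k) - Vof h σ k i h2 := by
    rw [Vof]; abel
  rw [Wof, e]
  refine (curl_sub (mV.add mW) mVof).trans ?_
  intro a b x hx
  have h1 := curl_QV_add_QW hσ hk hF a b hx
  simp only [Pi.add_apply, Pi.sub_apply, Pi.neg_apply] at h1 ⊢
  rw [h1]; ring

theorem Vof_eq (hF : FirstOrderEqs U h σ k) (hi : IsSymTensor U i) (h2s : IsSymTensor U h2)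
    (hS : SecondOrderEqs U h σ k i h2) :
    AgreeOn U (Vof h σ k i h2) (curl h (Wof h σ k i h2) - (2 : ℝ) • i) := by
  obtain ⟨-, hV, hB⟩ := (secondOrderEqs_iff hσ hk hF hi h2s).1 hS
  have mS := symCurl_mem (kappa_mem hσ hk.1.1)
  have mc := curl_mem hV.1.1
  have mW := mc.neg.add mS
  have e1 := curl_congr (curl_mem
    (((h2s.sub (hi.smul (1 / 2))).add (QW_symTensor hσ hk.1.1)).1)) mW
    (Wof_eq hσ hk hF hi h2s)
  have e2 := curl_add mc.neg mS
  have e3 := curl_neg mc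
  have e4 := curl_curl_sdt hV
  intro a b x hx
  have e1 := e1 a b hx
  have e2 := e2 a b hx
  have e3 := e3 a b hx
  have e4 := e4 a b hx
  have e5 := hB a b hx
  change curl h (Wof h σ k i h2) a b x = _ at e1
  simp only [Pi.add_apply, Pi.sub_apply, Pi.neg_apply, Pi.smul_apply, smul_eq_mul] at e1 e2 e3 e4 e5 ⊢
  linarith

lemma symCurl_two_smul_add_kappa (hF : FirstOrderEqs U h σ k) (hi : IsSDT U h i) :
    AgreeOn U (symCurl h ((2 : ℝ) • i + kappa h σ k))
      ((2 : ℝ) • curl h i + symCurl h (kappa h σ k)) := by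
  have h2 := Smooth2.smul 2 hi.1.1
  have h3 := (curl_sdt (isSDT_smul 2 hi)).1
  exact (symCurl_add h2 (kappa_mem hσ hk.1.1)).trans
    (((symm_of_symTensor h3).trans (curl_smul 2 hi.1.1)).add (AgreeOn.refl _))

theorem WSystem_of_second (hF : FirstOrderEqs U h σ k) (hi : IsSymTensor U i)
    (h2s : IsSymTensor U h2) (hS : SecondOrderEqs U h σ k i h2) :
    WSystem U h σ k (Wof h σ k i h2) i := by
  obtain ⟨hL, hV, -⟩ := (secondOrderEqs_iff hσ hk hF hi h2s).1 hS
  have mW : Smooth2 U (Wof h σ k i h2) := curl_mem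
    (((h2s.sub (hi.smul (1 / 2))).add (QW_symTensor hσ hk.1.1)).1)
  have eW := Wof_eq hσ hk hF hi h2s
  have hC := curl_sdt hV
  have hW := ((hC.neg).add (symCurl_kappa_sdt hσ hk hF)).congr mW eW.symm
  refine ⟨hW, AgreeOn.trans ?_ (symCurl_two_smul_add_kappa hσ hk hF hL.1).symm, hL⟩
  have m1 := curl_mem mW
  have m2 := Smooth2.smul 2 hi.1
  have e1 := curl_curl_sdt hW
  have eV := Vof_eq hσ hk hF hi h2s hS
  have e2 := curl_congr hV.1.1 (m1.sub m2) eV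
  have e3 := curl_sub m1 m2
  have e4 := curl_smul 2 hi.1
  intro a b x hx
  have e1 := e1 a b hx
  have e2 := e2 a b hx
  have e3 := e3 a b hx
  have e4 := e4 a b hx
  have e5 := eW a b hx
  simp only [Pi.add_apply, Pi.sub_apply, Pi.neg_apply, Pi.smul_apply, smul_eq_mul] at e1 e2 e3 e4 e5 ⊢
  linarith

theorem second_of_WSystem (hF : FirstOrderEqs U h σ k) (hW : WSystem U h σ k W i) :
    IsSymTensor U (h2of h σ k (curl h W - (2 : ℝ) • i) i) ∧
    SecondOrderEqs U h σ k i (h2of h σ k (curl h W - (2 : ℝ) • i) i) ∧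
    AgreeOn U (Wof h σ k i (h2of h σ k (curl h W - (2 : ℝ) • i) i)) W := by
  obtain ⟨sW, bW, hL⟩ := hW
  have hC := curl_sdt sW
  have hi2 := isSDT_smul 2 hL.1
  have hV : IsSDT U h (curl h W - (2 : ℝ) • i) := by
    rw [sub_eq_add_neg]; exact hC.add (hi2.neg)
  have h2s := h2of_symTensor hσ hk hL.1.1 hV.1
  have mS := symCurl_mem (kappa_mem hσ hk.1.1)
  have mc := curl_mem hL.1.1.1
  have hb : AgreeOn U (boxT h W) ((2 : ℝ) • W + ((2 : ℝ) • curl h i + symCurl h (kappa h σ k))) := by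
    intro a b x hx
    have := (bW.trans (symCurl_two_smul_add_kappa hσ hk hF hL.1)) a b hx
    simp only [Pi.sub_apply] at this
    rw [Pi.add_apply, Pi.add_apply, Pi.add_apply, ← this]; ring
  refine ⟨h2s, (secondOrderEqs_iff hσ hk hF hL.1.1 h2s).2 ?_, ?_⟩
  · rw [Vof_h2of]
    refine ⟨hL, hV, ?_⟩
    have m2c := Smooth2.smul 2 mc
    have e1 := boxT_curl sW
    have e2 := curl_congr (boxT_mem sW.1.1) ((Smooth2.smul 2 sW.1.1).add (m2c.add mS)) hb
    have e3 := curl_add (Smooth2.smul 2 sW.1.1) (m2c.add mS)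
    have e4 := curl_add m2c mS
    have e5 := curl_smul 2 sW.1.1
    have e6 := curl_smul 2 mc
    have e7 := hL.curl_curl_eq
    have e8 := boxT_add hC.1.1 (Smooth2.smul (-2) hL.1.1.1)
    have e9 := boxT_smul (-2) hL.1.1.1
    intro a b x hx
    have e0 := hL.2 a b hx
    have e1 := e1 a b hx
    have e2 := e2 a b hx
    have e3 := e3 a b hx
    have e4 := e4 a b hx
    have e5 := e5 a b hx
    have e6 := e6 a b hx
    have e7 := e7 a b hx
    have e8 := e8 a b hx
    have e9 := e9 a b hx
    have e : curl h W - (2 : ℝ) • i = curl h W + (-2 : ℝ) • i := by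
      rw [neg_smul, sub_eq_add_neg]
    rw [e]
    simp only [Pi.add_apply, Pi.sub_apply, Pi.neg_apply, Pi.zero_apply, Pi.smul_apply, smul_eq_mul] at *
    linarith
  · have e1 := Wof_eq hσ hk hF hL.1.1 h2s
    rw [Vof_h2of] at e1
    refine e1.trans ?_
    have e2 := curl_sub hC.1.1 hi2.1.1
    have e3 := curl_smul 2 hL.1.1.1
    have e4 := curl_curl_sdt sW
    intro a b x hx
    have e0 := hb a b hx
    have e2 := e2 a b hx
    have e3 := e3 a b hx
    have e4 := e4 a b hx
    simp only [Pi.add_apply, Pi.sub_apply, Pi.neg_apply, Pi.smul_apply, smul_eq_mul] at e0 e2 e3 e4 ⊢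
    linarith

omit hσ hk in
lemma SecondOrderEqs.congr {h2' : Cov2} (hS : SecondOrderEqs U h σ k i h2) (h2m : Smooth2 U h2)
    (h2m' : Smooth2 U h2') (e : AgreeOn U h2 h2') : SecondOrderEqs U h σ k i h2' :=
  ⟨hS.1, (tr_congr e).symm.trans hS.2.1, fun a => (dvg_congr h2m h2m' e a).symm.trans (hS.2.2.1 a),
    ((boxT_congr h2m h2m' e).sub (e.smul 2)).symm.trans hS.2.2.2⟩

theorem second_iff_WSystem (hF : FirstOrderEqs U h σ k) (hi : IsSymTensor U i)
    (h2s : IsSymTensor U h2) : SecondOrderEqs U h σ k i h2 ↔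
      WSystem U h σ k (Wof h σ k i h2) i ∧
        AgreeOn U h2 (h2of h σ k (curl h (Wof h σ k i h2) - (2 : ℝ) • i) i) := by
  constructor
  · intro hS
    refine ⟨WSystem_of_second hσ hk hF hi h2s hS, fun a b x hx => ?_⟩
    have := Vof_eq hσ hk hF hi h2s hS a b hx
    nth_rw 1 [← h2of_Vof h σ k i h2]
    simp only [h2of, Pi.add_apply, Pi.neg_apply, this]
  · rintro ⟨hW, e⟩
    obtain ⟨s, hS, -⟩ := second_of_WSystem hσ hk hF hW
    exact hS.congr s.1 h2s.1 e.symm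

lemma curl_VSource (hj : LogEqs U h j) (hF : FirstOrderEqs U h σ k) :
    AgreeOn U (curl h (-(2 : ℝ) • j + symCurl h (kappa h σ k)))
      (curl h (symCurl h (kappa h σ k)) - (2 : ℝ) • curl h j) := by
  have mS := symCurl_mem (kappa_mem hσ hk.1.1)
  refine (curl_add (Smooth2.smul (-2) hj.1.1.1) mS).trans ?_
  intro a b x hx
  have := curl_smul (-2) hj.1.1.1 a b hx
  simp only [Pi.add_apply, Pi.sub_apply, Pi.smul_apply, smul_eq_mul] at this ⊢
  rw [this]; ring

theorem second_iff_VSystem (hF : FirstOrderEqs U h σ k) (hi : IsSymTensor U i)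
    (h2s : IsSymTensor U h2) : SecondOrderEqs U h σ k i h2 ↔
      VSystem U h σ k (Vof h σ k i h2) (-curl h i) ∧ AgreeOn U i (curl h (-curl h i)) := by
  have hc : LogEqs U h i → AgreeOn U i (curl h (-curl h i)) := fun hL => by
    have h1 := (curl_neg (curl_mem hi.1)).trans (hL.curl_curl_eq).neg
    rw [neg_neg] at h1
    exact h1.symm
  rw [secondOrderEqs_iff hσ hk hF hi h2s]
  constructor
  · rintro ⟨hL, hV, hB⟩
    have hj := (hL.curl).neg
    exact ⟨⟨hV, hB.trans (((AgreeOn.refl _).sub ((hc hL).smul 2)).trans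
      (curl_VSource hσ hk hj hF).symm), hj⟩, hc hL⟩
  · rintro ⟨⟨hV, hB, hj⟩, e⟩
    exact ⟨(hj.curl).congr hi.1 e.symm, hV,
      hB.trans ((curl_VSource hσ hk hj hF).trans ((AgreeOn.refl _).sub (e.symm.smul 2)))⟩

theorem second_of_VSystem (hF : FirstOrderEqs U h σ k) (hV : VSystem U h σ k V j) :
    IsSymTensor U (curl h j) ∧ IsSymTensor U (h2of h σ k V (curl h j)) ∧
      SecondOrderEqs U h σ k (curl h j) (h2of h σ k V (curl h j)) ∧
      AgreeOn U (-curl h (curl h j)) j := by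
  obtain ⟨sV, hB, hj⟩ := hV
  have hi := hj.curl
  have h2s := h2of_symTensor hσ hk hi.1.1 sV.1
  refine ⟨hi.1.1, h2s, (secondOrderEqs_iff hσ hk hF hi.1.1 h2s).2 ?_, ?_⟩
  · rw [Vof_h2of]
    exact ⟨hi, sV, hB.trans (curl_VSource hσ hk hj hF)⟩
  · have := (hj.curl_curl_eq).neg
    rwa [neg_neg] at this

end

/-! ### Truncated expansions in `1 / ρ` and `log ρ / ρ²` -/

/-- Formal expansions `c0 + c1 / ρ + c2 / ρ² + cl log ρ / ρ²` modulo `o(ρ⁻²)`. -/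
@[ext]
structure Tr (R : Type*) where
  c0 : R
  c1 : R
  c2 : R
  cl : R

namespace Tr

variable {R S : Type*} [CommRing R] [CommRing S]

instance : Zero (Tr R) := ⟨⟨0, 0, 0, 0⟩⟩
instance : One (Tr R) := ⟨⟨1, 0, 0, 0⟩⟩
instance : Add (Tr R) := ⟨fun f g => ⟨f.c0 + g.c0, f.c1 + g.c1, f.c2 + g.c2, f.cl + g.cl⟩⟩
instance : Neg (Tr R) := ⟨fun f => ⟨-f.c0, -f.c1, -f.c2, -f.cl⟩⟩
instance : Sub (Tr R) := ⟨fun f g => ⟨f.c0 - g.c0, f.c1 - g.c1, f.c2 - g.c2, f.cl - g.cl⟩⟩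
instance : Mul (Tr R) := ⟨fun f g => ⟨f.c0 * g.c0, f.c0 * g.c1 + f.c1 * g.c0,
  f.c0 * g.c2 + f.c1 * g.c1 + f.c2 * g.c0, f.c0 * g.cl + f.cl * g.c0⟩⟩
instance {A : Type*} [SMul A R] : SMul A (Tr R) :=
  ⟨fun r f => ⟨r • f.c0, r • f.c1, r • f.c2, r • f.cl⟩⟩

@[simp] lemma zero_c0 : (0 : Tr R).c0 = 0 := rfl
@[simp] lemma zero_c1 : (0 : Tr R).c1 = 0 := rfl
@[simp] lemma zero_c2 : (0 : Tr R).c2 = 0 := rfl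
@[simp] lemma zero_cl : (0 : Tr R).cl = 0 := rfl
@[simp] lemma neg_c0 (f : Tr R) : (-f).c0 = -f.c0 := rfl
@[simp] lemma neg_c1 (f : Tr R) : (-f).c1 = -f.c1 := rfl
@[simp] lemma neg_c2 (f : Tr R) : (-f).c2 = -f.c2 := rfl
@[simp] lemma neg_cl (f : Tr R) : (-f).cl = -f.cl := rfl

@[simp]
lemma coeffs : ((1 : Tr R).c0 = 1 ∧ (1 : Tr R).c1 = 0 ∧ (1 : Tr R).c2 = 0 ∧ (1 : Tr R).cl = 0) ∧
    (∀ f g : Tr R, (f + g).c0 = f.c0 + g.c0 ∧ (f + g).c1 = f.c1 + g.c1 ∧ (f + g).c2 = f.c2 + g.c2 ∧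
      (f + g).cl = f.cl + g.cl) ∧
    (∀ f g : Tr R, (f - g).c0 = f.c0 - g.c0 ∧ (f - g).c1 = f.c1 - g.c1 ∧ (f - g).c2 = f.c2 - g.c2 ∧
      (f - g).cl = f.cl - g.cl) ∧
    ∀ f g : Tr R, (f * g).c0 = f.c0 * g.c0 ∧ (f * g).c1 = f.c0 * g.c1 + f.c1 * g.c0 ∧
      (f * g).c2 = f.c0 * g.c2 + f.c1 * g.c1 + f.c2 * g.c0 ∧ (f * g).cl = f.c0 * g.cl + f.cl * g.c0 := by
  and_intros <;> intros <;> and_intros <;> rfl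

section
variable {A : Type*} [SMul A R]
@[simp] lemma smul_c0 (r : A) (f : Tr R) : (r • f).c0 = r • f.c0 := rfl
@[simp] lemma smul_c1 (r : A) (f : Tr R) : (r • f).c1 = r • f.c1 := rfl
@[simp] lemma smul_c2 (r : A) (f : Tr R) : (r • f).c2 = r • f.c2 := rfl
@[simp] lemma smul_cl (r : A) (f : Tr R) : (r • f).cl = r • f.cl := rfl
end

instance : CommRing (Tr R) where
  add_assoc f g h := by ext <;> simp <;> ring
  zero_add f := by ext <;> simp
  add_zero f := by ext <;> simp
  add_comm f g := by ext <;> simp <;> ring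
  neg_add_cancel f := by ext <;> simp
  sub_eq_add_neg f g := by ext <;> simp <;> ring
  nsmul n f := n • f
  nsmul_zero f := by ext <;> simp
  nsmul_succ n f := by ext <;> simp <;> ring
  zsmul n f := n • f
  zsmul_zero' f := by ext <;> simp
  zsmul_succ' n f := by ext <;> simp <;> ring
  zsmul_neg' n f := by ext <;> simp [Int.negSucc_eq] <;> ring
  mul_assoc f g h := by ext <;> simp <;> ring
  one_mul f := by ext <;> simp
  mul_one f := by ext <;> simp
  mul_comm f g := by ext <;> simp <;> ring
  left_distrib f g h := by ext <;> simp <;> ring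
  right_distrib f g h := by ext <;> simp <;> ring
  zero_mul f := by ext <;> simp
  mul_zero f := by ext <;> simp
  natCast n := ⟨n, 0, 0, 0⟩
  natCast_zero := by ext <;> simp
  natCast_succ n := by ext <;> simp
  intCast n := ⟨n, 0, 0, 0⟩
  intCast_ofNat n := by ext <;> simp <;> rfl
  intCast_negSucc n := by
    ext
    · exact Int.cast_negSucc n
    all_goals exact neg_zero.symm

variable [Algebra ℝ R] [Algebra ℝ S]

instance : Module ℝ (Tr R) where
  one_smul f := by ext <;> simp
  mul_smul r s f := by ext <;> simp [mul_smul]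
  smul_zero r := by ext <;> simp
  smul_add r f g := by ext <;> simp
  add_smul r s f := by ext <;> simp [add_smul]
  zero_smul f := by ext <;> simp

instance : Algebra ℝ (Tr R) := Algebra.ofModule
  (fun r f g => by ext <;> simp) (fun r f g => by ext <;> simp)

/-- The coefficients as linear maps. -/
def c0L : Tr R →ₗ[ℝ] R := ⟨⟨c0, fun _ _ => rfl⟩, fun _ _ => rfl⟩
/-- The coefficients as linear maps. -/
def c1L : Tr R →ₗ[ℝ] R := ⟨⟨c1, fun _ _ => rfl⟩, fun _ _ => rfl⟩
/-- The coefficients as linear maps. -/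
def c2L : Tr R →ₗ[ℝ] R := ⟨⟨c2, fun _ _ => rfl⟩, fun _ _ => rfl⟩
/-- The coefficients as linear maps. -/
def clL : Tr R →ₗ[ℝ] R := ⟨⟨cl, fun _ _ => rfl⟩, fun _ _ => rfl⟩

section sums
variable {ι : Type*} (s : Finset ι) (f : ι → Tr R)
lemma sum_c0 : (∑ i ∈ s, f i).c0 = ∑ i ∈ s, (f i).c0 := map_sum c0L f s
lemma sum_c1 : (∑ i ∈ s, f i).c1 = ∑ i ∈ s, (f i).c1 := map_sum c1L f s
lemma sum_c2 : (∑ i ∈ s, f i).c2 = ∑ i ∈ s, (f i).c2 := map_sum c2L f s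
lemma sum_cl : (∑ i ∈ s, f i).cl = ∑ i ∈ s, (f i).cl := map_sum clL f s
end sums

lemma intCast_eq (n : ℤ) : ((n : Tr R)) = ⟨n, 0, 0, 0⟩ := rfl

/-- Constant expansions. -/
def C : R →+* Tr R where
  toFun r := ⟨r, 0, 0, 0⟩
  map_one' := rfl
  map_zero' := rfl
  map_mul' r s := by ext <;> simp
  map_add' r s := by ext <;> simp

lemma C_apply (r : R) : C r = ⟨r, 0, 0, 0⟩ := rfl

/-- Coefficientwise application of an algebra homomorphism. -/
def map (φ : R →ₐ[ℝ] S) : Tr R →ₐ[ℝ] Tr S :=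
  AlgHom.ofLinearMap
    { toFun := fun f => ⟨φ f.c0, φ f.c1, φ f.c2, φ f.cl⟩
      map_add' := fun f g => by ext <;> simp
      map_smul' := fun r f => by ext <;> simp }
    (by ext <;> simp) (fun f g => by ext <;> simp)

lemma map_apply (φ : R →ₐ[ℝ] S) (f : Tr R) : map φ f = ⟨φ f.c0, φ f.c1, φ f.c2, φ f.cl⟩ := rfl

/-- Coefficientwise application of a derivation. -/
def der (D : Derivation ℝ R R) : Derivation ℝ (Tr R) (Tr R) :=
  Derivation.mk'
    { toFun := fun f => ⟨D f.c0, D f.c1, D f.c2, D f.cl⟩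
      map_add' := fun f g => by ext <;> simp
      map_smul' := fun r f => by ext <;> simp }
    (fun f g => by ext <;> simp <;> ring)

lemma der_apply (D : Derivation ℝ R R) (f : Tr R) :
    der D f = ⟨D f.c0, D f.c1, D f.c2, D f.cl⟩ := rfl

/-- The Euler derivation `ρ ∂_ρ`. -/
def euler : Derivation ℝ (Tr R) (Tr R) :=
  Derivation.mk'
    { toFun := fun f => ⟨0, -f.c1, -(2 : ℝ) • f.c2 + f.cl, -(2 : ℝ) • f.cl⟩
      map_add' := fun f g => by ext <;> simp <;> abel
      map_smul' := fun r f => by ext <;> simp [smul_comm r (2 : ℝ)] }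
    (fun f g => by
      have h2 : ∀ r : R, (2 : ℝ) • r = r + r := two_smul ℝ
      ext <;> simp [h2] <;> ring)

lemma euler_apply (f : Tr R) :
    euler f = ⟨0, -f.c1, -(2 : ℝ) • f.c2 + f.cl, -(2 : ℝ) • f.cl⟩ := rfl

lemma euler_der (D : Derivation ℝ R R) (f : Tr R) : euler (der D f) = der D (euler f) := by
  ext <;> simp [euler_apply, der_apply]

lemma euler_C (r : R) : euler (C r) = 0 := by ext <;> simp [euler_apply, C_apply]

lemma der_C (D : Derivation ℝ R R) (r : R) : der D (C r) = C (D r) := by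
  ext <;> simp [der_apply, C_apply]

end Tr

/-- Base change of a geometry to formal expansions. -/
def Geo.tr {R : Type*} [CommRing R] [Algebra ℝ R] (G : Geo R) : Geo (Tr R) where
  d a := Tr.der (G.d a)
  d_comm a b f := by ext <;> simp [Tr.der_apply, G.d_comm a b]
  Γ a b c := Tr.C (G.Γ a b c)
  Γ_symm a b c := by rw [G.Γ_symm]
  E a I := Tr.C (G.E a I)
  F I a := Tr.C (G.F I a)
  FE I J := by
    simp only [← map_mul, ← map_sum, G.FE]; split_ifs <;> simp
  EF a b := by
    simp only [← map_mul, ← map_sum, G.EF]; split_ifs <;> simp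
  metric_d c a b := by
    simp only [← map_mul, ← map_sum, ← map_add, Tr.der_C, G.metric_d]
  curv a b c c' := by
    simp only [← map_mul, ← map_sum, ← map_add, ← map_sub, Tr.der_C, G.curv]
    split_ifs <;> simp

/-! ### The formal 3+1 decomposition -/

/-- A metric `N² dρ² + ρ² γ_{ab} dx^a dx^b` over a geometry with a formal radial derivative
`θ = ρ ∂_ρ`. -/
structure Slicing {B : Type*} [CommRing B] [Algebra ℝ B] (G : Geo B) where
  θ : Derivation ℝ B B
  θ_d : ∀ a f, θ (G.d a f) = G.d a (θ f)
  θ_Γ : ∀ a b c, θ (G.Γ a b c) = 0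
  θ_E : ∀ a I, θ (G.E a I) = 0
  N : B
  Ni : B
  N_Ni : N * Ni = 1
  γ : Fin 3 → Fin 3 → B
  γ_symm : ∀ a b, γ a b = γ b a
  γt : Fin 3 → Fin 3 → B
  γ_γt : ∀ a b, ∑ e, γ a e * ∑ f, frameInv G.E e f * γt f b = G.h a b

section Raise

variable {B : Type*} [CommRing B] [Algebra ℝ B] (G : Geo B)

/-- Raising an index. -/
def Geo.rs (v : Fin 3 → B) (c : Fin 3) : B := ∑ d, frameInv G.E c d * v d

lemma Geo.rs_h (c a : Fin 3) : G.rs (fun d => G.h d a) c = if c = a then 1 else 0 := by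
  rw [← G.EF c a, Geo.rs]
  simp only [frameInv, Finset.sum_mul]
  rw [Finset.sum_comm]
  refine Finset.sum_congr rfl fun I _ => ?_
  have := G.sum_E_h I.rev a
  rw [Fin.rev_rev] at this
  rw [← this, Finset.mul_sum]
  exact Finset.sum_congr rfl fun d _ => by ring

lemma Geo.h_rs (v : Fin 3 → B) (a : Fin 3) : ∑ c, G.h a c * G.rs v c = v a := by
  have h1 : ∀ d, ∑ c, G.h a c * (frameInv G.E c d * v d) = (if d = a then 1 else 0) * v d := by
    intro d
    rw [← G.rs_h d a, Geo.rs, Finset.sum_mul]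
    exact Finset.sum_congr rfl fun c _ => by rw [frameInv_comm _ d c, G.h_symm a c]; ring
  simp only [Geo.rs, Finset.mul_sum]
  rw [Finset.sum_comm]
  simp [h1]

lemma Geo.d_frameInv (c a b : Fin 3) : G.d c (frameInv G.E a b) =
    -∑ e, (G.Γ a c e * frameInv G.E e b + G.Γ b c e * frameInv G.E a e) := by
  have hA : ∀ K L M : Fin 3, G.conn c K M.rev + G.conn c M K.rev = 0 := by
    intro K L M
    have h1 : ∀ K, G.conn c K M.rev + G.conn c M K.rev =
        ∑ I, G.F I c * (G.om I K M.rev + G.om I M K.rev) := by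
      intro K
      have h2 : ∀ K L, G.conn c K L = ∑ I, G.F I c * G.om I K L := by
        intro K L
        simp only [Framed.om, Finset.mul_sum]
        rw [Finset.sum_comm]
        have : ∀ a, ∑ I, G.F I c * (G.E a I * G.conn a K L) =
            (if a = c then 1 else 0) * G.conn a K L := by
          intro a
          rw [← G.EF a c, Finset.sum_mul]
          exact Finset.sum_congr rfl fun I _ => by ring
        simp [this]
      rw [h2, h2, ← Finset.sum_add_distrib]
      exact Finset.sum_congr rfl fun I _ => by ring
    rw [h1]
    simp [G.om_antisymm]
  have h00 := hA 0 0 0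
  have h01 := hA 0 0 1
  have h02 := hA 0 0 2
  have h11 := hA 1 0 1
  have h12 := hA 1 0 2
  have h22 := hA 2 0 2
  simp only [rev3] at h00 h01 h02 h11 h12 h22
  simp only [frameInv, Fin.sum_univ_three, rev3, map_add, Derivation.leibniz, Framed.d_E,
    smul_eq_mul]
  linear_combination G.E a 2 * G.E b 2 * h00 + (G.E a 1 * G.E b 2 + G.E a 2 * G.E b 1) * h01 +
    (G.E a 0 * G.E b 2 + G.E a 2 * G.E b 0) * h02 + G.E a 1 * G.E b 1 * h11 +
    (G.E a 0 * G.E b 1 + G.E a 1 * G.E b 0) * h12 + G.E a 0 * G.E b 0 * h22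

/-- The derivative of a raised index. -/
lemma Geo.d_rs (v : Fin 3 → B) (e a : Fin 3) :
    G.d e (G.rs v a) = G.rs (G.D1 v e) a - ∑ f, G.Γ a e f * G.rs v f := by
  simp only [Geo.rs, Framed.D1, Fin.sum_univ_three, map_add, Derivation.leibniz, smul_eq_mul,
    G.d_frameInv]
  ring

end Raise

namespace Slicing

variable {B : Type*} [CommRing B] [Algebra ℝ B] {G : Geo B} (s : Slicing G)

/-- Lowering with `h` the index raised by the inverse of `γ`. -/
def lw (v : Fin 3 → B) (d : Fin 3) : B := ∑ e, s.γt d e * G.rs v e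

lemma γ_rs_lw (v : Fin 3 → B) (a : Fin 3) : ∑ c, s.γ a c * G.rs (s.lw v) c = v a := by
  rw [← G.h_rs v a]
  simp only [← s.γ_γt, Geo.rs, lw, Finset.mul_sum, Finset.sum_mul]
  rw [Finset.sum_comm' (t' := Finset.univ) (s' := fun _ => Finset.univ) (by simp)]
  have hs : ∀ f : Fin 3 → Fin 3 → Fin 3 → Fin 3 → B, ∑ y, ∑ x, ∑ z, ∑ w, f y x z w =
      ∑ z, ∑ w, ∑ x, ∑ y, f y x z w := by
    intro f
    simp only [Fin.sum_univ_three]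
    ring
  rw [hs]
  exact Finset.sum_congr rfl fun _ _ => Finset.sum_congr rfl fun _ _ =>
    Finset.sum_congr rfl fun _ _ => Finset.sum_congr rfl fun _ _ => by ring

/-- Half of the radial derivative of `ρ² γ`. -/
def kap (a b : Fin 3) : B := s.γ a b + (1 / 2 : ℝ) • s.θ (s.γ a b)
/-- The extrinsic curvature, `K_{db}`. -/
def K (d b : Fin 3) : B := s.lw (fun e => s.kap e b) d
/-- The lowered difference of the connections of `γ` and `h`. -/
def Z (d a b : Fin 3) : B :=
  (1 / 2 : ℝ) • (G.D2 s.γ a d b + G.D2 s.γ b d a - G.D2 s.γ d a b)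
/-- The difference of the connections of `γ` and `h`. -/
def Cn (d a b : Fin 3) : B := s.lw (fun e => s.Z e a b) d
/-- `∂_a log N`. -/
def n (a : Fin 3) : B := s.Ni * G.d a s.N
/-- `θ log N`. -/
def m : B := s.Ni * s.θ s.N
/-- The acceleration. -/
def X (d : Fin 3) : B := s.lw (fun e => -(s.N * G.d e s.N)) d
/-- The components `Γ^ρ_{ab}`. -/
def P (a b : Fin 3) : B := -(s.Ni * s.Ni * s.kap a b)

/-- The spacetime metric. -/
def G4 : Fin 4 → Fin 4 → B :=
  Fin.cons (Fin.cons (s.N * s.N) 0) (fun a => Fin.cons 0 (s.γ a))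

/-- The spacetime connection. -/
def Γ4 : Fin 4 → Fin 4 → Fin 4 → B :=
  Fin.cons (Fin.cons (Fin.cons s.m s.n) (fun a => Fin.cons (s.n a) (s.P a)))
    (fun c => Fin.cons (Fin.cons (G.rs s.X c) (fun b => G.rs (fun d => s.K d b) c))
      (fun a => Fin.cons (G.rs (fun d => s.K d a) c)
        (fun b => G.Γ c a b + G.rs (fun d => s.Cn d a b) c)))

/-- The derivative of a quantity of weight `ρ^w`. -/
def wd : Fin 4 → ℤ → B → B :=
  Fin.cons (fun w f => (w : B) * f + s.θ f) (fun a _ f => G.d a f)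

/-- The spacetime Ricci tensor. -/
def ric4 (b d : Fin 4) : B :=
  ∑ c, (s.wd c (radial c - radial b - radial d) (s.Γ4 c b d) -
    s.wd d (radial c - radial b - radial c) (s.Γ4 c b c) +
    ∑ e, (s.Γ4 c c e * s.Γ4 e b d - s.Γ4 c d e * s.Γ4 e b c))

lemma radial_zero : radial 0 = 1 := rfl
lemma radial_succ (a : Fin 3) : radial a.succ = 0 := by simp [radial]

lemma two_smul_half (f : B) : (1 / 2 : ℝ) • f + (1 / 2 : ℝ) • f = f := by
  rw [← add_smul]; norm_num

lemma half_two (f : B) : (1 / 2 : ℝ) • (2 * f) = f := by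
  rw [two_mul, smul_add, two_smul_half]

lemma γ_Γ_Cn (a b c : Fin 3) :
    ∑ e, s.γ a e * (G.Γ e b c + G.rs (fun d => s.Cn d b c) e) =
      (1 / 2 : ℝ) • (G.d b (s.γ a c) + G.d c (s.γ a b) - G.d a (s.γ b c)) := by
  simp only [mul_add, Finset.sum_add_distrib]
  have : ∑ e, s.γ a e * G.rs (fun d => s.Cn d b c) e = s.Z a b c := s.γ_rs_lw _ a
  rw [this, Z]
  have h2 : ∑ e, s.γ a e * G.Γ e b c = (1 / 2 : ℝ) • (2 * ∑ e, s.γ a e * G.Γ e b c) :=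
    (half_two _).symm
  rw [h2, ← smul_add]
  congr 1
  simp only [Framed.D2, Fin.sum_univ_three, G.Γ_symm _ c b, G.Γ_symm _ b a, G.Γ_symm _ c a,
    s.γ_symm _ a]
  ring_nf
  rw [s.γ_symm b 0, s.γ_symm b 1, s.γ_symm b 2]
  ring

lemma christoffel4 (β b d : Fin 4) : ∑ e, s.G4 β e * s.Γ4 e b d =
    (1 / 2 : ℝ) • (s.wd b (2 - radial β - radial d) (s.G4 β d) +
      s.wd d (2 - radial β - radial b) (s.G4 β b) - s.wd β (2 - radial b - radial d) (s.G4 b d)) := by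
  rw [Fin.sum_univ_succ]
  have hN : s.N * s.N * s.m = s.N * s.θ s.N := by
    rw [m]; linear_combination s.N * s.θ s.N * s.N_Ni
  have hn : ∀ a, s.N * s.N * s.n a = s.N * G.d a s.N := fun a => by
    rw [n]; linear_combination s.N * G.d a s.N * s.N_Ni
  have hP : ∀ a b, s.N * s.N * s.P a b = -s.kap a b := fun a b => by
    rw [P]; linear_combination -s.kap a b * (s.N * s.Ni + 1) * s.N_Ni
  have hX : ∀ a, ∑ c, s.γ a c * G.rs s.X c = -(s.N * G.d a s.N) := fun a => s.γ_rs_lw _ a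
  have hK : ∀ a b, ∑ c, s.γ a c * G.rs (fun d => s.K d b) c = s.kap a b := fun a b => s.γ_rs_lw _ a
  have hk : ∀ a b, (1 / 2 : ℝ) • (2 * s.γ a b + s.θ (s.γ a b)) = s.kap a b := fun a b => by
    rw [smul_add, half_two]; rfl
  have z1 : ∀ a : Fin 3, (0 : Fin 3 → B) a = 0 := fun _ => rfl
  have hl : ∀ D : Derivation ℝ B B, D (s.N * s.N) = 2 * (s.N * D s.N) := fun D => by
    rw [Derivation.leibniz, smul_eq_mul]; ring
  refine Fin.cases ?_ (fun β => ?_) β <;> refine Fin.cases ?_ (fun b => ?_) b <;>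
    refine Fin.cases ?_ (fun d => ?_) d <;>
    simp only [G4, Γ4, wd, Fin.cons_zero, Fin.cons_succ, radial_zero, radial_succ, z1, zero_mul,
      Finset.sum_const_zero, add_zero, zero_add, map_zero, mul_zero, sub_zero, hN, hn, hP, hX, hK,
      hl, γ_Γ_Cn, zero_sub, smul_neg, Nat.cast_one, Nat.cast_zero, sub_self, Int.cast_zero,
      Int.cast_ofNat, hk, half_two, add_sub_cancel_right, add_sub_cancel_left]
  all_goals norm_num [hk, half_two, hl]

/-- The trace of the extrinsic curvature. -/
def trK : B := ∑ c, G.rs (fun d => s.K d c) c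
/-- The trace of the difference of the connections. -/
def trC (e : Fin 3) : B := ∑ c, G.rs (fun d => s.Cn d c e) c

lemma Cn_symm (d a b : Fin 3) : s.Cn d a b = s.Cn d b a := by
  unfold Cn
  congr 1
  funext e
  have h1 : G.D2 s.γ e a b = G.D2 s.γ e b a := by
    rw [Framed.D2, Framed.D2, s.γ_symm a b]
    congr 1
    exact Finset.sum_congr rfl fun i _ => by rw [s.γ_symm i b, s.γ_symm a i]; ring
  rw [Z, Z, h1, add_comm]

lemma ric4_zero_zero : s.ric4 0 0 =
    ∑ c, G.rs (G.D1 s.X c) c + ∑ e, s.trC e * G.rs s.X e - s.θ s.trK + s.trK + s.trK * s.m -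
      ∑ c, s.n c * G.rs s.X c - ∑ c, ∑ e, G.rs (fun d => s.K d e) c * G.rs (fun d => s.K d c) e := by
  rw [ric4, Fin.sum_univ_succ]
  simp only [Fin.sum_univ_succ (n := 3), Γ4, wd, Fin.cons_zero, Fin.cons_succ, radial_zero, radial_succ,
    trK, trC, G.d_rs, map_sum]
  push_cast
  simp only [Fin.sum_univ_three]
  ring

lemma ric4_zero_succ (b : Fin 3) : s.ric4 0 b.succ =
    ∑ c, G.rs (fun d => G.D2 s.K c d b) c - G.d b s.trK + s.trK * s.n b +
      ∑ e, s.trC e * G.rs (fun d => s.K d b) e -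
      ∑ c, ∑ e, G.rs (fun d => s.Cn d b e) c * G.rs (fun d => s.K d c) e -
      ∑ e, s.P b e * G.rs s.X e := by
  have h0 : s.θ (s.n b) = G.d b s.m := by
    have hi : ∀ D : Derivation ℝ B B, D s.Ni = -(s.Ni * s.Ni * D s.N) := fun D => by
      have := congrArg D s.N_Ni
      rw [Derivation.leibniz, Derivation.map_one_eq_zero, smul_eq_mul, smul_eq_mul] at this
      linear_combination s.Ni * this - D s.Ni * s.N_Ni
    rw [n, m, Derivation.leibniz, Derivation.leibniz, hi, hi, s.θ_d]
    simp only [smul_eq_mul]; ring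
  have h1 : ∀ c, G.d c (G.rs (fun d => s.K d b) c) = G.rs (fun d => G.D2 s.K c d b) c +
      ∑ e, G.Γ e c b * G.rs (fun d => s.K d e) c - ∑ f, G.Γ c c f * G.rs (fun d => s.K d b) f := by
    intro c
    rw [G.d_rs]
    simp only [Geo.rs, Framed.D1, Framed.D2, Fin.sum_univ_three]
    ring
  rw [ric4, Fin.sum_univ_succ]
  simp only [Fin.sum_univ_succ (n := 3), Γ4, wd, Fin.cons_zero, Fin.cons_succ, radial_zero, radial_succ,
    trK, trC, map_sum, h1]
  push_cast
  rw [h0]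
  simp only [Fin.sum_univ_three, G.Γ_symm _ b]
  ring

lemma ric4_succ_zero (b : Fin 3) : s.ric4 b.succ 0 =
    ∑ c, G.rs (fun d => G.D2 s.K c d b) c - s.θ (s.trC b) + s.trK * s.n b +
      ∑ e, s.trC e * G.rs (fun d => s.K d b) e -
      ∑ c, ∑ e, G.rs (fun d => s.Cn d b e) c * G.rs (fun d => s.K d c) e -
      ∑ e, s.P b e * G.rs s.X e := by
  have h1 : ∀ c, G.d c (G.rs (fun d => s.K d b) c) = G.rs (fun d => G.D2 s.K c d b) c +
      ∑ e, G.Γ e c b * G.rs (fun d => s.K d e) c - ∑ f, G.Γ c c f * G.rs (fun d => s.K d b) f := by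
    intro c
    rw [G.d_rs]
    simp only [Geo.rs, Framed.D1, Framed.D2, Fin.sum_univ_three]
    ring
  rw [ric4, Fin.sum_univ_succ]
  simp only [Fin.sum_univ_succ (n := 3), Γ4, wd, Fin.cons_zero, Fin.cons_succ, radial_zero, radial_succ,
    trK, trC, map_sum, map_add, h1, s.θ_Γ]
  push_cast
  simp only [Fin.sum_univ_three, G.Γ_symm _ b, s.Cn_symm _ b]
  ring

lemma ric4_succ_succ (a b : Fin 3) : s.ric4 a.succ b.succ =
    2 * G.h a b + ∑ c, G.rs (fun d => G.D3 s.Cn c d a b) c - ∑ c, G.rs (fun d => G.D3 s.Cn b d a c) c +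
      ∑ e, s.trC e * G.rs (fun d => s.Cn d a b) e -
      ∑ c, ∑ e, G.rs (fun d => s.Cn d b e) c * G.rs (fun d => s.Cn d a c) e +
      (s.θ (s.P a b) + s.P a b) + (s.m + s.trK) * s.P a b - G.D1 s.n b a +
      ∑ e, s.n e * G.rs (fun d => s.Cn d a b) e - s.n b * s.n a -
      ∑ e, s.P b e * G.rs (fun d => s.K d a) e - ∑ e, s.P a e * G.rs (fun d => s.K d b) e := by
  have h1 : ∀ c' c a b, G.d c' (G.rs (fun d => s.Cn d a b) c) =
      G.rs (fun d => G.D3 s.Cn c' d a b) c +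
      ∑ e, G.Γ e c' a * G.rs (fun d => s.Cn d e b) c + ∑ e, G.Γ e c' b * G.rs (fun d => s.Cn d a e) c -
      ∑ f, G.Γ c c' f * G.rs (fun d => s.Cn d a b) f := by
    intro c' c a b
    rw [G.d_rs]
    simp only [Geo.rs, Framed.D1, Framed.D3, Fin.sum_univ_three]
    ring
  have hR : ∑ c, (G.d c (G.Γ c a b) - G.d b (G.Γ c a c) +
      ∑ e, (G.Γ c c e * G.Γ e a b - G.Γ c b e * G.Γ e a c)) = 2 * G.h a b := by
    have : ∀ c, G.d c (G.Γ c a b) - G.d b (G.Γ c a c) +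
      ∑ e, (G.Γ c c e * G.Γ e a b - G.Γ c b e * G.Γ e a c) = _ := fun c => G.curv c a c b
    simp only [this]
    change ∑ c, ((if c = c then G.h a b else 0) - if c = b then G.h a c else 0) = _
    simp only [if_true, Finset.sum_sub_distrib, Finset.sum_ite_eq', Finset.mem_univ]
    simp only [Fin.sum_univ_three]; ring
  rw [ric4, Fin.sum_univ_succ]
  simp only [Fin.sum_univ_succ (n := 3), Γ4, wd, Fin.cons_zero, Fin.cons_succ, radial_zero, radial_succ,
    trK, trC, map_sum, map_add, h1, Framed.D1]
  push_cast
  rw [← hR]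
  simp only [Fin.sum_univ_three, G.Γ_symm _ b, s.Cn_symm _ b, G.Γ_symm _ 2 a, G.Γ_symm _ 1 a, G.Γ_symm _ 0 a,
    s.Cn_symm _ 2 a, s.Cn_symm _ 1 a, s.Cn_symm _ 0 a, G.Γ_symm _ 1 0, G.Γ_symm _ 2 0, G.Γ_symm _ 2 1, s.Cn_symm _ 1 0, s.Cn_symm _ 2 0, s.Cn_symm _ 2 1]
  ring

end Slicing

/-! ### Frame components of the 3+1 decomposition -/

section Contract

variable {R : Type*} [CommRing R] (E : Fin 3 → Fin 3 → R)

lemma contract_mixed (X Y : Fin 3 → Fin 3 → R) :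
    ∑ c, ∑ e, (∑ d, frameInv E c d * X d e) * (∑ f, frameInv E e f * Y f c) =
      ∑ I, ∑ M, t1 E (fun d => t1 E (fun e => X d e) M) I *
        t1 E (fun f => t1 E (fun c => Y f c) I.rev) M.rev := by
  simp only [contract_one, t1_sum, t1_mul_left]
  rw [Finset.sum_comm]
  have : ∀ M, ∑ c, (∑ d, frameInv E c d * t1 E (fun e => X d e) M) * t1 E (fun f => Y f c) M.rev =
      ∑ c, t1 E (fun f => Y f c) M.rev * ∑ d, frameInv E c d * t1 E (fun e => X d e) M :=
    fun M => Finset.sum_congr rfl fun _ _ => mul_comm _ _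
  simp only [this, contract_one]
  rw [Finset.sum_comm, ← sum_rev]
  refine Finset.sum_congr rfl fun I _ => Finset.sum_congr rfl fun M _ => ?_
  rw [Fin.rev_rev, mul_comm, t1_comm E (fun c f => Y f c)]

lemma t1_swap_four (X : Fin 3 → Fin 3 → Fin 3 → Fin 3 → R) (I J K L : Fin 3) :
    t1 E (fun c => t1 E (fun d => t1 E (fun a => t1 E (fun b => X b d a c) L) K) J) I =
      t1 E (fun b => t1 E (fun d => t1 E (fun a => t1 E (fun c => X b d a c) I) K) J) L := by
  rw [show (fun c => t1 E (fun d => t1 E (fun a => t1 E (fun b => X b d a c) L) K) J) =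
    fun c => t1 E (fun b => t1 E (fun d => t1 E (fun a => X b d a c) K) J) L from funext fun c => by
      rw [← t1_comm E (fun d b => t1 E (fun a => X b d a c) K)]
      congr 1; funext d; exact t1_comm E (fun a b => X b d a c) K L]
  rw [t1_comm E (fun c b => t1 E (fun d => t1 E (fun a => X b d a c) K) J)]
  congr 1; funext b
  rw [t1_comm E (fun c d => t1 E (fun a => X b d a c) K)]
  congr 1; funext d
  exact t1_comm E (fun c a => X b d a c) I K

lemma t1_rot (X : Fin 3 → Fin 3 → Fin 3 → R) (I J L : Fin 3) :
    t1 E (fun a => t1 E (fun b => t1 E (fun e => X e a b) I) L) J =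
      t1 E (fun e => t1 E (fun a => t1 E (fun b => X e a b) L) J) I := by
  rw [← t1_comm E (fun a e => t1 E (fun b => X e a b) L)]
  congr 1; funext a
  exact t1_comm E (fun b e => X e a b) L I

end Contract

section Raise

variable {B : Type*} [CommRing B] [Algebra ℝ B] (G : Geo B)

lemma Geo.tf1_eq (v : Fin 3 → B) : G.tf1 v = t1 G.E v := rfl

lemma Geo.sum_mul_rs (v w : Fin 3 → B) :
    ∑ e, v e * G.rs w e = ∑ I, G.tf1 v I * G.tf1 w I.rev := contract_one G.E v w

lemma Geo.sum_rs (T : Fin 3 → Fin 3 → B) : ∑ c, G.rs (T c) c = ∑ I, G.tf2 T I I.rev := by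
  simp only [Geo.tf2_apply]; exact contract G.E T

lemma Geo.sum_rs' (T : Fin 3 → Fin 3 → B) :
    ∑ c, G.rs (fun d => T d c) c = ∑ I, G.tf2 T I I.rev := by
  rw [G.sum_rs fun c d => T d c, ← sum_rev]
  refine Finset.sum_congr rfl fun I _ => ?_
  rw [Geo.tf2_apply, Geo.tf2_apply, Geo.tf1_comm, Fin.rev_rev]

end Raise

namespace Slicing

variable {B : Type*} [CommRing B] [Algebra ℝ B] {G : Geo B} (s : Slicing G)

lemma θ_tf1 (v : Fin 3 → B) (I : Fin 3) : s.θ (G.tf1 v I) = G.tf1 (fun a => s.θ (v a)) I := by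
  simp only [Geo.tf1_eq, t1, map_sum, Derivation.leibniz, s.θ_E, smul_zero, smul_eq_mul,
    mul_zero, add_zero]

lemma θ_tf2 (T : Fin 3 → Fin 3 → B) (I J : Fin 3) :
    s.θ (G.tf2 T I J) = G.tf2 (fun a b => s.θ (T a b)) I J := by
  simp only [Geo.tf2_apply, θ_tf1]

lemma tf1_lw (v : Fin 3 → B) (I : Fin 3) :
    G.tf1 (s.lw v) I = ∑ M, G.tf2 s.γt I M * G.tf1 v M.rev := by
  have : s.lw v = fun d => ∑ M, G.tf1 (s.γt d) M * G.tf1 v M.rev := by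
    funext d; exact G.sum_mul_rs _ _
  rw [this]
  simp only [Geo.tf1_eq, t1_sum, t1_mul_right, Geo.tf2_apply]

lemma tf2_kap (I J : Fin 3) : G.tf2 s.kap I J =
    G.tf2 s.γ I J + (1 / 2 : ℝ) • s.θ (G.tf2 s.γ I J) := by
  have h1 : s.kap = s.γ + algebraMap ℝ B (1 / 2) • fun a b => s.θ (s.γ a b) := by
    funext a b
    simp only [Pi.add_apply, Pi.smul_apply, algebraMap_smul]; rfl
  rw [h1, ← Framed.tf2L_apply, map_add, map_smul]
  simp only [Pi.add_apply, Pi.smul_apply, algebraMap_smul, Framed.tf2L_apply, θ_tf2]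

lemma tf2_K (I J : Fin 3) : G.tf2 s.K I J = ∑ M, G.tf2 s.γt I M * G.tf2 s.kap M.rev J := by
  rw [Geo.tf2_apply, Geo.tf1_comm]
  have : ∀ b, G.tf1 (fun d => s.K d b) I = ∑ M, G.tf2 s.γt I M * G.tf1 (fun e => s.kap e b) M.rev :=
    fun b => s.tf1_lw _ I
  simp only [this]
  simp only [Geo.tf1_eq, t1_sum, t1_mul_left]
  refine Finset.sum_congr rfl fun M _ => ?_
  rw [Geo.tf2_apply, t1_comm]; rfl

lemma tf3_swap (X : Fin 3 → Fin 3 → Fin 3 → B) (I J L : Fin 3) :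
    G.tf3 (fun d a b => X a d b) I J L = G.tf3 X J I L := by
  rw [Geo.tf3_apply, Geo.tf3_apply, Geo.tf1_comm]

lemma tf3_swap' (X : Fin 3 → Fin 3 → Fin 3 → B) (I J L : Fin 3) :
    G.tf3 (fun d a b => X d b a) I J L = G.tf3 X I L J := by
  rw [Geo.tf3_apply, Geo.tf3_apply]
  congr 1; funext d; rw [Geo.tf1_comm]

lemma tf3_rot (X : Fin 3 → Fin 3 → Fin 3 → B) (I J L : Fin 3) :
    G.tf3 (fun d a b => X b d a) I J L = G.tf3 X L I J :=
  (tf3_swap' (fun d b a => X b d a) I J L).trans (tf3_swap X I L J)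

lemma tf3_Z (I J L : Fin 3) : G.tf3 s.Z I J L = (1 / 2 : ℝ) • (G.N2 (G.tf2 s.γ) J I L +
    G.N2 (G.tf2 s.γ) L I J - G.N2 (G.tf2 s.γ) I J L) := by
  have h1 : s.Z = algebraMap ℝ B (1 / 2) • ((fun d a b => G.D2 s.γ a d b) +
      (fun d a b => G.D2 s.γ b d a) - G.D2 s.γ) := by
    funext d a b
    simp only [Pi.add_apply, Pi.sub_apply, Pi.smul_apply, algebraMap_smul]; rfl
  rw [h1, ← Framed.tf3L_apply, map_smul, map_sub, map_add]
  simp only [Pi.add_apply, Pi.sub_apply, Pi.smul_apply, algebraMap_smul, Framed.tf3L_apply]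
  rw [tf3_swap (G.D2 s.γ), tf3_rot (G.D2 s.γ), Framed.tf3_D2]

lemma tf3_Cn (I J L : Fin 3) :
    G.tf3 s.Cn I J L = ∑ M, G.tf2 s.γt I M * G.tf3 s.Z M.rev J L := by
  rw [Geo.tf3_apply]
  simp only [Geo.tf1_eq]
  rw [← t1_rot]
  have h2 : ∀ a b, G.tf1 (fun d => s.Cn d a b) I =
      ∑ M, G.tf2 s.γt I M * G.tf1 (fun e => s.Z e a b) M.rev := fun a b => s.tf1_lw _ I
  simp only [Geo.tf1_eq] at h2
  simp only [h2, t1_sum, t1_mul_left]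
  refine Finset.sum_congr rfl fun M _ => ?_
  rw [Geo.tf3_apply, t1_rot]; rfl

lemma tf1_X (I : Fin 3) :
    G.tf1 s.X I = -(s.N * ∑ M, G.tf2 s.γt I M * G.e M.rev s.N) := by
  have h1 : ∀ M, G.tf1 (fun e => -(s.N * G.d e s.N)) M = -(s.N * G.e M s.N) := fun M => by
    rw [← Framed.e_zero_tf, ← Geo.tf1_mul_left]
    simp [Geo.tf1_eq, t1]
  have : G.tf1 s.X I = ∑ M, G.tf2 s.γt I M * -(s.N * G.e M.rev s.N) := by
    simp only [← h1]; exact s.tf1_lw _ I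
  rw [this, Finset.mul_sum, ← Finset.sum_neg_distrib]
  exact Finset.sum_congr rfl fun _ _ => by ring

lemma tf1_n (I : Fin 3) : G.tf1 s.n I = s.Ni * G.e I s.N := by
  rw [← Framed.e_zero_tf, ← Geo.tf1_mul_left]; rfl

lemma tf2_P (I J : Fin 3) : G.tf2 s.P I J = -(s.Ni * s.Ni * G.tf2 s.kap I J) := by
  simp only [Geo.tf2_apply, ← Geo.tf1_mul_left]
  simp [P, Geo.tf1_eq, t1]

lemma trK_eq : s.trK = ∑ I, G.tf2 s.K I I.rev := G.sum_rs' s.K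

lemma tf1_trC (J : Fin 3) : G.tf1 s.trC J = ∑ I, G.tf3 s.Cn I I.rev J := by
  have h1 : s.trC = fun e => ∑ c, ∑ d, frameInv G.E c d * s.Cn d c e := rfl
  rw [h1]
  simp only [Geo.tf1_eq, t1_sum, t1_mul_left]
  have h2 := G.sum_rs' fun d c => t1 G.E (s.Cn d c) J
  simp only [Geo.tf3_apply, Geo.tf2_apply] at h2 ⊢
  exact h2

/-- The frame components of the Ricci tensor. -/
lemma ric_zero_zero : s.ric4 0 0 = ∑ I, G.N1 (G.tf1 s.X) I I.rev +
    ∑ I, G.tf1 s.trC I * G.tf1 s.X I.rev - s.θ s.trK + s.trK + s.trK * s.m -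
    ∑ I, G.tf1 s.n I * G.tf1 s.X I.rev - ∑ I, ∑ M, G.tf2 s.K I M * G.tf2 s.K M.rev I.rev := by
  rw [ric4_zero_zero, G.sum_rs, G.sum_mul_rs, G.sum_mul_rs, Framed.tf2_D1]
  have := contract_mixed G.E s.K s.K
  simp only [Geo.rs]
  rw [this]
  simp only [Geo.tf2_apply]
  rfl

lemma tf1_div (J : Fin 3) : G.tf1 (fun b => ∑ c, G.rs (fun d => G.D2 s.K c d b) c) J =
    ∑ I, G.N2 (G.tf2 s.K) I I.rev J := by
  simp only [Geo.rs]
  simp only [Geo.tf1_eq, t1_sum, t1_mul_left]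
  rw [contract, ← Framed.tf3_D2]
  simp only [Geo.tf3_apply]
  rfl

lemma tf1_CK (J : Fin 3) : G.tf1 (fun b => ∑ c, ∑ e, G.rs (fun d => s.Cn d b e) c *
    G.rs (fun d => s.K d c) e) J =
    ∑ I, ∑ M, G.tf3 s.Cn I J M * G.tf2 s.K M.rev I.rev := by
  have h1 : ∀ b, ∑ c, ∑ e, G.rs (fun d => s.Cn d b e) c * G.rs (fun d => s.K d c) e = _ :=
    fun b => contract_mixed G.E (fun d e => s.Cn d b e) s.K
  simp only [h1]
  simp only [Geo.tf1_eq, t1_sum, t1_mul_right]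
  refine Finset.sum_congr rfl fun I _ => Finset.sum_congr rfl fun M _ => ?_
  rw [Geo.tf3_apply, Geo.tf2_apply, t1_comm G.E (fun f c => s.K f c),
    t1_comm G.E (fun a d => t1 G.E (fun b => s.Cn d a b) M)]
  rw [t1_comm G.E (fun c f => s.K f c)]
  rfl

lemma tf1_pair_K (v : Fin 3 → B) (J : Fin 3) :
    G.tf1 (fun b => ∑ e, v e * G.rs (fun d => s.K d b) e) J =
      ∑ I, G.tf1 v I * G.tf2 s.K I.rev J := by
  simp only [G.sum_mul_rs]
  simp only [Geo.tf1_eq, t1_sum, t1_mul_left]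
  refine Finset.sum_congr rfl fun I _ => ?_
  rw [Geo.tf2_apply, t1_comm]; rfl

lemma tf1_pair_P (v : Fin 3 → B) (J : Fin 3) :
    G.tf1 (fun b => ∑ e, s.P b e * G.rs v e) J = ∑ I, G.tf2 s.P J I * G.tf1 v I.rev := by
  simp only [G.sum_mul_rs]
  simp only [Geo.tf1_eq, t1_sum, t1_mul_right]
  refine Finset.sum_congr rfl fun I _ => ?_
  rw [Geo.tf2_apply]; rfl

lemma ric_zero_succ (J : Fin 3) : G.tf1 (fun b => s.ric4 0 b.succ) J =
    ∑ I, G.N2 (G.tf2 s.K) I I.rev J - G.e J s.trK + s.trK * G.tf1 s.n J +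
      ∑ I, G.tf1 s.trC I * G.tf2 s.K I.rev J -
      ∑ I, ∑ M, G.tf3 s.Cn I J M * G.tf2 s.K M.rev I.rev -
      ∑ I, G.tf2 s.P J I * G.tf1 s.X I.rev := by
  simp only [ric4_zero_succ, Geo.tf1_sub', Geo.tf1_add', tf1_div, tf1_CK, tf1_pair_K, tf1_pair_P,
    Geo.tf1_mul_left, Framed.e_zero_tf]

lemma ric_succ_zero (J : Fin 3) : G.tf1 (fun b => s.ric4 b.succ 0) J =
    ∑ I, G.N2 (G.tf2 s.K) I I.rev J - s.θ (G.tf1 s.trC J) + s.trK * G.tf1 s.n J +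
      ∑ I, G.tf1 s.trC I * G.tf2 s.K I.rev J -
      ∑ I, ∑ M, G.tf3 s.Cn I J M * G.tf2 s.K M.rev I.rev -
      ∑ I, G.tf2 s.P J I * G.tf1 s.X I.rev := by
  simp only [ric4_succ_zero, Geo.tf1_sub', Geo.tf1_add', tf1_div, tf1_CK, tf1_pair_K, tf1_pair_P,
    Geo.tf1_mul_left, θ_tf1]

lemma tf2_pair_Cn (v : Fin 3 → B) (J L : Fin 3) :
    G.tf1 (fun a => G.tf1 (fun b => ∑ e, v e * G.rs (fun d => s.Cn d a b) e) L) J =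
      ∑ I, G.tf1 v I * G.tf3 s.Cn I.rev J L := by
  simp only [G.sum_mul_rs]
  simp only [Geo.tf1_eq, t1_sum, t1_mul_left]
  refine Finset.sum_congr rfl fun I _ => ?_
  rw [Geo.tf3_apply, t1_rot]; rfl

lemma tf2_div_Cn (J L : Fin 3) :
    G.tf1 (fun a => G.tf1 (fun b => ∑ c, G.rs (fun d => G.D3 s.Cn c d a b) c) L) J =
      ∑ I, G.N3 (G.tf3 s.Cn) I I.rev J L := by
  simp only [Geo.rs]
  simp only [Geo.tf1_eq, t1_sum, t1_mul_left]
  rw [contract, ← Framed.tf4_D3]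
  simp only [Geo.tf4_apply]
  rfl

lemma tf2_grad_trC (J L : Fin 3) :
    G.tf1 (fun a => G.tf1 (fun b => ∑ c, G.rs (fun d => G.D3 s.Cn b d a c) c) L) J =
      ∑ I, G.N3 (G.tf3 s.Cn) L I.rev J I := by
  simp only [Geo.rs]
  simp only [Geo.tf1_eq, t1_sum, t1_mul_left]
  rw [contract, ← Framed.tf4_D3]
  refine Finset.sum_congr rfl fun I _ => ?_
  rw [Geo.tf4_apply]
  exact t1_swap_four G.E (fun b d a c => G.D3 s.Cn b d a c) _ _ _ _

lemma tf2_CC (J L : Fin 3) :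
    G.tf1 (fun a => G.tf1 (fun b => ∑ c, ∑ e, G.rs (fun d => s.Cn d b e) c *
      G.rs (fun d => s.Cn d a c) e) L) J =
      ∑ I, ∑ M, G.tf3 s.Cn I L M * G.tf3 s.Cn M.rev J I.rev := by
  have h1 : ∀ a b, ∑ c, ∑ e, G.rs (fun d => s.Cn d b e) c * G.rs (fun d => s.Cn d a c) e = _ :=
    fun a b => contract_mixed G.E (fun d e => s.Cn d b e) (fun d c => s.Cn d a c)
  simp only [h1]
  simp only [Geo.tf1_eq, t1_sum, t1_mul_right, t1_mul_left]
  refine Finset.sum_congr rfl fun I _ => Finset.sum_congr rfl fun M _ => ?_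
  rw [Geo.tf3_apply, Geo.tf3_apply, t1_comm G.E (fun b d => t1 G.E (fun e => s.Cn d b e) M),
    t1_comm G.E (fun a f => t1 G.E (fun c => s.Cn f a c) I.rev)]
  rfl

lemma ric_succ_succ (J L : Fin 3) : G.tf2 (fun a b => s.ric4 a.succ b.succ) J L =
    2 * nullMetric B J L + ∑ I, G.N3 (G.tf3 s.Cn) I I.rev J L - ∑ I, G.N3 (G.tf3 s.Cn) L I.rev J I +
      ∑ I, G.tf1 s.trC I * G.tf3 s.Cn I.rev J L -
      ∑ I, ∑ M, G.tf3 s.Cn I L M * G.tf3 s.Cn M.rev J I.rev +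
      (s.θ (G.tf2 s.P J L) + G.tf2 s.P J L) + (s.m + s.trK) * G.tf2 s.P J L -
      G.N1 (G.tf1 s.n) L J + ∑ I, G.tf1 s.n I * G.tf3 s.Cn I.rev J L -
      G.tf1 s.n L * G.tf1 s.n J - ∑ I, G.tf2 s.P L I * G.tf2 s.K I.rev J -
      ∑ I, G.tf2 s.P J I * G.tf2 s.K I.rev L := by
  have h1 : G.tf1 (fun a => G.tf1 (fun b => ∑ e, s.P b e * G.rs (fun d => s.K d a) e) L) J =
      ∑ I, G.tf2 s.P L I * G.tf2 s.K I.rev J := by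
    simp only [tf1_pair_P]
    simp only [Geo.tf1_eq, t1_sum, t1_mul_left]
    refine Finset.sum_congr rfl fun I _ => ?_
    rw [Geo.tf2_apply G s.K, Geo.tf1_comm]; rfl
  have h2 : G.tf1 (fun a => G.tf1 (fun b => ∑ e, s.P a e * G.rs (fun d => s.K d b) e) L) J =
      ∑ I, G.tf2 s.P J I * G.tf2 s.K I.rev L := by
    simp only [tf1_pair_K]
    simp only [Geo.tf1_eq, t1_sum, t1_mul_right]
    refine Finset.sum_congr rfl fun I _ => ?_
    rw [Geo.tf2_apply G s.P]; rfl
  have h3 : G.tf1 (fun a => G.tf1 (fun b => G.D1 s.n b a) L) J = G.N1 (G.tf1 s.n) L J := by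
    rw [← Framed.tf2_D1, Geo.tf2_apply, Geo.tf1_comm]
  have h4 : G.tf1 (fun a => G.tf1 (fun b => s.n b * s.n a) L) J = G.tf1 s.n L * G.tf1 s.n J := by
    simp only [Geo.tf1_eq, t1_mul_right, t1_mul_left]
  have h5 : G.tf1 (fun a => G.tf1 (fun b => G.h a b) L) J = nullMetric B J L := by
    rw [← Geo.tf2_apply, Geo.tf2_h]
  have h6 : G.tf1 (fun a => G.tf1 (fun b => s.P a b) L) J = G.tf2 s.P J L :=
    (Geo.tf2_apply G s.P J L).symm
  have h7 : G.tf1 (fun a => G.tf1 (fun b => s.θ (s.P a b)) L) J = s.θ (G.tf2 s.P J L) := by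
    rw [θ_tf2, Geo.tf2_apply]
  rw [Geo.tf2_apply]
  simp only [ric4_succ_succ, Geo.tf1_sub', Geo.tf1_add', tf2_pair_Cn, tf2_div_Cn,
    tf2_grad_trC, tf2_CC, Geo.tf1_mul_left, h1, h2, h3, h4, h5, h6, h7]

end Slicing

/-! ### Asymptotic expansions -/

/-- The function represented by a truncated expansion. -/
def tval (T : Tr ℝ) (ρ : ℝ) : ℝ :=
  T.c0 + T.c1 * ρ⁻¹ + T.c2 * (ρ ^ 2)⁻¹ + T.cl * (Real.log ρ * (ρ ^ 2)⁻¹)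

/-- `F` has the expansion `T` up to `o(ρ⁻²)`. -/
def Asy (F : ℝ → ℝ) (T : Tr ℝ) : Prop :=
  (fun ρ => F ρ - tval T ρ) =o[atTop] fun ρ : ℝ => (ρ ^ 2)⁻¹

lemma tendsto_log_mul_inv : Tendsto (fun ρ : ℝ => Real.log ρ * ρ⁻¹) atTop (nhds 0) := by
  simpa [div_eq_mul_inv] using Real.isLittleO_log_id_atTop.tendsto_div_nhds_zero

lemma tendsto_tval (T : Tr ℝ) : Tendsto (tval T) atTop (nhds T.c0) := by
  have h1 := tendsto_inv_atTop_zero (𝕜 := ℝ)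
  have h2 : Tendsto (fun ρ : ℝ => (ρ ^ 2)⁻¹) atTop (nhds 0) := by
    simpa [inv_pow] using h1.pow 2
  have h3 : Tendsto (fun ρ : ℝ => Real.log ρ * (ρ ^ 2)⁻¹) atTop (nhds 0) := by
    have := tendsto_log_mul_inv.mul h1
    simp only [mul_zero] at this
    refine this.congr fun ρ => ?_
    rw [pow_two, mul_inv, mul_assoc]
  have := (((h1.const_mul T.c1).const_add T.c0).add (h2.const_mul T.c2)).add (h3.const_mul T.cl)
  simp only [mul_zero, add_zero] at this
  exact this

lemma tval_add (S T : Tr ℝ) (ρ : ℝ) : tval (S + T) ρ = tval S ρ + tval T ρ := by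
  simp only [tval, Tr.coeffs]; ring

lemma tval_smul (c : ℝ) (T : Tr ℝ) (ρ : ℝ) : tval (c • T) ρ = c * tval T ρ := by
  simp only [tval, Tr.smul_c0, Tr.smul_c1, Tr.smul_c2, Tr.smul_cl, smul_eq_mul]; ring

lemma tval_zero : tval 0 = 0 := by
  funext ρ; simp [tval]

lemma isLittleO_mul_of_tendsto {f g : ℝ → ℝ} (hf : Tendsto f atTop (nhds 0)) :
    (fun ρ => g ρ * f ρ) =o[atTop] g := by
  simpa using (isBigO_refl g atTop).mul_isLittleO ((isLittleO_one_iff ℝ).2 hf)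

lemma tval_mul (S T : Tr ℝ) : (fun ρ => tval S ρ * tval T ρ - tval (S * T) ρ) =o[atTop]
    fun ρ : ℝ => (ρ ^ 2)⁻¹ := by
  have h1 := tendsto_inv_atTop_zero (𝕜 := ℝ)
  have h3 := tendsto_log_mul_inv
  have hlim : Tendsto (fun ρ : ℝ => (S.c1 * T.c2 + S.c2 * T.c1) * ρ⁻¹ +
      (S.c2 * T.c2) * (ρ⁻¹ * ρ⁻¹) + (S.c1 * T.cl + S.cl * T.c1) * (Real.log ρ * ρ⁻¹) +
      (S.c2 * T.cl + S.cl * T.c2) * ((Real.log ρ * ρ⁻¹) * ρ⁻¹) +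
      S.cl * T.cl * ((Real.log ρ * ρ⁻¹) * (Real.log ρ * ρ⁻¹))) atTop (nhds 0) := by
    have := ((((h1.const_mul (S.c1 * T.c2 + S.c2 * T.c1)).add ((h1.mul h1).const_mul (S.c2 * T.c2))).add
      (h3.const_mul (S.c1 * T.cl + S.cl * T.c1))).add
      ((h3.mul h1).const_mul (S.c2 * T.cl + S.cl * T.c2))).add ((h3.mul h3).const_mul (S.cl * T.cl))
    simpa using this
  refine (isLittleO_mul_of_tendsto (g := fun ρ : ℝ => (ρ ^ 2)⁻¹) hlim).congr_left fun ρ => ?_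
  simp only [tval, Tr.coeffs, pow_two, mul_inv]
  ring

namespace Asy

variable {F F' : ℝ → ℝ} {S T : Tr ℝ}

lemma congr' (h : Asy F T) (hF : F =ᶠ[atTop] F') : Asy F' T :=
  IsLittleO.congr' h (hF.mono fun ρ hρ => by simp only [hρ]) EventuallyEq.rfl

lemma of_tval : Asy (tval T) T := by simp [Asy]

lemma add (h : Asy F S) (h' : Asy F' T) : Asy (fun ρ => F ρ + F' ρ) (S + T) :=
  (IsLittleO.add h h').congr_left fun ρ => by rw [tval_add]; ring

lemma smul (c : ℝ) (h : Asy F T) : Asy (fun ρ => c * F ρ) (c • T) :=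
  (IsLittleO.const_mul_left h c).congr_left fun ρ => by rw [tval_smul]; ring

lemma sub (h : Asy F S) (h' : Asy F' T) : Asy (fun ρ => F ρ - F' ρ) (S - T) := by
  have := h.add (h'.smul (-1))
  rw [neg_one_smul, ← sub_eq_add_neg] at this
  exact this.congr' (Eventually.of_forall fun ρ => by ring)

lemma zero : Asy (fun _ => 0) 0 := by simp [Asy, tval_zero]

lemma sum {ι : Type*} (s : Finset ι) {F : ι → ℝ → ℝ} {T : ι → Tr ℝ} (h : ∀ i, Asy (F i) (T i)) :
    Asy (fun ρ => ∑ i ∈ s, F i ρ) (∑ i ∈ s, T i) := by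
  classical
  induction s using Finset.induction_on with
  | empty => simpa using zero
  | insert i s hi ih => simpa [Finset.sum_insert hi] using (h i).add ih

lemma tendsto (h : Asy F T) : Tendsto F atTop (nhds T.c0) := by
  have h2 : Tendsto (fun ρ : ℝ => (ρ ^ 2)⁻¹) atTop (nhds 0) := by
    simpa [inv_pow] using (tendsto_inv_atTop_zero (𝕜 := ℝ)).pow 2
  have h3 : Tendsto (fun ρ => F ρ - tval T ρ) atTop (nhds 0) := IsLittleO.trans_tendsto h h2
  simpa using h3.add (tendsto_tval T)

lemma mul (h : Asy F S) (h' : Asy F' T) : Asy (fun ρ => F ρ * F' ρ) (S * T) := by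
  have h1 : (fun ρ => F' ρ * (F ρ - tval S ρ)) =o[atTop] fun ρ : ℝ => (ρ ^ 2)⁻¹ := by
    simpa using (h'.tendsto.isBigO_one ℝ).mul_isLittleO h
  have h2 : (fun ρ => tval S ρ * (F' ρ - tval T ρ)) =o[atTop] fun ρ : ℝ => (ρ ^ 2)⁻¹ := by
    simpa using ((tendsto_tval S).isBigO_one ℝ).mul_isLittleO h'
  exact ((h1.add h2).add (tval_mul S T)).congr_left fun ρ => by ring

lemma eq_zero_of_isLittleO_one (h : (tval T) =o[atTop] fun ρ : ℝ => (ρ ^ 1)⁻¹) :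
    T.c0 = 0 ∧ T.c1 = 0 := by
  have h1 := tendsto_inv_atTop_zero (𝕜 := ℝ)
  have h0 : T.c0 = 0 := by
    refine tendsto_nhds_unique (tendsto_tval T) (h.trans_tendsto ?_)
    simpa using h1
  refine ⟨h0, ?_⟩
  have h3 := (isLittleO_iff_tendsto' ((eventually_gt_atTop 0).mono fun ρ (hρ : (0 : ℝ) < ρ) h =>
    absurd h (by positivity))).1 h
  have h4 : Tendsto (fun ρ : ℝ => T.c1 + T.c2 * ρ⁻¹ + T.cl * (Real.log ρ * ρ⁻¹)) atTop (nhds T.c1) := by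
    have := ((h1.const_mul T.c2).const_add T.c1).add (tendsto_log_mul_inv.const_mul T.cl)
    simpa using this
  refine tendsto_nhds_unique h4 (h3.congr' ?_)
  filter_upwards [eventually_gt_atTop 0] with ρ hρ
  rw [tval, h0]
  field_simp
  ring

lemma eq_zero_of_isLittleO_two (h : (tval T) =o[atTop] fun ρ : ℝ => (ρ ^ 2)⁻¹) : T = 0 := by
  have h01 := eq_zero_of_isLittleO_one (T := T) (h.trans_isBigO (by
    refine IsBigO.of_bound 1 ?_
    filter_upwards [eventually_ge_atTop 1] with ρ (hρ : (1 : ℝ) ≤ ρ)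
    rw [one_mul, Real.norm_of_nonneg (by positivity), Real.norm_of_nonneg (by positivity)]
    exact inv_anti₀ (by positivity) (pow_le_pow_right₀ hρ (by norm_num))))
  have h3 := (isLittleO_iff_tendsto' ((eventually_gt_atTop 0).mono fun ρ (hρ : (0 : ℝ) < ρ) h =>
    absurd h (by positivity))).1 h
  have h4 : Tendsto (fun ρ : ℝ => T.c2 + T.cl * Real.log ρ) atTop (nhds 0) := by
    refine h3.congr' ?_
    filter_upwards [eventually_gt_atTop 0] with ρ hρ
    rw [tval, h01.1, h01.2]
    field_simp
    ring
  have hl : Tendsto (fun ρ : ℝ => (Real.log ρ)⁻¹) atTop (nhds 0) :=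
    Real.tendsto_log_atTop.inv_tendsto_atTop
  have h5 : T.cl = 0 := by
    have h6 : Tendsto (fun ρ : ℝ => T.c2 * (Real.log ρ)⁻¹ + T.cl) atTop (nhds T.cl) := by
      simpa using (hl.const_mul T.c2).add_const T.cl
    refine tendsto_nhds_unique h6 ?_
    have h7 := h4.mul hl
    rw [zero_mul] at h7
    refine h7.congr' ?_
    filter_upwards [eventually_gt_atTop 1] with ρ (hρ : (1 : ℝ) < ρ)
    have := (Real.log_pos hρ).ne'
    field_simp
  rw [h5] at h4
  have h8 : T.c2 = 0 := tendsto_nhds_unique (by simp) h4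
  exact Tr.ext h01.1 h01.2 h8 h5

lemma isLittleO_one_iff (h : Asy F T) :
    F =o[atTop] (fun ρ : ℝ => (ρ ^ 1)⁻¹) ↔ T.c0 = 0 ∧ T.c1 = 0 := by
  have hle : (fun ρ : ℝ => (ρ ^ 2)⁻¹) =o[atTop] fun ρ : ℝ => (ρ ^ 1)⁻¹ := by
    refine (isLittleO_mul_of_tendsto (g := fun ρ : ℝ => (ρ ^ 1)⁻¹)
      (tendsto_inv_atTop_zero (𝕜 := ℝ))).congr_left fun ρ => ?_
    rw [pow_one, pow_two, mul_inv]
  have h1 := IsLittleO.trans h hle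
  constructor
  · intro hF
    exact eq_zero_of_isLittleO_one ((hF.sub h1).congr_left fun ρ => by ring)
  · rintro ⟨h0, h0'⟩
    have h2 : tval T =o[atTop] fun ρ : ℝ => (ρ ^ 1)⁻¹ := by
      have : Tendsto (fun ρ : ℝ => T.c2 * ρ⁻¹ + T.cl * (Real.log ρ * ρ⁻¹)) atTop (nhds 0) := by
        simpa using ((tendsto_inv_atTop_zero (𝕜 := ℝ)).const_mul T.c2).add
          (tendsto_log_mul_inv.const_mul T.cl)
      refine (isLittleO_mul_of_tendsto (g := fun ρ : ℝ => (ρ ^ 1)⁻¹) this).congr_left fun ρ => ?_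
      rw [tval, h0, h0', pow_one, pow_two, mul_inv]; ring
    exact (h1.add h2).congr_left fun ρ => by ring

lemma isLittleO_two_iff (h : Asy F T) : F =o[atTop] (fun ρ : ℝ => (ρ ^ 2)⁻¹) ↔ T = 0 := by
  constructor
  · intro hF
    exact eq_zero_of_isLittleO_two ((IsLittleO.sub hF h).congr_left fun ρ => by ring)
  · rintro rfl
    exact IsLittleO.congr_left h fun ρ => by simp [tval_zero]

end Asy

/-- Solving a linear system of expansions. -/
lemma Asy.solve {n : ℕ} {M : Fin n → Fin n → ℝ → ℝ} {G : Fin n → Fin n → Tr ℝ}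
    {y s : Fin n → ℝ → ℝ} {Y Sf : Fin n → Tr ℝ} (hM : ∀ a b, Asy (M a b) (G a b))
    (hdet : (Matrix.of fun a b => (G a b).c0).det ≠ 0)
    (hs : ∀ a, Asy (s a) (Sf a)) (hY : ∀ a, ∑ e, G a e * Y e = Sf a)
    (hy : ∀ᶠ ρ in atTop, ∀ a, ∑ e, M a e ρ * y e ρ = s a ρ) (e : Fin n) : Asy (y e) (Y e) := by
  have hlim : Tendsto (fun ρ => Matrix.of fun a b => M a b ρ) atTop
      (nhds (Matrix.of fun a b => (G a b).c0)) :=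
    tendsto_pi_nhds.2 fun a => tendsto_pi_nhds.2 fun b => (hM a b).tendsto
  have hd : Tendsto (fun ρ => (Matrix.of fun a b => M a b ρ).det) atTop
      (nhds (Matrix.of fun a b => (G a b).c0).det) :=
    ((continuous_id.matrix_det).tendsto _).comp hlim
  have hadj : Tendsto (fun ρ => (Matrix.of fun a b => M a b ρ).adjugate) atTop
      (nhds (Matrix.of fun a b => (G a b).c0).adjugate) :=
    ((continuous_id.matrix_adjugate).tendsto _).comp hlim
  have hinv : ∀ a b, (fun ρ => ((Matrix.of fun a b => M a b ρ).det)⁻¹ *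
      (Matrix.of fun a b => M a b ρ).adjugate a b) =O[atTop] fun _ => (1 : ℝ) := fun a b =>
    ((hd.inv₀ hdet).mul ((tendsto_pi_nhds.1 (tendsto_pi_nhds.1 hadj a)) b)).isBigO_one ℝ
  have hr : ∀ a, (fun ρ => s a ρ - ∑ e, M a e ρ * tval (Y e) ρ) =o[atTop]
      fun ρ : ℝ => (ρ ^ 2)⁻¹ := fun a => by
    have h1 := Asy.sum Finset.univ fun e => (hM a e).mul (Asy.of_tval (T := Y e))
    rw [hY] at h1
    exact (IsLittleO.sub (hs a) h1).congr_left fun ρ => by ring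
  have h2 : (fun ρ => ∑ a, ((Matrix.of fun a b => M a b ρ).det)⁻¹ *
      (Matrix.of fun a b => M a b ρ).adjugate e a * (s a ρ - ∑ e, M a e ρ * tval (Y e) ρ))
      =o[atTop] fun ρ : ℝ => (ρ ^ 2)⁻¹ :=
    IsLittleO.fun_sum fun a _ => by simpa using (hinv e a).mul_isLittleO (hr a)
  refine IsLittleO.congr' h2 ?_ EventuallyEq.rfl
  filter_upwards [hy, hd.eventually_ne hdet] with ρ hρ hdρ
  set A := Matrix.of fun a b => M a b ρ with hA
  have h3 : ∀ a, s a ρ - ∑ e, M a e ρ * tval (Y e) ρ =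
      A.mulVec (fun e => y e ρ - tval (Y e) ρ) a := fun a => by
    rw [← hρ a, ← Finset.sum_sub_distrib, Matrix.mulVec, dotProduct]
    exact Finset.sum_congr rfl fun e _ => by rw [hA, Matrix.of_apply]; ring
  have h4 := congrFun (Matrix.mulVec_mulVec (fun e => y e ρ - tval (Y e) ρ) A.adjugate A) e
  rw [Matrix.adjugate_mul, Matrix.smul_mulVec, Matrix.one_mulVec, Matrix.mulVec, dotProduct,
    Pi.smul_apply, smul_eq_mul] at h4
  simp only [h3, mul_assoc]
  rw [← Finset.mul_sum, h4, ← mul_assoc, inv_mul_cancel₀ hdρ, one_mul]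

/-! ### Expansions of spacetime fields and their derivatives -/

/-- The product of a function of `ρ` and a function of `x`. -/
def sep (u : ℝ → ℝ) (c : Fld 3) : Fld 4 := fun p => u (p 0) * c (Fin.tail p)

/-- The point `(ρ, x)`. -/
abbrev at4 (x : Fin 3 → ℝ) (ρ : ℝ) : Fin 4 → ℝ := Matrix.vecCons ρ x

lemma at4_zero (x : Fin 3 → ℝ) (ρ : ℝ) : at4 x ρ 0 = ρ := rfl

lemma tail_at4 (x : Fin 3 → ℝ) (ρ : ℝ) : Fin.tail (at4 x ρ) = x := rfl

/-- Forgetting `ρ`, as a linear map. -/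
def tailL : (Fin 4 → ℝ) →L[ℝ] (Fin 3 → ℝ) :=
  ContinuousLinearMap.pi fun a => ContinuousLinearMap.proj a.succ

lemma tailL_apply (p : Fin 4 → ℝ) : tailL p = Fin.tail p := rfl

lemma contDiffAt_sep {u : ℝ → ℝ} {c : Fld 3} {p : Fin 4 → ℝ} {k : WithTop ℕ∞}
    (hu : ContDiffAt ℝ k u (p 0)) (hc : ContDiffAt ℝ k c (Fin.tail p)) :
    ContDiffAt ℝ k (sep u c) p :=
  (hu.comp p (contDiff_apply ℝ ℝ (0 : Fin 4)).contDiffAt).mul (hc.comp p tailL.contDiff.contDiffAt)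

lemma pd_sep {u : ℝ → ℝ} {u' : ℝ} {c : Fld 3} {p : Fin 4 → ℝ} (hu : HasDerivAt u u' (p 0))
    (hc : DifferentiableAt ℝ c (Fin.tail p)) :
    pd 0 (sep u c) p = u' * c (Fin.tail p) ∧
      ∀ a : Fin 3, pd a.succ (sep u c) p = u (p 0) * pd a c (Fin.tail p) := by
  have h1 : HasFDerivAt (fun p : Fin 4 → ℝ => u (p 0))
      (u' • (ContinuousLinearMap.proj 0 : (Fin 4 → ℝ) →L[ℝ] ℝ)) p :=
    hu.comp_hasFDerivAt p (ContinuousLinearMap.proj 0 : (Fin 4 → ℝ) →L[ℝ] ℝ).hasFDerivAt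
  have h2 : HasFDerivAt (fun p : Fin 4 → ℝ => c (Fin.tail p))
      ((fderiv ℝ c (Fin.tail p)).comp tailL) p :=
    HasFDerivAt.comp p (g := c) (f := tailL) hc.hasFDerivAt tailL.hasFDerivAt
  have h3 := (h1.mul h2).fderiv
  have ht0 : tailL (Pi.single 0 1) = 0 := by
    funext a; simp [tailL_apply, Fin.tail]
  have hts : ∀ a : Fin 3, tailL (Pi.single a.succ 1) = Pi.single a 1 := by
    intro a; funext b
    simp only [tailL_apply, Fin.tail, Pi.single_apply, Fin.succ_inj]
  constructor
  · rw [pd, show sep u c = (fun p => u (p 0)) * fun p => c (Fin.tail p) from rfl, h3]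
    simp [ht0, mul_comm]
  · intro a
    rw [pd, show sep u c = (fun p => u (p 0)) * fun p => c (Fin.tail p) from rfl, h3]
    simp [hts, pd, Pi.single_apply]

variable {V : TopologicalSpace.Opens (Fin 3 → ℝ)}

/-- The spacetime function `ρ^w T`. -/
def mfun (w : ℤ) (T : Tr (Sm V)) : Fld 4 :=
  sep (fun ρ => ρ ^ w) T.c0.rep + sep (fun ρ => ρ ^ (w - 1)) T.c1.rep +
    sep (fun ρ => ρ ^ (w - 2)) T.c2.rep + sep (fun ρ => Real.log ρ * ρ ^ (w - 2)) T.cl.rep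

/-- The derivative of a quantity of weight `w`. -/
def trd : Fin 4 → ℤ → Tr (Sm V) → Tr (Sm V) :=
  Fin.cons (fun w f => (w : Tr (Sm V)) * f + Tr.euler f) (fun a _ f => Tr.der (Sm.der a) f)

/-- Evaluation of the coefficients at a point. -/
def trEv (x : V) : Tr (Sm V) →ₐ[ℝ] Tr ℝ := Tr.map (Sm.ev x)

lemma mfun_at4 (w : ℤ) (T : Tr (Sm V)) (x : V) {ρ : ℝ} (hρ : 0 < ρ) :
    mfun w T (at4 x ρ) = ρ ^ w * tval (trEv x T) ρ := by
  simp only [mfun, sep, Pi.add_apply, tail_at4, Sm.rep_apply, tval, trEv, Tr.map_apply,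
    zpow_sub₀ hρ.ne', zpow_one, at4, Matrix.cons_val_zero]
  rw [zpow_ofNat]
  ring

lemma contDiffAt_zpow (w : ℤ) {ρ : ℝ} (hρ : 0 < ρ) {k : WithTop ℕ∞} :
    ContDiffAt ℝ k (fun ρ : ℝ => ρ ^ w) ρ := by
  cases w with
  | ofNat n => simpa using contDiffAt_id.pow n
  | negSucc n =>
    simp only [zpow_negSucc]
    exact (contDiffAt_id.pow _).inv (pow_ne_zero _ hρ.ne')

lemma contDiffAt_mfun (w : ℤ) (T : Tr (Sm V)) {p : Fin 4 → ℝ} (h0 : 0 < p 0) (ht : Fin.tail p ∈ V) :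
    ContDiffAt ℝ 2 (mfun w T) p := by
  have hr : ∀ c : Sm V, ContDiffAt ℝ 2 c.rep (Fin.tail p) := fun c =>
    (Sm.rep_contDiffAt c ⟨_, ht⟩).of_le (by norm_cast)
  exact (((contDiffAt_sep (contDiffAt_zpow _ h0) (hr _)).add
    (contDiffAt_sep (contDiffAt_zpow _ h0) (hr _))).add
    (contDiffAt_sep (contDiffAt_zpow _ h0) (hr _))).add
    (contDiffAt_sep ((Real.contDiffAt_log.2 h0.ne').mul (contDiffAt_zpow _ h0)) (hr _))

lemma pd_mfun (w : ℤ) (T : Tr (Sm V)) {p : Fin 4 → ℝ} (h0 : 0 < p 0) (ht : Fin.tail p ∈ V)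
    (c : Fin 4) : pd c (mfun w T) p = mfun (w - radial c) (trd c w T) p := by
  have hr : ∀ c : Sm V, DifferentiableAt ℝ c.rep (Fin.tail p) := fun c => Sm.rep_diff c ⟨_, ht⟩
  have hz : ∀ w : ℤ, HasDerivAt (fun ρ : ℝ => ρ ^ w) (w * p 0 ^ (w - 1)) (p 0) := fun w =>
    hasDerivAt_zpow w _ (Or.inl h0.ne')
  have hlog : HasDerivAt (fun ρ => Real.log ρ * ρ ^ (w - 2))
      ((p 0)⁻¹ * p 0 ^ (w - 2) + Real.log (p 0) * ((w - 2 : ℤ) * p 0 ^ (w - 2 - 1))) (p 0) :=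
    (Real.hasDerivAt_log h0.ne').mul (hz (w - 2))
  have hd : ∀ (u : ℝ → ℝ) (u' : ℝ) (c : Sm V), HasDerivAt u u' (p 0) →
      DifferentiableAt ℝ (sep u c.rep) p := fun u u' c hu =>
    (hu.differentiableAt.comp p (differentiableAt_apply (0 : Fin 4) p)).mul
      ((hr c).comp p tailL.differentiableAt)
  have e1 := pd_sep (hz w) (hr T.c0)
  have e2 := pd_sep (hz (w - 1)) (hr T.c1)
  have e3 := pd_sep (hz (w - 2)) (hr T.c2)
  have e4 := pd_sep hlog (hr T.cl)
  have d1 := hd _ _ T.c0 (hz w)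
  have d2 := hd _ _ T.c1 (hz (w - 1))
  have d3 := hd _ _ T.c2 (hz (w - 2))
  have d4 := hd _ _ T.cl hlog
  have hv : ∀ F : Sm V, F.rep (Fin.tail p) = Sm.ev ⟨Fin.tail p, ht⟩ F := fun F =>
    Sm.rep_apply F ⟨Fin.tail p, ht⟩
  have hp : ∀ n : ℤ, p 0 ^ (n - 1) = p 0 ^ n * (p 0)⁻¹ := fun n => zpow_sub_one₀ h0.ne' n
  have key : ∀ c : Fin 4, pd c (mfun w T) p = pd c (sep (fun ρ => ρ ^ w) T.c0.rep) p +
      pd c (sep (fun ρ => ρ ^ (w - 1)) T.c1.rep) p + pd c (sep (fun ρ => ρ ^ (w - 2)) T.c2.rep) p +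
      pd c (sep (fun ρ => Real.log ρ * ρ ^ (w - 2)) T.cl.rep) p := fun c => by
    rw [mfun, pd_add_apply ((d1.add d2).add d3) d4, pd_add_apply (d1.add d2) d3, pd_add_apply d1 d2]
  rw [key]
  refine Fin.cases ?_ (fun a => ?_) c
  · rw [e1.1, e2.1, e3.1, e4.1]
    simp only [mfun, sep, Pi.add_apply, trd, Fin.cons_zero, Tr.intCast_eq, Slicing.radial_zero, hv,
      Tr.coeffs,
      Tr.euler_apply, map_add, map_mul, map_neg, map_zero, map_intCast, map_smul, smul_eq_mul]
    have h1 : w - ((1 : ℕ) : ℤ) - 1 = w - 1 - 1 := by norm_num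
    have h2 : w - ((1 : ℕ) : ℤ) - 2 = w - 2 - 1 := by norm_num; ring
    have h3 : w - ((1 : ℕ) : ℤ) = w - 1 := by norm_num
    rw [h1, h2, h3, hp (w - 1), hp (w - 2), hp w]
    push_cast
    ring
  · rw [e1.2, e2.2, e3.2, e4.2]
    have hdv : ∀ F : Sm V, pd a F.rep (Fin.tail p) = Sm.ev ⟨Fin.tail p, ht⟩ (Sm.der a F) :=
      fun F => (Sm.ev_pdFun a F ⟨Fin.tail p, ht⟩).symm
    simp only [mfun, sep, Pi.add_apply, trd, Fin.cons_succ, Slicing.radial_succ, hv, hdv, Tr.der_apply,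
      Nat.cast_zero, sub_zero]

/-- `f` has the expansion `ρ^w T` at `x`, twice differentiably. -/
structure HasExp (x : V) (w : ℤ) (f : Fld 4) (T : Tr (Sm V)) : Prop where
  smooth : ∀ᶠ ρ in atTop, ContDiffAt ℝ 2 f (at4 x ρ)
  zero : Asy (fun ρ => ρ ^ (-w) * f (at4 x ρ)) (trEv x T)
  one : ∀ c, Asy (fun ρ => ρ ^ (-(w - radial c)) * pd c f (at4 x ρ)) (trEv x (trd c w T))
  two : ∀ c c', Asy (fun ρ => ρ ^ (-(w - radial c - radial c')) * pd c' (pd c f) (at4 x ρ))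
    (trEv x (trd c' (w - radial c) (trd c w T)))

lemma isOpen_halfspace : IsOpen {p : Fin 4 → ℝ | 0 < p 0 ∧ Fin.tail p ∈ V} :=
  (isOpen_Ioi.preimage (continuous_apply 0)).inter (V.isOpen.preimage tailL.continuous)

lemma hasExp_mfun (x : V) (w : ℤ) (T : Tr (Sm V)) : HasExp x w (mfun w T) T := by
  have h0 : ∀ᶠ ρ : ℝ in atTop, 0 < ρ := eventually_gt_atTop 0
  have hA : ∀ (w : ℤ) (T : Tr (Sm V)), Asy (fun ρ => ρ ^ (-w) * mfun w T (at4 x ρ)) (trEv x T) := by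
    intro w T
    refine Asy.of_tval.congr' ?_
    filter_upwards [h0] with ρ hρ
    rw [mfun_at4 w T x hρ, ← mul_assoc, ← zpow_add₀ hρ.ne', neg_add_cancel, zpow_zero, one_mul]
  refine ⟨h0.mono fun ρ hρ => contDiffAt_mfun w T hρ x.2, hA w T, fun c => ?_, fun c c' => ?_⟩
  · refine (hA (w - radial c) _).congr' (h0.mono fun ρ hρ => ?_)
    simp only
    rw [pd_mfun w T (p := at4 x ρ) hρ x.2 c]
  · refine (hA (w - radial c - radial c') _).congr' (h0.mono fun ρ hρ => ?_)
    have : pd c (mfun w T) =ᶠ[nhds (at4 x ρ)] mfun (w - radial c) (trd c w T) := by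
      have hmem : at4 x ρ ∈ {p : Fin 4 → ℝ | 0 < p 0 ∧ Fin.tail p ∈ V} := ⟨hρ, x.2⟩
      filter_upwards [isOpen_halfspace.mem_nhds hmem] with p hp
      exact pd_mfun w T hp.1 hp.2 c
    simp only
    rw [pd_congr_apply this, pd_mfun _ _ (p := at4 x ρ) hρ x.2 c']

lemma trd_zero (c : Fin 4) (w : ℤ) : trd c w (0 : Tr (Sm V)) = 0 := by
  refine Fin.cases ?_ (fun a => ?_) c <;> simp [trd]

lemma trd_add (c : Fin 4) (w : ℤ) (S T : Tr (Sm V)) : trd c w (S + T) = trd c w S + trd c w T := by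
  refine Fin.cases ?_ (fun a => ?_) c
  · simp only [trd, Fin.cons_zero, map_add]; ring
  · simp [trd]

lemma trd_sub (c : Fin 4) (w : ℤ) (S T : Tr (Sm V)) : trd c w (S - T) = trd c w S - trd c w T := by
  refine Fin.cases ?_ (fun a => ?_) c
  · simp only [trd, Fin.cons_zero, map_sub]; ring
  · simp [trd]

lemma trd_smul (c : Fin 4) (w : ℤ) (r : ℝ) (T : Tr (Sm V)) : trd c w (r • T) = r • trd c w T := by
  refine Fin.cases ?_ (fun a => ?_) c
  · simp only [trd, Fin.cons_zero, Derivation.map_smul, smul_add, mul_smul_comm]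
  · simp [trd]

lemma trd_sum (c : Fin 4) (w : ℤ) {ι : Type*} (s : Finset ι) (T : ι → Tr (Sm V)) :
    trd c w (∑ i ∈ s, T i) = ∑ i ∈ s, trd c w (T i) :=
  _root_.map_sum (⟨⟨trd c w, trd_zero c w⟩, trd_add c w⟩ : Tr (Sm V) →+ Tr (Sm V)) T s

lemma trd_mul (c : Fin 4) (v w : ℤ) (S T : Tr (Sm V)) :
    trd c (v + w) (S * T) = trd c v S * T + S * trd c w T := by
  refine Fin.cases ?_ (fun a => ?_) c
  · simp only [trd, Fin.cons_zero, Derivation.leibniz, smul_eq_mul]; push_cast; ring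
  · simp only [trd, Fin.cons_succ, Derivation.leibniz, smul_eq_mul]; ring

lemma HasExp.add {x : V} {w : ℤ} {f g : Fld 4} {S T : Tr (Sm V)} (hf : HasExp x w f S)
    (hg : HasExp x w g T) : HasExp x w (f + g) (S + T) := by
  have h1 : ∀ ρ, ContDiffAt ℝ 2 f (at4 x ρ) → ContDiffAt ℝ 2 g (at4 x ρ) → ∀ c,
      pd c (f + g) (at4 x ρ) = pd c f (at4 x ρ) + pd c g (at4 x ρ) := fun ρ h1 h2 c =>
    pd_add_apply (h1.differentiableAt (by simp)) (h2.differentiableAt (by simp)) c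
  refine ⟨hf.smooth.mp (hg.smooth.mono fun ρ h1 h2 => h2.add h1), ?_, fun c => ?_, fun c c' => ?_⟩
  · rw [map_add]
    exact (hf.zero.add hg.zero).congr' (Eventually.of_forall fun ρ => by simp [mul_add])
  · rw [trd_add, map_add]
    refine ((hf.one c).add (hg.one c)).congr' ?_
    filter_upwards [hf.smooth, hg.smooth] with ρ hfρ hgρ
    rw [h1 ρ hfρ hgρ, mul_add]
  · rw [trd_add, trd_add, map_add]
    refine ((hf.two c c').add (hg.two c c')).congr' ?_
    filter_upwards [hf.smooth, hg.smooth] with ρ hfρ hgρ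
    have h2 : pd c (f + g) =ᶠ[nhds (at4 x ρ)] pd c f + pd c g := by
      filter_upwards [hfρ.eventually (by simp), hgρ.eventually (by simp)] with p hp hq
      exact pd_add_apply (hp.differentiableAt (by simp)) (hq.differentiableAt (by simp)) c
    have hpd : ∀ f : Fld 4, ContDiffAt ℝ 2 f (at4 x ρ) → DifferentiableAt ℝ (pd c f) (at4 x ρ) :=
      fun f hf => ((hf.fderiv_right (m := 1) (by norm_num)).differentiableAt (by simp)).clm_apply
        (differentiableAt_const _)
    rw [pd_congr_apply h2, pd_add_apply (hpd f hfρ) (hpd g hgρ), mul_add]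

lemma HasExp.radius_mul {x : V} {w : ℤ} {f : Fld 4} {T : Tr (Sm V)} (hf : HasExp x w f T) :
    HasExp x (w + 1) (fun p => p 0 * f p) T := by
  have hp0 : ∀ (p : Fin 4 → ℝ) c, pd c (fun p : Fin 4 → ℝ => p 0) p = radial c := by
    intro p c
    have : HasFDerivAt (fun p : Fin 4 → ℝ => p 0)
      (ContinuousLinearMap.proj 0 : (Fin 4 → ℝ) →L[ℝ] ℝ) p :=
      (ContinuousLinearMap.proj 0 : (Fin 4 → ℝ) →L[ℝ] ℝ).hasFDerivAt
    rw [pd, this.fderiv]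
    simp [radial, Pi.single_apply, eq_comm]
  have hd0 : ∀ p, DifferentiableAt ℝ (fun p : Fin 4 → ℝ => p 0) p := fun p =>
    differentiableAt_apply (0 : Fin 4) p
  have hmul : ∀ (g : Fld 4) p c, DifferentiableAt ℝ g p →
      pd c (fun p => p 0 * g p) p = p 0 * pd c g p + radial c * g p := fun g p c hg => by
    have := pd_mul_apply (hd0 p) hg c
    rw [hp0] at this
    exact this
  have hT : ∀ c (w : ℤ) (T : Tr (Sm V)), trd c (w + 1) T = trd c w T + (radial c : ℝ) • T := by
    intro c w T
    refine Fin.cases ?_ (fun a => ?_) c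
    · simp only [trd, Fin.cons_zero, Slicing.radial_zero]; push_cast; rw [one_smul]; ring
    · simp [trd, Slicing.radial_succ]
  have hrad : ∀ (c : Fin 4) (ρ : ℝ) (w : ℤ) (y : ℝ), 0 < ρ →
      radial c * (ρ ^ (-(w - radial c + 1)) * y) = radial c * (ρ ^ (-w) * y) := by
    intro c ρ w y hρ
    refine Fin.cases ?_ (fun a => ?_) c
    · simp [Slicing.radial_zero]
    · simp [Slicing.radial_succ]
  have hz : ∀ (ρ : ℝ) (w : ℤ), 0 < ρ → ρ ^ (-(w + 1)) * ρ = ρ ^ (-w) := by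
    intro ρ w hρ
    rw [← zpow_add_one₀ hρ.ne']; congr 1; ring
  have h0 : ∀ᶠ ρ : ℝ in atTop, 0 < ρ := eventually_gt_atTop 0
  refine ⟨?_, ?_, fun c => ?_, fun c c' => ?_⟩
  · filter_upwards [hf.smooth] with ρ hρ
    exact (contDiff_apply ℝ ℝ (0 : Fin 4)).contDiffAt.mul hρ
  · refine hf.zero.congr' ?_
    filter_upwards [h0] with ρ hρ
    simp only [Matrix.cons_val_zero]
    rw [← mul_assoc, hz ρ w hρ]
  · rw [hT, map_add, map_smul]
    refine ((hf.one c).add (hf.zero.smul (radial c))).congr' ?_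
    filter_upwards [hf.smooth, h0] with ρ hρ h0
    have e1 := hz ρ (w - radial c) h0
    have e2 := hrad c ρ w (f (at4 x ρ)) h0
    rw [hmul f _ c (hρ.differentiableAt (by simp)), at4_zero,
      show w + 1 - (radial c : ℤ) = (w - radial c) + 1 by ring]
    linear_combination -pd c f (at4 x ρ) * e1 - e2
  · rw [hT, show w + 1 - (radial c : ℤ) = (w - radial c) + 1 by ring, hT, trd_add, trd_smul]
    simp only [map_add, map_smul]
    have h3 := ((hf.two c c').add ((hf.one c').smul (radial c))).add ((hf.one c).smul (radial c'))
    have hTT : (radial c : ℝ) • trEv x (trd c' (w - radial c) T) + ((radial c' : ℝ) •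
      (radial c : ℝ) • trEv x T) = (radial c : ℝ) • trEv x (trd c' w T) := by
      have := hT c' (w - 1) T
      rw [sub_add_cancel] at this
      refine Fin.cases ?_ (fun a => ?_) c
      · simp only [Slicing.radial_zero, Nat.cast_one, one_smul]
        rw [this, map_add, map_smul]
      · simp [Slicing.radial_succ]
    have hsum : trEv x (trd c' (w - radial c) (trd c w T)) +
        (radial c : ℝ) • trEv x (trd c' (w - radial c) T) +
        ((radial c' : ℝ) • (trEv x (trd c w T) + (radial c : ℝ) • trEv x T)) =
        trEv x (trd c' (w - radial c) (trd c w T)) + (radial c : ℝ) • trEv x (trd c' w T) +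
        (radial c' : ℝ) • trEv x (trd c w T) := by
      rw [← hTT, smul_add]; abel
    rw [hsum]
    refine h3.congr' ?_
    filter_upwards [hf.smooth, h0] with ρ hρ h0
    have h2 : pd c (fun p => p 0 * f p) =ᶠ[nhds (at4 x ρ)]
        (fun p => p 0 * pd c f p) + (radial c : ℝ) • f := by
      filter_upwards [hρ.eventually (by simp)] with p hp
      rw [hmul f p c (hp.differentiableAt (by simp))]; rfl
    have hpd : DifferentiableAt ℝ (pd c f) (at4 x ρ) :=
      ((hρ.fderiv_right (m := 1) (by norm_num)).differentiableAt (by simp)).clm_apply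
        (differentiableAt_const _)
    have hfd := hρ.differentiableAt (by simp)
    rw [pd_congr_apply h2, pd_add_apply
      (show DifferentiableAt ℝ (fun p => p 0 * pd c f p) _ from (hd0 _).mul hpd) (hfd.const_smul _),
      pd_smul_apply _ hfd, hmul (pd c f) _ c' hpd, at4_zero,
      show w - (radial c : ℤ) + 1 - radial c' = (w - radial c - radial c') + 1 by ring]
    have e1 := hz ρ (w - radial c - radial c') h0
    have e2 := hrad c ρ (w - radial c') (pd c' f (at4 x ρ)) h0
    have e3 := hrad c' ρ (w - radial c) (pd c f (at4 x ρ)) h0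
    rw [show w - (radial c' : ℤ) - radial c + 1 = w - radial c - radial c' + 1 by ring] at e2
    linear_combination -pd c' (pd c f) (at4 x ρ) * e1 - e2 - e3

lemma hasExp_of_isRemainder {m : ℕ} {f : Fld 4} (hf : IsRemainder U m f)
    (x : V) (hx : (x : Fin 3 → ℝ) ∈ U) : HasExp x (2 - m) f 0 := by
  obtain ⟨h1, h2, h3, h4⟩ := hf x hx
  have key : ∀ (k : ℕ) (j : ℤ) (F : ℝ → ℝ), j = k - 2 → F =o[atTop] (fun ρ : ℝ => (ρ ^ k)⁻¹) →
      Asy (fun ρ => ρ ^ j * F ρ) 0 := by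
    intro k j F hj hF
    have h5 : (fun ρ : ℝ => ρ ^ j * F ρ) =o[atTop] fun ρ : ℝ => ρ ^ j * (ρ ^ k)⁻¹ :=
      (isBigO_refl _ _).mul_isLittleO hF
    refine h5.congr' (Eventually.of_forall fun ρ => by simp [tval_zero]) ?_
    filter_upwards [eventually_gt_atTop 0] with ρ (hρ : 0 < ρ)
    rw [hj, zpow_sub₀ hρ.ne', zpow_natCast, zpow_ofNat]
    field_simp
  refine ⟨h1, ?_, fun c => ?_, fun c c' => ?_⟩
  · rw [map_zero]; exact key m _ _ (by ring) h2
  · rw [trd_zero, map_zero]; exact key _ _ _ (by push_cast; ring) (h3 c)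
  · rw [trd_zero, trd_zero, map_zero]; exact key _ _ _ (by push_cast; ring) (h4 c' c)

/-! ### Expansion of the Ricci tensor -/

section Connection

variable {n : ℕ} {g : Fin n → Fin n → Fld n} {p : Fin n → ℝ}

lemma contDiffAt_pd {f : Fld n} (hf : ContDiffAt ℝ 2 f p) (c : Fin n) : ContDiffAt ℝ 1 (pd c f) p :=
  (hf.fderiv_right (m := 1) (by norm_num)).clm_apply contDiffAt_const

lemma contDiffAt_christoffel (hg : ∀ a b, ContDiffAt ℝ 2 (g a b) p)
    (hdet : (Matrix.of fun i j => g i j p).det ≠ 0) (a b c : Fin n) :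
    ContDiffAt ℝ 1 (christoffel g a b c) p := by
  have h1 : ContDiffAt ℝ 1 (fun p => ∑ e, ginv g a e p *
      (pd b (g e c) p + pd c (g e b) p - pd e (g b c) p)) p :=
    ContDiffAt.sum fun e _ => (contDiffAt_ginv (fun i j => (hg i j).of_le (by norm_num)) hdet a e).mul
      (((contDiffAt_pd (hg _ _) _).add (contDiffAt_pd (hg _ _) _)).sub (contDiffAt_pd (hg _ _) _))
  refine (contDiffAt_const.mul h1 (f := fun _ => (1 / 2 : ℝ))).congr_of_eventuallyEq
    (Eventually.of_forall fun q => ?_)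
  simp [christoffel]

lemma sum_g_christoffel (hdet : (Matrix.of fun i j => g i j p).det ≠ 0) (β b d : Fin n) :
    ∑ e, g β e p * christoffel g e b d p =
      (1 / 2) * (pd b (g β d) p + pd d (g β b) p - pd β (g b d) p) := by
  have h1 : ∀ e, g β e p * christoffel g e b d p = ∑ f, g β e p * ginv g e f p *
      ((1 / 2) * (pd b (g f d) p + pd d (g f b) p - pd f (g b d) p)) := fun e => by
    simp only [christoffel, Pi.smul_apply, Finset.sum_apply, Pi.mul_apply, Pi.sub_apply,
      Pi.add_apply, smul_eq_mul, Finset.mul_sum]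
    exact Finset.sum_congr rfl fun f _ => by ring
  simp only [h1]
  rw [Finset.sum_comm]
  simp only [← Finset.sum_mul, sum_g_ginv hdet]
  simp

lemma eventually_regular (hg : ∀ a b, ContDiffAt ℝ 2 (g a b) p)
    (hdet : (Matrix.of fun i j => g i j p).det ≠ 0) : ∀ᶠ q in nhds p,
      (∀ a b, ContDiffAt ℝ 2 (g a b) q) ∧ (Matrix.of fun i j => g i j q).det ≠ 0 := by
  refine Filter.Eventually.and ?_ ?_
  · exact eventually_all.2 fun a => eventually_all.2 fun b => (hg a b).eventually (by simp)
  · exact (contDiffAt_det hg).continuousAt.eventually_ne hdet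

lemma sum_g_pd_christoffel (hg : ∀ a b, ContDiffAt ℝ 2 (g a b) p)
    (hdet : (Matrix.of fun i j => g i j p).det ≠ 0) (c β b d : Fin n) :
    ∑ e, g β e p * pd c (christoffel g e b d) p =
      (1 / 2) * (pd c (pd b (g β d)) p + pd c (pd d (g β b)) p - pd c (pd β (g b d)) p) -
        ∑ e, pd c (g β e) p * christoffel g e b d p := by
  have hd : ∀ a b, DifferentiableAt ℝ (g a b) p := fun a b => (hg a b).differentiableAt (by simp)
  have hd' : ∀ c a b, DifferentiableAt ℝ (pd c (g a b)) p := fun c a b =>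
    (contDiffAt_pd (hg a b) c).differentiableAt (by simp)
  have hΓ : ∀ e, DifferentiableAt ℝ (christoffel g e b d) p := fun e =>
    (contDiffAt_christoffel hg hdet e b d).differentiableAt (by simp)
  have h1 : (∑ e, g β e * christoffel g e b d) =ᶠ[nhds p]
      (1 / 2 : ℝ) • (pd b (g β d) + pd d (g β b) - pd β (g b d)) := by
    filter_upwards [eventually_regular hg hdet] with q hq
    simp only [Finset.sum_apply, Pi.mul_apply, Pi.smul_apply, Pi.sub_apply, Pi.add_apply, smul_eq_mul]
    exact sum_g_christoffel hq.2 β b d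
  have h2 := pd_congr_apply h1 c
  have h3 : pd c (∑ e, g β e * christoffel g e b d) p =
      ∑ e, (g β e p * pd c (christoffel g e b d) p + pd c (g β e) p * christoffel g e b d p) := by
    have : pd c (∑ e, g β e * christoffel g e b d) p = ∑ e, pd c (g β e * christoffel g e b d) p := by
      simp only [pd]
      rw [fderiv_sum fun e _ => (hd β e).mul (hΓ e)]
      simp
    rw [this]
    exact Finset.sum_congr rfl fun e _ => pd_mul_apply (hd β e) (hΓ e) c
  have h4 : pd c (pd b (g β d) + pd d (g β b) - pd β (g b d)) p =
      pd c (pd b (g β d)) p + pd c (pd d (g β b)) p - pd c (pd β (g b d)) p := by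
    have h5 : pd b (g β d) + pd d (g β b) - pd β (g b d) =
      pd b (g β d) + pd d (g β b) + (-1 : ℝ) • pd β (g b d) := by rw [neg_one_smul, sub_eq_add_neg]
    rw [h5, pd_add_apply ((hd' _ _ _).add (hd' _ _ _)) ((hd' _ _ _).const_smul _),
      pd_add_apply (hd' _ _ _) (hd' _ _ _), pd_smul_apply _ (hd' _ _ _)]
    ring
  rw [h3, pd_smul_apply _ (((hd' _ _ _).add (hd' _ _ _)).sub (hd' _ _ _)), h4,
    Finset.sum_add_distrib] at h2
  linarith

end Connection

section Expansion

variable {V : TopologicalSpace.Opens (Fin 3 → ℝ)} (x : V) {g : Fin 4 → Fin 4 → Fld 4}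
  {G : Fin 4 → Fin 4 → Tr (Sm V)} {Γ : Fin 4 → Fin 4 → Fin 4 → Tr (Sm V)}

/-- The data for the expansion of the connection at `x`. -/
structure ConnExp (g : Fin 4 → Fin 4 → Fld 4) (G : Fin 4 → Fin 4 → Tr (Sm V))
    (Γ : Fin 4 → Fin 4 → Fin 4 → Tr (Sm V)) : Prop where
  hg : ∀ a b, HasExp x (2 - radial a - radial b) (g a b) (G a b)
  hdet : (Matrix.of fun a b => (trEv x (G a b)).c0).det ≠ 0
  hΓ : ∀ β b d, ∑ e, G β e * Γ e b d = (1 / 2 : ℝ) • (trd b (2 - radial β - radial d) (G β d) +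
    trd d (2 - radial β - radial b) (G β b) - trd β (2 - radial b - radial d) (G b d))

namespace ConnExp

variable {x} (H : ConnExp x g G Γ)
include H

lemma eventually_smooth : ∀ᶠ ρ in atTop, ∀ a b, ContDiffAt ℝ 2 (g a b) (at4 x ρ) :=
  eventually_all.2 fun a => eventually_all.2 fun b => (H.hg a b).smooth

lemma eventually_det : ∀ᶠ ρ in atTop, (Matrix.of fun a b => g a b (at4 x ρ)).det ≠ 0 := by
  have hlim : Tendsto (fun ρ : ℝ => Matrix.of fun a b : Fin 4 =>
      ρ ^ (-(2 - (radial a : ℤ) - radial b)) * g a b (at4 x ρ)) atTop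
      (nhds (Matrix.of fun a b => (trEv x (G a b)).c0)) :=
    tendsto_pi_nhds.2 fun a => tendsto_pi_nhds.2 fun b => (H.hg a b).zero.tendsto
  have hd := ((continuous_id.matrix_det).tendsto _).comp hlim
  filter_upwards [hd.eventually_ne H.hdet, eventually_gt_atTop 0] with ρ hρ h0
  intro hz
  refine hρ ?_
  have : (Matrix.of fun a b : Fin 4 => ρ ^ (-(2 - (radial a : ℤ) - radial b)) * g a b (at4 x ρ)) =
      Matrix.diagonal (fun a => ρ ^ ((radial a : ℤ) - 1)) * (Matrix.of fun a b => g a b (at4 x ρ)) *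
        Matrix.diagonal (fun a => ρ ^ ((radial a : ℤ) - 1)) := by
    ext a b
    rw [Matrix.mul_diagonal, Matrix.diagonal_mul, Matrix.of_apply, Matrix.of_apply,
      mul_right_comm, ← zpow_add₀ h0.ne']
    congr 2; ring
  simp only [Function.comp_apply, id_eq]
  rw [this, Matrix.det_mul, Matrix.det_mul, hz]
  ring

lemma asy_christoffel (e b d : Fin 4) :
    Asy (fun ρ => ρ ^ (-((radial e : ℤ) - radial b - radial d)) * christoffel g e b d (at4 x ρ))
      (trEv x (Γ e b d)) := by
  refine Asy.solve (M := fun a b ρ => ρ ^ (-(2 - (radial a : ℤ) - radial b)) * g a b (at4 x ρ))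
    (y := fun e ρ => ρ ^ (-((radial e : ℤ) - radial b - radial d)) * christoffel g e b d (at4 x ρ))
    (Y := fun e => trEv x (Γ e b d))
    (fun a b => (H.hg a b).zero) H.hdet (fun β => ((((H.hg β d).one b).add ((H.hg β b).one d)).sub
      ((H.hg b d).one β)).smul (1 / 2)) (fun β => ?_) ?_ e
  · rw [← map_add, ← map_sub, ← map_smul, ← H.hΓ, map_sum]
    simp only [map_mul]
  · filter_upwards [H.eventually_det, eventually_gt_atTop 0] with ρ hdet h0 β
    have h1 : ∀ e, ρ ^ (-(2 - (radial β : ℤ) - radial e)) * g β e (at4 x ρ) *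
        (ρ ^ (-((radial e : ℤ) - radial b - radial d)) * christoffel g e b d (at4 x ρ)) =
        ρ ^ (-(2 - (radial β : ℤ) - radial b - radial d)) *
          (g β e (at4 x ρ) * christoffel g e b d (at4 x ρ)) := fun e => by
      rw [mul_mul_mul_comm, ← zpow_add₀ h0.ne']
      congr 2; ring
    simp only [h1]
    rw [← Finset.mul_sum, sum_g_christoffel hdet,
      show 2 - (radial β : ℤ) - radial d - radial b = 2 - radial β - radial b - radial d by ring,
      show 2 - (radial b : ℤ) - radial d - radial β = 2 - radial β - radial b - radial d by ring]
    ring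

lemma asy_pd_christoffel (c e b d : Fin 4) :
    Asy (fun ρ => ρ ^ (-((radial e : ℤ) - radial b - radial d - radial c)) *
      pd c (christoffel g e b d) (at4 x ρ))
      (trEv x (trd c (radial e - radial b - radial d) (Γ e b d))) := by
  refine Asy.solve (M := fun a b ρ => ρ ^ (-(2 - (radial a : ℤ) - radial b)) * g a b (at4 x ρ))
    (y := fun e ρ => ρ ^ (-((radial e : ℤ) - radial b - radial d - radial c)) *
      pd c (christoffel g e b d) (at4 x ρ))
    (Y := fun e => trEv x (trd c (radial e - radial b - radial d) (Γ e b d)))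
    (fun a b => (H.hg a b).zero) H.hdet
    (fun β => (((((H.hg β d).two b c).add ((H.hg β b).two d c)).sub
      ((H.hg b d).two β c)).smul (1 / 2)).sub
      (Asy.sum Finset.univ fun e => ((H.hg β e).one c).mul (H.asy_christoffel e b d)))
    (fun β => ?_) ?_ e
  · have h1 := congrArg (trd c (2 - radial β - radial b - radial d)) (H.hΓ β b d)
    have h2 : ∀ e, trd c (2 - radial β - radial b - radial d) (G β e * Γ e b d) =
        trd c (2 - radial β - radial e) (G β e) * Γ e b d +
          G β e * trd c (radial e - radial b - radial d) (Γ e b d) := fun e => by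
      rw [← trd_mul]; congr 1; ring
    rw [trd_sum, trd_smul, trd_sub, trd_add] at h1
    simp only [h2, Finset.sum_add_distrib] at h1
    have h3 := congrArg (trEv x) h1
    simp only [map_add, map_sum, map_mul, map_smul, map_sub] at h3
    rw [show 2 - (radial β : ℤ) - radial d - radial b = 2 - radial β - radial b - radial d by ring,
      show 2 - (radial b : ℤ) - radial d - radial β = 2 - radial β - radial b - radial d by ring,
      ← h3]
    ring
  · filter_upwards [H.eventually_det, H.eventually_smooth, eventually_gt_atTop 0] with ρ hdet hs h0 β
    have h1 : ∀ e, ρ ^ (-(2 - (radial β : ℤ) - radial e)) * g β e (at4 x ρ) *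
        (ρ ^ (-((radial e : ℤ) - radial b - radial d - radial c)) *
          pd c (christoffel g e b d) (at4 x ρ)) =
        ρ ^ (-(2 - (radial β : ℤ) - radial b - radial d - radial c)) *
          (g β e (at4 x ρ) * pd c (christoffel g e b d) (at4 x ρ)) := fun e => by
      rw [mul_mul_mul_comm, ← zpow_add₀ h0.ne']
      congr 2; ring
    have h2 : ∀ e, ρ ^ (-(2 - (radial β : ℤ) - radial e - radial c)) * pd c (g β e) (at4 x ρ) *
        (ρ ^ (-((radial e : ℤ) - radial b - radial d)) * christoffel g e b d (at4 x ρ)) =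
        ρ ^ (-(2 - (radial β : ℤ) - radial b - radial d - radial c)) *
          (pd c (g β e) (at4 x ρ) * christoffel g e b d (at4 x ρ)) := fun e => by
      rw [mul_mul_mul_comm, ← zpow_add₀ h0.ne']
      congr 2; ring
    simp only [h1, h2]
    rw [← Finset.mul_sum, ← Finset.mul_sum, sum_g_pd_christoffel hs hdet,
      show 2 - (radial β : ℤ) - radial d - radial b = 2 - radial β - radial b - radial d by ring,
      show 2 - (radial b : ℤ) - radial d - radial β = 2 - radial β - radial b - radial d by ring]
    ring

lemma asy_ricci (b d : Fin 4) : Asy (fun ρ => ρ ^ (radial b + radial d) * ricci g b d (at4 x ρ))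
    (trEv x (∑ c, (trd c (radial c - radial b - radial d) (Γ c b d) -
      trd d (radial c - radial b - radial c) (Γ c b c) +
        ∑ e, (Γ c c e * Γ e b d - Γ c d e * Γ e b c)))) := by
  simp only [map_sum, map_add, map_sub, map_mul]
  refine (Asy.sum Finset.univ fun c => ((H.asy_pd_christoffel c c b d).sub
    (H.asy_pd_christoffel d c b c)).add (Asy.sum Finset.univ fun e =>
      ((H.asy_christoffel c c e).mul (H.asy_christoffel e b d)).sub
      ((H.asy_christoffel c d e).mul (H.asy_christoffel e b c)))).congr' ?_
  filter_upwards [eventually_gt_atTop 0] with ρ h0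
  simp only [ricci, riemann, Finset.sum_apply, Pi.add_apply, Pi.sub_apply, Pi.mul_apply,
    Finset.mul_sum]
  refine Finset.sum_congr rfl fun c _ => ?_
  have hw : ∀ n : ℤ, n = radial b + radial d → ρ ^ n = ρ ^ (radial b + radial d) := by
    rintro n rfl; exact zpow_natCast ρ (radial b + radial d)
  have hm : ∀ (m n : ℤ) (y z : ℝ), m + n = radial b + radial d →
      ρ ^ m * y * (ρ ^ n * z) = ρ ^ (radial b + radial d) * (y * z) := by
    intro m n y z h
    rw [mul_mul_mul_comm, ← zpow_add₀ h0.ne', hw _ h]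
  rw [hw _ (by ring), hw _ (by ring), mul_add, mul_sub, Finset.mul_sum]
  congr 1
  refine Finset.sum_congr rfl fun e _ => ?_
  rw [hm _ _ _ _ (by ring), hm _ _ _ _ (by ring), mul_sub]

end ConnExp

lemma isLittleO_weight (F : ℝ → ℝ) (n k : ℕ) :
    (F =o[atTop] fun ρ : ℝ => (ρ ^ (n + k))⁻¹) ↔
      (fun ρ => ρ ^ k * F ρ) =o[atTop] fun ρ : ℝ => (ρ ^ n)⁻¹ := by
  have h0 : ∀ᶠ ρ : ℝ in atTop, ρ ≠ 0 := (eventually_gt_atTop 0).mono fun _ h => ne_of_gt h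
  constructor
  · intro h
    refine ((isBigO_refl (fun ρ : ℝ => ρ ^ k) atTop).mul_isLittleO h).congr' EventuallyEq.rfl ?_
    filter_upwards [h0] with ρ hρ
    rw [pow_add]; field_simp
  · intro h
    refine ((isBigO_refl (fun ρ : ℝ => (ρ ^ k)⁻¹) atTop).mul_isLittleO h).congr' ?_ ?_
    · filter_upwards [h0] with ρ hρ
      field_simp
    · filter_upwards [h0] with ρ hρ
      rw [pow_add, mul_inv, mul_comm]

end Expansion

/-! ### The slicing of the Beig–Schmidt expansion -/

namespace Geo

variable {R : Type*} [CommRing R] [Algebra ℝ R] (G : Geo R)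

lemma tr_frameInv (a b : Fin 3) : frameInv G.tr.E a b = Tr.C (frameInv G.E a b) := by
  simp only [frameInv, map_sum, map_mul]; rfl

lemma tr_tf1 (v : Fin 3 → Tr R) (I : Fin 3) : G.tr.tf1 v I = ⟨G.tf1 (fun a => (v a).c0) I,
    G.tf1 (fun a => (v a).c1) I, G.tf1 (fun a => (v a).c2) I, G.tf1 (fun a => (v a).cl) I⟩ := by
  have hE : ∀ a I, G.tr.E a I = Tr.C (G.E a I) := fun _ _ => rfl
  ext <;> simp [tf1_eq, t1, hE, Tr.sum_c0, Tr.sum_c1, Tr.sum_c2, Tr.sum_cl, Tr.C_apply]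

lemma tr_tf2 (T : Fin 3 → Fin 3 → Tr R) (I J : Fin 3) : G.tr.tf2 T I J =
    ⟨G.tf2 (fun a b => (T a b).c0) I J, G.tf2 (fun a b => (T a b).c1) I J,
      G.tf2 (fun a b => (T a b).c2) I J, G.tf2 (fun a b => (T a b).cl) I J⟩ := by
  simp only [tf2_apply, tr_tf1]

lemma tr_e (K : Fin 3) (f : Tr R) : G.tr.e K f = ⟨G.e K f.c0, G.e K f.c1, G.e K f.c2, G.e K f.cl⟩ := by
  have hd : ∀ a, G.tr.d a f = ⟨G.d a f.c0, G.d a f.c1, G.d a f.c2, G.d a f.cl⟩ := fun _ => rfl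
  simp only [← Framed.e_zero_tf, tr_tf1, hd]

lemma tr_conn (c I L : Fin 3) : G.tr.conn c I L = Tr.C (G.conn c I L) := by
  have hE : ∀ a I, G.tr.E a I = Tr.C (G.E a I) := fun _ _ => rfl
  have hF : ∀ a I, G.tr.F a I = Tr.C (G.F a I) := fun _ _ => rfl
  have hΓ : ∀ a b c, G.tr.Γ a b c = Tr.C (G.Γ a b c) := fun _ _ _ => rfl
  have hd : ∀ a, G.tr.d a = Tr.der (G.d a) := fun _ => rfl
  simp only [Framed.conn, hE, hF, hΓ, hd, Tr.der_C, map_sum, map_mul, map_add]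

lemma tr_om (K I L : Fin 3) : G.tr.om K I L = Tr.C (G.om K I L) := by
  have hE : ∀ a I, G.tr.E a I = Tr.C (G.E a I) := fun _ _ => rfl
  simp only [Framed.om, hE, tr_conn, map_sum, map_mul]

lemma tr_N2 (T : Fin 3 → Fin 3 → Tr R) (K I J : Fin 3) : G.tr.N2 T K I J =
    ⟨G.N2 (fun I J => (T I J).c0) K I J, G.N2 (fun I J => (T I J).c1) K I J,
      G.N2 (fun I J => (T I J).c2) K I J, G.N2 (fun I J => (T I J).cl) K I J⟩ := by
  ext <;> simp [Framed.N2, tr_e, tr_om, Tr.sum_c0, Tr.sum_c1, Tr.sum_c2, Tr.sum_cl, Tr.C_apply]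

lemma tr_h (a b : Fin 3) : G.tr.h a b = Tr.C (G.h a b) := by
  have hF : ∀ a I, G.tr.F a I = Tr.C (G.F a I) := fun _ _ => rfl
  simp only [h, hF, map_sum, map_mul]

/-- The metric `(1 + σ/ρ)² dρ² + ρ² (h + A/ρ + H/ρ² + I log ρ/ρ²)`. -/
def slice (σ : R) (A H I : Fin 3 → Fin 3 → R) (hA : ∀ a b, A a b = A b a)
    (hH : ∀ a b, H a b = H b a) (hI : ∀ a b, I a b = I b a) : Slicing G.tr where
  θ := Tr.euler
  θ_d _ _ := Tr.euler_der _ _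
  θ_Γ _ _ _ := Tr.euler_C _
  θ_E _ _ := Tr.euler_C _
  N := ⟨1, σ, 0, 0⟩
  Ni := ⟨1, -σ, σ ^ 2, 0⟩
  N_Ni := by ext <;> simp; ring
  γ a b := ⟨G.h a b, A a b, H a b, I a b⟩
  γ_symm a b := by rw [G.h_symm, hA, hH, hI]
  γt a b := ⟨G.h a b, -A a b, ∑ e, A a e * G.rs (fun f => A f b) e - H a b, -I a b⟩
  γ_γt a b := by
    have hr : ∀ e (v : Fin 3 → Tr R), ∑ f, frameInv G.tr.E e f * v f = ⟨G.rs (fun f => (v f).c0) e,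
        G.rs (fun f => (v f).c1) e, G.rs (fun f => (v f).c2) e, G.rs (fun f => (v f).cl) e⟩ := by
      intro e v
      ext <;> simp [tr_frameInv, rs, Tr.sum_c0, Tr.sum_c1, Tr.sum_c2, Tr.sum_cl, Tr.C_apply]
    simp only [hr, tr_h, G.rs_h]
    ext
    · simp [Tr.sum_c0, Tr.C_apply]
    · simp [Tr.sum_c1, Tr.C_apply, Finset.sum_add_distrib, G.h_rs]
    · have : ∀ v w : Fin 3 → R, ∀ e, G.rs (fun f => v f - w f) e = G.rs v e - G.rs w e := fun v w e => by
        simp [rs, mul_sub]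
      have hn : ∀ v : Fin 3 → R, ∀ e, G.rs (fun f => - v f) e = -G.rs v e := fun v e => by simp [rs]
      simp [Tr.sum_c2, Tr.C_apply, Finset.sum_add_distrib, this, hn, mul_sub, G.h_rs]
      ring
    · simp [Tr.sum_cl, Tr.C_apply, Finset.sum_add_distrib, G.h_rs]

section

variable (σ : R) {A H I : Fin 3 → Fin 3 → R} (hA : ∀ a b, A a b = A b a) (hH : ∀ a b, H a b = H b a)
  (hI : ∀ a b, I a b = I b a)

lemma tf2_slice_γ (J K : Fin 3) : G.tr.tf2 (G.slice σ A H I hA hH hI).γ J K =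
    ⟨nullMetric _ J K, G.tf2 A J K, G.tf2 H J K, G.tf2 I J K⟩ := by
  rw [G.tr_tf2, ← G.tf2_h]; rfl

lemma tf2_slice_γt (J K : Fin 3) : G.tr.tf2 (G.slice σ A H I hA hH hI).γt J K =
    ⟨nullMetric _ J K, -G.tf2 A J K, ∑ M, G.tf2 A J M * G.tf2 A M.rev K - G.tf2 H J K,
      -G.tf2 I J K⟩ := by
  have hn : ∀ T : Fin 3 → Fin 3 → R, G.tf2 (fun a b => -T a b) J K = -G.tf2 T J K :=
    fun T => by simp [Geo.tf2_apply, Geo.tf1_eq, t1]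
  have h1 : ∀ X Y : Fin 3 → Fin 3 → R, G.tf2 (fun a b => ∑ e, X a e * G.rs (fun f => X f b) e -
      Y a b) J K = ∑ M, G.tf2 X J M * G.tf2 X M.rev K - G.tf2 Y J K := by
    intro X Y
    simp only [Geo.tf2_apply, G.sum_mul_rs, Geo.tf1_sub', Geo.tf1_eq, t1_sum, t1_mul_left, t1_mul_right]
    congr 1
    exact Finset.sum_congr rfl fun M _ => by rw [t1_comm G.E (fun b f => X f b)]
  rw [G.tr_tf2, ← G.tf2_h, ← hn, ← hn, ← h1]
  rfl

lemma N2_null (P J K : Fin 3) : G.N2 (nullMetric R) P J K = 0 := by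
  rw [← G.tf2_h, ← Framed.tf3_D2, show G.D2 G.h = 0 by funext c a b; exact G.D2_h c a b,
    ← Framed.tf3L_apply, map_zero]; rfl

end

end Geo

lemma null_contract {R : Type*} [CommRing R] (I : Fin 3) (f : Fin 3 → R) :
    ∑ M, nullMetric R I M * f M.rev = f I := by
  induction I using fin3_cases <;>
  simp only [Fin.sum_univ_three, rev3, null_values] <;> ring

lemma null_contract' {R : Type*} [CommRing R] (K : Fin 3) (f : Fin 3 → R) :
    ∑ M, f M * nullMetric R M.rev K = f K := by
  induction K using fin3_cases <;>
  simp only [Fin.sum_univ_three, rev3, null_values] <;> ring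

namespace LocalFrame

variable (L : LocalFrame U h x₀) (σ : Fld 3)
  {A H I : Cov2} (hA : IsSymTensor U A) (hH : IsSymTensor U H) (hI : IsSymTensor U I)

/-- The slicing over a local frame. -/
def slice : Slicing L.G.tr :=
  L.G.slice (L.fr0 σ) (fun a b => L.fr0 (A a b)) (fun a b => L.fr0 (H a b)) (fun a b => L.fr0 (I a b))
    (fun a b => L.fr0_congr (hA.1 a b) (hA.1 b a) (hA.2 a b))
    (fun a b => L.fr0_congr (hH.1 a b) (hH.1 b a) (hH.2 a b))
    (fun a b => L.fr0_congr (hI.1 a b) (hI.1 b a) (hI.2 a b))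

lemma slice_θ : (L.slice σ hA hH hI).θ = Tr.euler := rfl
lemma slice_N : (L.slice σ hA hH hI).N = ⟨1, L.fr0 σ, 0, 0⟩ := rfl
lemma slice_Ni : (L.slice σ hA hH hI).Ni = ⟨1, -L.fr0 σ, L.fr0 σ ^ 2, 0⟩ := rfl

lemma slice_m : (L.slice σ hA hH hI).m = ⟨0, -L.fr0 σ, L.fr0 σ ^ 2, 0⟩ := by
  rw [Slicing.m, slice_θ, slice_N, slice_Ni]
  ext <;> simp [Tr.euler_apply]; ring

lemma slice_n (J : Fin 3) : L.G.tr.tf1 (L.slice σ hA hH hI).n J =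
    ⟨0, L.G.e J (L.fr0 σ), -(L.fr0 σ * L.G.e J (L.fr0 σ)), 0⟩ := by
  rw [Slicing.tf1_n, slice_N, slice_Ni, L.G.tr_e]
  ext <;> simp

lemma slice_γ (J K : Fin 3) : L.G.tr.tf2 (L.slice σ hA hH hI).γ J K =
    ⟨nullMetric _ J K, L.fr2 A J K, L.fr2 H J K, L.fr2 I J K⟩ :=
  L.G.tf2_slice_γ _ _ _ _ J K

lemma slice_γt (J K : Fin 3) : L.G.tr.tf2 (L.slice σ hA hH hI).γt J K =
    ⟨nullMetric _ J K, -L.fr2 A J K, ∑ M, L.fr2 A J M * L.fr2 A M.rev K - L.fr2 H J K,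
      -L.fr2 I J K⟩ :=
  L.G.tf2_slice_γt _ _ _ _ J K

lemma slice_kap (J K : Fin 3) : L.G.tr.tf2 (L.slice σ hA hH hI).kap J K =
    ⟨nullMetric _ J K, (1 / 2 : ℝ) • L.fr2 A J K, (1 / 2 : ℝ) • L.fr2 I J K, 0⟩ := by
  rw [Slicing.tf2_kap, slice_γ, slice_θ, Tr.euler_apply]
  ext
  · simp
  · simp only [Tr.coeffs, Tr.smul_c1]; module
  · simp only [Tr.coeffs, Tr.smul_c2]; module
  · simp only [Tr.coeffs, Tr.smul_cl]; module

lemma slice_K (J K : Fin 3) : L.G.tr.tf2 (L.slice σ hA hH hI).K J K =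
    ⟨nullMetric _ J K, -(1 / 2 : ℝ) • L.fr2 A J K, (1 / 2 : ℝ) • ∑ M, L.fr2 A J M * L.fr2 A M.rev K -
      L.fr2 H J K + (1 / 2 : ℝ) • L.fr2 I J K, -L.fr2 I J K⟩ := by
  have h2 : ∀ (T : Fin 3 → Fin 3 → Sm L.V), ∑ M, T J M * nullMetric _ M.rev K = T J K := fun T =>
    null_contract' K (T J)
  rw [Slicing.tf2_K]
  simp only [slice_kap, slice_γt]
  ext
  · simp [Tr.sum_c0, null_contract J fun M => nullMetric (Sm L.V) M K]
  · simp only [Tr.sum_c1, Tr.coeffs, Finset.sum_add_distrib, h2, mul_smul_comm, ← Finset.smul_sum,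
      null_contract J fun M => L.fr2 A M K, neg_mul, Finset.sum_neg_distrib]
    module
  · simp only [Tr.sum_c2, Tr.coeffs, Finset.sum_add_distrib, mul_smul_comm, ← Finset.smul_sum,
      null_contract J fun M => L.fr2 I M K, neg_mul, Finset.sum_neg_distrib, sub_mul,
      Finset.sum_sub_distrib, h2 fun J M => L.fr2 H J M,
      h2 fun J M => ∑ N, L.fr2 A J N * L.fr2 A N.rev M]
    module
  · simp [Tr.sum_cl, Finset.sum_add_distrib, h2]

/-- The lowered Christoffel symbols of a perturbation. -/
def lowC {B : Type*} [CommRing B] [Algebra ℝ B] (D : Fin 3 → Fin 3 → Fin 3 → B) (J K M : Fin 3) : B :=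
  (1 / 2 : ℝ) • (D K J M + D M J K - D J K M)

lemma slice_Z (J K M : Fin 3) : L.G.tr.tf3 (L.slice σ hA hH hI).Z J K M =
    ⟨0, lowC (L.G.N2 (L.fr2 A)) J K M, lowC (L.G.N2 (L.fr2 H)) J K M,
      lowC (L.G.N2 (L.fr2 I)) J K M⟩ := by
  rw [Slicing.tf3_Z]
  simp only [L.G.tr_N2, slice_γ]
  ext <;> simp [lowC, L.G.N2_null]

lemma slice_C (J K M : Fin 3) : L.G.tr.tf3 (L.slice σ hA hH hI).Cn J K M =
    ⟨0, lowC (L.G.N2 (L.fr2 A)) J K M, lowC (L.G.N2 (L.fr2 H)) J K M -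
      ∑ P, L.fr2 A J P * lowC (L.G.N2 (L.fr2 A)) P.rev K M, lowC (L.G.N2 (L.fr2 I)) J K M⟩ := by
  rw [Slicing.tf3_Cn]
  simp only [slice_γt, slice_Z]
  ext
  · simp [Tr.sum_c0]
  · simp [Tr.sum_c1, null_contract J fun P => lowC (L.G.N2 (L.fr2 A)) P K M]
  · simp [Tr.sum_c2, Finset.sum_add_distrib, null_contract J fun P => lowC (L.G.N2 (L.fr2 H)) P K M]
    ring
  · simp [Tr.sum_cl, null_contract J fun P => lowC (L.G.N2 (L.fr2 I)) P K M]

lemma slice_X (J : Fin 3) : L.G.tr.tf1 (L.slice σ hA hH hI).X J = ⟨0, -L.G.e J (L.fr0 σ),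
    ∑ M, L.fr2 A J M * L.G.e M.rev (L.fr0 σ) - L.fr0 σ * L.G.e J (L.fr0 σ), 0⟩ := by
  rw [Slicing.tf1_X]
  simp only [slice_γt, slice_N, L.G.tr_e]
  ext
  · simp [Tr.sum_c0]
  · simp [Tr.sum_c1, Tr.sum_c0, null_contract J fun P => L.G.e P (L.fr0 σ)]
  · simp [Tr.sum_c2, Tr.sum_c1, Tr.sum_c0, null_contract J fun P => L.G.e P (L.fr0 σ)]
    ring
  · simp [Tr.sum_cl, Tr.sum_c0]

lemma slice_P (J K : Fin 3) : L.G.tr.tf2 (L.slice σ hA hH hI).P J K = ⟨-nullMetric _ J K,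
    -(1 / 2 : ℝ) • L.fr2 A J K + (2 : ℝ) • (L.fr0 σ * nullMetric _ J K),
    -(1 / 2 : ℝ) • L.fr2 I J K + L.fr0 σ * L.fr2 A J K - (3 : ℝ) • (L.fr0 σ ^ 2 * nullMetric _ J K), 0⟩ := by
  have h2 : ∀ f : Sm L.V, (2 : ℝ) • f = 2 * f := fun f => by rw [two_smul, two_mul]
  have h3 : ∀ f : Sm L.V, (3 : ℝ) • f = 3 * f := fun f => by
    rw [show (3 : ℝ) = 1 + 2 by norm_num, add_smul, h2, one_smul]; ring
  have h4 : ∀ f : Sm L.V, f * ((1 / 2 : ℝ) • L.fr2 A J K) * 2 = f * L.fr2 A J K := fun f => by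
    rw [mul_assoc, mul_comm _ (2 : Sm L.V), ← h2, smul_smul]; norm_num
  rw [Slicing.tf2_P, slice_kap, slice_Ni]
  ext
  · simp
  · simp [h2]; ring
  · simp only [Tr.neg_c2, Tr.coeffs, one_mul, mul_one, h3, neg_smul]
    linear_combination h4 (L.fr0 σ)
  · simp

end LocalFrame

lemma Tr.map_euler {R S : Type*} [CommRing R] [CommRing S] [Algebra ℝ R] [Algebra ℝ S]
    (φ : R →ₐ[ℝ] S) (f : Tr R) : Tr.map φ (Tr.euler f) = Tr.euler (Tr.map φ f) := by
  ext <;> simp [Tr.map_apply, Tr.euler_apply]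

namespace LocalFrame

variable (L : LocalFrame U h x₀) [Patch U h]

/-! #### Values of the expansion coefficients -/

/-- The values of the coefficients of an expansion. -/
def ev4 : Tr (Sm L.V) →ₐ[ℝ] Tr ℝ := Tr.map L.ev0

lemma ev4_apply (f : Tr (Sm L.V)) :
    L.ev4 f = ⟨L.ev0 f.c0, L.ev0 f.c1, L.ev0 f.c2, L.ev0 f.cl⟩ := rfl

lemma ev4_om (K I J : Fin 3) : L.ev4 (L.G.tr.om K I J) = 0 := by
  rw [L.G.tr_om, ev4_apply, Tr.C_apply]; ext <;> simp [ev0_om]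

lemma ev4_N1 (v : Fin 3 → Tr (Sm L.V)) (K I : Fin 3) :
    L.ev4 (L.G.tr.N1 v K I) = L.ev4 (L.G.tr.e K (v I)) := by simp [Framed.N1, ev4_om]

lemma ev4_N2 (T : Fin 3 → Fin 3 → Tr (Sm L.V)) (K I J : Fin 3) :
    L.ev4 (L.G.tr.N2 T K I J) = L.ev4 (L.G.tr.e K (T I J)) := by simp [Framed.N2, ev4_om]

lemma ev4_N3 (T : Fin 3 → Fin 3 → Fin 3 → Tr (Sm L.V)) (P K I J : Fin 3) :
    L.ev4 (L.G.tr.N3 T P K I J) = L.ev4 (L.G.tr.e P (T K I J)) := by simp [Framed.N3, ev4_om]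

lemma ev4_euler (f : Tr (Sm L.V)) : L.ev4 (Tr.euler f) = Tr.euler (L.ev4 f) := Tr.map_euler _ _

lemma ev4_null (J K : Fin 3) : L.ev4 (nullMetric _ J K) = ⟨nullMetric ℝ J K, 0, 0, 0⟩ := by
  have : nullMetric (Tr (Sm L.V)) J K = ⟨nullMetric _ J K, 0, 0, 0⟩ := by
    unfold nullMetric; split_ifs <;> rfl
  rw [this, ev4_apply]; ext <;> simp [ev0_null]

variable (σ : Fld 3) {A H I : Cov2} (hA : IsSymTensor U A) (hH : IsSymTensor U H)
  (hI : IsSymTensor U I) (P J K M : Fin 3)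

local notation "§" => LocalFrame.slice L σ hA hH hI

lemma ev0_lowC (T : Cov2) : L.ev0 (lowC (L.G.N2 (L.fr2 T)) J K M) = lowC (L.j1 T) J K M := by
  simp only [lowC, map_smul, map_add, map_sub, ev0_N2_fr2]

lemma ev0_e_lowC (T : Cov2) :
    L.ev0 (L.G.e P (lowC (L.G.N2 (L.fr2 T)) J K M)) = lowC (L.j2 T P) J K M := by
  simp only [lowC, Derivation.map_smul, map_smul, map_add, map_sub, ev0_e_N2]

lemma ev4_m : L.ev4 §.m = ⟨0, -L.s0 σ, L.s0 σ ^ 2, 0⟩ := by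
  rw [slice_m, ev4_apply]; ext <;> simp [ev0_fr0]

lemma ev4_n : L.ev4 (L.G.tr.tf1 §.n J) =
    ⟨0, L.s1 σ J, -(L.s0 σ * L.s1 σ J), 0⟩ := by
  rw [slice_n, ev4_apply]; ext <;> simp [ev0_fr0, ev0_e_fr0]

lemma ev4_e_n : L.ev4 (L.G.tr.e P (L.G.tr.tf1 §.n J)) =
    ⟨0, L.s2 σ P J, -(L.s0 σ * L.s2 σ P J + L.s1 σ P * L.s1 σ J), 0⟩ := by
  rw [slice_n, L.G.tr_e, ev4_apply]
  ext <;> simp [ev0_fr0, ev0_e_fr0, ev0_e_e, Derivation.leibniz]; ring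

lemma ev4_X : L.ev4 (L.G.tr.tf1 §.X J) =
    ⟨0, -L.s1 σ J, ∑ M, L.j0 A J M * L.s1 σ M.rev - L.s0 σ * L.s1 σ J, 0⟩ := by
  rw [slice_X, ev4_apply]; ext <;> simp [ev0_fr0, ev0_e_fr0, ev0_fr2]

lemma ev4_e_X : L.ev4 (L.G.tr.e P (L.G.tr.tf1 §.X J)) =
    ⟨0, -L.s2 σ P J, ∑ M, (L.j0 A J M * L.s2 σ P M.rev + L.j1 A P J M * L.s1 σ M.rev) -
      (L.s0 σ * L.s2 σ P J + L.s1 σ P * L.s1 σ J), 0⟩ := by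
  rw [slice_X, L.G.tr_e, ev4_apply]
  ext <;> simp [ev0_fr0, ev0_e_fr0, ev0_e_e, ev0_fr2, ev0_e_fr2, Derivation.leibniz, mul_comm]

lemma ev4_K : L.ev4 (L.G.tr.tf2 §.K J K) =
    ⟨nullMetric _ J K, -(1 / 2) * L.j0 A J K, 1 / 2 * ∑ M, L.j0 A J M * L.j0 A M.rev K -
      L.j0 H J K + 1 / 2 * L.j0 I J K, -L.j0 I J K⟩ := by
  rw [slice_K, ev4_apply]; ext <;> simp [ev0_null, ev0_fr2]

lemma ev4_e_K : L.ev4 (L.G.tr.e P (L.G.tr.tf2 §.K J K)) =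
    ⟨0, -(1 / 2) * L.j1 A P J K, 1 / 2 * ∑ M, (L.j0 A J M * L.j1 A P M.rev K +
      L.j1 A P J M * L.j0 A M.rev K) - L.j1 H P J K + 1 / 2 * L.j1 I P J K, -L.j1 I P J K⟩ := by
  rw [slice_K, L.G.tr_e, ev4_apply]
  ext <;> simp [e_null, ev0_fr2, ev0_e_fr2, Derivation.leibniz, mul_comm]

lemma ev4_C : L.ev4 (L.G.tr.tf3 §.Cn J K M) =
    ⟨0, lowC (L.j1 A) J K M, lowC (L.j1 H) J K M - ∑ P, L.j0 A J P * lowC (L.j1 A) P.rev K M,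
      lowC (L.j1 I) J K M⟩ := by
  rw [slice_C, ev4_apply]; ext <;> simp [ev0_lowC, ev0_fr2]

lemma ev4_e_C : L.ev4 (L.G.tr.e P (L.G.tr.tf3 §.Cn J K M)) =
    ⟨0, lowC (L.j2 A P) J K M, lowC (L.j2 H P) J K M - ∑ Q, (L.j0 A J Q * lowC (L.j2 A P) Q.rev K M +
      L.j1 A P J Q * lowC (L.j1 A) Q.rev K M), lowC (L.j2 I P) J K M⟩ := by
  rw [slice_C, L.G.tr_e, ev4_apply]
  ext <;> simp [ev0_lowC, ev0_e_lowC, ev0_fr2, ev0_e_fr2, Derivation.leibniz, mul_comm]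

lemma ev4_P : L.ev4 (L.G.tr.tf2 §.P J K) = ⟨-nullMetric _ J K,
    -(1 / 2) * L.j0 A J K + 2 * (L.s0 σ * nullMetric _ J K),
    -(1 / 2) * L.j0 I J K + L.s0 σ * L.j0 A J K - 3 * (L.s0 σ ^ 2 * nullMetric _ J K), 0⟩ := by
  rw [slice_P, ev4_apply]; ext <;> simp [ev0_null, ev0_fr2, ev0_fr0]

lemma ev4_ric_zero_zero : L.ev4 (§.ric4 0 0) =
    ∑ J, L.ev4 (L.G.tr.e J (L.G.tr.tf1 §.X J.rev)) +
    ∑ J, (∑ K, L.ev4 (L.G.tr.tf3 §.Cn K K.rev J)) *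
      L.ev4 (L.G.tr.tf1 §.X J.rev) -
    Tr.euler (∑ K, L.ev4 (L.G.tr.tf2 §.K K K.rev)) +
    (∑ K, L.ev4 (L.G.tr.tf2 §.K K K.rev)) *
      (1 + L.ev4 §.m) -
    ∑ J, L.ev4 (L.G.tr.tf1 §.n J) *
      L.ev4 (L.G.tr.tf1 §.X J.rev) -
    ∑ J, ∑ K, L.ev4 (L.G.tr.tf2 §.K J K) *
      L.ev4 (L.G.tr.tf2 §.K K.rev J.rev) := by
  rw [Slicing.ric_zero_zero]
  simp only [Slicing.trK_eq, Slicing.tf1_trC, map_add, map_sub, map_sum, map_mul, ev4_N1, slice_θ,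
    ev4_euler]
  ring

/-- The terms common to the two forms of the mixed components. -/
def mixedRic : Tr ℝ := ∑ K, L.ev4 (L.G.tr.e K (L.G.tr.tf2 §.K K.rev J)) +
    (∑ K, L.ev4 (L.G.tr.tf2 §.K K K.rev)) *
      L.ev4 (L.G.tr.tf1 §.n J) +
    ∑ K, (∑ M, L.ev4 (L.G.tr.tf3 §.Cn M M.rev K)) *
      L.ev4 (L.G.tr.tf2 §.K K.rev J) -
    ∑ K, ∑ M, L.ev4 (L.G.tr.tf3 §.Cn K J M) *
      L.ev4 (L.G.tr.tf2 §.K M.rev K.rev) -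
    ∑ K, L.ev4 (L.G.tr.tf2 §.P J K) *
      L.ev4 (L.G.tr.tf1 §.X K.rev)

lemma ev4_ric_zero_succ : L.ev4 (L.G.tr.tf1 (fun b => §.ric4 0 b.succ) J) =
    L.mixedRic σ hA hH hI J -
      ∑ K, L.ev4 (L.G.tr.e J (L.G.tr.tf2 §.K K K.rev)) := by
  rw [Slicing.ric_zero_succ, mixedRic]
  simp only [Slicing.trK_eq, Slicing.tf1_trC, map_add, map_sub, map_sum, map_mul, ev4_N2]
  ring

lemma ev4_ric_succ_zero : L.ev4 (L.G.tr.tf1 (fun b => §.ric4 b.succ 0) J) =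
    L.mixedRic σ hA hH hI J -
      Tr.euler (∑ K, L.ev4 (L.G.tr.tf3 §.Cn K K.rev J)) := by
  rw [Slicing.ric_succ_zero, mixedRic]
  simp only [Slicing.trK_eq, Slicing.tf1_trC, map_add, map_sub, map_sum, map_mul, ev4_N2, slice_θ,
    ev4_euler]
  ring

lemma ev4_ric_succ_succ :
    L.ev4 (L.G.tr.tf2 (fun a b => §.ric4 a.succ b.succ) J K) =
    2 * L.ev4 (nullMetric _ J K) +
    ∑ M, L.ev4 (L.G.tr.e M (L.G.tr.tf3 §.Cn M.rev J K)) -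
    ∑ M, L.ev4 (L.G.tr.e K (L.G.tr.tf3 §.Cn M.rev J M)) +
    ∑ M, (∑ P, L.ev4 (L.G.tr.tf3 §.Cn P P.rev M)) *
      L.ev4 (L.G.tr.tf3 §.Cn M.rev J K) -
    ∑ M, ∑ P, L.ev4 (L.G.tr.tf3 §.Cn M K P) *
      L.ev4 (L.G.tr.tf3 §.Cn P.rev J M.rev) +
    Tr.euler (L.ev4 (L.G.tr.tf2 §.P J K)) +
    (1 + L.ev4 §.m +
      ∑ M, L.ev4 (L.G.tr.tf2 §.K M M.rev)) *
      L.ev4 (L.G.tr.tf2 §.P J K) -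
    L.ev4 (L.G.tr.e K (L.G.tr.tf1 §.n J)) +
    ∑ M, L.ev4 (L.G.tr.tf1 §.n M) *
      L.ev4 (L.G.tr.tf3 §.Cn M.rev J K) -
    L.ev4 (L.G.tr.tf1 §.n K) * L.ev4 (L.G.tr.tf1 §.n J) -
    ∑ M, L.ev4 (L.G.tr.tf2 §.P K M) *
      L.ev4 (L.G.tr.tf2 §.K M.rev J) -
    ∑ M, L.ev4 (L.G.tr.tf2 §.P J M) *
      L.ev4 (L.G.tr.tf2 §.K M.rev K) := by
  rw [Slicing.ric_succ_succ]
  simp only [Slicing.trK_eq, Slicing.tf1_trC, map_add, map_sub, map_sum, map_mul, ev4_N1, ev4_N3,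
    slice_θ, ev4_euler, map_ofNat]
  ring

end LocalFrame

/-- The first-order part of the metric, `k_{ab} - 2 σ h_{ab}`. -/
def conf (h : Cov2) (σ : Fld 3) (k : Cov2) : Cov2 := k + fun a b => (-(2 : ℝ) • σ) * h a b

section

variable [Patch U h] (hσ : σ ∈ smoothOn U)
include hσ

lemma conf_symTensor (hk : IsSymTensor U k) : IsSymTensor U (conf h σ k) :=
  hk.add ⟨scalar_mem (smul_smooth _ hσ) h_mem, fun a b x hx => by
    simp only [Pi.mul_apply, Patch.hyp.1.2 a b hx]⟩

namespace LocalFrame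

variable (L : LocalFrame U h x₀)

lemma j0_conf (hk : Smooth2 U k) (I J : Fin 3) :
    L.j0 (conf h σ k) I J = L.j0 k I J - 2 * (L.s0 σ * nullMetric ℝ I J) := by
  have h2 := smul_smooth (-2) hσ
  rw [conf, L.j0_add hk (scalar_mem h2 h_mem), L.j0_scalar_h h2, L.s0_smul _ hσ]; ring

lemma j1_conf (hk : Smooth2 U k) (K I J : Fin 3) :
    L.j1 (conf h σ k) K I J = L.j1 k K I J - 2 * (L.s1 σ K * nullMetric ℝ I J) := by
  have h2 := smul_smooth (-2) hσ
  rw [conf, L.j1_add hk (scalar_mem h2 h_mem), L.j1_scalar_h h2, L.s1_smul _ hσ]; ring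

lemma j2_conf (hk : Smooth2 U k) (P K I J : Fin 3) :
    L.j2 (conf h σ k) P K I J = L.j2 k P K I J - 2 * (L.s2 σ P K * nullMetric ℝ I J) := by
  have h2 := smul_smooth (-2) hσ
  rw [conf, L.j2_add hk (scalar_mem h2 h_mem), L.j2_scalar_h h2, L.s2_smul _ hσ]; ring

variable (hk : IsSDT U h k) {H I : Cov2} (hH : IsSymTensor U H) (hI : IsSymTensor U I)
include hk

local notation "§" => LocalFrame.slice L σ (conf_symTensor hσ (And.left hk)) hH hI

omit hσ in
lemma j1_div (J : Fin 3) : ∑ K, L.j1 k K J K.rev = 0 := by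
  have := congrArg L.ev0 (L.sdt_N2_div hk J)
  rwa [map_sum, map_zero] at this

omit hσ in
lemma j2_div (P J : Fin 3) : ∑ K, L.j2 k P K J K.rev = 0 := by
  have := congrArg (fun f => L.ev0 (L.G.e P f)) (L.sdt_N2_div hk J)
  simpa only [map_sum, map_zero, ev0_e_N2] using this

omit hσ in
lemma sum_fr2_trace : ∑ K, L.fr2 k K K.rev = 0 := by
  rw [← L.fr0_tr hk.1.1]
  exact Sm.ext_ev fun x => by rw [L.ev_fr0 (tr_mem hk.1.1), hk.2.1 (L.sub x.2)]; simp

omit hσ in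
lemma j0_trace : ∑ K, L.j0 k K K.rev = 0 := by
  have := congrArg L.ev0 (L.sum_fr2_trace hk)
  rwa [map_sum, map_zero] at this

omit hσ in
lemma j1_trace (P : Fin 3) : ∑ K, L.j1 k P K K.rev = 0 := by
  have := congrArg (fun f => L.ev0 (L.G.e P f)) (L.sum_fr2_trace hk)
  simpa only [map_sum, map_zero, ev0_e_fr2] using this

omit hσ in
lemma j2_trace (P Q : Fin 3) : ∑ K, L.j2 k P Q K K.rev = 0 := by
  have h1 := L.G.N2_trace (L.fr2 k) Q
  rw [L.sum_fr2_trace hk, map_zero] at h1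
  have := congrArg (fun f => L.ev0 (L.G.e P f)) h1
  simpa only [map_sum, map_zero, ev0_e_N2] using this

lemma ric_tt_first : (L.ev4 (§.ric4 0 0)).c0 = 0 ∧
    (L.ev4 (§.ric4 0 0)).c1 =
      -(∑ K, L.s2 σ K K.rev + 3 * L.s0 σ) := by
  have t0 := L.j0_trace hk
  rw [ev4_ric_zero_zero]
  simp only [Fin.sum_univ_three, rev3] at t0
  simp only [Fin.sum_univ_three, rev3, ev4_X, ev4_e_X, ev4_C, ev4_K, ev4_m, ev4_n, Tr.euler_apply,
    Tr.coeffs, null_values,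
    j0_conf hσ L hk.1.1, lowC]
  exact ⟨by ring, by linear_combination (0 : ℝ) * t0⟩

lemma mixedRic_first (J : Fin 3) :
    (L.ev4 (L.G.tr.tf1 (fun b => §.ric4 0 b.succ) J)).c0 = 0 ∧
    (L.ev4 (L.G.tr.tf1 (fun b => §.ric4 0 b.succ) J)).c1 = 0 ∧
    (L.ev4 (L.G.tr.tf1 (fun b => §.ric4 b.succ 0) J)).c0 = 0 ∧
    (L.ev4 (L.G.tr.tf1 (fun b => §.ric4 b.succ 0) J)).c1 = 0 := by
  have d0 := L.j1_div hk J
  have t0 := L.j1_trace hk J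
  rw [ev4_ric_zero_succ, ev4_ric_succ_zero, mixedRic]
  induction J using fin3_cases <;>
  simp only [Fin.sum_univ_three, rev3, ev4_X, ev4_e_K, ev4_C, ev4_K, ev4_m, ev4_n, ev4_P,
    Tr.euler_apply, Tr.coeffs, null_values,
    L.j1_conf hσ hk.1.1, lowC, fun K => fin3_symm (L.j1_symm hk.1 K)] at d0 t0 ⊢ <;>
  exact ⟨by ring, by linear_combination (-1 / 2) * d0 + 1 / 2 * t0, by ring, by linear_combination (-1 / 2) * d0 + 1 / 2 * t0⟩

lemma ric_first (J K : Fin 3) :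
    (L.ev4 (L.G.tr.tf2 (fun a b => §.ric4 a.succ b.succ) J K)).c0 = 0 ∧
    2 * (L.ev4 (L.G.tr.tf2 (fun a b => §.ric4 a.succ b.succ) J K)).c1 =
      -(∑ M, L.j2 k M M.rev J K - 3 * L.j0 k J K) +
        2 * (∑ M, L.s2 σ M M.rev + 3 * L.s0 σ) * nullMetric ℝ J K := by
  have d1 := L.j2_div hk J K
  have d2 := L.j2_div hk K J
  have t0 := L.j0_trace hk
  have t2 := L.j2_trace hk K J
  have cw := fun I J => fin3_comm fun A B => L.j2_comm k A B I J
  have ew := fun P K => fin3_symm (L.j2_symm hk.1 P K)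
  rw [ev4_ric_succ_succ, ev4_null]
  induction J using fin3_cases <;> induction K using fin3_cases <;>
  simp only [Fin.sum_univ_three, rev3, ev4_X, ev4_e_K, ev4_C, ev4_e_C, ev4_K, ev4_m, ev4_n, ev4_P,
    ev4_e_n, two_mul, Tr.euler_apply, Tr.coeffs, null_values, L.j0_conf hσ hk.1.1, L.j2_conf hσ hk.1.1, lowC, cw, ew, fin3_symm (L.j0_symm hk.1), fin3_symm (L.s2_symm σ)] at d1 d2 t0 t2 ⊢ <;>
  refine ⟨by ring, ?_⟩
  · linear_combination d1 + d2 - t2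
  · linear_combination d1 + d2 - t2
  · linear_combination d1 + d2 - t2 - t0
  · linear_combination d1 + d2 - t2
  · linear_combination d1 + d2 - t2 - t0
  · linear_combination d1 + d2 - t2
  · linear_combination d1 + d2 - t2 - t0
  · linear_combination d1 + d2 - t2
  · linear_combination d1 + d2 - t2

end LocalFrame

end

namespace LocalFrame

variable (L : LocalFrame U h x₀)
variable [Patch U h] (hσ : σ ∈ smoothOn U)

/-! #### Jets of the sources -/

lemma s1_sub (hf : f ∈ smoothOn U) (hg : g ∈ smoothOn U) (I : Fin 3) :
    L.s1 (f - g) I = L.s1 f I - L.s1 g I := by rw [s1, L.fr0_sub hf hg, map_sub, map_sub]; rfl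

lemma s2_sub (hf : f ∈ smoothOn U) (hg : g ∈ smoothOn U) (I J : Fin 3) :
    L.s2 (f - g) I J = L.s2 f I J - L.s2 g I J := by
  simp only [← ev0_e_e, L.fr0_sub hf hg, map_sub]

lemma s1_inner2_self (hk : Smooth2 U k) (I : Fin 3) :
    L.s1 (inner2 h k k) I = ∑ K, ∑ M, (L.j1 k I K M * L.j0 k K.rev M.rev +
      L.j0 k K M * L.j1 k I K.rev M.rev) := by
  rw [s1, L.fr0_inner2 hk hk, Geo.e_contract]
  simp only [map_sum, map_add, map_mul, ev0_fr2, ev0_N2_fr2]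

include hσ

lemma s0_traceSrc (hk : Smooth2 U k) : L.s0 (traceSrc h σ k) = 12 * L.s0 σ ^ 2 +
    ∑ K, L.s1 σ K * L.s1 σ K.rev + 1 / 4 * ∑ K, ∑ M, L.j0 k K M * L.j0 k K.rev M.rev +
    ∑ K, ∑ M, L.j0 k K M * L.s2 σ K.rev M.rev := by
  have h2 := pow_mem hσ 2
  have hg := gradSq_mem hσ
  have hi := inner2_mem hk hk
  have hs := hess_mem hσ
  have a1 := add_mem (smul_smooth (U := U) 12 h2) hg
  have a2 := add_mem a1 (smul_smooth (1 / 4) hi)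
  rw [s0, traceSrc, L.fr0_add a2 (inner2_mem hk hs), L.fr0_add a1 (smul_smooth _ hi),
    L.fr0_add (smul_smooth _ h2) hg, L.fr0_smul _ h2, L.fr0_smul _ hi, L.fr0_pow hσ,
    L.fr0_gradSq hσ, L.fr0_inner2 hk hk, L.fr0_inner2 hk hs, L.fr2_hess hσ]
  simp only [map_add, map_smul, map_sum, map_mul, map_pow, smul_eq_mul, ev0_fr0, ev0_e_fr0, ev0_fr2,
    ev0_frH]

lemma s1_traceSrc (hk : Smooth2 U k) (I : Fin 3) : L.s1 (traceSrc h σ k) I =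
    12 * L.s1 (σ ^ 2) I + L.s1 (gradSq h σ) I + 1 / 4 * L.s1 (inner2 h k k) I +
      L.s1 (inner2 h k (hess h σ)) I := by
  have h2 := pow_mem hσ 2
  have hi := inner2_mem hk hk
  have a1 := add_mem (smul_smooth (U := U) 12 h2) (gradSq_mem hσ)
  rw [traceSrc, L.s1_add (add_mem a1 (smul_smooth _ hi)) (inner2_mem hk (hess_mem hσ)),
    L.s1_add a1 (smul_smooth _ hi), L.s1_add (smul_smooth _ h2) (gradSq_mem hσ),
    L.s1_smul _ h2, L.s1_smul _ hi]

lemma s2_traceSrc (hk : Smooth2 U k) (I J : Fin 3) : L.s2 (traceSrc h σ k) I J =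
    12 * L.s2 (σ ^ 2) I J + L.s2 (gradSq h σ) I J + 1 / 4 * L.s2 (inner2 h k k) I J +
      L.s2 (inner2 h k (hess h σ)) I J := by
  have h2 := pow_mem hσ 2
  have hi := inner2_mem hk hk
  have a1 := add_mem (smul_smooth (U := U) 12 h2) (gradSq_mem hσ)
  rw [traceSrc, L.s2_add (add_mem a1 (smul_smooth _ hi)) (inner2_mem hk (hess_mem hσ)),
    L.s2_add a1 (smul_smooth _ hi), L.s2_add (smul_smooth _ h2) (gradSq_mem hσ),
    L.s2_smul _ h2, L.s2_smul _ hi]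

lemma s1_divSrc_scalar (hk : Smooth2 U k) (I : Fin 3) : L.s1 (gradSq h σ + (8 : ℝ) • σ ^ 2 -
    (1 / 8 : ℝ) • inner2 h k k + inner2 h k (hess h σ)) I = L.s1 (gradSq h σ) I +
      8 * L.s1 (σ ^ 2) I - 1 / 8 * L.s1 (inner2 h k k) I + L.s1 (inner2 h k (hess h σ)) I := by
  have h2 := pow_mem hσ 2
  have hi := inner2_mem hk hk
  have a1 := add_mem (gradSq_mem hσ) (smul_smooth (U := U) 8 h2)
  rw [L.s1_add (sub_mem a1 (smul_smooth _ hi)) (inner2_mem hk (hess_mem hσ)),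
    L.s1_sub a1 (smul_smooth _ hi), L.s1_add (gradSq_mem hσ) (smul_smooth _ h2),
    L.s1_smul _ h2, L.s1_smul _ hi]

lemma s2_divSrc_scalar (hk : Smooth2 U k) (I J : Fin 3) : L.s2 (gradSq h σ + (8 : ℝ) • σ ^ 2 -
    (1 / 8 : ℝ) • inner2 h k k + inner2 h k (hess h σ)) I J = L.s2 (gradSq h σ) I J +
      8 * L.s2 (σ ^ 2) I J - 1 / 8 * L.s2 (inner2 h k k) I J + L.s2 (inner2 h k (hess h σ)) I J := by
  have h2 := pow_mem hσ 2
  have hi := inner2_mem hk hk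
  have a1 := add_mem (gradSq_mem hσ) (smul_smooth (U := U) 8 h2)
  rw [L.s2_add (sub_mem a1 (smul_smooth _ hi)) (inner2_mem hk (hess_mem hσ)),
    L.s2_sub a1 (smul_smooth _ hi), L.s2_add (gradSq_mem hσ) (smul_smooth _ h2),
    L.s2_smul _ h2, L.s2_smul _ hi]

lemma fr1_divSrc (hk : Smooth2 U k) (I : Fin 3) : L.fr1 (divSrc h σ k) I =
    (1 / 2 : ℝ) • (∑ K, ∑ M, L.G.N2 (L.fr2 k) K I M * L.fr2 k K.rev M.rev) +
      L.G.e I (L.fr0 (gradSq h σ + (8 : ℝ) • σ ^ 2 - (1 / 8 : ℝ) • inner2 h k k +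
        inner2 h k (hess h σ))) := by
  have hf := divSrc_scalar_mem hσ hk
  rw [← L.fr1_divTerm hk I, ← congrFun (L.fr1_grad hf) I]
  refine Sm.ext_ev fun x => ?_
  simp only [L.ev_fr1 (divSrc_mem hσ hk), L.ev_fr1 (divTerm_mem hk), map_add, map_smul,
    L.ev_fr1 (grad_mem hf), divSrc, t1, Pi.add_apply, Pi.smul_apply, smul_eq_mul, grad,
    Finset.mul_sum, ← Finset.sum_add_distrib]
  exact Finset.sum_congr rfl fun a _ => by ring

lemma j0_D1_divSrc (hk : Smooth2 U k) (I J : Fin 3) : L.j0 (D1 h (divSrc h σ k)) I J =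
    1 / 2 * (∑ K, ∑ M, (L.j2 k I K J M * L.j0 k K.rev M.rev + L.j1 k K J M * L.j1 k I K.rev M.rev)) +
      (L.s2 (gradSq h σ) I J + 8 * L.s2 (σ ^ 2) I J - 1 / 8 * L.s2 (inner2 h k k) I J +
        L.s2 (inner2 h k (hess h σ)) I J) := by
  rw [j0, L.fr2_D1 (divSrc_mem hσ hk), ev0_N1, L.fr1_divSrc hσ hk,
    ← L.s2_divSrc_scalar hσ hk, ← ev0_e_e]
  simp only [map_add, Derivation.map_smul, map_sum, Derivation.leibniz, map_smul, map_mul, smul_eq_mul,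
    ev0_fr2, ev0_e_fr2, ev0_e_N2, ev0_N2_fr2]
  congr 2
  exact Finset.sum_congr rfl fun _ _ => Finset.sum_congr rfl fun _ _ => by ring

/-! #### The second-order coefficients -/

variable {H I : Cov2} (hH : IsSymTensor U H) (hI : IsSymTensor U I)
  (hk : IsSDT U h k)

local notation "§" => LocalFrame.slice L σ (conf_symTensor hσ (And.left hk)) hH hI

lemma ric_tt_second (hF : FirstOrderEqs U h σ k) :
    (L.ev4 (§.ric4 0 0)).c2 =
      -(∑ K, L.j0 H K K.rev - L.s0 (traceSrc h σ k)) + 3 / 2 * ∑ K, L.j0 I K K.rev ∧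
    (L.ev4 (§.ric4 0 0)).cl =
      -∑ K, L.j0 I K K.rev := by
  have t0 := L.j0_trace hk
  have t1 := L.j1_trace hk
  have d1 := L.j1_div hk
  have b := L.sum_s2_of_box hσ hF
  have u0 := d1 0
  have u1 := d1 1
  have u2 := d1 2
  have v0 := t1 0
  have v1 := t1 1
  have v2 := t1 2
  rw [ev4_ric_zero_zero, L.s0_traceSrc hσ hk.1.1]
  simp only [Fin.sum_univ_three, rev3, ev4_X, ev4_e_X, ev4_C, ev4_K, ev4_m, ev4_n, Tr.euler_apply,
    Tr.coeffs, null_values, L.j0_conf hσ hk.1.1,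
    L.j1_conf hσ hk.1.1, lowC, smul_eq_mul,
    fin3_symm (L.j0_symm hk.1), fun K => fin3_symm (L.j1_symm hk.1 K), fin3_symm (L.s2_symm σ)]
    at t0 u0 u1 u2 v0 v1 v2 b ⊢
  refine ⟨?_, by ring⟩
  linear_combination (-1 / 2) * L.s0 σ * t0 - 3 * L.s0 σ * b + L.s1 σ 0 * (u2 - 1 / 2 * v2) +
    L.s1 σ 2 * (u0 - 1 / 2 * v0) + L.s1 σ 1 * (u1 - 1 / 2 * v1)

lemma ric_mixed_second (hF : FirstOrderEqs U h σ k) (J : Fin 3) :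
    (L.ev4 (L.G.tr.tf1 (fun b => §.ric4 0 b.succ) J)).c2 =
      ∑ K, L.j1 H J K K.rev - L.s1 (traceSrc h σ k) J -
      (∑ K, L.j1 H K J K.rev - L.ev0 (L.fr1 (divSrc h σ k) J)) +
      1 / 2 * (∑ K, L.j1 I K J K.rev - ∑ K, L.j1 I J K K.rev) ∧
    (L.ev4 (L.G.tr.tf1 (fun b => §.ric4 0 b.succ) J)).cl =
      -∑ K, L.j1 I K J K.rev + ∑ K, L.j1 I J K K.rev := by
  obtain ⟨D⟩ := exists_jetData L hσ hk hF
  rw [ev0_divSrc L hσ hk.1.1, L.s1_traceSrc hσ hk.1.1, L.s1_divSrc_scalar hσ hk.1.1,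
    L.s1_sq hσ, L.s1_inner2_self hk.1.1, ev4_ric_zero_succ, mixedRic]
  induction J using fin3_cases <;>
  simp only [Fin.sum_univ_three, rev3, ev4_X, ev4_e_K, ev4_C, ev4_K, ev4_m, ev4_n, ev4_P,
    Tr.euler_apply, Tr.coeffs, null_values, L.j0_conf hσ hk.1.1,
    L.j1_conf hσ hk.1.1, lowC, smul_eq_mul, fun K => fin3_symm (L.j1_symm hH K), fun K => fin3_symm (L.j1_symm hI K), D.k0, D.k1,
    stf2_values, jet_values, Nat.reduceAdd, Nat.reduceLeDiff, Nat.reduceLT, ite_true, ite_false] <;>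
  exact ⟨by ring, by ring⟩

lemma ric_mixed_second' (J : Fin 3) :
    (L.ev4 (L.G.tr.tf1 (fun b => §.ric4 b.succ 0) J)).c2 =
    (L.ev4 (L.G.tr.tf1 (fun b => §.ric4 0 b.succ) J)).c2 ∧
    (L.ev4 (L.G.tr.tf1 (fun b => §.ric4 b.succ 0) J)).cl =
    (L.ev4 (L.G.tr.tf1 (fun b => §.ric4 0 b.succ) J)).cl := by
  rw [ev4_ric_zero_succ, ev4_ric_succ_zero]
  induction J using fin3_cases <;>
  simp only [Fin.sum_univ_three, rev3, ev4_e_K, ev4_C, Tr.euler_apply, Tr.coeffs, null_values, L.j0_conf hσ hk.1.1, L.j1_conf hσ hk.1.1, lowC,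
    smul_eq_mul, fun K => fin3_symm (L.j1_symm hH K), fun K => fin3_symm (L.j1_symm hI K), fin3_symm (L.j0_symm hk.1), fun K => fin3_symm (L.j1_symm hk.1 K)] <;>
  exact ⟨by ring, by ring⟩

end LocalFrame

namespace LocalFrame

variable (L : LocalFrame U h x₀)
variable [Patch U h] (hσ : σ ∈ smoothOn U)

/-! #### Jets of the nonlinear terms -/

include hσ

lemma j0_NLss (J K : Fin 3) : L.j0 (NLss h σ) J K = 5 * L.s2 (σ ^ 2) J K + L.s2 (gradSq h σ) J K +
    (-18 * L.s0 σ ^ 2 + 4 * ∑ M, L.s1 σ M * L.s1 σ M.rev) * nullMetric ℝ J K +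
      4 * (L.s0 σ * L.s2 σ J K) := by
  have h2 := pow_mem hσ 2
  have hg := gradSq_mem hσ
  have a1 := add_mem (smul_smooth (U := U) 5 h2) hg
  have a2 := add_mem (smul_smooth (U := U) (-18) h2) (smul_smooth (U := U) 4 hg)
  have hs := scalar_mem hσ (hess_mem hσ)
  have e : NLss h σ = hess h ((5 : ℝ) • σ ^ 2 + gradSq h σ) + (fun a b =>
      ((-18 : ℝ) • σ ^ 2 + (4 : ℝ) • gradSq h σ) * h a b) + (4 : ℝ) • fun a b => σ * hess h σ a b := by
    funext a b; simp only [NLss, Pi.add_apply, mul_comm (h a b)]; rfl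
  rw [e, L.j0_add ((hess_mem a1).add (scalar_mem a2 h_mem)) (Smooth2.smul 4 hs),
    L.j0_add (hess_mem a1) (scalar_mem a2 h_mem), L.j0_smul 4 hs, L.j0_hess a1,
    L.j0_scalar_h a2, L.s2_add (smul_smooth _ h2) hg, L.s2_smul _ h2, j0, L.fr2_scalar hσ
    (hess_mem hσ), L.fr2_hess hσ, L.s0_add (smul_smooth _ h2) (smul_smooth _ hg),
    L.s0_smul _ h2, L.s0_smul _ hg, s0, L.fr0_pow hσ, s0, L.fr0_gradSq hσ]
  simp only [map_pow, map_sum, map_mul, ev0_fr0, ev0_e_fr0, ev0_frH]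

lemma j0_NLsk (hk : Smooth2 U k) (J K : Fin 3) : L.j0 (NLsk h σ k) J K =
    L.s2 (inner2 h k (hess h σ)) J K -
      2 * ((∑ M, ∑ P, L.j0 k M P * L.s2 σ M.rev P.rev) * nullMetric ℝ J K) +
      4 * (L.s0 σ * L.j0 k J K) + 4 * (1 / 2 * ((∑ M, L.s1 σ M.rev * L.j1 k J K M) +
        ∑ M, L.s1 σ M.rev * L.j1 k K J M) - ∑ M, L.s1 σ M.rev * L.j1 k M J K) +
      4 * (1 / 2 * ((∑ M, L.s2 σ J M * L.j0 k K M.rev) + ∑ M, L.s2 σ K M * L.j0 k J M.rev)) := by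
  have hs := hess_mem hσ
  have hi := inner2_mem hk hs
  have m1 := hess_mem hi
  have m2 := scalar_mem hi h_mem
  have m3 := scalar_mem hσ hk
  have m4 := sigDkSym_mem hσ hk
  have m5 := sigDk_mem hσ hk
  have m6 := hessK_mem hσ hk
  have a2 := m1.sub (Smooth2.smul 2 m2)
  have a3 := a2.add (Smooth2.smul 4 m3)
  have a4 := a3.add (Smooth2.smul 4 (m4.sub m5))
  have e : NLsk h σ k = hess h (inner2 h k (hess h σ)) -
      (2 : ℝ) • (fun a b => inner2 h k (hess h σ) * h a b) + (4 : ℝ) • (fun a b => σ * k a b) +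
      (4 : ℝ) • (sigDkSym h σ k - sigDk h σ k) + (4 : ℝ) • hessK h σ k := rfl
  rw [e, L.j0_add a4 (Smooth2.smul 4 m6), L.j0_add a3 (Smooth2.smul 4 (m4.sub m5)),
    L.j0_add a2 (Smooth2.smul 4 m3), L.j0_sub m1 (Smooth2.smul 2 m2), L.j0_smul _ m2, L.j0_smul _ m3,
    L.j0_smul _ (m4.sub m5), L.j0_sub m4 m5, L.j0_smul _ m6, L.j0_hess hi, L.j0_scalar_h hi, s0,
    L.fr0_inner2 hk hs, L.fr2_hess hσ]
  simp only [j0]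
  rw [L.fr2_scalar hσ hk, L.fr2_sigDkSym hσ hk, L.fr2_sigDk hσ hk, L.fr2_hessK hσ hk]
  simp only [map_add, map_smul, map_sum, map_mul, smul_eq_mul, ev0_fr0, ev0_e_fr0, ev0_frH, ev0_fr2,
    ev0_N2_fr2]

omit hσ in
lemma j0_NLkk (hk : Smooth2 U k) (J K : Fin 3) : L.j0 (NLkk h k) J K =
    (∑ M, L.j0 k J M * L.j0 k K M.rev) -
      1 / 2 * ((∑ M, ∑ P, L.j0 k M.rev P.rev * L.j2 k P J K M) +
        ∑ M, ∑ P, L.j0 k M.rev P.rev * L.j2 k P K J M) +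
      (∑ M, ∑ P, L.j0 k M.rev P.rev * L.j2 k M P J K) -
      1 / 2 * (∑ M, ∑ P, L.j1 k J M P * L.j1 k K M.rev P.rev) +
      1 / 2 * ((∑ M, ∑ P, L.j1 k K M P * L.j1 k M.rev P.rev J) +
        ∑ M, ∑ P, L.j1 k J M P * L.j1 k M.rev P.rev K) +
      (∑ M, ∑ P, L.j1 k M J P * L.j1 k M.rev P.rev K) -
      ∑ M, ∑ P, L.j1 k M J P * L.j1 k P.rev M.rev K := by
  have m1 := prod2_mem hk hk
  have m2 := kDaDk_mem hk
  have m3 := kDcDk_mem hk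
  have m4 := DkDk_mem hk
  have m5 := DkDkMixed_mem hk
  have m6 := DkDkInner_mem hk
  have m7 := DkDkCross_mem hk
  have a2 := m1.sub (symm_mem m2)
  have a3 := a2.add m3
  have a4 := a3.sub (Smooth2.smul (1 / 2) m4)
  have a5 := a4.add (symm_mem m5)
  have a6 := a5.add m6
  rw [NLkk_eq, L.j0_sub a6 m7, L.j0_add a5 m6, L.j0_add a4 (symm_mem m5),
    L.j0_sub a3 (Smooth2.smul _ m4), L.j0_add a2 m3, L.j0_sub m1 (symm_mem m2), L.j0_smul _ m4]
  simp only [j0]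
  rw [L.fr2_prod2 hk hk, L.fr2_symm m2, L.fr2_kDaDk hk, L.fr2_kDaDk hk,
    L.fr2_kDcDk hk, L.fr2_DkDk hk, L.fr2_symm m5, L.fr2_DkDkMixed hk,
    L.fr2_DkDkMixed hk, L.fr2_DkDkInner hk, L.fr2_DkDkCross hk]
  simp only [map_add, map_smul, map_sum, map_mul, smul_eq_mul, ev0_fr2, ev0_N2_fr2, ev0_N3, ev0_e_N2]

end LocalFrame

section

variable [Patch U h]

lemma NLss_mem (hσ : σ ∈ smoothOn U) : Smooth2 U (NLss h σ) := fun a b =>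
  add_mem (add_mem (hess_mem (add_mem (smul_smooth _ (pow_mem hσ 2)) (gradSq_mem hσ)) a b)
    (mul_mem (h_mem a b) (add_mem (smul_smooth _ (pow_mem hσ 2)) (smul_smooth _
      (gradSq_mem hσ))))) (smul_smooth _ (mul_mem hσ (hess_mem hσ a b)))

lemma NLsk_mem (hσ : σ ∈ smoothOn U) (hk : Smooth2 U k) : Smooth2 U (NLsk h σ k) := fun a b =>
  have hi := inner2_mem hk (hess_mem hσ)
  add_mem (add_mem (add_mem (sub_mem (hess_mem hi a b) (smul_smooth _ (mul_mem hi (h_mem a b))))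
    (smul_smooth _ (mul_mem hσ (hk a b)))) (smul_smooth _ (sub_mem (sigDkSym_mem hσ hk a b)
    (sigDk_mem hσ hk a b)))) (smul_smooth _ (hessK_mem hσ hk a b))

lemma NLkk_mem (hk : Smooth2 U k) : Smooth2 U (NLkk h k) := by
  rw [NLkk_eq]
  exact ((((((prod2_mem hk hk).sub (symm_mem (kDaDk_mem hk))).add (kDcDk_mem hk)).sub
    (Smooth2.smul _ (DkDk_mem hk))).add (symm_mem (DkDkMixed_mem hk))).add
    (DkDkInner_mem hk)).sub (DkDkCross_mem hk)

end

namespace LocalFrame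

variable (L : LocalFrame U h x₀)
variable [Patch U h] (hσ : σ ∈ smoothOn U)
variable {H I : Cov2} (hH : IsSymTensor U H) (hI : IsSymTensor U I)
  (hk : IsSDT U h k)

local notation "§" => LocalFrame.slice L σ (conf_symTensor hσ (And.left hk)) hH hI

lemma ric_log (J K : Fin 3) :
    2 * (L.ev4 (L.G.tr.tf2 (fun a b =>
      §.ric4 a.succ b.succ) J K)).cl =
      -(∑ M, L.j2 I M M.rev J K - 2 * L.j0 I J K) + ∑ M, L.j2 I J M K M.rev +
      ∑ M, L.j2 I K M J M.rev - ∑ M, L.j2 I J K M M.rev := by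
  have cw := fun P K => fin3_comm fun A B => L.j2_comm I A B P K
  have ew := fun P K => fin3_symm (L.j2_symm hI P K)
  rw [ev4_ric_succ_succ, ev4_null]
  induction J using fin3_cases <;> induction K using fin3_cases <;>
  simp only [Fin.sum_univ_three, rev3, ev4_X, ev4_C, ev4_e_C, ev4_K, ev4_m, ev4_n, ev4_P, ev4_e_n,
    two_mul, Tr.euler_apply, Tr.coeffs,
    null_values, lowC, smul_eq_mul, cw, ew,
    fin3_symm (L.j0_symm hI)] <;>
  ring

set_option maxHeartbeats 4000000 in
lemma ric_second (hF : FirstOrderEqs U h σ k) (J K : Fin 3) :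
    2 * (L.ev4 (L.G.tr.tf2 (fun a b =>
      §.ric4 a.succ b.succ) J K)).c2 =
      -(∑ M, L.j2 H M M.rev J K - 2 * L.j0 H J K - 2 * L.j0 I J K -
        (L.j0 (NLss h σ) J K + L.j0 (NLsk h σ k) J K + L.j0 (NLkk h k) J K)) +
      (∑ M, L.j2 H J M K M.rev - L.j0 (D1 h (divSrc h σ k)) J K) +
      (∑ M, L.j2 H K M J M.rev - L.j0 (D1 h (divSrc h σ k)) K J) -
      (∑ M, L.j2 H J K M M.rev - L.s2 (traceSrc h σ k) J K) -
      nullMetric ℝ J K * ∑ M, L.j0 I M M.rev := by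
  obtain ⟨D⟩ := exists_jetData L hσ hk hF
  rw [L.j0_NLss hσ, L.j0_NLsk hσ hk.1.1, L.j0_NLkk hk.1.1,
    L.j0_D1_divSrc hσ hk.1.1, L.j0_D1_divSrc hσ hk.1.1, L.s2_traceSrc hσ hk.1.1,
    L.s2_symm _ K J, L.s2_symm _ K J, L.s2_symm _ K J, L.s2_symm _ K J,
    L.s2_sq hσ, L.s2_inner2_self hk.1.1, ev4_ric_succ_succ, ev4_null]
  generalize L.s2 (gradSq h σ) J K = g
  generalize L.s2 (inner2 h k (hess h σ)) J K = q
  have cw := fun P K => fin3_comm fun A B => L.j2_comm H A B P K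
  have ew := fun P K => fin3_symm (L.j2_symm hH P K)
  induction J using fin3_cases <;> induction K using fin3_cases <;>
  simp only [Fin.sum_univ_three, rev3, ev4_X, ev4_C, ev4_e_C, ev4_K, ev4_m, ev4_n, ev4_P, ev4_e_n,
    two_mul, Tr.euler_apply, Tr.coeffs, L.j0_conf hσ hk.1.1, L.j1_conf hσ hk.1.1,
    L.j2_conf hσ hk.1.1, null_values, lowC, smul_eq_mul, cw, ew, fin3_symm (L.j0_symm hI),
    fin3_symm (L.j0_symm hH), D.k0, D.k1, D.k2, D.f2, stf2_values, jet_values,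
    Nat.reduceAdd, Nat.reduceLeDiff, Nat.reduceLT, ite_true, ite_false] <;>
  ring

end LocalFrame

/-! ### The expansion of the spacetime metric -/

section

variable {V : TopologicalSpace.Opens (Fin 3 → ℝ)}

lemma HasExp.congr {x : V} {w : ℤ} {f g : Fld 4} {T : Tr (Sm V)} (hf : HasExp x w f T)
    (hfg : ∀ p : Fin 4 → ℝ, 0 < p 0 → Fin.tail p ∈ V → f p = g p) : HasExp x w g T := by
  have h0 : ∀ᶠ ρ : ℝ in atTop, 0 < ρ := eventually_gt_atTop 0
  have hn : ∀ p : Fin 4 → ℝ, 0 < p 0 → Fin.tail p ∈ V → f =ᶠ[nhds p] g := fun p h1 h2 => by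
    filter_upwards [isOpen_halfspace.mem_nhds (show p ∈ {p : Fin 4 → ℝ | 0 < p 0 ∧ Fin.tail p ∈ V} from ⟨h1, h2⟩)]
      with q hq
    exact hfg q hq.1 hq.2
  have hpd : ∀ c (p : Fin 4 → ℝ), 0 < p 0 → Fin.tail p ∈ V → pd c f =ᶠ[nhds p] pd c g :=
    fun c p h1 h2 => by
      filter_upwards [isOpen_halfspace.mem_nhds (show p ∈ {p : Fin 4 → ℝ | 0 < p 0 ∧ Fin.tail p ∈ V} from ⟨h1, h2⟩)]
        with q hq
      exact pd_congr_apply (hn q hq.1 hq.2) c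
  refine ⟨?_, hf.zero.congr' (h0.mono fun ρ hρ => ?_), fun c => (hf.one c).congr' (h0.mono fun ρ hρ => ?_),
    fun c c' => (hf.two c c').congr' (h0.mono fun ρ hρ => ?_)⟩
  · filter_upwards [hf.smooth, h0] with ρ h1 hρ
    exact h1.congr_of_eventuallyEq (hn (at4 x ρ) hρ x.2).symm
  · simp only [hfg (at4 x ρ) hρ x.2]
  · simp only [pd_congr_apply (hn (at4 x ρ) hρ x.2) c]
  · simp only [pd_congr_apply (hpd c (at4 x ρ) hρ x.2) c']

lemma mfun_apply (w : ℤ) (T : Tr (Sm V)) {p : Fin 4 → ℝ} (h0 : 0 < p 0) (hy : Fin.tail p ∈ V) :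
    mfun w T p = p 0 ^ w * tval (trEv ⟨Fin.tail p, hy⟩ T) (p 0) := by
  have := mfun_at4 w T ⟨_, hy⟩ h0
  rwa [show at4 (Fin.tail p) (p 0) = p from Fin.cons_self_tail p] at this

end

namespace LocalFrame

variable (L : LocalFrame U h x₀)
 {A H I : Cov2} (hA : IsSymTensor U A) (hH : IsSymTensor U H) (hI : IsSymTensor U I)

lemma slice_wd (c : Fin 4) (w : ℤ) (f : Tr (Sm L.V)) : (L.slice σ hA hH hI).wd c w f = trd c w f := by
  refine Fin.cases rfl (fun a => ?_) c
  have : L.G.tr.d a = Tr.der (L.G.d a) := rfl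
  simp only [Slicing.wd, trd, Fin.cons_succ, this, L.d_eq]

variable [Patch U h] (hσ : σ ∈ smoothOn U) (hk : IsSymTensor U k)
  (h2s : IsSymTensor U h2) (hi : IsSymTensor U i) {s : Fld 4} {N : Fin 3 → Fld 4}
  {r : Fin 3 → Fin 3 → Fld 4} (hR : AreRemainders U s N r)
include hR

local notation "§" => LocalFrame.slice L σ (conf_symTensor hσ hk) h2s hi

lemma hasExp_metric (a b : Fin 4) : HasExp L.pt (2 - radial a - radial b)
    (metric h σ k i h2 s N r a b) (§.G4 a b) := by
  have hx : (L.pt : Fin 3 → ℝ) ∈ U := L.sub L.pt.2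
  refine Fin.cases ?_ (fun a => ?_) a <;> refine Fin.cases ?_ (fun b => ?_) b
  · have h1 := (hasExp_mfun L.pt 0 (§.G4 0 0)).add
      (hasExp_of_isRemainder hR.1 L.pt hx)
    rw [add_zero] at h1
    refine h1.congr fun p hp hy => ?_
    have e : trEv ⟨Fin.tail p, hy⟩ (§.G4 0 0) =
        ⟨1, 2 * σ (Fin.tail p), σ (Fin.tail p) ^ 2, 0⟩ := by
      simp only [Slicing.G4, Fin.cons_zero, slice_N, trEv, map_mul, Tr.map_apply, map_one, map_zero,
        L.ev_fr0 hσ]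
      ext <;> simp <;> ring
    rw [Pi.add_apply, mfun_apply _ _ hp hy, e, zpow_zero, one_mul, tval]
    simp only [metric, Fin.cons_zero]
    ring
  · have h1 := hasExp_of_isRemainder (hR.2.1 b) L.pt hx
    exact h1
  · have h1 := hasExp_of_isRemainder (hR.2.1 a) L.pt hx
    exact h1
  · have h1 := (((hasExp_mfun L.pt 0
      (§.G4 a.succ b.succ)).add
      (hasExp_of_isRemainder (hR.2.2.1 a b) L.pt hx)).radius_mul).radius_mul
    rw [add_zero] at h1
    refine HasExp.congr (w := 2 - radial a.succ - radial b.succ) h1 fun p hp hy => ?_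
    have e : trEv ⟨Fin.tail p, hy⟩ (§.G4 a.succ b.succ) =
        ⟨h a b (Fin.tail p), conf h σ k a b (Fin.tail p), h2 a b (Fin.tail p), i a b (Fin.tail p)⟩ := by
      rw [← L.h_eq a b ⟨_, hy⟩, ← L.ev_fr0 (h2s.1 a b) ⟨_, hy⟩, ← L.ev_fr0 (hi.1 a b) ⟨_, hy⟩,
        ← L.ev_fr0 ((conf_symTensor hσ hk).1 a b) ⟨_, hy⟩]
      rfl
    simp only [Pi.add_apply, mfun_apply _ _ hp hy]
    rw [e, zpow_zero, one_mul, tval]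
    simp only [metric, Fin.cons_succ, conf, Pi.add_apply, Pi.mul_apply, Pi.smul_apply, smul_eq_mul]
    ring

lemma connExp_metric : ConnExp L.pt (metric h σ k i h2 s N r)
    §.G4 §.Γ4 where
  hg := L.hasExp_metric hσ hk h2s hi hR
  hdet := by
    have h1 : ∀ a b, (trEv L.pt (§.G4 a b)).c0 =
      (Fin.cons (Fin.cons 1 0) (fun a => Fin.cons 0 (fun b => h a b x₀)) : Fin 4 → Fin 4 → ℝ) a b := by
      intro a b
      refine Fin.cases ?_ (fun a => ?_) a <;> refine Fin.cases ?_ (fun b => ?_) b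
      · simp [Slicing.G4, slice_N, trEv, Tr.map_apply]
      · simp [Slicing.G4, trEv, Tr.map_apply]
      · simp [Slicing.G4, trEv, Tr.map_apply]
      · exact L.h_eq a b L.pt
    simp only [h1]
    rw [Matrix.det_succ_row_zero, Fin.sum_univ_succ]
    simp only [Matrix.of_apply, Fin.cons_zero, Fin.cons_succ, Pi.zero_apply, mul_zero, zero_mul,
      Finset.sum_const_zero, add_zero, Fin.val_zero, pow_zero, one_mul]
    exact (det_neg (L.sub L.mem)).ne
  hΓ β b d := by
    rw [Slicing.christoffel4]
    simp only [slice_wd]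

lemma asy_ricci_metric (b d : Fin 4) :
    Asy (fun ρ => ρ ^ (radial b + radial d) * ricci (metric h σ k i h2 s N r) b d (Matrix.vecCons ρ x₀))
      (L.ev4 (§.ric4 b d)) := by
  have := (L.connExp_metric hσ hk h2s hi hR).asy_ricci b d
  simp only [Slicing.ric4, slice_wd]
  exact this

end LocalFrame

namespace LocalFrame

variable (L : LocalFrame U h x₀) [Patch U h]

lemma ev4_tf1 (v : Fin 3 → Tr (Sm L.V)) (J : Fin 3) :
    L.ev4 (L.G.tr.tf1 v J) = ∑ a, L.ev0 (L.G.E a J) • L.ev4 (v a) := by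
  rw [L.G.tr_tf1]
  simp only [Geo.tf1_eq, t1, ev4_apply, map_sum, map_mul]
  ext <;> simp [Tr.sum_c0, Tr.sum_c1, Tr.sum_c2, Tr.sum_cl]

variable {S : Submodule ℝ (Tr ℝ)}

lemma ev4_tf1_mem {v : Fin 3 → Tr (Sm L.V)} :
    (∀ J, L.ev4 (L.G.tr.tf1 v J) ∈ S) ↔ ∀ a, L.ev4 (v a) ∈ S := by
  constructor
  · intro hJ a
    have h1 : ∑ J, L.ev0 (L.G.F J a) • L.ev4 (L.G.tr.tf1 v J) = L.ev4 (v a) := by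
      have h2 : ∀ b, ∑ J, L.ev0 (L.G.F J a) * L.ev0 (L.G.E b J) = if b = a then 1 else 0 := fun b => by
        have := congrArg L.ev0 (L.G.EF b a)
        rw [map_sum, apply_ite L.ev0, map_one, map_zero] at this
        rw [← this]
        exact Finset.sum_congr rfl fun J _ => by rw [map_mul, mul_comm]
      simp only [ev4_tf1, Finset.smul_sum, smul_smul]
      rw [Finset.sum_comm]
      simp [← Finset.sum_smul, h2]
    rw [← h1]
    exact Submodule.sum_mem _ fun J _ => S.smul_mem _ (hJ J)
  · intro ha J
    rw [ev4_tf1]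
    exact Submodule.sum_mem _ fun a _ => S.smul_mem _ (ha a)

lemma ev4_tf2_mem {T : Fin 3 → Fin 3 → Tr (Sm L.V)} :
    (∀ J K, L.ev4 (L.G.tr.tf2 T J K) ∈ S) ↔ ∀ a b, L.ev4 (T a b) ∈ S := by
  simp only [Geo.tf2_apply]
  rw [forall_comm]
  simp only [ev4_tf1_mem]
  rw [forall_comm]
  simp only [ev4_tf1_mem]

lemma ev4_mem_iff {X : Fin 4 → Fin 4 → Tr (Sm L.V)} : (∀ b d, L.ev4 (X b d) ∈ S) ↔
    L.ev4 (X 0 0) ∈ S ∧ (∀ J, L.ev4 (L.G.tr.tf1 (fun b => X 0 b.succ) J) ∈ S) ∧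
    (∀ J, L.ev4 (L.G.tr.tf1 (fun b => X b.succ 0) J) ∈ S) ∧
    ∀ J K, L.ev4 (L.G.tr.tf2 (fun a b => X a.succ b.succ) J K) ∈ S := by
  rw [ev4_tf1_mem, ev4_tf1_mem, ev4_tf2_mem]
  simp only [Fin.forall_fin_succ (n := 3), forall_and, and_assoc]
  exact and_congr_right fun _ => and_left_comm

end LocalFrame

/-- Expansions without terms of order `0` and `1`. -/
def Tr.lowOrder : Submodule ℝ (Tr ℝ) where
  carrier := {T | T.c0 = 0 ∧ T.c1 = 0}
  add_mem' := fun {S T} hS hT => ⟨by simp [hS.1, hT.1], by simp [hS.2, hT.2]⟩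
  zero_mem' := ⟨rfl, rfl⟩
  smul_mem' c T hT := ⟨by simp [hT.1], by simp [hT.2]⟩

lemma Tr.mem_lowOrder {T : Tr ℝ} : T ∈ Tr.lowOrder ↔ T.c0 = 0 ∧ T.c1 = 0 := Iff.rfl

section

variable [Patch U h]
 (hσ : σ ∈ smoothOn U) {s : Fld 4} {N : Fin 3 → Fld 4}
  {r : Fin 3 → Fin 3 → Fld 4}

lemma einsteinToOrder_iff (hk : IsSymTensor U k)
    (h2s : IsSymTensor U h2) (hi : IsSymTensor U i) (hR : AreRemainders U s N r) (n : ℕ)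
    {S : Submodule ℝ (Tr ℝ)} (hS : ∀ {F : ℝ → ℝ} {T : Tr ℝ}, Asy F T →
      (F =o[atTop] (fun ρ : ℝ => (ρ ^ n)⁻¹) ↔ T ∈ S)) :
    EinsteinToOrder U n (metric h σ k i h2 s N r) ↔ ∀ x₀, ∀ L : LocalFrame U h x₀, ∀ b d,
      L.ev4 ((L.slice σ (conf_symTensor hσ hk) h2s hi).ric4 b d) ∈ S := by
  constructor
  · intro hE x₀ L b d
    have := hE x₀ (L.sub L.mem) b d
    rw [add_assoc, isLittleO_weight] at this
    exact (hS (L.asy_ricci_metric hσ hk h2s hi hR b d)).1 this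
  · intro H x₀ hx b d
    obtain ⟨L⟩ := exists_localFrame hx
    rw [add_assoc, isLittleO_weight]
    exact (hS (L.asy_ricci_metric hσ hk h2s hi hR b d)).2 (H x₀ L b d)

include hσ

lemma firstOrderEqs_iff (hk : IsSymTensor U k) : FirstOrderEqs U h σ k ↔
    ∀ x₀, ∀ L : LocalFrame U h x₀, ∑ K, L.s2 σ K K.rev + 3 * L.s0 σ = 0 ∧
      ∀ I J, ∑ M, L.j2 k M M.rev I J - 3 * L.j0 k I J = 0 := by
  have hm : boxS h σ ∈ smoothOn U := tr_mem (hess_mem hσ)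
  have hb := boxT_mem hk.1
  have e1 : ∀ x₀, ∀ L : LocalFrame U h x₀, L.s0 (boxS h σ + (3 : ℝ) • σ) =
      ∑ K, L.s2 σ K K.rev + 3 * L.s0 σ := fun x₀ L => by
    rw [L.s0_add hm (smul_smooth 3 hσ), L.s0_boxS hσ, L.s0_smul 3 hσ]
  have e2 : ∀ x₀, ∀ L : LocalFrame U h x₀, ∀ I J, L.j0 (boxT h k - (3 : ℝ) • k) I J =
      ∑ M, L.j2 k M M.rev I J - 3 * L.j0 k I J := fun x₀ L I J => by
    rw [L.j0_sub hb (Smooth2.smul 3 hk.1), L.j0_box hk.1, L.j0_smul 3 hk.1]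
  have z2 : Smooth2 U (0 : Cov2) := fun _ _ => zero_mem _
  have z : ∀ x₀, ∀ L : LocalFrame U h x₀, ∀ I J, L.j0 (0 : Cov2) I J = 0 := fun x₀ L I J => by
    have := L.j0_sub z2 z2 I J
    simpa using this
  constructor
  · intro hF x₀ L
    refine ⟨?_, fun I J => ?_⟩
    · rw [← e1, L.s0_eq (add_mem hm (smul_smooth 3 hσ))]
      exact hF.1 (L.sub L.mem)
    · rw [← e2, LocalFrame.j0, L.fr2_congr (hb.sub (Smooth2.smul 3 hk.1)) z2 hF.2]
      exact z x₀ L I J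
  · intro H
    refine ⟨eqOn_of_frames₀ (add_mem hm (smul_smooth 3 hσ)) (zero_mem _) fun x₀ L => ?_,
      agreeOn_of_frames (hb.sub (Smooth2.smul 3 hk.1)) z2 fun x₀ L I J => ?_⟩
    · rw [e1, (H x₀ L).1, L.s0_eq (zero_mem (smoothOn U))]; rfl
    · rw [e2, (H x₀ L).2, z]

theorem einsteinToOrder_one_iff (hk : IsSDT U h k) (h2s : IsSymTensor U h2) (hi : IsSymTensor U i)
    (hR : AreRemainders U s N r) :
    EinsteinToOrder U 1 (metric h σ k i h2 s N r) ↔ FirstOrderEqs U h σ k := by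
  rw [einsteinToOrder_iff hσ hk.1 h2s hi hR 1 (S := Tr.lowOrder) fun hA => hA.isLittleO_one_iff,
    firstOrderEqs_iff hσ hk.1]
  refine forall_congr' fun x₀ => forall_congr' fun L => ?_
  rw [L.ev4_mem_iff]
  simp only [Tr.mem_lowOrder]
  have t := L.ric_tt_first hσ hk h2s hi
  have m := L.mixedRic_first hσ hk h2s hi
  have s := L.ric_first hσ hk h2s hi
  constructor
  · rintro ⟨a, -, -, b⟩
    have e : ∑ K, L.s2 σ K K.rev + 3 * L.s0 σ = 0 := by
      rw [t.2] at a; exact neg_eq_zero.1 a.2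
    refine ⟨e, fun I J => ?_⟩
    have := (s I J).2
    rw [(b I J).2, e] at this
    linarith
  · rintro ⟨e, b⟩
    refine ⟨⟨t.1, by rw [t.2, e, neg_zero]⟩, fun J => ⟨(m J).1, (m J).2.1⟩, fun J => (m J).2.2,
      fun J K => ⟨(s J K).1, ?_⟩⟩
    have := (s J K).2
    rw [e, b J K] at this
    linarith

end

section

variable [Patch U h] namespace LocalFrame

variable (L : LocalFrame U h x₀)

lemma jets_of_tr_eq (hT : Smooth2 U T) (hf : f ∈ smoothOn U) (e : EqOn (tr h T) f U) :
    ∑ K, L.j0 T K K.rev = L.s0 f ∧ (∀ J, ∑ K, L.j1 T J K K.rev = L.s1 f J) ∧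
      ∀ J K, ∑ M, L.j2 T J K M M.rev = L.s2 f J K := by
  have e' := L.fr0_congr (tr_mem hT) hf e
  refine ⟨?_, fun J => ?_, fun J K => ?_⟩
  · rw [← L.s0_tr hT, s0, e', s0]
  · rw [← L.s1_tr hT, s1, e', s1]
  · rw [← ev0_e_e, ← e', L.fr0_tr hT, ← L.G.N2_trace, map_sum, map_sum]
    simp only [ev0_e_N2]

lemma jets_of_dvg_eq (hT : Smooth2 U T) {v : Cov1} (hv : Smooth1 U v)
    (e : ∀ a, EqOn (dvg h T a) (v a) U) : (∀ J, ∑ K, L.j1 T K J K.rev = L.ev0 (L.fr1 v J)) ∧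
      ∀ J K, ∑ M, L.j2 T J M K M.rev = L.j0 (D1 h v) J K := by
  have hd := dvg_mem hT
  have e' := L.fr1_congr hd hv e
  refine ⟨fun J => by rw [← L.ev0_dvg hT, e'], fun J K => ?_⟩
  rw [← L.j0_D1_dvg hT, j0, j0, L.fr2_D1 hd, L.fr2_D1 hv, e']

lemma j0_box_sub (hT : Smooth2 U T) (c : ℝ) (I J : Fin 3) :
    L.j0 (boxT h T - c • T) I J = ∑ M, L.j2 T M M.rev I J - c * L.j0 T I J := by
  rw [L.j0_sub (boxT_mem hT) (Smooth2.smul c hT), L.j0_box hT, L.j0_smul c hT]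

lemma j0_zero (I J : Fin 3) : L.j0 (0 : Cov2) I J = 0 := by
  have z2 : Smooth2 U (0 : Cov2) := fun _ _ => zero_mem _
  have := L.j0_sub z2 z2 I J
  simpa using this

lemma j0_congr (hS : Smooth2 U S) (hT : Smooth2 U T) (e : AgreeOn U S T) (I J : Fin 3) :
    L.j0 S I J = L.j0 T I J := by rw [j0, L.fr2_congr hS hT e, j0]

end LocalFrame

variable (hσ : σ ∈ smoothOn U) {s : Fld 4} {N : Fin 3 → Fld 4}
  {r : Fin 3 → Fin 3 → Fld 4} (hk : IsSDT U h k) (h2s : IsSymTensor U h2) (hi : IsSymTensor U i)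
  (hF : FirstOrderEqs U h σ k)
include hσ hk hF h2s hi

lemma secondOrderEqs_of_ric (H : ∀ x₀, ∀ L : LocalFrame U h x₀, ∀ b d,
      L.ev4 ((L.slice σ (conf_symTensor hσ hk.1) h2s hi).ric4 b d) ∈ (⊥ : Submodule ℝ (Tr ℝ))) :
    SecondOrderEqs U h σ k i h2 := by
  have hs := traceSrc_mem hσ hk.1.1
  have hd := divSrc_mem hσ hk.1.1
  have H' := fun x₀ (L : LocalFrame U h x₀) => L.ev4_mem_iff.1 (H x₀ L)
  simp only [Submodule.mem_bot] at H'
  have t1 : EqOn (tr h i) 0 U := eqOn_of_frames₀ (tr_mem hi.1) (zero_mem _) fun x₀ L => by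
    have := (L.ric_tt_second hσ h2s hi hk hF).2
    rw [(H' x₀ L).1] at this
    rw [L.s0_tr hi.1, L.s0_eq (zero_mem (smoothOn U))]
    simpa using this
  have t2 : EqOn (tr h h2) (traceSrc h σ k) U :=
    eqOn_of_frames₀ (tr_mem h2s.1) hs fun x₀ L => by
      have := (L.ric_tt_second hσ h2s hi hk hF).1
      rw [(H' x₀ L).1, ← L.s0_tr hi.1, L.s0_eq (tr_mem hi.1), t1 (L.sub L.mem)] at this
      rw [L.s0_tr h2s.1]
      simp only [Tr.zero_c2, Pi.zero_apply] at this
      linarith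
  have d1 : ∀ a, EqOn (dvg h i a) ((0 : Cov1) a) U := eqOn_of_frames (dvg_mem hi.1)
    (fun _ => zero_mem _) fun x₀ L J => by
      have := (L.ric_mixed_second hσ h2s hi hk hF J).2
      rw [(H' x₀ L).2.1, (L.jets_of_tr_eq hi.1 (zero_mem _) t1).2.1, LocalFrame.s1,
        L.fr0_zero] at this
      rw [L.ev0_dvg hi.1, L.fr1_zero]
      simpa using this
  have hI : IsSDT U h i := ⟨hi, t1, d1⟩
  have d2 : ∀ a, EqOn (dvg h h2 a) (divSrc h σ k a) U := eqOn_of_frames (dvg_mem h2s.1) hd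
    fun x₀ L J => by
      have := (L.ric_mixed_second hσ h2s hi hk hF J).1
      rw [(H' x₀ L).2.1, (L.jets_of_tr_eq h2s.1 hs t2).2.1, L.j1_div hI,
        L.j1_trace hI, Tr.zero_c2] at this
      rw [L.ev0_dvg h2s.1]
      linarith
  refine ⟨⟨hI, agreeOn_of_frames ((boxT_mem hi.1).sub (Smooth2.smul 2 hi.1))
    (fun _ _ => zero_mem _) fun x₀ L J K => ?_⟩, t2, d2,
    agreeOn_of_frames ((boxT_mem h2s.1).sub (Smooth2.smul 2 h2s.1))
    (((Smooth2.smul 2 hi.1).add (NLss_mem hσ)).add (NLsk_mem hσ hk.1.1) |>.add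
      (NLkk_mem hk.1.1)) fun x₀ L J K => ?_⟩
  · have := L.ric_log hσ h2s hi hk J K
    rw [(H' x₀ L).2.2.2, L.j2_div hI, L.j2_div hI, L.j2_trace hI, Tr.zero_cl] at this
    rw [L.j0_box_sub hi.1, L.j0_zero]
    linarith
  · have := L.ric_second hσ h2s hi hk hF J K
    have d2' := L.jets_of_dvg_eq h2s.1 hd d2
    rw [(H' x₀ L).2.2.2, d2'.2, d2'.2, (L.jets_of_tr_eq h2s.1 hs t2).2.2, L.j0_trace hI,
      Tr.zero_c2] at this
    rw [L.j0_box_sub h2s.1, L.j0_add (((Smooth2.smul 2 hi.1).add (NLss_mem hσ)).add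
      (NLsk_mem hσ hk.1.1)) (NLkk_mem hk.1.1), L.j0_add ((Smooth2.smul 2 hi.1).add
      (NLss_mem hσ)) (NLsk_mem hσ hk.1.1), L.j0_add (Smooth2.smul 2 hi.1)
      (NLss_mem hσ), L.j0_smul 2 hi.1]
    linarith

lemma ric_of_secondOrderEqs (hS : SecondOrderEqs U h σ k i h2) (L : LocalFrame U h x₀) (b d : Fin 4) :
    L.ev4 ((L.slice σ (conf_symTensor hσ hk.1) h2s hi).ric4 b d) ∈ (⊥ : Submodule ℝ (Tr ℝ)) := by
  obtain ⟨⟨hI, bI⟩, t2, d2, bH⟩ := hS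
  have hs := traceSrc_mem hσ hk.1.1
  have hd := divSrc_mem hσ hk.1.1
  have hFl := (firstOrderEqs_iff hσ hk.1).1 hF x₀ L
  have t2' := L.jets_of_tr_eq h2s.1 hs t2
  have d2' := L.jets_of_dvg_eq h2s.1 hd d2
  have e := (Smooth2.smul 2 hi.1).add (NLss_mem hσ)
  have e' := e.add (NLsk_mem hσ hk.1.1)
  have bI' := L.j0_congr ((boxT_mem hi.1).sub (Smooth2.smul 2 hi.1)) (T := 0) (fun _ _ => zero_mem _) bI
  have bH' := L.j0_congr ((boxT_mem h2s.1).sub (Smooth2.smul 2 h2s.1))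
    (e'.add (NLkk_mem hk.1.1)) bH
  simp only [L.j0_box_sub hi.1, L.j0_box_sub h2s.1, L.j0_zero,
    L.j0_add e' (NLkk_mem hk.1.1), L.j0_add e (NLsk_mem hσ hk.1.1),
    L.j0_add (Smooth2.smul 2 hi.1) (NLss_mem hσ), L.j0_smul 2 hi.1] at bI' bH'
  have m := L.mixedRic_first hσ hk h2s hi
  have a0 : ∀ J, (L.ev4 (L.G.tr.tf1
      (fun b => (L.slice σ (conf_symTensor hσ hk.1) h2s hi).ric4 0 b.succ) J)).c2 = 0 ∧
      (L.ev4 (L.G.tr.tf1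
      (fun b => (L.slice σ (conf_symTensor hσ hk.1) h2s hi).ric4 0 b.succ) J)).cl = 0 := fun J => by
    have := L.ric_mixed_second hσ h2s hi hk hF J
    rw [t2'.2.1, d2'.1, L.j1_div hI, L.j1_trace hI] at this
    exact ⟨this.1.trans (by ring), this.2.trans (by ring)⟩
  revert b d
  refine L.ev4_mem_iff.2 ⟨?_, fun J => ?_, fun J => ?_, fun J K => ?_⟩ <;> rw [Submodule.mem_bot]
  · have h1 := L.ric_tt_first hσ hk h2s hi
    have h2' := L.ric_tt_second hσ h2s hi hk hF
    rw [t2'.1, L.j0_trace hI] at h2'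
    exact Tr.ext h1.1 (h1.2.trans (by rw [hFl.1]; simp)) (h2'.1.trans (by simp)) (h2'.2.trans (by simp))
  · exact Tr.ext (m J).1 (m J).2.1 (a0 J).1 (a0 J).2
  · have h1 := L.ric_mixed_second' hσ h2s hi hk J
    exact Tr.ext (m J).2.2.1 (m J).2.2.2 (h1.1.trans (a0 J).1) (h1.2.trans (a0 J).2)
  · have h1 := L.ric_first hσ hk h2s hi J K
    have h3 := L.ric_second hσ h2s hi hk hF J K
    have h4 := L.ric_log hσ h2s hi hk J K
    have b1 := bI' J K
    have b2 := bH' J K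
    rw [d2'.2, d2'.2, t2'.2.2, L.j0_trace hI] at h3
    rw [L.j2_div hI, L.j2_div hI, L.j2_trace hI] at h4
    rw [hFl.1, hFl.2] at h1
    refine Tr.ext h1.1 ?_ ?_ ?_
    · simp only [Tr.zero_c1]; linarith [h1.2]
    · simp only [Tr.zero_c2]; linarith
    · simp only [Tr.zero_cl]; linarith

omit hF in
theorem einsteinToOrder_two_iff (hR : AreRemainders U s N r) :
    EinsteinToOrder U 2 (metric h σ k i h2 s N r) ↔
      FirstOrderEqs U h σ k ∧ SecondOrderEqs U h σ k i h2 := by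
  have h1 := einsteinToOrder_iff hσ hk.1 h2s hi hR 1 (S := Tr.lowOrder)
    fun hA => hA.isLittleO_one_iff
  have h2' := einsteinToOrder_iff hσ hk.1 h2s hi hR 2 (S := ⊥)
    fun hA => by rw [hA.isLittleO_two_iff, Submodule.mem_bot]
  rw [h2']
  constructor
  · intro H
    have hF := (einsteinToOrder_one_iff hσ hk h2s hi hR).1 (h1.2 fun x₀ L b d => by
      rw [(Submodule.mem_bot ℝ).1 (H x₀ L b d)]; exact zero_mem _)
    exact ⟨hF, secondOrderEqs_of_ric hσ hk h2s hi hF H⟩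
  · rintro ⟨hF, hS⟩ x₀ L b d
    exact ric_of_secondOrderEqs hσ hk h2s hi hF hS L b d

end

end BeigSchmidt

end

open BeigSchmidt

theorem mainTheorem2
    (U : Set (Fin 3 → ℝ)) (hU : IsOpen U)
    (h : Cov2) (hh : IsUnitHyperboloid U h)
    (σ : Fld 3) (hσ : ContDiffOn ℝ ∞ σ U)
    (k : Cov2) (hk : IsSDT U h k) :
    -- the expansion of Einstein's equations
    (∀ (i h2 : Cov2) (s : Fld 4) (N : Fin 3 → Fld 4) (r : Fin 3 → Fin 3 → Fld 4),
      IsSymTensor U i → IsSymTensor U h2 → AreRemainders U s N r →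
      (EinsteinToOrder U 1 (metric h σ k i h2 s N r) ↔ FirstOrderEqs U h σ k) ∧
      (EinsteinToOrder U 2 (metric h σ k i h2 s N r) ↔
        FirstOrderEqs U h σ k ∧ SecondOrderEqs U h σ k i h2)) ∧
    (FirstOrderEqs U h σ k →
      -- the source of the two compact systems
      AgreeOn U (curl h (QV h σ k + QW h σ k)) (symCurl h (kappa h σ k)) ∧
      -- duality relations
      (∀ i h2 : Cov2, IsSymTensor U i → IsSymTensor U h2 → SecondOrderEqs U h σ k i h2 →
        AgreeOn U (Wof h σ k i h2) (-curl h (Vof h σ k i h2) + symCurl h (kappa h σ k)) ∧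
        AgreeOn U (Vof h σ k i h2) (curl h (Wof h σ k i h2) - (2 : ℝ) • i)) ∧
      -- equivalence with the system for `W` and `i`
      (∀ i h2 : Cov2, IsSymTensor U i → IsSymTensor U h2 →
        (SecondOrderEqs U h σ k i h2 ↔
          WSystem U h σ k (Wof h σ k i h2) i ∧
            AgreeOn U h2 (h2of h σ k (curl h (Wof h σ k i h2) - (2 : ℝ) • i) i))) ∧
      (∀ W i : Cov2, WSystem U h σ k W i →
        IsSymTensor U (h2of h σ k (curl h W - (2 : ℝ) • i) i) ∧
        SecondOrderEqs U h σ k i (h2of h σ k (curl h W - (2 : ℝ) • i) i) ∧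
        AgreeOn U (Wof h σ k i (h2of h σ k (curl h W - (2 : ℝ) • i) i)) W) ∧
      -- equivalence with the system for `V` and `j = -curl i`
      (∀ i h2 : Cov2, IsSymTensor U i → IsSymTensor U h2 →
        (SecondOrderEqs U h σ k i h2 ↔
          VSystem U h σ k (Vof h σ k i h2) (-curl h i) ∧ AgreeOn U i (curl h (-curl h i)))) ∧
      (∀ V j : Cov2, VSystem U h σ k V j →
        IsSymTensor U (curl h j) ∧ IsSymTensor U (h2of h σ k V (curl h j)) ∧
        SecondOrderEqs U h σ k (curl h j) (h2of h σ k V (curl h j)) ∧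
        AgreeOn U (-curl h (curl h j)) j)) := by
  have : Patch U h := ⟨hU, hh⟩
  refine ⟨fun i h2 s N r hi h2s hR => ?_, fun hF => ⟨curl_QV_add_QW hσ hk hF,
    fun i h2 hi h2s hS => ⟨Wof_eq hσ hk hF hi h2s, Vof_eq hσ hk hF hi h2s hS⟩,
    fun i h2 hi h2s => second_iff_WSystem hσ hk hF hi h2s,
    fun W i hW => second_of_WSystem hσ hk hF hW,
    fun i h2 hi h2s => second_iff_VSystem hσ hk hF hi h2s,
    fun V j hV => second_of_VSystem hσ hk hF hV⟩⟩
  exact ⟨einsteinToOrder_one_iff hσ hk h2s hi hR, einsteinToOrder_two_iff hσ hk h2s hi hR⟩
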